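/- Let $M$ be a compact smooth manifold without boundary, and let $E\to M$ be a Courant algebroid: a smooth real vector bundle of finite rank with a fibrewise non-degenerate symmetric pairing $\langle\cdot,\cdot\rangle$, an anchor $\rho\colon E\to TM$ and an $\mathbb R$-bilinear bracket on $\Gamma(E)$ such that, for all $u,v,w\in\Gamma(E)$ and $f\in C^\infty(M)$: $[u,[v,w]]=[[u,v],w]+[v,[u,w]]$, $[u,fv]=f[u,v]+(\rho(u)f)v$, $\rho(u)\langle v,w\rangle=\langle[u,v],w\rangle+\langle v,[u,w]\rangle$, and $\langle [u,v]+[v,u],w\rangle=\rho(w)\langle u,v\rangle$. A generalized pseudometric is a smooth endomorphism $\mathcal G$ of $E$ with $\mathcal G^T=\mathcal G$ and $\mathcal G^2=\mathrm{Id}$ whose eigenbundles $V_\pm$ (for the eigenvalues $\pm1$) do not have rank $1$. It is a generalized metric if $\langle\cdot,\cdot\rangle|_{V_+}$ is positive definite and $\rho|_{V_+}\colon V_+\to TM$ is an isomorphism; it is strictly positive if moreover $\langle\mathcal G\cdot,\cdot\rangle>0$. A positive half-density $\sigma$ induces the divergence operator $\operatorname{div}_\sigma u=\sigma^{-2}L_{\rho(u)}\sigma^2$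 on $\Gamma(E)$. A Courant algebroid connection is a map $(u,v)\mapsto D_uv$ on $\Gamma(E)$ that is $C^\infty(M)$-linear in $u$, $\mathbb R$-linear in $v$, and satisfies $D_u(fv)=fD_uv+(\rho(u)f)v$ and $\rho(u)\langle v,w\rangle=\langle D_uv,w\rangle+\langle v,D_uw\rangle$. Let $D$ be such a connection with $D\mathcal G=0$, vanishing torsion ($\langle D_uv-D_vu-[u,v],w\rangle+\langle D_wu,v\rangle=0$) and divergence $D_\alpha u^\alpha=\operatorname{div}_\sigma u$. Raising and lowering indices with $\langle\cdot,\cdot\rangle$, put $$\mathcal Rm(w,z,x,y)=\tfrac12 w^\delta y^\beta\big(x^\alpha[D_\alpha,D_\beta]z_\delta+z^\alpha[D_\alpha,D_\delta]x_\beta-(D_\alpha x_\beta)(D^\alpha z_\delta)\big),\qquad \langle v,\mathcal F(u)\rangle=\mathcal Rm(e^\alpha,v,e_\alpha,u),$$ where $x^\alpha y^\beta D_\alpha D_\beta z=D_xD_yz-D_{D_xy}z$ and $(e_\alpha)$, $(e^\alpha)$ are dual local frames of $E$. The Ricci tensor $\mathcal Rc_{\mathcal G,\sigma}=\mathcal F-\mathcal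 G\mathcal F\mathcal G$ and the generalized scalar curvature $\mathcal R_{\mathcal G,\sigma}=\operatorname{Tr}(\mathcal G\mathcal F)$ depend only on $(\mathcal G,\sigma)$, and not on the choice of $D$. Let $J\subseteq[0,\infty)$ be an interval with least element $0$, and let $(\mathcal G_t,\sigma_t)_{t\in J}$ be a smooth solution of the generalized Ricci flow $$\partial_t\mathcal G=-2\,\mathcal Rc_{\mathcal G,\sigma},\qquad \partial_t\sigma=-\tfrac12\,\mathcal R_{\mathcal G,\sigma}\,\sigma$$ in the space of generalized pseudometrics and positive half-densities, whose initial datum $\mathcal G_0$ is a strictly positive generalized metric. Then $\mathcal R_{\mathcal G_t,\sigma_t}$ is bounded below on $M$ for every $t\in J$, and $t\mapsto\inf_M\mathcal R_{\mathcal G_t,\sigma_t}$ is nondecreasing on $J$; in particular $\inf_M\mathcal R_{\mathcal G_t,\sigma_t}\ge\inf_M\mathcal R_{\mathcal G_0,\sigma_0}$ for all $t\in J$. -/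

import Mathlib

open Bundle Set Module
open scoped Manifold ContDiff

noncomputable section

namespace CourantFlow

variable {n : ℕ} {M : Type*} [TopologicalSpace M] [ChartedSpace (EuclideanSpace ℝ (Fin n)) M]
  [IsManifold (𝓡 n) ∞ M]
  {F : Type*} [NormedAddCommGroup F] [NormedSpace ℝ F]
  {E : M → Type*} [TopologicalSpace (TotalSpace F E)] [∀ x, TopologicalSpace (E x)]
  [∀ x, AddCommGroup (E x)] [∀ x, Module ℝ (E x)] [FiberBundle F E] [VectorBundle ℝ F E]
  [ContMDiffVectorBundle ∞ F E (𝓡 n)]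

/-! ### Courant algebroids -/

/-- The product `f u` of a smooth function and a smooth section. -/
def smulSec (f : C^∞⟮𝓡 n, M; ℝ⟯) (u : Cₛ^∞⟮𝓡 n; F, E⟯) : Cₛ^∞⟮𝓡 n; F, E⟯ :=
  ⟨fun x => f x • u x, f.contMDiff.smul_section u.contMDiff⟩

/-- Every vector of a fibre is the value of a global smooth section. -/
theorem exists_section [T2Space M] (x : M) (v : E x) : ∃ s : Cₛ^∞⟮𝓡 n; F, E⟯, s x = v := by
  obtain ⟨U, hU, hs⟩ := FiberBundle.exists_contMDiffOn_extend (k := ∞) (𝓡 n) F v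
  obtain ⟨V, hVU, hVo, hxV⟩ := mem_nhds_iff.1 hU
  obtain ⟨f, -, hf⟩ := (SmoothBumpFunction.nhds_basis_tsupport (I := 𝓡 n) x).mem_iff.1
    (hVo.mem_nhds hxV)
  refine ⟨⟨fun y => f y • FiberBundle.extend F v y, ?_⟩, ?_⟩
  · exact ContMDiffOn.smul_section_of_tsupport (u := V) f.contMDiff.contMDiffOn hVo hf
      (hs.mono hVU)
  · simp

variable (n F E) in
/-- A Courant algebroid structure on the smooth vector bundle `E → M` (of finite rank). -/
structure CourantAlgebroid where
  /-- The fibrewise pairing `⟨·,·⟩`. -/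
  pairing : ∀ x, LinearMap.BilinForm ℝ (E x)
  pairing_symm : ∀ x u v, pairing x u v = pairing x v u
  pairing_nondegenerate : ∀ x, (pairing x).Nondegenerate
  pairing_smooth : ∀ u v : Cₛ^∞⟮𝓡 n; F, E⟯,
    ContMDiff (𝓡 n) 𝓘(ℝ, ℝ) ∞ fun x => pairing x (u x) (v x)
  /-- The anchor `ρ : E → TM`. -/
  anchor : ∀ x, E x →ₗ[ℝ] TangentSpace (𝓡 n) x
  anchor_smooth : ∀ u : Cₛ^∞⟮𝓡 n; F, E⟯,
    ContMDiff (𝓡 n) (𝓡 n).tangent ∞ fun x => (⟨x, anchor x (u x)⟩ : TangentBundle (𝓡 n) M)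
  /-- The bracket on smooth sections. -/
  bracket : Cₛ^∞⟮𝓡 n; F, E⟯ →ₗ[ℝ] Cₛ^∞⟮𝓡 n; F, E⟯ →ₗ[ℝ] Cₛ^∞⟮𝓡 n; F, E⟯
  jacobi : ∀ u v w, bracket u (bracket v w) = bracket (bracket u v) w + bracket v (bracket u w)
  leibniz : ∀ (u v : Cₛ^∞⟮𝓡 n; F, E⟯) (f : C^∞⟮𝓡 n, M; ℝ⟯) (x : M),
    bracket u (smulSec f v) x =
      f x • bracket u v x + mvfderiv (𝓡 n) f x (anchor x (u x)) • v x
  invariance : ∀ (u v w : Cₛ^∞⟮𝓡 n; F, E⟯) (x : M),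
    mvfderiv (𝓡 n) (fun y => pairing y (v y) (w y)) x (anchor x (u x)) =
      pairing x (bracket u v x) (w x) + pairing x (v x) (bracket u w x)
  /-- `[u,v] + [v,u] = 𝒟⟨u,v⟩`, paired with an arbitrary section `w`. -/
  symmetric_part : ∀ (u v w : Cₛ^∞⟮𝓡 n; F, E⟯) (x : M),
    pairing x (bracket u v x + bracket v u x) (w x) =
      mvfderiv (𝓡 n) (fun y => pairing y (u y) (v y)) x (anchor x (w x))

variable (n F) in
/-- A smooth section with the given value at `x`. -/
def sectionThrough [T2Space M] (x : M) (v : E x) : Cₛ^∞⟮𝓡 n; F, E⟯ :=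
  (exists_section x v).choose

variable [FiniteDimensional ℝ F]

variable (F E) in
/-- A basis of the fibre `E x`. -/
def fiberBasis (x : M) : Basis (Fin (finrank ℝ F)) ℝ (E x) :=
  (finBasis ℝ F).map (VectorBundle.continuousLinearEquivAt ℝ F E x).symm.toLinearEquiv

namespace CourantAlgebroid

variable (C : CourantAlgebroid n F E)

/-- The contraction `B(e^α, e_α)` of a bilinear form on the fibre `E x` with the pairing, where
`⟨e^α, e_β⟩ = δ^α_β`. -/
def contract (x : M) (B : E x → E x → ℝ) : ℝ :=
  ∑ i, B ((C.pairing x).dualBasis (C.pairing_nondegenerate x) (fiberBasis F E x) i)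
    (fiberBasis F E x i)

end CourantAlgebroid

/-! ### Positive half-densities and their divergence operators -/

/-- The coordinate frame at `y` of the preferred chart at `c`. -/
def coordFrame (c y : M) : Fin n → TangentSpace (𝓡 n) y := fun i =>
  (trivializationAt (EuclideanSpace ℝ (Fin n)) (TangentSpace (𝓡 n)) c).symm y
    (EuclideanSpace.single i 1)

variable (n M) in
/-- A smooth everywhere positive half-density, as a function on frames of the tangent spaces which
scales by `|det A|^{1/2}` (hence vanishes on linearly dependent tuples). -/
structure PosHalfDensity where
  toFun : ∀ x : M, (Fin n → TangentSpace (𝓡 n) x) → ℝ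
  map_comp : ∀ (x : M) (A : TangentSpace (𝓡 n) x →ₗ[ℝ] TangentSpace (𝓡 n) x)
    (v : Fin n → TangentSpace (𝓡 n) x),
    toFun x (fun i => A (v i)) = √|LinearMap.det A| * toFun x v
  pos : ∀ (x : M) (v : Fin n → TangentSpace (𝓡 n) x), LinearIndependent ℝ v → 0 < toFun x v
  smooth : ∀ c : M, ContMDiffOn (𝓡 n) 𝓘(ℝ, ℝ) ∞ (fun y => toFun y (coordFrame c y))
    (chartAt (EuclideanSpace ℝ (Fin n)) c).source

/-- `σ⁻² L_X σ²`: in a chart in which `σ² = s² |dx¹ ∧ ⋯ ∧ dxⁿ|` this is `s⁻² ∑ᵢ ∂ᵢ (s² Xⁱ)`. -/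
def PosHalfDensity.div (σ : PosHalfDensity n M) (X : ∀ x : M, TangentSpace (𝓡 n) x) (x : M) : ℝ :=
  let φ := extChartAt (𝓡 n) x
  let s : EuclideanSpace ℝ (Fin n) → ℝ := fun y => σ.toFun (φ.symm y) (coordFrame x (φ.symm y))
  let Xc : EuclideanSpace ℝ (Fin n) → EuclideanSpace ℝ (Fin n) := fun y =>
    (trivializationAt (EuclideanSpace ℝ (Fin n)) (TangentSpace (𝓡 n)) x
      ⟨φ.symm y, X (φ.symm y)⟩).2
  LinearMap.trace ℝ (EuclideanSpace ℝ (Fin n))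
    (fderiv ℝ (fun y => s y ^ 2 • Xc y) (φ x) : _ →ₗ[ℝ] _) / s (φ x) ^ 2

/-! ### Generalized (pseudo)metrics -/

/-- A generalized pseudometric: a smooth symmetric endomorphism `𝒢` of `E` with `𝒢² = 1`, whose
eigenbundles `V₊`, `V₋` do not have rank one. -/
structure GenPseudometric (C : CourantAlgebroid n F E) where
  toFun : ∀ x, E x →ₗ[ℝ] E x
  smooth : ∀ u : Cₛ^∞⟮𝓡 n; F, E⟯,
    ContMDiff (𝓡 n) ((𝓡 n).prod 𝓘(ℝ, F)) ∞ fun x => TotalSpace.mk' F x (toFun x (u x))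
  symm : ∀ x u v, C.pairing x (toFun x u) v = C.pairing x u (toFun x v)
  invol : ∀ x u, toFun x (toFun x u) = u
  rank_pos_ne_one : ∀ x, finrank ℝ (End.eigenspace (toFun x) 1) ≠ 1
  rank_neg_ne_one : ∀ x, finrank ℝ (End.eigenspace (toFun x) (-1)) ≠ 1

namespace GenPseudometric

variable {C : CourantAlgebroid n F E} (G : GenPseudometric C)

/-- The action of `𝒢` on sections. -/
def app (u : Cₛ^∞⟮𝓡 n; F, E⟯) : Cₛ^∞⟮𝓡 n; F, E⟯ := ⟨fun x => G.toFun x (u x), G.smooth u⟩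

/-- A generalized metric: the pairing is positive definite on `V₊` and `ρ : V₊ → TM` is an
isomorphism. -/
def IsGenMetric : Prop :=
  ∀ x, (∀ v ∈ End.eigenspace (G.toFun x) 1, v ≠ 0 → 0 < C.pairing x v v) ∧
    Function.Bijective ((C.anchor x).domRestrict (End.eigenspace (G.toFun x) 1))

/-- Strict positivity: `⟨𝒢·,·⟩ > 0`. -/
def IsStrictlyPositive : Prop := ∀ x v, v ≠ 0 → 0 < C.pairing x (G.toFun x v) v

end GenPseudometric

/-! ### Connections and curvature -/

/-- A Courant algebroid connection `(u, v) ↦ D_u v`. -/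
structure Connection (C : CourantAlgebroid n F E) where
  toFun : Cₛ^∞⟮𝓡 n; F, E⟯ →ₗ[ℝ] Cₛ^∞⟮𝓡 n; F, E⟯ →ₗ[ℝ] Cₛ^∞⟮𝓡 n; F, E⟯
  smul_left : ∀ (f : C^∞⟮𝓡 n, M; ℝ⟯) u v, toFun (smulSec f u) v = smulSec f (toFun u v)
  leibniz : ∀ (u v : Cₛ^∞⟮𝓡 n; F, E⟯) (f : C^∞⟮𝓡 n, M; ℝ⟯) (x : M),
    toFun u (smulSec f v) x = f x • toFun u v x + mvfderiv (𝓡 n) f x (C.anchor x (u x)) • v x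
  metric : ∀ (u v w : Cₛ^∞⟮𝓡 n; F, E⟯) (x : M),
    mvfderiv (𝓡 n) (fun y => C.pairing y (v y) (w y)) x (C.anchor x (u x)) =
      C.pairing x (toFun u v x) (w x) + C.pairing x (v x) (toFun u w x)

namespace Connection

variable {C : CourantAlgebroid n F E} (D : Connection C)

/-- Vanishing of the torsion `T(u,v) = D_u v - D_v u - [u,v] + ⟨Du,v⟩`, paired with `w`. -/
def IsTorsionFree : Prop :=
  ∀ (u v w : Cₛ^∞⟮𝓡 n; F, E⟯) (x : M), C.pairing x (D.toFun u v x - D.toFun v u x - C.bracket u v x) (w x) +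
    C.pairing x (D.toFun w u x) (v x) = 0

/-- Compatibility `D𝒢 = 0`. -/
def IsCompatible (G : GenPseudometric C) : Prop :=
  ∀ u v, D.toFun u (G.app v) = G.app (D.toFun u v)

/-- `x^α y^β [D_α, D_β] z`. -/
def comm (x y z : Cₛ^∞⟮𝓡 n; F, E⟯) : Cₛ^∞⟮𝓡 n; F, E⟯ :=
  (D.toFun x (D.toFun y z) - D.toFun (D.toFun x y) z) -
    (D.toFun y (D.toFun x z) - D.toFun (D.toFun y x) z)

variable [T2Space M]

/-- The divergence `div_D u = D_α u^α` of a connection. -/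
def div (u : Cₛ^∞⟮𝓡 n; F, E⟯) (p : M) : ℝ :=
  C.contract p fun a b => C.pairing p a (D.toFun (sectionThrough n F p b) u p)

/-- The generalized Riemann tensor `Rm_D(w,z,x,y) = ½ w^δ y^β (x^α [D_α, D_β] z_δ +
z^α [D_α, D_δ] x_β - (D_α x_β)(D^α z_δ))` at the point `p`. -/
def riemann (w z x y : Cₛ^∞⟮𝓡 n; F, E⟯) (p : M) : ℝ :=
  (C.pairing p (w p) (D.comm x y z p) + C.pairing p (y p) (D.comm z w x p) -
    C.contract p fun a b =>
      C.pairing p (D.toFun (sectionThrough n F p b) x p) (y p) *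
      C.pairing p (D.toFun (sectionThrough n F p a) z p) (w p)) / 2

/-- The full Ricci tensor as the bilinear form `(v, u) ↦ ⟨v, fRc(u)⟩ = Rm(e^α, v, e_α, u)`. -/
def fullRicci (p : M) (v u : E p) : ℝ :=
  C.contract p fun a b =>
    D.riemann (sectionThrough n F p a) (sectionThrough n F p v) (sectionThrough n F p b)
      (sectionThrough n F p u) p

/-- The Ricci tensor `Rc = fRc - 𝒢 fRc 𝒢` as the bilinear form `(v, u) ↦ ⟨v, Rc(u)⟩`. -/
def ricci (G : GenPseudometric C) (p : M) (v u : E p) : ℝ :=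
  D.fullRicci p v u - D.fullRicci p (G.toFun p v) (G.toFun p u)

/-- The scalar curvature `R = Tr(𝒢 fRc) = ⟨𝒢 e^α, fRc(e_α)⟩`. -/
def scalar (G : GenPseudometric C) (p : M) : ℝ :=
  C.contract p fun a b => D.fullRicci p (G.toFun p a) b

end Connection

variable [T2Space M]

/-- The Levi-Civita connections of `𝒢` whose divergence is `div_σ u = σ⁻² L_{ρ(u)} σ²`. -/
def LeviCivita {C : CourantAlgebroid n F E} (G : GenPseudometric C) (σ : PosHalfDensity n M) :
    Set (Connection C) :=
  {D | D.IsTorsionFree ∧ D.IsCompatible G ∧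
    ∀ u x, D.div u x = σ.div (fun y => C.anchor y (u y)) x}

open Classical in
/-- The Ricci tensor `Rc_{𝒢,σ}`, computed from a connection in `LeviCivita G σ`. Such a connection
always exists and the result does not depend on which one is used. -/
def ricci {C : CourantAlgebroid n F E} (G : GenPseudometric C) (σ : PosHalfDensity n M)
    (x : M) (v u : E x) : ℝ :=
  if h : (LeviCivita G σ).Nonempty then h.some.ricci G x v u else 0

open Classical in
/-- The scalar curvature `R_{𝒢,σ}`, computed from a connection in `LeviCivita G σ`. Such a
connection always exists and the result does not depend on which one is used. -/
def scalarCurvature {C : CourantAlgebroid n F E} (G : GenPseudometric C) (σ : PosHalfDensity n M)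
    (x : M) : ℝ :=
  if h : (LeviCivita G σ).Nonempty then h.some.scalar G x else 0

/-- A smooth solution `(𝒢_t, σ_t)`, `t ∈ J`, of the generalized Ricci flow `∂_t 𝒢 = -2 Rc_{𝒢,σ}`,
`∂_t σ = -½ R_{𝒢,σ} σ`. -/
structure IsGenRicciFlow {C : CourantAlgebroid n F E} (J : Set ℝ) (G : ℝ → GenPseudometric C)
    (σ : ℝ → PosHalfDensity n M) : Prop where
  smooth_metric : ∀ u v : Cₛ^∞⟮𝓡 n; F, E⟯,
    ContMDiffOn (𝓘(ℝ, ℝ).prod (𝓡 n)) 𝓘(ℝ, ℝ) ∞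
      (fun p : ℝ × M => C.pairing p.2 (v p.2) ((G p.1).toFun p.2 (u p.2))) (J ×ˢ univ)
  smooth_density : ∀ c : M,
    ContMDiffOn (𝓘(ℝ, ℝ).prod (𝓡 n)) 𝓘(ℝ, ℝ) ∞
      (fun p : ℝ × M => (σ p.1).toFun p.2 (coordFrame c p.2))
      (J ×ˢ (chartAt (EuclideanSpace ℝ (Fin n)) c).source)
  metric_eq : ∀ t ∈ J, ∀ x (v u : E x),
    HasDerivWithinAt (fun s => C.pairing x v ((G s).toFun x u))
      (-2 * ricci (G t) (σ t) x v u) J t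
  density_eq : ∀ t ∈ J, ∀ (x : M) (v : Fin n → TangentSpace (𝓡 n) x),
    HasDerivWithinAt (fun s => (σ s).toFun x v)
      (-(1 / 2) * scalarCurvature (G t) (σ t) x * (σ t).toFun x v) J t

end CourantFlow

end

set_option linter.unusedSectionVars false

noncomputable section

namespace CourantFlow

/-! ### Algebra of adapted frames -/

section FrameAlgebra

variable {P Q B : Type*} [Fintype P] [Fintype Q] [CommRing B]

/-! Strict positivity makes the pairing positive on V₊ and negative on V₋, so locally there is an
orthonormal frame (e_a, e_i) adapted to the splitting. The geometry is then carried by the anchors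
X_a = ρ(e_a) and Y_i = ρ(e_i), the divergences d_a and h_i of the frame, and the totally
antisymmetric structure functions c_{ABC} = ⟨[e_A, e_B], e_C⟩. The parts of a Levi-Civita connection
which these data leave undetermined drop out of the curvatures: 6R = S₊ + S₋ with one explicit
summand per eigenbundle (`halfScalar`), and the only nonzero components of Rc are the mixed ones,
equal to 2A_{ai} with A given by `mixedRicci`. See `FrameConnection.six_scalar` and
`FrameConnection.two_ricci`.

The heart of the matter is the evolution equation R' = 8|A|² + 2ΔR, with |A|² = ∑ A_{ai}² and Δ =
∑_a (X_a X_a + d_a X_a), proved in `HalfFrame.scalar_variation`. Let the frame move by e_a' = κ_{ai}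
e_i, e_i' = κ_{ai} e_a with κ = 2A. By `HalfFrame.halfScalar_variation`, S₊ changes by 12 κ·A plus
12 times the divergence of the covector X_a R - (div κ)_a on V₊. The contracted Bianchi identity
`HalfFrame.bianchi` says that 6 (div κ)_a = X_a S₊, so this covector is X_a S₋ / 6 and the second
contribution is 2ΔS₋. With the roles of V₊ and V₋ exchanged, S₋ contributes another 12 κ·A and twice
the Laplacian of V₋ applied to S₊. The Laplacians of the two halves agree because ρρ* = 0. The total
is 48|A|² + 2Δ(S₊ + S₋) = 48|A|² + 12ΔR.

At a spatial minimum of R the first derivatives vanish and each X_a X_a R is non-negative, hence R'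
≥ 0 there. Since M is compact, the maximum principle `monotoneOn_iInf_of_deriv_nonneg_at_min` makes
the infimum nondecreasing.

Three facts make this applicable. Strict positivity persists along the flow by a connectedness
argument (`isStrictlyPositive_of_continuousOn`). Levi-Civita connections with the prescribed
divergence exist (`nonempty_leviCivita`); here the eigenbundles must not have rank one. Near (t₀,
x₀) there are frames adapted to 𝒢_t which at t₀ move as above (`exists_moving_coeff`): project a
frame adapted to 𝒢_{t₀} to the eigenbundles of 𝒢_t and orthonormalize with the inverse square root
of the Gram matrix.

The computations take place in commutative algebras with derivations. They are applied to smooth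
functions on a chart domain and on its product with a time interval, which are related by
restriction to a time slice (`SliceMap`). -/

theorem two_mul_sum_sum (f : P → P → B) :
    2 * ∑ a, ∑ b, f a b = ∑ a, ∑ b, (f a b + f b a) := by
  simp only [Finset.sum_add_distrib]
  rw [Finset.sum_comm (f := fun a b => f b a)]
  ring

theorem sum_cyclic (f : P → P → P → B) :
    ∑ a, ∑ b, ∑ c, f a b c = ∑ a, ∑ b, ∑ c, f b c a := by
  calc ∑ a, ∑ b, ∑ c, f a b c = ∑ a, ∑ c, ∑ b, f a b c :=
        Finset.sum_congr rfl fun a _ => Finset.sum_comm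
    _ = ∑ c, ∑ a, ∑ b, f a b c := Finset.sum_comm

theorem sum_swap_outer (f : Q → P → Q → B) :
    ∑ i, ∑ b, ∑ j, f i b j = ∑ i, ∑ b, ∑ j, f j b i := by
  calc ∑ i, ∑ b, ∑ j, f i b j = ∑ b, ∑ i, ∑ j, f i b j := Finset.sum_comm
    _ = ∑ b, ∑ i, ∑ j, f j b i := Finset.sum_congr rfl fun b _ => Finset.sum_comm
    _ = ∑ i, ∑ b, ∑ j, f j b i := Finset.sum_comm

variable [Algebra ℝ B]

/-- The identities satisfied by an adapted orthonormal frame `(e_a, e_i)` with `a` in the positive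
and `i` in the negative eigenbundle, written for the positive half: `k = c_{abc}`, `m = c_{iab}`,
`w = c_{aij}`, together with the anchors `X`, `Y` and the divergences `d`, `h` of the frame. -/
structure HalfFrame (X : P → Derivation ℝ B B) (Y : Q → Derivation ℝ B B) (d : P → B) (h : Q → B)
    (k : P → P → P → B) (m : Q → P → P → B) (w : P → Q → Q → B) : Prop where
  k_swap₁₂ : ∀ a b c, k b a c = -k a b c
  k_swap₂₃ : ∀ a b c, k a c b = -k a b c
  m_swap : ∀ i a b, m i b a = -m i a b
  w_swap : ∀ a i j, w a j i = -w a i j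
  comm_pos : ∀ a b f, X a (X b f) - X b (X a f) = ∑ c, k a b c * X c f - ∑ i, m i a b * Y i f
  comm_mixed : ∀ i b f, Y i (X b f) - X b (Y i f) = ∑ c, m i b c * X c f + ∑ j, w b i j * Y j f
  div_pos : ∀ a b, X a (d b) - X b (d a) =
    ∑ c, (X c (k a b c) + d c * k a b c) - ∑ i, (Y i (m i a b) + h i * m i a b)
  div_mixed : ∀ i b, Y i (d b) - X b (h i) =
    ∑ c, (X c (m i b c) + d c * m i b c) + ∑ j, (Y j (w b i j) + h j * w b i j)
  jacobi_pos : ∀ a b c e, X a (k b c e) - X b (k a c e) + X c (k a b e) - X e (k a b c) =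
    ∑ f, (k b c f * k a e f - k a c f * k b e f + k a b f * k c e f) -
      ∑ i, (m i b c * m i a e - m i a c * m i b e + m i a b * m i c e)
  jacobi_mixed : ∀ a i b c, X a (m i b c) - Y i (k a b c) - X b (m i a c) + X c (m i a b) =
    ∑ f, (m i b f * k a c f - k a b f * m i c f - m i a f * k b c f) +
      ∑ j, (w b i j * m j a c - m j a b * w c i j - w a i j * m j b c)
  laplace : ∀ f, ∑ a, (X a (X a f) + d a * X a f) = ∑ i, (Y i (Y i f) + h i * Y i f)

/-- The mixed component of the full Ricci tensor. -/
def mixedRicci (X : P → Derivation ℝ B B) (Y : Q → Derivation ℝ B B) (d : P → B)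
    (m : Q → P → P → B) (w : P → Q → Q → B) (a : P) (i : Q) : B :=
  ∑ b, (X b (m i a b) + d b * m i a b) + ∑ b, ∑ j, w b i j * m j a b - Y i (d a)

/-- Six times the trace of the full Ricci tensor over the positive eigenbundle. -/
def halfScalar (X : P → Derivation ℝ B B) (d : P → B)
    (k : P → P → P → B) (m : Q → P → P → B) : B :=
  -12 * ∑ a, X a (d a) - 6 * ∑ a, d a * d a + ∑ a, ∑ b, ∑ c, k a b c * k a b c -
    3 * ∑ i, ∑ a, ∑ b, m i a b * m i a b


theorem eq_zero_of_eq_neg {x : B} (h : x = -x) : x = 0 := by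
  have h2 : (2 : ℝ) • x = 0 := by rw [two_smul]; nth_rewrite 1 [h]; exact neg_add_cancel x
  simpa using congrArg (fun y => (2⁻¹ : ℝ) • y) h2

theorem sum_antisymm_eq_zero (f : P → P → B) (h : ∀ a b, f b a = -f a b) :
    ∑ a, ∑ b, f a b = 0 := by
  apply eq_zero_of_eq_neg
  calc ∑ a, ∑ b, f a b = ∑ a, ∑ b, f b a := Finset.sum_comm
    _ = -∑ a, ∑ b, f a b := by
      rw [← Finset.sum_neg_distrib]
      exact Finset.sum_congr rfl fun a _ => by
        rw [← Finset.sum_neg_distrib]; exact Finset.sum_congr rfl fun b _ => h a b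

namespace HalfFrame

variable {X : P → Derivation ℝ B B} {Y : Q → Derivation ℝ B B} {d : P → B} {h : Q → B}
  {k : P → P → P → B} {m : Q → P → P → B} {w : P → Q → Q → B}

/-- The Jacobi identity contracted with `c_{bce}`. -/
theorem jacobi_pos_contracted (H : HalfFrame X Y d h k m w) (a : P) :
    ∑ b, ∑ c, ∑ e, k b c e * X a (k b c e) = 3 * ∑ b, ∑ c, ∑ e, k b c e * X e (k a b c) -
      3 * ∑ b, ∑ c, ∑ e, ∑ i, k b c e * (m i b c * m i a e) := by
  have rot (b c e) : k c e b = k b c e := by rw [H.k_swap₂₃ c b e, H.k_swap₁₂ b c e, neg_neg]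
  have h1 : ∑ b, ∑ c, ∑ e, k b c e * X b (k a c e) = ∑ b, ∑ c, ∑ e, k b c e * X e (k a b c) := by
    rw [sum_cyclic fun b c e => k b c e * X e (k a b c)]
    simp only [rot]
  have h2 : ∑ b, ∑ c, ∑ e, k b c e * X c (k a b e) =
      -∑ b, ∑ c, ∑ e, k b c e * X e (k a b c) := by
    simp only [← Finset.sum_neg_distrib]
    refine Finset.sum_congr rfl fun b _ => ?_
    rw [Finset.sum_comm]
    refine Finset.sum_congr rfl fun c _ => Finset.sum_congr rfl fun e _ => ?_
    rw [H.k_swap₂₃ b c e, neg_mul]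
  -- The terms cubic in `k` vanish, since exchanging a suitable pair of summation indices reverses
  -- their sign. The three terms with two factors `m` survive and agree up to sign, which accounts
  -- for the factor 3.
  have z1 : ∑ b, ∑ c, ∑ e, ∑ f, k b c e * (k b c f * k a e f) = 0 :=
    Finset.sum_eq_zero fun b _ => Finset.sum_eq_zero fun c _ =>
      sum_antisymm_eq_zero _ fun e f => by rw [H.k_swap₂₃ a e f]; ring
  have z2 : ∑ b, ∑ c, ∑ e, ∑ f, k b c e * (k a c f * k b e f) = 0 := by
    refine Finset.sum_eq_zero fun b _ => ?_
    rw [Finset.sum_comm]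
    refine Finset.sum_eq_zero fun e _ => ?_
    exact sum_antisymm_eq_zero _ fun c f => by
      rw [H.k_swap₂₃ a c f, H.k_swap₂₃ b e f, H.k_swap₂₃ b e c]; ring
  have z3 : ∑ b, ∑ c, ∑ e, ∑ f, k b c e * (k a b f * k c e f) = 0 := by
    rw [← sum_cyclic fun c e b => ∑ f, k b c e * (k a b f * k c e f)]
    refine Finset.sum_eq_zero fun c _ => Finset.sum_eq_zero fun e _ =>
      sum_antisymm_eq_zero _ fun b f => by
        rw [← rot f c e, ← rot b c e, H.k_swap₂₃ a b f]; ring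
  have z4 : ∑ b, ∑ c, ∑ e, ∑ i, k b c e * (m i a c * m i b e) =
      -∑ b, ∑ c, ∑ e, ∑ i, k b c e * (m i b c * m i a e) := by
    simp only [← Finset.sum_neg_distrib]
    refine Finset.sum_congr rfl fun b _ => ?_
    rw [Finset.sum_comm]
    refine Finset.sum_congr rfl fun c _ => Finset.sum_congr rfl fun e _ =>
      Finset.sum_congr rfl fun i _ => ?_
    rw [H.k_swap₂₃ b c e]; ring
  have z5 : ∑ b, ∑ c, ∑ e, ∑ i, k b c e * (m i a b * m i c e) =
      ∑ b, ∑ c, ∑ e, ∑ i, k b c e * (m i b c * m i a e) := by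
    rw [sum_cyclic fun b c e => ∑ i, k b c e * (m i b c * m i a e)]
    simp only [rot]
    refine Finset.sum_congr rfl fun b _ => Finset.sum_congr rfl fun c _ =>
      Finset.sum_congr rfl fun e _ => Finset.sum_congr rfl fun i _ => ?_
    ring
  have h3 : ∑ b, ∑ c, ∑ e, k b c e * (X a (k b c e) - X b (k a c e) + X c (k a b e) - X e (k a b c))
      = -3 * ∑ b, ∑ c, ∑ e, ∑ i, k b c e * (m i b c * m i a e) := by
    simp only [H.jacobi_pos, mul_sub, mul_add, Finset.mul_sum, Finset.sum_add_distrib,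
      Finset.sum_sub_distrib, z1, z2, z3, z4, z5]
    simp only [← Finset.mul_sum]
    ring
  simp only [mul_sub, mul_add, Finset.sum_add_distrib, Finset.sum_sub_distrib, h1, h2] at h3
  linear_combination h3

/-- The Jacobi identity contracted with `c_{ibc}`. -/
theorem jacobi_mixed_contracted (H : HalfFrame X Y d h k m w) (a : P) :
    ∑ i, ∑ b, ∑ c, m i b c * X a (m i b c) = ∑ i, ∑ b, ∑ c, m i b c * Y i (k a b c) -
      2 * ∑ i, ∑ b, ∑ c, m i b c * X c (m i a b) -
      ∑ b, ∑ c, ∑ e, ∑ i, k b c e * (m i b c * m i a e) -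
      2 * ∑ i, ∑ b, ∑ c, ∑ j, m i b c * (w c i j * m j a b) := by
  have h1 : ∑ i, ∑ b, ∑ c, m i b c * X b (m i a c) = -∑ i, ∑ b, ∑ c, m i b c * X c (m i a b) := by
    simp only [← Finset.sum_neg_distrib]
    refine Finset.sum_congr rfl fun i _ => ?_
    rw [Finset.sum_comm]
    refine Finset.sum_congr rfl fun c _ => Finset.sum_congr rfl fun e _ => ?_
    rw [H.m_swap i c e, neg_mul]
  have z1 : ∑ i, ∑ b, ∑ c, ∑ f, m i b c * (m i b f * k a c f) = 0 :=
    Finset.sum_eq_zero fun i _ => Finset.sum_eq_zero fun b _ =>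
      sum_antisymm_eq_zero _ fun e f => by rw [H.k_swap₂₃ a e f]; ring
  have z2 : ∑ i, ∑ b, ∑ c, ∑ f, m i b c * (k a b f * m i c f) = 0 := by
    refine Finset.sum_eq_zero fun i _ => ?_
    rw [Finset.sum_comm]
    refine Finset.sum_eq_zero fun c _ => sum_antisymm_eq_zero _ fun b f => ?_
    rw [H.k_swap₂₃ a b f, H.m_swap i f c, H.m_swap i b c]; ring
  have z3 : ∑ i, ∑ b, ∑ c, ∑ f, m i b c * (m i a f * k b c f) =
      ∑ b, ∑ c, ∑ e, ∑ i, k b c e * (m i b c * m i a e) := by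
    rw [Finset.sum_comm]
    refine Finset.sum_congr rfl fun b _ => ?_
    rw [Finset.sum_comm]
    refine Finset.sum_congr rfl fun c _ => ?_
    rw [Finset.sum_comm]
    refine Finset.sum_congr rfl fun f _ => Finset.sum_congr rfl fun i _ => ?_
    ring
  have z4 : ∑ i, ∑ b, ∑ c, ∑ j, m i b c * (w b i j * m j a c) =
      -∑ i, ∑ b, ∑ c, ∑ j, m i b c * (w c i j * m j a b) := by
    simp only [← Finset.sum_neg_distrib]
    refine Finset.sum_congr rfl fun i _ => ?_
    rw [Finset.sum_comm]
    refine Finset.sum_congr rfl fun c _ => Finset.sum_congr rfl fun e _ =>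
      Finset.sum_congr rfl fun j _ => ?_
    rw [H.m_swap i c e, neg_mul]
  have z4' : ∑ i, ∑ b, ∑ c, ∑ j, m i b c * (m j a b * w c i j) =
      ∑ i, ∑ b, ∑ c, ∑ j, m i b c * (w c i j * m j a b) := by
    simp only [mul_comm (w _ _ _)]
  have z5 : ∑ i, ∑ b, ∑ c, ∑ j, m i b c * (w a i j * m j b c) = 0 := by
    rw [Finset.sum_comm]
    refine Finset.sum_eq_zero fun b _ => ?_
    rw [Finset.sum_comm]
    refine Finset.sum_eq_zero fun c _ => sum_antisymm_eq_zero _ fun i j => ?_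
    rw [H.w_swap a i j]; ring
  have h3 : ∑ i, ∑ b, ∑ c, m i b c * (X a (m i b c) - Y i (k a b c) - X b (m i a c) + X c (m i a b))
      = -∑ b, ∑ c, ∑ e, ∑ i, k b c e * (m i b c * m i a e) -
        2 * ∑ i, ∑ b, ∑ c, ∑ j, m i b c * (w c i j * m j a b) := by
    simp only [H.jacobi_mixed, mul_sub, mul_add, Finset.mul_sum, Finset.sum_add_distrib,
      Finset.sum_sub_distrib, z1, z2, z3, z4, z4', z5]
    simp only [← Finset.mul_sum]
    ring
  simp only [mul_sub, mul_add, Finset.sum_add_distrib, Finset.sum_sub_distrib, h1] at h3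
  linear_combination h3

/-- The contracted Bianchi identity. -/
theorem bianchi (H : HalfFrame X Y d h k m w) (a : P) :
    12 * (∑ i, (Y i (mixedRicci X Y d m w a i) + h i * mixedRicci X Y d m w a i) -
      ∑ i, ∑ b, m i a b * mixedRicci X Y d m w b i) = X a (halfScalar X d k m) := by
  -- The mixed Ricci component contains `-Y i (d a)`, so its divergence contains the Laplacian of V₋
  -- applied to `d a`. This is traded for the Laplacian of V₊, after which `div_pos` replaces `X b
  -- (d a)` by `X a (d b)` up to terms in `k` and `m`.
  have h1 := H.laplace (d a)
  have hdiv (b) : X b (d a) = X a (d b) - (∑ c, (X c (k a b c) + d c * k a b c) -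
      ∑ i, (Y i (m i a b) + h i * m i a b)) := by
    linear_combination -H.div_pos a b
  have h2 : ∑ b, (X b (X b (d a)) + d b * X b (d a)) = ∑ b, (X b (X a (d b)) + d b * X a (d b)) -
      ∑ b, ∑ c, (X b (X c (k a b c) + d c * k a b c) + d b * (X c (k a b c) + d c * k a b c)) +
      ∑ i, ∑ b, (X b (Y i (m i a b) + h i * m i a b) + d b * (Y i (m i a b) + h i * m i a b)) := by
    rw [Finset.sum_comm (s := (Finset.univ : Finset Q))]
    simp only [hdiv, map_sub, map_sum, mul_sub, Finset.mul_sum, ← Finset.sum_add_distrib,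
      ← Finset.sum_sub_distrib]
    refine Finset.sum_congr rfl fun b _ => ?_
    simp only [Finset.sum_add_distrib]
    ring
  -- The two orders of taking the divergences of `m` along V₊ and V₋ differ by the commutator of the
  -- vector fields and by the mixed derivatives of `d` and `h`; both are part of the frame
  -- identities.
  have h3 : ∑ i, ∑ b, (Y i (X b (m i a b) + d b * m i a b) + h i * (X b (m i a b) + d b * m i a b)) -
      ∑ i, ∑ b, (X b (Y i (m i a b) + h i * m i a b) + d b * (Y i (m i a b) + h i * m i a b)) =
      ∑ i, ∑ b, ∑ c, m i b c * X c (m i a b) +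
      ∑ i, ∑ b, ∑ c, m i a b * (X c (m i b c) + d c * m i b c) +
      ∑ i, ∑ b, ∑ j, (w b i j * Y j (m i a b) + m i a b * (Y j (w b i j) + h j * w b i j)) := by
    simp only [← Finset.sum_add_distrib, ← Finset.sum_sub_distrib]
    refine Finset.sum_congr rfl fun i _ => Finset.sum_congr rfl fun b _ => ?_
    have e1 := H.comm_mixed i b (m i a b)
    have e2 := H.div_mixed i b
    simp only [map_add, Derivation.leibniz, smul_eq_mul]
    simp only [Finset.sum_add_distrib, ← Finset.mul_sum] at e2 ⊢
    linear_combination e1 + m i a b * e2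
  have h4 : ∑ i, ∑ b, ∑ j, (Y i (w b i j * m j a b) + h i * (w b i j * m j a b)) =
      -∑ i, ∑ b, ∑ j, (w b i j * Y j (m i a b) + m i a b * (Y j (w b i j) + h j * w b i j)) := by
    rw [sum_swap_outer]
    simp only [← Finset.sum_neg_distrib]
    refine Finset.sum_congr rfl fun i _ => Finset.sum_congr rfl fun b _ =>
      Finset.sum_congr rfl fun j _ => ?_
    rw [H.w_swap b i j, Derivation.leibniz, map_neg, smul_eq_mul, smul_eq_mul]
    ring
  have h5 : ∑ b, (X b (X a (d b)) + d b * X a (d b)) = X a (∑ b, X b (d b)) +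
      ∑ b, d b * X a (d b) - ∑ b, ∑ c, k a b c * X c (d b) +
      ∑ i, ∑ b, m i a b * Y i (d b) := by
    rw [Finset.sum_comm (s := (Finset.univ : Finset Q))]
    simp only [map_sum, ← Finset.sum_add_distrib, ← Finset.sum_sub_distrib]
    refine Finset.sum_congr rfl fun b _ => ?_
    have e := H.comm_pos a b (d b)
    linear_combination -e
  -- Antisymmetry of `k a b c` in `b` and `c` turns twice its double divergence into a sum of
  -- commutators.
  have h6 : 2 * ∑ b, ∑ c, (X b (X c (k a b c) + d c * k a b c) +
      d b * (X c (k a b c) + d c * k a b c)) = ∑ b, ∑ c, ∑ e, k b c e * X e (k a b c) -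
      ∑ i, ∑ b, ∑ c, m i b c * Y i (k a b c) - 2 * ∑ b, ∑ c, k a b c * X c (d b) := by
    rw [Finset.sum_comm (s := (Finset.univ : Finset Q)), two_mul_sum_sum, two_mul_sum_sum]
    simp only [← Finset.sum_sub_distrib]
    refine Finset.sum_congr rfl fun b _ => ?_
    rw [Finset.sum_comm (s := (Finset.univ : Finset Q)), ← Finset.sum_sub_distrib,
      ← Finset.sum_sub_distrib]
    refine Finset.sum_congr rfl fun c _ => ?_
    have e := H.comm_pos b c (k a b c)
    simp only [H.k_swap₂₃ a b c, map_add, Derivation.leibniz, smul_eq_mul, map_neg]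
    linear_combination e
  have h7 : ∑ i, ∑ b, ∑ c, ∑ j, m i a b * (w c i j * m j b c) =
      -∑ i, ∑ b, ∑ c, ∑ j, m i b c * (w c i j * m j a b) := by
    have e (i : Q) (b : P) (f : P → Q → B) : ∑ c, ∑ j, f c j = ∑ j, ∑ c, f c j := Finset.sum_comm
    rw [Finset.sum_congr rfl fun i _ => Finset.sum_congr rfl fun b _ => e i b _, sum_swap_outer]
    simp only [← Finset.sum_neg_distrib]
    refine Finset.sum_congr rfl fun i _ => Finset.sum_congr rfl fun b _ => ?_
    rw [Finset.sum_comm]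
    refine Finset.sum_congr rfl fun c _ => Finset.sum_congr rfl fun j _ => ?_
    rw [H.w_swap c i j]; ring
  -- The contracted Jacobi identities supply the derivatives of the squared norms of `k` and `m` in
  -- `halfScalar`.
  have j1 := H.jacobi_pos_contracted a
  have j2 := H.jacobi_mixed_contracted a
  have hl : ∑ i, (Y i (mixedRicci X Y d m w a i) + h i * mixedRicci X Y d m w a i) -
      ∑ i, ∑ b, m i a b * mixedRicci X Y d m w b i =
      ∑ i, ∑ b, (Y i (X b (m i a b) + d b * m i a b) + h i * (X b (m i a b) + d b * m i a b)) +
      ∑ i, ∑ b, ∑ j, (Y i (w b i j * m j a b) + h i * (w b i j * m j a b)) -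
      ∑ i, (Y i (Y i (d a)) + h i * Y i (d a)) -
      ∑ i, ∑ b, ∑ c, m i a b * (X c (m i b c) + d c * m i b c) -
      ∑ i, ∑ b, ∑ c, ∑ j, m i a b * (w c i j * m j b c) +
      ∑ i, ∑ b, m i a b * Y i (d b) := by
    simp only [mixedRicci, ← Finset.sum_add_distrib, ← Finset.sum_sub_distrib]
    refine Finset.sum_congr rfl fun i _ => ?_
    simp only [map_sub, map_add, map_sum, mul_sub, mul_add, Finset.mul_sum, Finset.sum_add_distrib,
      Finset.sum_sub_distrib]
    ring
  have hr : X a (halfScalar X d k m) = -12 * X a (∑ b, X b (d b)) - 12 * ∑ b, d b * X a (d b) +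
      2 * ∑ b, ∑ c, ∑ e, k b c e * X a (k b c e) -
      6 * ∑ i, ∑ b, ∑ c, m i b c * X a (m i b c) := by
    have e12 : X a (12 : B) = 0 := (X a).map_natCast 12
    have e6 : X a (6 : B) = 0 := (X a).map_natCast 6
    have e3 : X a (3 : B) = 0 := (X a).map_natCast 3
    simp only [halfScalar, map_sub, map_add, map_neg, Derivation.leibniz, e12, e6, e3, smul_eq_mul,
      map_sum, ← two_mul, ← Finset.mul_sum]
    ring
  rw [hl, hr]
  linear_combination 12 * h3 + 12 * h4 + 12 * h1 - 12 * h2 - 12 * h5 + 6 * h6 - 12 * h7 - 2 * j1 + 6 * j2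

/-- The first variation of `halfScalar` when the frame moves by `e_a' = κ_{ai} e_i`,
`e_i' = κ_{ai} e_a` and the half-density by `σ' = -½ R σ`. -/
theorem halfScalar_variation (H : HalfFrame X Y d h k m w) (κ : P → Q → B) (R : B)
    {d' : P → B} {k' : P → P → P → B} {m' : Q → P → P → B}
    (hd : ∀ a, d' a = ∑ i, (Y i (κ a i) + h i * κ a i) - X a R)
    (hk : ∀ a b c, k' a b c = ∑ i, (κ a i * m i b c - κ b i * m i a c + κ c i * m i a b))
    (hm : ∀ i a b, m' i a b = ∑ c, κ c i * k c a b - X a (κ b i) + X b (κ a i) +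
      ∑ j, (κ a j * w b i j - κ b j * w a i j)) :
    -12 * ∑ a, (∑ i, κ a i * Y i (d a) + X a (d' a)) - 12 * ∑ a, d a * d' a +
      2 * ∑ a, ∑ b, ∑ c, k a b c * k' a b c - 6 * ∑ i, ∑ a, ∑ b, m i a b * m' i a b =
    12 * ∑ a, ∑ i, κ a i * mixedRicci X Y d m w a i +
      12 * ∑ a, (X a (X a R - (∑ i, (Y i (κ a i) + h i * κ a i) - ∑ i, ∑ b, m i a b * κ b i)) +
        d a * (X a R - (∑ i, (Y i (κ a i) + h i * κ a i) - ∑ i, ∑ b, m i a b * κ b i))) := by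
  have rot (b c e) : k c e b = k b c e := by rw [H.k_swap₂₃ c b e, H.k_swap₁₂ b c e, neg_neg]
  -- By total antisymmetry of `k`, the three terms of `k'` contribute equally.
  have h1 : ∑ a, ∑ b, ∑ c, k a b c * k' a b c = 3 * ∑ i, ∑ a, ∑ b, ∑ c, m i a b * (κ c i * k c a b) := by
    have z0 : ∑ i, ∑ a, ∑ b, ∑ c, m i a b * (κ c i * k c a b) =
        ∑ a, ∑ b, ∑ c, ∑ i, k a b c * (κ c i * m i a b) := by
      rw [Finset.sum_comm]
      refine Finset.sum_congr rfl fun a _ => ?_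
      rw [Finset.sum_comm]
      refine Finset.sum_congr rfl fun b _ => ?_
      rw [Finset.sum_comm]
      refine Finset.sum_congr rfl fun c _ => Finset.sum_congr rfl fun i _ => ?_
      rw [rot c a b]; ring
    have z1 : ∑ a, ∑ b, ∑ c, ∑ i, k a b c * (κ a i * m i b c) =
        ∑ a, ∑ b, ∑ c, ∑ i, k a b c * (κ c i * m i a b) := by
      rw [sum_cyclic fun a b c => ∑ i, k a b c * (κ c i * m i a b)]
      simp only [rot]
    have z2 : ∑ a, ∑ b, ∑ c, ∑ i, k a b c * (κ b i * m i a c) =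
        -∑ a, ∑ b, ∑ c, ∑ i, k a b c * (κ c i * m i a b) := by
      simp only [← Finset.sum_neg_distrib]
      refine Finset.sum_congr rfl fun a _ => ?_
      rw [Finset.sum_comm]
      refine Finset.sum_congr rfl fun b _ => Finset.sum_congr rfl fun c _ =>
        Finset.sum_congr rfl fun i _ => ?_
      rw [H.k_swap₂₃ a b c]; ring
    simp only [hk, Finset.mul_sum, mul_add, mul_sub, Finset.sum_add_distrib,
      Finset.sum_sub_distrib, z1, z2]
    simp only [← Finset.mul_sum] at z0 ⊢
    rw [z0]; ring
  have h2 : ∑ i, ∑ a, ∑ b, m i a b * m' i a b = ∑ i, ∑ a, ∑ b, ∑ c, m i a b * (κ c i * k c a b) -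
      2 * ∑ i, ∑ a, ∑ b, m i a b * X a (κ b i) -
      2 * ∑ i, ∑ a, ∑ b, ∑ j, m i a b * (κ b j * w a i j) := by
    have z1 : ∑ i, ∑ a, ∑ b, m i a b * X b (κ a i) = -∑ i, ∑ a, ∑ b, m i a b * X a (κ b i) := by
      simp only [← Finset.sum_neg_distrib]
      refine Finset.sum_congr rfl fun i _ => ?_
      rw [Finset.sum_comm]
      refine Finset.sum_congr rfl fun b _ => Finset.sum_congr rfl fun c _ => ?_
      rw [H.m_swap i b c, neg_mul]
    have z2 : ∑ i, ∑ a, ∑ b, ∑ j, m i a b * (κ a j * w b i j) =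
        -∑ i, ∑ a, ∑ b, ∑ j, m i a b * (κ b j * w a i j) := by
      simp only [← Finset.sum_neg_distrib]
      refine Finset.sum_congr rfl fun i _ => ?_
      rw [Finset.sum_comm]
      refine Finset.sum_congr rfl fun b _ => Finset.sum_congr rfl fun c _ =>
        Finset.sum_congr rfl fun j _ => ?_
      rw [H.m_swap i b c, neg_mul]
    simp only [hm, Finset.mul_sum, mul_add, mul_sub, Finset.sum_add_distrib,
      Finset.sum_sub_distrib, z1, z2]
    simp only [← Finset.mul_sum]
    ring
  have h3 : ∑ a, (X a (∑ i, ∑ b, m i a b * κ b i) + d a * ∑ i, ∑ b, m i a b * κ b i) =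
      ∑ i, ∑ a, ∑ b, m i a b * X a (κ b i) -
      ∑ i, ∑ b, κ b i * (∑ a, (X a (m i b a) + d a * m i b a)) := by
    rw [← Finset.sum_sub_distrib]
    simp only [map_sum, Finset.mul_sum, ← Finset.sum_add_distrib]
    rw [Finset.sum_comm]
    refine Finset.sum_congr rfl fun i _ => ?_
    rw [Finset.sum_comm (f := fun b a => κ b i * (X a (m i b a) + d a * m i b a)),
      ← Finset.sum_sub_distrib]
    refine Finset.sum_congr rfl fun a _ => ?_
    rw [← Finset.sum_sub_distrib]
    refine Finset.sum_congr rfl fun b _ => ?_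
    rw [H.m_swap i a b, Derivation.leibniz, map_neg, smul_eq_mul, smul_eq_mul]
    ring
  have h4 : ∑ i, ∑ b, κ b i * ∑ a, ∑ j, w a i j * m j b a =
      ∑ i, ∑ a, ∑ b, ∑ j, m i a b * (κ b j * w a i j) := by
    simp only [Finset.mul_sum]
    have e (f : P → P → Q → B) : ∑ b, ∑ a, ∑ j, f b a j = ∑ j, ∑ a, ∑ b, f b a j := by
      calc ∑ b, ∑ a, ∑ j, f b a j = ∑ b, ∑ j, ∑ a, f b a j :=
            Finset.sum_congr rfl fun b _ => Finset.sum_comm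
        _ = ∑ j, ∑ b, ∑ a, f b a j := Finset.sum_comm
        _ = _ := Finset.sum_congr rfl fun b _ => Finset.sum_comm
    rw [Finset.sum_congr rfl fun i _ => e _, Finset.sum_comm]
    refine Finset.sum_congr rfl fun i _ => ?_
    have e' (f : Q → P → P → B) : ∑ j, ∑ a, ∑ b, f j a b = ∑ a, ∑ b, ∑ j, f j a b := by
      calc ∑ j, ∑ a, ∑ b, f j a b = ∑ a, ∑ j, ∑ b, f j a b := Finset.sum_comm
        _ = _ := Finset.sum_congr rfl fun b _ => Finset.sum_comm
    rw [e']
    refine Finset.sum_congr rfl fun a _ => Finset.sum_congr rfl fun b _ =>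
        Finset.sum_congr rfl fun j _ => ?_
    rw [H.w_swap a i j, H.m_swap i a b]; ring
  have h5 : ∑ a, ∑ i, κ a i * mixedRicci X Y d m w a i =
      ∑ i, ∑ b, κ b i * (∑ a, (X a (m i b a) + d a * m i b a)) +
      ∑ i, ∑ b, κ b i * ∑ a, ∑ j, w a i j * m j b a - ∑ a, ∑ i, κ a i * Y i (d a) := by
    rw [Finset.sum_comm, Finset.sum_comm (f := fun a i => κ a i * Y i (d a))]
    simp only [mixedRicci, ← Finset.sum_add_distrib, ← Finset.sum_sub_distrib]
    refine Finset.sum_congr rfl fun i _ => Finset.sum_congr rfl fun a _ => ?_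
    simp only [Finset.sum_add_distrib]
    ring
  -- The variation `d'` involves the divergence of `κ` without the frame correction in `m`. Adding
  -- and subtracting that correction produces the covariant divergence of the Bianchi identity.
  have h6 : ∑ a, X a (d' a) + ∑ a, d a * d' a = -∑ a, (X a (X a R - (∑ i, (Y i (κ a i) + h i * κ a i) -
        ∑ i, ∑ b, m i a b * κ b i)) +
        d a * (X a R - (∑ i, (Y i (κ a i) + h i * κ a i) - ∑ i, ∑ b, m i a b * κ b i))) +
      ∑ a, (X a (∑ i, ∑ b, m i a b * κ b i) + d a * ∑ i, ∑ b, m i a b * κ b i) := by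
    rw [← Finset.sum_neg_distrib, ← Finset.sum_add_distrib, ← Finset.sum_add_distrib]
    refine Finset.sum_congr rfl fun a _ => ?_
    rw [hd, map_sub, map_sub, map_sub]
    ring
  rw [Finset.sum_add_distrib]
  linear_combination (-12) * h6 + 2 * h1 - 6 * h2 - 12 * h3 - 12 * h4 - 12 * h5

/-- The full Ricci tensor has the same mixed component whichever half it is computed from. The
difference of the two expressions is exactly the identity `div_mixed`. -/
theorem mixedRicci_flip (H : HalfFrame X Y d h k m w) (a : P) (i : Q) :
    mixedRicci Y X h (fun a i j => -w a i j) (fun i a b => -m i a b) i a =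
      mixedRicci X Y d m w a i := by
  have e := H.div_mixed i a
  simp only [mixedRicci, map_neg, mul_neg, neg_mul, neg_neg, ← neg_add, Finset.sum_neg_distrib]
  rw [Finset.sum_comm (s := (Finset.univ : Finset Q))]
  simp only [mul_comm (m _ _ _)]
  linear_combination e

/-- The evolution equation `R' = 8 |A|² + 2 Δ R` of the scalar curvature. -/
theorem scalar_variation {l : Q → Q → Q → B} (H : HalfFrame X Y d h k m w)
    (H' : HalfFrame Y X h d (fun i j n => -l i j n) (fun a i j => -w a i j) (fun i a b => -m i a b))
    (κ : P → Q → B) (R : B) (hκ : ∀ a i, κ a i = 2 * mixedRicci X Y d m w a i)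
    (hR : 6 * R = halfScalar X d k m +
      halfScalar Y h (fun i j n => -l i j n) (fun a i j => -w a i j))
    {d' : P → B} {h' : Q → B} {k' : P → P → P → B} {m' : Q → P → P → B} {l' : Q → Q → Q → B}
    {w' : P → Q → Q → B}
    (hd : ∀ a, d' a = ∑ i, (Y i (κ a i) + h i * κ a i) - X a R)
    (hh : ∀ i, h' i = ∑ a, (X a (κ a i) + d a * κ a i) - Y i R)
    (hk : ∀ a b c, k' a b c = ∑ i, (κ a i * m i b c - κ b i * m i a c + κ c i * m i a b))
    (hl : ∀ i j n, l' i j n = ∑ a, (κ a i * w a j n - κ a j * w a i n + κ a n * w a i j))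
    (hm : ∀ i a b, m' i a b = ∑ c, κ c i * k c a b - X a (κ b i) + X b (κ a i) +
      ∑ j, (κ a j * w b i j - κ b j * w a i j))
    (hw : ∀ a i j, w' a i j = ∑ n, κ a n * l n i j + Y i (κ a j) - Y j (κ a i) +
      ∑ b, (κ b i * m j a b - κ b j * m i a b)) :
    (-12 * ∑ a, (∑ i, κ a i * Y i (d a) + X a (d' a)) - 12 * ∑ a, d a * d' a +
      2 * ∑ a, ∑ b, ∑ c, k a b c * k' a b c - 6 * ∑ i, ∑ a, ∑ b, m i a b * m' i a b) +
    (-12 * ∑ i, (∑ a, κ a i * X a (h i) + Y i (h' i)) - 12 * ∑ i, h i * h' i +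
      2 * ∑ i, ∑ j, ∑ n, l i j n * l' i j n - 6 * ∑ a, ∑ i, ∑ j, w a i j * w' a i j) =
    48 * ∑ a, ∑ i, mixedRicci X Y d m w a i * mixedRicci X Y d m w a i +
      12 * ∑ a, (X a (X a R) + d a * X a R) := by
  have e1 := H.halfScalar_variation κ R hd hk hm
  have e2 := H'.halfScalar_variation (fun i a => κ a i) R (d' := h') (k' := fun i j n => -l' i j n)
    (m' := fun a i j => -w' a i j) hh
    (fun i j n => by
      simp only [hl, ← Finset.sum_neg_distrib]
      exact Finset.sum_congr rfl fun _ _ => by ring)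
    (fun a i j => by
      simp only [hw, mul_neg, Finset.sum_neg_distrib, Finset.sum_sub_distrib]
      ring)
  have n6 (D : Derivation ℝ B B) (f : B) : D (6 * f) = 6 * D f := by
    rw [D.leibniz, show D (6 : B) = 0 from D.map_natCast 6, smul_zero, add_zero, smul_eq_mul]
  have n2 (D : Derivation ℝ B B) (f : B) : D (2 * f) = 2 * D f := by
    rw [D.leibniz, show D (2 : B) = 0 from D.map_natCast 2, smul_zero, add_zero, smul_eq_mul]
  -- The contracted Bianchi identity, with 6 in place of 12 because `κ` is twice the mixed Ricci
  -- component.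
  have b1 (a : P) : 6 * (∑ i, (Y i (κ a i) + h i * κ a i) - ∑ i, ∑ b, m i a b * κ b i) =
      X a (halfScalar X d k m) := by
    rw [← H.bianchi a]
    simp only [hκ, n2, mul_left_comm _ (2 : B), ← mul_add, ← Finset.mul_sum]
    ring
  have b2 (i : Q) : 6 * (∑ a, (X a (κ a i) + d a * κ a i) - ∑ a, ∑ j, -w a i j * κ a j) =
      Y i (halfScalar Y h (fun i j n => -l i j n) (fun a i j => -w a i j)) := by
    rw [← H'.bianchi i]
    simp only [H.mixedRicci_flip, hκ, n2, mul_left_comm _ (2 : B), ← mul_add, ← Finset.mul_sum]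
    ring
  -- As 6R is the sum of the two halves, subtracting the divergence of `κ` from `X a R` leaves a
  -- sixth of the derivative of the other half.
  have c1 : 12 * ∑ a, (X a (X a R - (∑ i, (Y i (κ a i) + h i * κ a i) -
        ∑ i, ∑ b, m i a b * κ b i)) +
        d a * (X a R - (∑ i, (Y i (κ a i) + h i * κ a i) - ∑ i, ∑ b, m i a b * κ b i))) =
      2 * ∑ a, (X a (X a (halfScalar Y h (fun i j n => -l i j n) (fun a i j => -w a i j))) +
        d a * X a (halfScalar Y h (fun i j n => -l i j n) (fun a i j => -w a i j))) := by
    rw [show (12 : B) = 2 * 6 by norm_num, mul_assoc, Finset.mul_sum]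
    congr 1
    refine Finset.sum_congr rfl fun a _ => ?_
    have e : X a (halfScalar Y h (fun i j n => -l i j n) (fun a i j => -w a i j)) =
        6 * (X a R - (∑ i, (Y i (κ a i) + h i * κ a i) - ∑ i, ∑ b, m i a b * κ b i)) := by
      rw [mul_sub, b1, ← n6, ← map_sub, hR, add_sub_cancel_left]
    rw [e, n6]
    ring
  -- For the negative half the Laplacian is that of V₋; `laplace` replaces it by the Laplacian of
  -- V₊, so that the two contributions can be added.
  have c2 : 12 * ∑ i, (Y i (Y i R - (∑ a, (X a (κ a i) + d a * κ a i) -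
        ∑ a, ∑ j, -w a i j * κ a j)) +
        h i * (Y i R - (∑ a, (X a (κ a i) + d a * κ a i) - ∑ a, ∑ j, -w a i j * κ a j))) =
      2 * ∑ a, (X a (X a (halfScalar X d k m)) + d a * X a (halfScalar X d k m)) := by
    rw [H.laplace, show (12 : B) = 2 * 6 by norm_num, mul_assoc, Finset.mul_sum]
    congr 1
    refine Finset.sum_congr rfl fun i _ => ?_
    have e : Y i (halfScalar X d k m) = 6 * (Y i R - (∑ a, (X a (κ a i) + d a * κ a i) -
        ∑ a, ∑ j, -w a i j * κ a j)) := by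
      rw [mul_sub, b2, ← n6, ← map_sub, hR, add_sub_cancel_right]
    rw [e, n6]
    ring
  have c3 : 12 * ∑ a, (X a (X a R) + d a * X a R) =
      2 * ∑ a, (X a (X a (halfScalar X d k m)) + d a * X a (halfScalar X d k m)) +
      2 * ∑ a, (X a (X a (halfScalar Y h (fun i j n => -l i j n) (fun a i j => -w a i j))) +
        d a * X a (halfScalar Y h (fun i j n => -l i j n) (fun a i j => -w a i j))) := by
    rw [show (12 : B) = 2 * 6 by norm_num, mul_assoc, ← mul_add, ← Finset.sum_add_distrib,
      Finset.mul_sum]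
    congr 1
    refine Finset.sum_congr rfl fun a _ => ?_
    have e : 6 * (X a R) = X a (halfScalar X d k m) +
        X a (halfScalar Y h (fun i j n => -l i j n) (fun a i j => -w a i j)) := by
      rw [← n6, hR, map_add]
    rw [mul_add, ← n6, e, mul_left_comm, e, map_add]
    ring
  have c4 : ∑ a, ∑ i, κ a i * mixedRicci X Y d m w a i =
      2 * ∑ a, ∑ i, mixedRicci X Y d m w a i * mixedRicci X Y d m w a i := by
    simp only [hκ, mul_assoc, ← Finset.mul_sum]
  have c5 : ∑ i, ∑ a, κ a i * mixedRicci X Y d m w a i =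
      2 * ∑ a, ∑ i, mixedRicci X Y d m w a i * mixedRicci X Y d m w a i := by
    rw [Finset.sum_comm, c4]
  rw [c1] at e1
  simp only [H.mixedRicci_flip] at e2
  rw [c2] at e2
  simp only [neg_mul_neg] at e2
  linear_combination e1 + e2 + 12 * c4 + 12 * c5 - c3

end HalfFrame

end FrameAlgebra

/-! ### Adapted frames in coordinates: vector fields, divergences and structure functions -/

section ChartAlgebra

variable {P Q K B : Type*} [CommRing B]

variable (P Q B) in
/-- The signature of an adapted frame. -/
def sgn (A : P ⊕ Q) : B := Sum.elim (fun _ => 1) (fun _ => -1) A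

@[simp] theorem sgn_inl (a : P) : sgn P Q B (Sum.inl a) = 1 := rfl

@[simp] theorem sgn_inr (i : Q) : sgn P Q B (Sum.inr i) = -1 := rfl

variable [Fintype P] [Fintype Q] [Fintype K] [Algebra ℝ B]

/-- The vector field with components `r`. -/
def vectorField (D : K → Derivation ℝ B B) (r : K → B) : Derivation ℝ B B := ∑ l, r l • D l

theorem vectorField_apply (D : K → Derivation ℝ B B) (r : K → B) (f : B) :
    vectorField D r f = ∑ l, r l * D l f := by
  have h := map_sum (Derivation.coeFnAddMonoidHom (R := ℝ) (A := B) (M := B)) (fun l => r l • D l)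
    Finset.univ
  refine (congrFun h f).trans ?_
  rw [Finset.sum_apply]
  rfl

/-- The divergence `∑ ∂ₗ rˡ + r(s)` of a vector field with respect to the density `exp s`. -/
def divergence (D : K → Derivation ℝ B B) (s : B) (r : K → B) : B :=
  ∑ l, D l (r l) + vectorField D r s

/-- The identities satisfied, in a coordinate chart, by the components `r A l` of the anchors of an
adapted orthonormal frame and by its structure functions `c`. -/
structure ChartFrame (D : K → Derivation ℝ B B) (r : P ⊕ Q → K → B)
    (c : P ⊕ Q → P ⊕ Q → P ⊕ Q → B) : Prop where
  swap₁₂ : ∀ A₁ A₂ A₃, c A₂ A₁ A₃ = -c A₁ A₂ A₃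
  swap₂₃ : ∀ A₁ A₂ A₃, c A₁ A₃ A₂ = -c A₁ A₂ A₃
  anchor_bracket : ∀ A₁ A₂ l, vectorField D (r A₁) (r A₂ l) - vectorField D (r A₂) (r A₁ l) =
    ∑ A, sgn P Q B A * (c A₁ A₂ A * r A l)
  jacobi : ∀ A₁ A₂ A₃ A₄, vectorField D (r A₁) (c A₂ A₃ A₄) - vectorField D (r A₂) (c A₁ A₃ A₄) +
      vectorField D (r A₃) (c A₁ A₂ A₄) - vectorField D (r A₄) (c A₁ A₂ A₃) =
    ∑ A, sgn P Q B A * (c A₂ A₃ A * c A₁ A₄ A - c A₁ A₃ A * c A₂ A₄ A + c A₁ A₂ A * c A₃ A₄ A)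
  anchor_isotropic : ∀ l l', ∑ A, sgn P Q B A * (r A l * r A l') = 0

namespace ChartFrame

variable {D : K → Derivation ℝ B B} {r : P ⊕ Q → K → B} {c : P ⊕ Q → P ⊕ Q → P ⊕ Q → B}

/-- The second-order terms cancel because coordinate derivatives commute; the first-order terms are
given by `anchor_bracket`. -/
theorem comm (H : ChartFrame D r c) (hD : ∀ l l' f, D l (D l' f) = D l' (D l f)) (A₁ A₂ : P ⊕ Q)
    (f : B) : vectorField D (r A₁) (vectorField D (r A₂) f) -
      vectorField D (r A₂) (vectorField D (r A₁) f) =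
    ∑ A, sgn P Q B A * (c A₁ A₂ A * vectorField D (r A) f) := by
  have h1 (A₁ A₂ : P ⊕ Q) : vectorField D (r A₁) (vectorField D (r A₂) f) =
      ∑ l, vectorField D (r A₁) (r A₂ l) * D l f +
        ∑ l, ∑ l', r A₁ l * (r A₂ l' * D l (D l' f)) := by
    rw [vectorField_apply D (r A₂) f, map_sum]
    simp only [Derivation.leibniz, Finset.sum_add_distrib, smul_eq_mul]
    rw [add_comm, Finset.sum_comm (s := (Finset.univ : Finset K))]
    simp only [mul_comm (D _ f), vectorField_apply D (r A₁) (D _ f), Finset.mul_sum,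
      mul_left_comm (r A₂ _)]
  have h2 : ∑ l, ∑ l', r A₁ l * (r A₂ l' * D l (D l' f)) =
      ∑ l, ∑ l', r A₂ l * (r A₁ l' * D l (D l' f)) := by
    rw [Finset.sum_comm]
    refine Finset.sum_congr rfl fun l _ => Finset.sum_congr rfl fun l' _ => ?_
    rw [hD l' l, mul_left_comm]
  rw [h1, h1, h2, add_sub_add_right_eq_sub, ← Finset.sum_sub_distrib]
  simp only [← sub_mul, H.anchor_bracket]
  simp only [vectorField_apply, Finset.sum_mul, Finset.mul_sum]
  rw [Finset.sum_comm]
  refine Finset.sum_congr rfl fun l _ => Finset.sum_congr rfl fun l' _ => ?_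
  ring

/-- This is X(div Y) - Y(div X) = div [X, Y] with the bracket expanded in the frame. The second
derivatives and the products of first derivatives cancel in the difference. -/
theorem div (H : ChartFrame D r c) (hD : ∀ l l' f, D l (D l' f) = D l' (D l f)) (s : B)
    (A₁ A₂ : P ⊕ Q) : vectorField D (r A₁) (divergence D s (r A₂)) -
      vectorField D (r A₂) (divergence D s (r A₁)) =
    ∑ A, sgn P Q B A * (vectorField D (r A) (c A₁ A₂ A) + divergence D s (r A) * c A₁ A₂ A) := by
  have h1 := H.comm hD A₁ A₂ s
  have h2 (A₁ A₂ : P ⊕ Q) : vectorField D (r A₁) (∑ l, D l (r A₂ l)) =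
      ∑ l, D l (vectorField D (r A₁) (r A₂ l)) - ∑ l, ∑ l', D l (r A₁ l') * D l' (r A₂ l) := by
    rw [map_sum, ← Finset.sum_sub_distrib]
    refine Finset.sum_congr rfl fun l _ => ?_
    simp only [vectorField_apply, map_sum, Derivation.leibniz, smul_eq_mul, Finset.sum_add_distrib]
    simp only [mul_comm (D _ (r A₁ _)), add_sub_cancel_right]
    exact Finset.sum_congr rfl fun l' _ => by rw [hD l l']
  have h3 : ∑ l, ∑ l', D l (r A₁ l') * D l' (r A₂ l) = ∑ l, ∑ l', D l (r A₂ l') * D l' (r A₁ l) := by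
    rw [Finset.sum_comm]
    exact Finset.sum_congr rfl fun l _ => Finset.sum_congr rfl fun l' _ => mul_comm _ _
  have h4 : ∑ l, D l (vectorField D (r A₁) (r A₂ l)) - ∑ l, D l (vectorField D (r A₂) (r A₁ l)) =
      ∑ A, sgn P Q B A * (vectorField D (r A) (c A₁ A₂ A) + (∑ l, D l (r A l)) * c A₁ A₂ A) := by
    rw [← Finset.sum_sub_distrib]
    simp only [← map_sub, H.anchor_bracket, map_sum]
    rw [Finset.sum_comm]
    refine Finset.sum_congr rfl fun A _ => ?_
    have hs (l : K) (f : B) : D l (sgn P Q B A * f) = sgn P Q B A * D l f := by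
      rcases A with a | i <;> simp
    simp only [hs, ← Finset.mul_sum]
    congr 1
    simp only [Derivation.leibniz, smul_eq_mul, vectorField_apply, Finset.sum_add_distrib,
      Finset.sum_mul]
    rw [add_comm]
    congr 1
    exact Finset.sum_congr rfl fun l _ => mul_comm _ _
  simp only [divergence, map_add, h2]
  simp only [add_mul, mul_add, Finset.sum_add_distrib] at h4 h1 ⊢
  simp only [mul_comm (c _ _ _)] at h1
  linear_combination h1 + h4 - h3

/-- Isotropy of the anchor says that the vector field ∑ ±X_A(f) X_A vanishes. The identity is its
divergence with respect to the density exp `s`, and it makes the Laplacians of the two halves equal.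
-/
theorem laplace (H : ChartFrame D r c) (s : B) (f : B) :
    ∑ A, sgn P Q B A * (vectorField D (r A) (vectorField D (r A) f) +
      divergence D s (r A) * vectorField D (r A) f) = 0 := by
  have hz (l : K) : ∑ A, sgn P Q B A * (r A l * vectorField D (r A) f) = 0 := by
    simp only [vectorField_apply, Finset.mul_sum]
    rw [Finset.sum_comm]
    refine Finset.sum_eq_zero fun l' _ => ?_
    have := congrArg (· * D l' f) (H.anchor_isotropic l l')
    simp only [Finset.sum_mul, zero_mul] at this
    rw [← this]
    exact Finset.sum_congr rfl fun A _ => by ring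
  have hs (l : K) (A : P ⊕ Q) (f : B) : D l (sgn P Q B A * f) = sgn P Q B A * D l f := by
    rcases A with a | i <;> simp
  have h1 (l : K) : ∑ A, sgn P Q B A * (r A l * D l (vectorField D (r A) f) +
      D l (r A l) * vectorField D (r A) f) = 0 := by
    have := congrArg (D l) (hz l)
    simpa only [map_sum, hs, map_zero, Derivation.leibniz, smul_eq_mul,
      mul_comm (vectorField D (r _) f)] using this
  have h2 (l : K) : ∑ A, sgn P Q B A * (r A l * D l s * vectorField D (r A) f) = 0 := by
    have := congrArg (· * D l s) (hz l)
    simp only [Finset.sum_mul, zero_mul] at this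
    rw [← this]
    exact Finset.sum_congr rfl fun A _ => by ring
  have h3 : ∑ l, (∑ A, sgn P Q B A * (r A l * D l (vectorField D (r A) f) +
      D l (r A l) * vectorField D (r A) f) +
      ∑ A, sgn P Q B A * (r A l * D l s * vectorField D (r A) f)) = 0 :=
    Finset.sum_eq_zero fun l _ => by rw [h1, h2, add_zero]
  rw [← h3]
  simp only [← Finset.sum_add_distrib]
  rw [Finset.sum_comm]
  refine Finset.sum_congr rfl fun A _ => ?_
  simp only [← mul_add, ← Finset.mul_sum]
  congr 1
  rw [divergence, vectorField_apply D (r A) (vectorField D (r A) f), vectorField_apply D (r A) s,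
    add_mul, Finset.sum_mul, Finset.sum_mul, ← Finset.sum_add_distrib, ← Finset.sum_add_distrib]
  exact Finset.sum_congr rfl fun l _ => by ring

/-- The frame identities seen from the positive eigenbundle. -/
theorem halfFrame_pos (H : ChartFrame D r c) (hD : ∀ l l' f, D l (D l' f) = D l' (D l f)) (s : B) :
    HalfFrame (fun a => vectorField D (r (Sum.inl a))) (fun i => vectorField D (r (Sum.inr i)))
      (fun a => divergence D s (r (Sum.inl a))) (fun i => divergence D s (r (Sum.inr i)))
      (fun a₁ a₂ a₃ => c (Sum.inl a₁) (Sum.inl a₂) (Sum.inl a₃))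
      (fun i a₁ a₂ => c (Sum.inr i) (Sum.inl a₁) (Sum.inl a₂))
      (fun a i₁ i₂ => c (Sum.inl a) (Sum.inr i₁) (Sum.inr i₂)) := by
  have r1 (A₁ A₂ A₃) : c A₂ A₃ A₁ = c A₁ A₂ A₃ := by rw [H.swap₂₃, H.swap₁₂, neg_neg]
  have q1 (a b : P) (i : Q) : c (Sum.inl a) (Sum.inl b) (Sum.inr i) =
    c (Sum.inr i) (Sum.inl a) (Sum.inl b) := r1 _ _ _
  have q2 (a b : P) (i : Q) : c (Sum.inl a) (Sum.inr i) (Sum.inl b) =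
    -c (Sum.inr i) (Sum.inl a) (Sum.inl b) := H.swap₁₂ _ _ _
  have q3 (a : P) (i j : Q) : c (Sum.inr i) (Sum.inl a) (Sum.inr j) =
    -c (Sum.inl a) (Sum.inr i) (Sum.inr j) := H.swap₁₂ _ _ _
  have q4 (a : P) (i j : Q) : c (Sum.inr i) (Sum.inr j) (Sum.inl a) =
    c (Sum.inl a) (Sum.inr i) (Sum.inr j) := r1 _ _ _
  refine ⟨fun _ _ _ => H.swap₁₂ _ _ _, fun _ _ _ => H.swap₂₃ _ _ _, fun _ _ _ => H.swap₂₃ _ _ _,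
    fun _ _ _ => H.swap₂₃ _ _ _, fun a b f => ?_, fun i b f => ?_, fun a b => ?_, fun i b => ?_,
    fun a b c e => ?_, fun a i b c => ?_, fun f => ?_⟩
  · have := H.comm hD (Sum.inl a) (Sum.inl b) f
    simp only [Fintype.sum_sum_type, sgn_inl, sgn_inr, q1, neg_mul, one_mul,
      Finset.sum_neg_distrib] at this
    linear_combination this
  · have := H.comm hD (Sum.inr i) (Sum.inl b) f
    simp only [Fintype.sum_sum_type, sgn_inl, sgn_inr, q3, neg_mul, one_mul, neg_neg] at this
    linear_combination this
  · have := H.div hD s (Sum.inl a) (Sum.inl b)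
    simp only [Fintype.sum_sum_type, sgn_inl, sgn_inr, q1, neg_mul, one_mul,
      Finset.sum_neg_distrib] at this
    linear_combination this
  · have := H.div hD s (Sum.inr i) (Sum.inl b)
    simp only [Fintype.sum_sum_type, sgn_inl, sgn_inr, q3, neg_mul, one_mul, map_neg, mul_neg,
      ← neg_add, neg_neg] at this
    linear_combination this
  · have := H.jacobi (Sum.inl a) (Sum.inl b) (Sum.inl c) (Sum.inl e)
    simp only [Fintype.sum_sum_type, sgn_inl, sgn_inr, q1, neg_mul, one_mul,
      Finset.sum_neg_distrib] at this
    linear_combination this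
  · have := H.jacobi (Sum.inl a) (Sum.inr i) (Sum.inl b) (Sum.inl c)
    simp only [Fintype.sum_sum_type, sgn_inl, sgn_inr, q1, q2, q3, neg_mul, one_mul, map_neg,
      mul_neg, neg_add, neg_neg, sub_neg_eq_add] at this
    simp only [Finset.sum_add_distrib, Finset.sum_sub_distrib, Finset.sum_neg_distrib] at this ⊢
    linear_combination this
  · have := H.laplace s f
    simp only [Fintype.sum_sum_type, sgn_inl, sgn_inr, neg_mul, one_mul,
      Finset.sum_neg_distrib] at this
    linear_combination this

/-- Reversing the sign of the pairing exchanges the two eigenbundles. -/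
theorem flip (H : ChartFrame D r c) : ChartFrame D (fun A : Q ⊕ P => r A.swap)
    (fun A₁ A₂ A₃ => -c A₁.swap A₂.swap A₃.swap) := by
  have hs (A : P ⊕ Q) : sgn Q P B A.swap = -sgn P Q B A := by rcases A with a | i <;> simp
  have hsum (f : P ⊕ Q → B) : ∑ A : Q ⊕ P, f A.swap = ∑ A, f A :=
    (Equiv.sumComm Q P).sum_comp f
  have hsum' (f : P ⊕ Q → B) : ∑ A : Q ⊕ P, sgn Q P B A * f A.swap =
      -∑ A, sgn P Q B A * f A := by
    rw [← Finset.sum_neg_distrib, ← hsum]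
    refine Finset.sum_congr rfl fun A _ => ?_
    rcases A with a | i <;> simp
  refine ⟨fun _ _ _ => congrArg Neg.neg (H.swap₁₂ _ _ _),
    fun _ _ _ => congrArg Neg.neg (H.swap₂₃ _ _ _), fun A₁ A₂ l => ?_, fun A₁ A₂ A₃ A₄ => ?_, fun l l' => ?_⟩
  · rw [H.anchor_bracket, hsum' fun A => -c A₁.swap A₂.swap A * r A l]
    simp [Finset.sum_neg_distrib]
  · simp only [map_neg, neg_mul_neg]
    rw [hsum' fun A => c A₂.swap A₃.swap A * c A₁.swap A₄.swap A -
      c A₁.swap A₃.swap A * c A₂.swap A₄.swap A + c A₁.swap A₂.swap A * c A₃.swap A₄.swap A,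
      ← H.jacobi]
    ring
  · rw [hsum' fun A => r A l * r A l', H.anchor_isotropic, neg_zero]

/-- The frame identities seen from the negative eigenbundle. -/
theorem halfFrame_neg (H : ChartFrame D r c) (hD : ∀ l l' f, D l (D l' f) = D l' (D l f)) (s : B) :
    HalfFrame (fun i => vectorField D (r (Sum.inr i))) (fun a => vectorField D (r (Sum.inl a)))
      (fun i => divergence D s (r (Sum.inr i))) (fun a => divergence D s (r (Sum.inl a)))
      (fun i₁ i₂ i₃ => -c (Sum.inr i₁) (Sum.inr i₂) (Sum.inr i₃))
      (fun a i₁ i₂ => -c (Sum.inl a) (Sum.inr i₁) (Sum.inr i₂))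
      (fun i a₁ a₂ => -c (Sum.inr i) (Sum.inl a₁) (Sum.inl a₂)) :=
  H.flip.halfFrame_pos hD s

end ChartFrame

end ChartAlgebra

/-! ### Smooth functions on subsets of a normed space, time slices and spatial minima -/

section SmoothFun

variable {V : Type*} {W : Set V}

/-- Extension of a function on a subset by zero. -/
def extendZero (f : W → ℝ) : V → ℝ := Function.extend Subtype.val f 0

@[simp] theorem extendZero_coe (f : W → ℝ) (x : W) : extendZero f x = f x :=
  Subtype.val_injective.extend_apply f 0 x

theorem extendZero_of_mem (f : W → ℝ) {x : V} (hx : x ∈ W) : extendZero f x = f ⟨x, hx⟩ :=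
  extendZero_coe f ⟨x, hx⟩

theorem eqOn_extendZero (g : V → ℝ) : EqOn (extendZero fun x : W => g x) g W :=
  fun _ hx => extendZero_of_mem _ hx

variable [NormedAddCommGroup V] [NormedSpace ℝ V]

variable (W) in
/-- The algebra of smooth functions on a subset of a normed space. -/
def SmoothFun : Subalgebra ℝ (W → ℝ) where
  carrier := {f | ContDiffOn ℝ ∞ (extendZero f) W}
  mul_mem' {f g} hf hg := (hf.mul hg).congr fun x hx => by simp [extendZero_of_mem _ hx]
  add_mem' {f g} hf hg := (hf.add hg).congr fun x hx => by simp [extendZero_of_mem _ hx]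
  algebraMap_mem' c := (contDiffOn_const (c := c)).congr fun x hx => by
    simp [extendZero_of_mem _ hx]

namespace SmoothFun

/-- A function which is smooth on `W`, as an element of `SmoothFun W`. -/
def mk (g : V → ℝ) (hg : ContDiffOn ℝ ∞ g W) : SmoothFun W :=
  ⟨fun x => g x, hg.congr (eqOn_extendZero g)⟩

theorem contDiffOn (f : SmoothFun W) : ContDiffOn ℝ ∞ (extendZero (f : W → ℝ)) W := f.2

theorem differentiableOn (f : SmoothFun W) : DifferentiableOn ℝ (extendZero (f : W → ℝ)) W :=
  (SmoothFun.contDiffOn f).differentiableOn (by simp)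

/-- The directional derivative as a derivation of `SmoothFun W`. -/
def pd (hW : UniqueDiffOn ℝ W) (v : V) : Derivation ℝ (SmoothFun W) (SmoothFun W) :=
  Derivation.mk'
    { toFun := fun f => mk (fun x => fderivWithin ℝ (extendZero (f : W → ℝ)) W x v)
        (((SmoothFun.contDiffOn f).fderivWithin hW (by simp)).clm_apply contDiffOn_const)
      map_add' := fun f g => by
        ext x
        have hf := (SmoothFun.differentiableOn f) x x.2
        have hg := (SmoothFun.differentiableOn g) x x.2
        have e : fderivWithin ℝ (extendZero ((f + g : SmoothFun W) : W → ℝ)) W x =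
            fderivWithin ℝ (extendZero (f : W → ℝ) + extendZero (g : W → ℝ)) W x :=
          fderivWithin_congr (fun y hy => by simp [extendZero_of_mem _ hy]) (by simp)
        rw [fderivWithin_add (hW x x.2) hf hg] at e
        exact congrArg (fun L : V →L[ℝ] ℝ => L v) e
      map_smul' := fun c f => by
        ext x
        have hf := (SmoothFun.differentiableOn f) x x.2
        have e : fderivWithin ℝ (extendZero ((c • f : SmoothFun W) : W → ℝ)) W x =
            fderivWithin ℝ (c • extendZero (f : W → ℝ)) W x :=
          fderivWithin_congr (fun y hy => by simp [extendZero_of_mem _ hy]) (by simp)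
        rw [fderivWithin_const_smul (hW x x.2) hf] at e
        exact congrArg (fun L : V →L[ℝ] ℝ => L v) e }
    (fun f g => by
        ext x
        have hf := (SmoothFun.differentiableOn f) x x.2
        have hg := (SmoothFun.differentiableOn g) x x.2
        have e : fderivWithin ℝ (extendZero ((f * g : SmoothFun W) : W → ℝ)) W x =
            fderivWithin ℝ (extendZero (f : W → ℝ) * extendZero (g : W → ℝ)) W x :=
          fderivWithin_congr (fun y hy => by simp [extendZero_of_mem _ hy]) (by simp)
        rw [fderivWithin_mul (hW x x.2) hf hg, extendZero_coe, extendZero_coe] at e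
        exact congrArg (fun L : V →L[ℝ] ℝ => L v) e)

theorem pd_apply (hW : UniqueDiffOn ℝ W) (v : V) (f : SmoothFun W) (x : W) :
    (pd hW v f : W → ℝ) x = fderivWithin ℝ (extendZero (f : W → ℝ)) W x v := rfl

theorem pd_mk_apply (hW : UniqueDiffOn ℝ W) (v : V) (g : V → ℝ) (hg : ContDiffOn ℝ ∞ g W) (x : W) :
    (pd hW v (mk g hg) : W → ℝ) x = fderivWithin ℝ g W x v := by
  have e : fderivWithin ℝ (extendZero (mk g hg : W → ℝ)) W x = fderivWithin ℝ g W x :=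
    fderivWithin_congr (eqOn_extendZero g) (eqOn_extendZero g x.2)
  rw [pd_apply, e]

/-- Space-time domains contain their initial time slice and so need not be open. Symmetry of the
second derivative within the set only requires the set to lie in the closure of its interior. -/
theorem pd_comm (hW : UniqueDiffOn ℝ W) (hW' : W ⊆ closure (interior W)) (v w : V)
    (f : SmoothFun W) : pd hW v (pd hW w f) = pd hW w (pd hW v f) := by
  have key (v w : V) (x : W) : (pd hW v (pd hW w f) : W → ℝ) x =
      fderivWithin ℝ (fderivWithin ℝ (extendZero (f : W → ℝ)) W) W x v w := by
    have h2 : DifferentiableWithinAt ℝ (fderivWithin ℝ (extendZero (f : W → ℝ)) W) W x :=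
      ((SmoothFun.contDiffOn f).fderivWithin hW (m := ∞) (by simp)).differentiableOn (by simp) x x.2
    change (pd hW v (mk _ _) : W → ℝ) x = _
    rw [pd_mk_apply, fderivWithin_clm_apply (hW x x.2) h2 (differentiableWithinAt_const _)]
    simp
  ext x
  rw [key, key]
  exact ((SmoothFun.contDiffOn f) x x.2).isSymmSndFDerivWithinAt (by simpa using ENat.LEInfty.out) hW (hW' x.2) x.2 v w

section Slice

variable {T : Set ℝ} {Ω : Set V}

/-- Restriction of a function of `(t, y)` to a time slice. -/
def slice {t : ℝ} (ht : t ∈ T) : SmoothFun (T ×ˢ Ω) →ₐ[ℝ] SmoothFun Ω where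
  toFun f := ⟨fun y => (f : T ×ˢ Ω → ℝ) ⟨(t, y), ht, y.2⟩, by
    have h := (SmoothFun.contDiffOn f).comp (t := T ×ˢ Ω) (s := Ω) (f := fun y : V => (t, y))
      (contDiff_const.prodMk contDiff_id).contDiffOn fun y hy => ⟨ht, hy⟩
    exact h.congr fun y hy => by
      rw [extendZero_of_mem _ hy, Function.comp_apply, extendZero_of_mem _ (show (t, y) ∈ T ×ˢ Ω from ⟨ht, hy⟩)]⟩
  map_one' := rfl
  map_mul' _ _ := rfl
  map_zero' := rfl
  map_add' _ _ := rfl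
  commutes' _ := rfl

@[simp] theorem slice_apply {t : ℝ} (ht : t ∈ T) (f : SmoothFun (T ×ˢ Ω)) (y : Ω) :
    (slice ht f : Ω → ℝ) y = (f : T ×ˢ Ω → ℝ) ⟨(t, y), ht, y.2⟩ := rfl

theorem slice_pd {t : ℝ} (ht : t ∈ T) (hW : UniqueDiffOn ℝ (T ×ˢ Ω)) (hΩ : UniqueDiffOn ℝ Ω) (v : V)
    (f : SmoothFun (T ×ˢ Ω)) : slice ht (pd hW (0, v) f) = pd hΩ v (slice ht f) := by
  ext y
  have h1 := ((SmoothFun.differentiableOn f) (t, y) ⟨ht, y.2⟩).hasFDerivWithinAt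
  have h2 : HasFDerivWithinAt (fun y : V => (t, y)) (ContinuousLinearMap.inr ℝ ℝ V) Ω y :=
    (hasFDerivAt_prodMk_right t (y : V)).hasFDerivWithinAt
  have h3 := h1.comp (y : V) h2 (fun z hz => (⟨ht, hz⟩ : (t, z) ∈ T ×ˢ Ω))
  have h4 : HasFDerivWithinAt (extendZero (slice ht f : Ω → ℝ)) _ Ω y :=
    h3.congr (fun z hz => by
      rw [extendZero_of_mem _ hz, Function.comp_apply, extendZero_of_mem _ (show (t, z) ∈ T ×ˢ Ω from ⟨ht, hz⟩)]; rfl)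
      (by rw [extendZero_of_mem _ y.2, Function.comp_apply, 
        extendZero_of_mem _ (show (t, (y : V)) ∈ T ×ˢ Ω from ⟨ht, y.2⟩)]; rfl)
  rw [pd_apply, h4.fderivWithin (hΩ y y.2), slice_apply, pd_apply]
  simp

theorem hasDerivWithinAt_time (hW : UniqueDiffOn ℝ (T ×ˢ Ω)) (f : SmoothFun (T ×ˢ Ω)) {t : ℝ}
    (ht : t ∈ T) (y : Ω) :
    HasDerivWithinAt (fun s => extendZero (f : T ×ˢ Ω → ℝ) (s, y))
      ((pd hW (1, 0) f : T ×ˢ Ω → ℝ) ⟨(t, y), ht, y.2⟩) T t := by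
  have h1 := ((SmoothFun.differentiableOn f) (t, y) ⟨ht, y.2⟩).hasFDerivWithinAt
  have h2 : HasDerivWithinAt (fun s : ℝ => (s, (y : V))) (1, 0) T t :=
    ((hasDerivAt_id t).prodMk (hasDerivAt_const t (y : V))).hasDerivWithinAt
  exact h1.comp_hasDerivWithinAt t h2 fun s hs => (⟨hs, y.2⟩ : (s, (y : V)) ∈ T ×ˢ Ω)

end Slice

section LocalMin

variable {Ω : Set V}

theorem hasDerivAt_line (hΩ : IsOpen Ω) (f : SmoothFun Ω) (v y : V) (s : ℝ) (hs : y + s • v ∈ Ω) :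
    HasDerivAt (fun s : ℝ => extendZero (f : Ω → ℝ) (y + s • v))
      (extendZero (pd hΩ.uniqueDiffOn v f : Ω → ℝ) (y + s • v)) s := by
  have h1 := (((SmoothFun.differentiableOn f) _ hs).differentiableAt (hΩ.mem_nhds hs)).hasFDerivAt
  have h2 : HasDerivAt (fun s : ℝ => y + s • v) v s := by
    simpa using ((hasDerivAt_id s).smul_const v).const_add y
  have h3 := h1.comp_hasDerivAt s h2
  rw [extendZero_of_mem _ hs, pd_apply, fderivWithin_of_isOpen hΩ hs]
  exact h3

theorem pd_eq_zero_of_isMin (hΩ : IsOpen Ω) (f : SmoothFun Ω) (v : V) (y : Ω)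
    (hy : ∀ z, (f : Ω → ℝ) y ≤ (f : Ω → ℝ) z) : (pd hΩ.uniqueDiffOn v f : Ω → ℝ) y = 0 := by
  have h0 : (y : V) + (0 : ℝ) • v ∈ Ω := by simp
  have hd := hasDerivAt_line hΩ f v y 0 h0
  have hev : ∀ᶠ s : ℝ in nhds 0, (y : V) + s • v ∈ Ω :=
    (by fun_prop : Continuous fun s : ℝ => (y : V) + s • v).continuousAt.eventually_mem
      (hΩ.mem_nhds h0)
  have hmin : IsLocalMin (fun s : ℝ => extendZero (f : Ω → ℝ) ((y : V) + s • v)) 0 := by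
    filter_upwards [hev] with s hs
    simpa [extendZero_of_mem _ hs] using hy ⟨_, hs⟩
  simpa using hmin.hasDerivAt_eq_zero hd

/-- If the second derivative along the line were negative, the minimum would also be a local
maximum. The function would then be constant near the point and its second derivative zero. -/
theorem pd_pd_nonneg_of_isMin (hΩ : IsOpen Ω) (f : SmoothFun Ω) (v : V) (y : Ω)
    (hy : ∀ z, (f : Ω → ℝ) y ≤ (f : Ω → ℝ) z) :
    0 ≤ (pd hΩ.uniqueDiffOn v (pd hΩ.uniqueDiffOn v f) : Ω → ℝ) y := by
  by_contra! hneg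
  have h0 : (y : V) + (0 : ℝ) • v ∈ Ω := by simp
  have hev : ∀ᶠ s : ℝ in nhds 0, (y : V) + s • v ∈ Ω :=
    (by fun_prop : Continuous fun s : ℝ => (y : V) + s • v).continuousAt.eventually_mem
      (hΩ.mem_nhds h0)
  set g := fun s : ℝ => extendZero (f : Ω → ℝ) ((y : V) + s • v) with hg
  have hd : deriv g =ᶠ[nhds 0]
      fun s => extendZero (pd hΩ.uniqueDiffOn v f : Ω → ℝ) ((y : V) + s • v) := by
    filter_upwards [hev] with s hs using (hasDerivAt_line hΩ f v y s hs).deriv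
  have hdd : deriv (deriv g) 0 = (pd hΩ.uniqueDiffOn v (pd hΩ.uniqueDiffOn v f) : Ω → ℝ) y := by
    rw [hd.deriv_eq, (hasDerivAt_line hΩ (pd hΩ.uniqueDiffOn v f) v y 0 h0).deriv]
    simp
  have hmin : IsLocalMin g 0 := by
    filter_upwards [hev] with s hs
    simpa [hg, extendZero_of_mem _ hs] using hy ⟨_, hs⟩
  have hmax : IsLocalMax g 0 :=
    isLocalMax_of_deriv_deriv_neg (hdd ▸ hneg) hmin.deriv_eq_zero
      (hasDerivAt_line hΩ f v y 0 h0).continuousAt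
  have hconst : g =ᶠ[nhds 0] fun _ => g 0 := by
    filter_upwards [hmin, hmax] with s h1 h2 using le_antisymm h2 h1
  have hz : deriv g =ᶠ[nhds 0] fun _ => 0 := by
    filter_upwards [hconst.eventuallyEq_nhds] with s hs
    rw [hs.deriv_eq, deriv_const]
  rw [← hdd, hz.deriv_eq, deriv_const] at hneg
  exact lt_irrefl _ hneg

end LocalMin

end SmoothFun

end SmoothFun

/-! ### The evolution equation on a time slice -/

section Evolution

variable {P Q K A B : Type*} [Fintype P] [Fintype Q] [Fintype K] [CommRing A] [Algebra ℝ A]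
  [CommRing B] [Algebra ℝ B]

theorem divergence_sum_mul {ι : Type*} [Fintype ι] (D : K → Derivation ℝ B B) (s : B)
    (f : ι → B) (r : ι → K → B) :
    divergence D s (fun l => ∑ i, f i * r i l) =
      ∑ i, (vectorField D (r i) (f i) + divergence D s (r i) * f i) := by
  simp only [divergence, vectorField_apply, map_sum, Derivation.leibniz, smul_eq_mul,
    Finset.sum_mul, add_mul, Finset.sum_add_distrib]
  rw [Finset.sum_comm (s := (Finset.univ : Finset K)),
    Finset.sum_comm (s := (Finset.univ : Finset K)), Finset.sum_comm (s := (Finset.univ : Finset K))]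
  have e1 : ∑ i, ∑ l, f i * D l (r i l) = ∑ i, ∑ l, D l (r i l) * f i :=
    Finset.sum_congr rfl fun _ _ => Finset.sum_congr rfl fun _ _ => mul_comm _ _
  have e2 : ∑ i, ∑ l, f i * r i l * D l s = ∑ i, ∑ l, r i l * D l s * f i :=
    Finset.sum_congr rfl fun _ _ => Finset.sum_congr rfl fun _ _ => by ring
  rw [e1, e2]
  ring

theorem vectorField_sum_mul {ι : Type*} [Fintype ι] (D : K → Derivation ℝ B B) (f : ι → B)
    (r : ι → K → B) (g : B) :
    vectorField D (fun l => ∑ i, f i * r i l) g = ∑ i, f i * vectorField D (r i) g := by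
  simp only [vectorField_apply, Finset.sum_mul, Finset.mul_sum, mul_assoc]
  exact Finset.sum_comm

/-- The halves of six times the scalar curvature in terms of anchors, log-density and structure
functions. -/
def sixScalar (D : K → Derivation ℝ B B) (s : B) (r : P ⊕ Q → K → B)
    (c : P ⊕ Q → P ⊕ Q → P ⊕ Q → B) : B :=
  halfScalar (fun a => vectorField D (r (Sum.inl a))) (fun a => divergence D s (r (Sum.inl a)))
      (fun a₁ a₂ a₃ => c (Sum.inl a₁) (Sum.inl a₂) (Sum.inl a₃))
      (fun i a₁ a₂ => c (Sum.inr i) (Sum.inl a₁) (Sum.inl a₂)) +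
    halfScalar (fun i => vectorField D (r (Sum.inr i))) (fun i => divergence D s (r (Sum.inr i)))
      (fun i₁ i₂ i₃ => -c (Sum.inr i₁) (Sum.inr i₂) (Sum.inr i₃))
      (fun a i₁ i₂ => -c (Sum.inl a) (Sum.inr i₁) (Sum.inr i₂))

/-- The mixed Ricci component in terms of anchors, log-density and structure functions. -/
def chartRicci (D : K → Derivation ℝ B B) (s : B) (r : P ⊕ Q → K → B)
    (c : P ⊕ Q → P ⊕ Q → P ⊕ Q → B) (a : P) (i : Q) : B :=
  mixedRicci (fun a => vectorField D (r (Sum.inl a))) (fun i => vectorField D (r (Sum.inr i)))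
    (fun a => divergence D s (r (Sum.inl a)))
    (fun i a₁ a₂ => c (Sum.inr i) (Sum.inl a₁) (Sum.inl a₂))
    (fun a i₁ i₂ => c (Sum.inl a) (Sum.inr i₁) (Sum.inr i₂)) a i

/-- A time dependent family, as elements of a larger algebra `A` with a time derivation `Dt`,
restricting to the algebra `B` of a time slice. -/
structure SliceMap (Dt : Derivation ℝ A A) (DA : K → Derivation ℝ A A) (D : K → Derivation ℝ B B)
    (φ : A →ₐ[ℝ] B) : Prop where
  map_deriv : ∀ l f, φ (DA l f) = D l (φ f)
  comm : ∀ l f, Dt (DA l f) = DA l (Dt f)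

namespace SliceMap

variable {Dt : Derivation ℝ A A} {DA : K → Derivation ℝ A A} {D : K → Derivation ℝ B B}
  {φ : A →ₐ[ℝ] B}

theorem map_vectorField (S : SliceMap Dt DA D φ) (r : K → A) (f : A) :
    φ (vectorField DA r f) = vectorField D (fun l => φ (r l)) (φ f) := by
  simp [vectorField_apply, S.map_deriv]

theorem map_divergence (S : SliceMap Dt DA D φ) (s : A) (r : K → A) :
    φ (divergence DA s r) = divergence D (φ s) (fun l => φ (r l)) := by
  simp [divergence, S.map_vectorField, S.map_deriv]

theorem map_dt_vectorField (S : SliceMap Dt DA D φ) (r : K → A) (f : A) :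
    φ (Dt (vectorField DA r f)) = vectorField D (fun l => φ (Dt (r l))) (φ f) +
      vectorField D (fun l => φ (r l)) (φ (Dt f)) := by
  simp only [vectorField_apply, map_sum, Derivation.leibniz, smul_eq_mul, map_add, map_mul,
    S.comm, S.map_deriv, Finset.sum_add_distrib]
  rw [add_comm]
  simp only [mul_comm (D _ (φ f))]

theorem map_dt_divergence (S : SliceMap Dt DA D φ) (s : A) (r : K → A) :
    φ (Dt (divergence DA s r)) = divergence D (φ s) (fun l => φ (Dt (r l))) +
      vectorField D (fun l => φ (r l)) (φ (Dt s)) := by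
  rw [divergence, map_add, map_add, S.map_dt_vectorField]
  simp only [divergence, map_sum, S.comm, S.map_deriv]
  ring

theorem map_halfScalar (S : SliceMap Dt DA D φ) {P Q : Type*} [Fintype P] [Fintype Q]
    (r : P → K → A) (d : P → A) (k : P → P → P → A) (m : Q → P → P → A) :
    φ (halfScalar (fun a => vectorField DA (r a)) d k m) =
      halfScalar (fun a => vectorField D fun l => φ (r a l)) (fun a => φ (d a))
        (fun a b c => φ (k a b c)) (fun i a b => φ (m i a b)) := by
  simp [halfScalar, S.map_vectorField, map_ofNat φ]

theorem map_sixScalar (S : SliceMap Dt DA D φ) (s : A) (r : P ⊕ Q → K → A)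
    (c : P ⊕ Q → P ⊕ Q → P ⊕ Q → A) :
    φ (sixScalar DA s r c) = sixScalar D (φ s) (fun A l => φ (r A l))
      (fun A₁ A₂ A₃ => φ (c A₁ A₂ A₃)) := by
  simp [sixScalar, S.map_halfScalar, S.map_divergence]

theorem map_dt_halfScalar (S : SliceMap Dt DA D φ) {P Q : Type*} [Fintype P] [Fintype Q]
    (r : P → K → A) (d : P → A) (k : P → P → P → A) (m : Q → P → P → A) :
    φ (Dt (halfScalar (fun a => vectorField DA (r a)) d k m)) =
      -12 * ∑ a, (vectorField D (fun l => φ (Dt (r a l))) (φ (d a)) +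
        vectorField D (fun l => φ (r a l)) (φ (Dt (d a)))) -
      12 * ∑ a, φ (d a) * φ (Dt (d a)) +
      2 * ∑ a, ∑ b, ∑ c, φ (k a b c) * φ (Dt (k a b c)) -
      6 * ∑ i, ∑ a, ∑ b, φ (m i a b) * φ (Dt (m i a b)) := by
  have e12 : Dt (12 : A) = 0 := Dt.map_natCast 12
  have e6 : Dt (6 : A) = 0 := Dt.map_natCast 6
  have e3 : Dt (3 : A) = 0 := Dt.map_natCast 3
  simp only [halfScalar, map_sub, map_add, map_neg, Derivation.leibniz, e12, e6, e3, smul_eq_mul,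
    map_sum, map_mul, S.map_dt_vectorField, map_ofNat, mul_zero, add_zero,
    ← two_mul, ← Finset.mul_sum, neg_zero]
  ring

/-- The evolution equation of the scalar curvature on a time slice, for a frame moving by
`e_a' = κ_{ai} e_i`, `e_i' = κ_{ai} e_a` with `κ = Rc`, and `σ' = -½ R σ`. -/
theorem evolution (S : SliceMap Dt DA D φ) (hD : ∀ l l' f, D l (D l' f) = D l' (D l f))
    {s R : A} {r : P ⊕ Q → K → A} {c : P ⊕ Q → P ⊕ Q → P ⊕ Q → A}
    (H : ChartFrame D (fun A l => φ (r A l)) (fun A₁ A₂ A₃ => φ (c A₁ A₂ A₃)))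
    (hR : 6 * R = sixScalar DA s r c) (hs : φ (Dt s) = -φ R) {κ : P → Q → B}
    (hκ : ∀ a i, κ a i = 2 * chartRicci D (φ s) (fun A l => φ (r A l))
      (fun A₁ A₂ A₃ => φ (c A₁ A₂ A₃)) a i)
    (hrp : ∀ a l, φ (Dt (r (Sum.inl a) l)) = ∑ i, κ a i * φ (r (Sum.inr i) l))
    (hrq : ∀ i l, φ (Dt (r (Sum.inr i) l)) = ∑ a, κ a i * φ (r (Sum.inl a) l))
    {κ' : P ⊕ Q → P ⊕ Q → B}
    (hκ₁ : ∀ a b, κ' (Sum.inl a) (Sum.inl b) = 0) (hκ₂ : ∀ i j, κ' (Sum.inr i) (Sum.inr j) = 0)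
    (hκ₃ : ∀ a i, κ' (Sum.inl a) (Sum.inr i) = κ a i)
    (hκ₄ : ∀ a i, κ' (Sum.inr i) (Sum.inl a) = κ a i)
    (hc : ∀ A₁ A₂ A₃, φ (Dt (c A₁ A₂ A₃)) = ∑ E, κ' A₁ E * φ (c E A₂ A₃) +
      ∑ E, κ' A₂ E * φ (c A₁ E A₃) + ∑ E, κ' A₃ E * φ (c A₁ A₂ E) +
      sgn P Q B A₃ * vectorField D (fun l => φ (r A₁ l)) (κ' A₂ A₃) -
      sgn P Q B A₃ * vectorField D (fun l => φ (r A₂ l)) (κ' A₁ A₃) +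
      sgn P Q B A₂ * vectorField D (fun l => φ (r A₃ l)) (κ' A₁ A₂)) :
    6 * φ (Dt R) = 48 * ∑ a, ∑ i, chartRicci D (φ s) (fun A l => φ (r A l))
        (fun A₁ A₂ A₃ => φ (c A₁ A₂ A₃)) a i * chartRicci D (φ s) (fun A l => φ (r A l))
        (fun A₁ A₂ A₃ => φ (c A₁ A₂ A₃)) a i +
      12 * ∑ a, (vectorField D (fun l => φ (r (Sum.inl a) l))
          (vectorField D (fun l => φ (r (Sum.inl a) l)) (φ R)) +
        divergence D (φ s) (fun l => φ (r (Sum.inl a) l)) *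
          vectorField D (fun l => φ (r (Sum.inl a) l)) (φ R)) := by
  have rot (A₁ A₂ A₃) : φ (c A₂ A₃ A₁) = φ (c A₁ A₂ A₃) := by rw [H.swap₂₃, H.swap₁₂, neg_neg]
  have q1 (a b : P) (i : Q) : φ (c (Sum.inl a) (Sum.inl b) (Sum.inr i)) =
    φ (c (Sum.inr i) (Sum.inl a) (Sum.inl b)) := rot _ _ _
  have q2 (a b : P) (i : Q) : φ (c (Sum.inl a) (Sum.inr i) (Sum.inl b)) =
    -φ (c (Sum.inr i) (Sum.inl a) (Sum.inl b)) := H.swap₁₂ _ _ _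
  have q3 (a : P) (i j : Q) : φ (c (Sum.inr i) (Sum.inl a) (Sum.inr j)) =
    -φ (c (Sum.inl a) (Sum.inr i) (Sum.inr j)) := H.swap₁₂ _ _ _
  have q4 (a : P) (i j : Q) : φ (c (Sum.inr i) (Sum.inr j) (Sum.inl a)) =
    φ (c (Sum.inl a) (Sum.inr i) (Sum.inr j)) := rot _ _ _
  -- The velocity matrix `κ'` has no diagonal blocks, so every sum over the whole frame in the
  -- variation of the structure functions collapses to the half opposite to the index being moved.
  -- The cyclic symmetry of `c` brings the rest to the form required of `k'`, `l'`, `m'` and `w'`.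
  have key := HalfFrame.scalar_variation (H.halfFrame_pos hD (φ s)) (H.halfFrame_neg hD (φ s)) κ
    (φ R) hκ (by rw [← map_ofNat φ 6, ← map_mul, hR, S.map_sixScalar]; rfl)
    (d' := fun a => φ (Dt (divergence DA s (r (Sum.inl a)))))
    (h' := fun i => φ (Dt (divergence DA s (r (Sum.inr i)))))
    (k' := fun a₁ a₂ a₃ => φ (Dt (c (Sum.inl a₁) (Sum.inl a₂) (Sum.inl a₃))))
    (m' := fun i a₁ a₂ => φ (Dt (c (Sum.inr i) (Sum.inl a₁) (Sum.inl a₂))))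
    (l' := fun i₁ i₂ i₃ => φ (Dt (c (Sum.inr i₁) (Sum.inr i₂) (Sum.inr i₃))))
    (w' := fun a i₁ i₂ => φ (Dt (c (Sum.inl a) (Sum.inr i₁) (Sum.inr i₂))))
    (fun a => by
      simp only [S.map_dt_divergence, hrp, divergence_sum_mul, hs, map_neg]
      ring)
    (fun i => by
      simp only [S.map_dt_divergence, hrq, divergence_sum_mul, hs, map_neg]
      ring)
    (fun a b e => by
      simp only [hc, Fintype.sum_sum_type, hκ₁, hκ₃, map_zero, q1, q2]
      simp only [Finset.sum_add_distrib, Finset.sum_sub_distrib, zero_mul, mul_zero,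
        Finset.sum_const_zero, mul_neg, Finset.sum_neg_distrib]
      ring)
    (fun i j n => by
      simp only [hc, Fintype.sum_sum_type, hκ₂, hκ₄, map_zero, q3, q4]
      simp only [Finset.sum_add_distrib, Finset.sum_sub_distrib, zero_mul, mul_zero,
        Finset.sum_const_zero, mul_neg, Finset.sum_neg_distrib]
      ring)
    (fun i a b => by
      simp only [hc, Fintype.sum_sum_type, hκ₁, hκ₂, hκ₃, hκ₄, map_zero, q3, q4]
      simp only [Finset.sum_sub_distrib, zero_mul, mul_zero, sgn_inl,
        Finset.sum_const_zero, mul_neg, Finset.sum_neg_distrib, one_mul]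
      ring)
    (fun a i j => by
      simp only [hc, Fintype.sum_sum_type, hκ₁, hκ₂, hκ₃, hκ₄, map_zero, q1, q2]
      simp only [Finset.sum_sub_distrib, zero_mul, mul_zero, sgn_inr,
        Finset.sum_const_zero, mul_neg, Finset.sum_neg_distrib, neg_mul, one_mul]
      ring)
  have e6 : 6 * φ (Dt R) = φ (Dt (sixScalar DA s r c)) := by
    rw [← hR, Dt.leibniz, show Dt (6 : A) = 0 from Dt.map_natCast 6, smul_zero, add_zero,
      smul_eq_mul, map_mul, map_ofNat]
  rw [e6, sixScalar, map_add, map_add, S.map_dt_halfScalar, S.map_dt_halfScalar]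
  simp only [hrp, hrq, vectorField_sum_mul, map_neg, neg_mul_neg, S.map_divergence]
  exact key

end SliceMap

end Evolution

/-! ### Coordinate invariance of the divergence with respect to a half-density -/

section Divergence

variable {V : Type*} [NormedAddCommGroup V] [NormedSpace ℝ V] [FiniteDimensional ℝ V]

theorem contDiff_det : ContDiff ℝ ∞ fun A : V →L[ℝ] V => LinearMap.det (A : V →ₗ[ℝ] V) := by
  set b := finBasis ℝ V
  have h : (fun A : V →L[ℝ] V => LinearMap.det (A : V →ₗ[ℝ] V)) = fun A : V →L[ℝ] V =>
      (LinearMap.toMatrix b b (A : V →ₗ[ℝ] V)).det := by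
    ext A; rw [LinearMap.det_toMatrix]
  rw [h]
  simp only [Matrix.det_apply]
  refine ContDiff.sum fun p _ => ContDiff.const_smul _ (contDiff_prod fun i _ => ?_)
  simp only [LinearMap.toMatrix_apply]
  have : (fun A : V →L[ℝ] V => b.repr ((A : V →ₗ[ℝ] V) (b i)) (p i)) =
      fun A : V →L[ℝ] V => (LinearMap.toContinuousLinearMap (b.coord (p i))) (A (b i)) := by
    ext A; simp
  rw [this]
  fun_prop

/-- Jacobi's formula. -/
theorem hasFDerivAt_det {A B : V →L[ℝ] V} (hAB : A.comp B = .id ℝ V) (N : V →L[ℝ] V) :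
    fderiv ℝ (fun A : V →L[ℝ] V => LinearMap.det (A : V →ₗ[ℝ] V)) A N =
      LinearMap.det (A : V →ₗ[ℝ] V) * LinearMap.trace ℝ V (B.comp N : V →L[ℝ] V) := by
  set δ := fun A : V →L[ℝ] V => LinearMap.det (A : V →ₗ[ℝ] V)
  have h1 : HasDerivAt (fun r : ℝ => δ (A + r • N)) (fderiv ℝ δ A N) 0 := by
    have h2 : HasDerivAt (fun r : ℝ => A + r • N) N 0 := by
      simpa using ((hasDerivAt_id (0 : ℝ)).smul_const N).const_add A
    have h3 : HasFDerivAt δ (fderiv ℝ δ A) (A + (0 : ℝ) • N) := by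
      rw [zero_smul, add_zero]
      exact ((contDiff_det (V := V)).differentiable (by simp) A).hasFDerivAt
    exact h3.comp_hasDerivAt 0 h2
  set b := finBasis ℝ V
  set K := LinearMap.toMatrix b b ((B.comp N : V →L[ℝ] V) : V →ₗ[ℝ] V)
  -- Since A + rN = A(1 + rBN), only the linear coefficient of det(1 + rK) matters, and this is the
  -- trace of K.
  have h4 (r : ℝ) : δ (A + r • N) = δ A * (1 + r • K).det := by
    have e : ((A + r • N : V →L[ℝ] V) : V →ₗ[ℝ] V) = (A : V →ₗ[ℝ] V) ∘ₗ
        (LinearMap.id + r • ((B.comp N : V →L[ℝ] V) : V →ₗ[ℝ] V)) := by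
      ext v
      have := DFunLike.congr_fun hAB (N v)
      simp at this
      simp [this]
    simp only [δ]
    rw [e, LinearMap.det_comp, ← LinearMap.det_toMatrix b (LinearMap.id + _), map_add, map_smul,
      LinearMap.toMatrix_id]
  have h5 : HasDerivAt (fun r : ℝ => δ (A + r • N)) (δ A * K.trace) 0 := by
    have : (fun r : ℝ => δ (A + r • N)) = fun r : ℝ => δ A * (1 + K.trace * r +
        ((1 + (Polynomial.X : Polynomial ℝ) • K.map Polynomial.C).det.divX.divX.eval r) * r ^ 2) := by
      ext r; rw [h4, Matrix.det_one_add_smul]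
    rw [this]
    refine HasDerivAt.const_mul _ ?_
    set p := (1 + (Polynomial.X : Polynomial ℝ) • K.map Polynomial.C).det.divX.divX
    have hp := (p.hasDerivAt (0 : ℝ)).mul ((hasDerivAt_id (0 : ℝ)).pow 2)
    have hq := (((hasDerivAt_id (0 : ℝ)).const_mul K.trace).const_add 1).add hp
    refine HasDerivAt.congr_deriv (f' := _) hq ?_
    simp
  rw [h1.unique h5, LinearMap.trace_eq_matrix_trace ℝ b]

/-- The divergence of a vector field with respect to a density does not depend on the coordinates:
`τ` is a change of coordinates which takes the vector field `X` to `Y` and the half-density `s` to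
`u`. -/
theorem trace_fderiv_transition {τ X Y : V → V} {s u : V → ℝ} {y₀ : V} {B : V →L[ℝ] V}
    (hτ : ContDiffAt ℝ 2 τ y₀) (hB : (fderiv ℝ τ y₀).comp B = .id ℝ V)
    (hB' : B.comp (fderiv ℝ τ y₀) = .id ℝ V)
    (hX : DifferentiableAt ℝ X y₀) (hY : DifferentiableAt ℝ Y (τ y₀))
    (hXY : ∀ᶠ y in nhds y₀, Y (τ y) = fderiv ℝ τ y (X y))
    (hu : DifferentiableAt ℝ u (τ y₀)) (hu₀ : 0 < u (τ y₀))
    (hs : ∀ᶠ y in nhds y₀, s y = √|LinearMap.det (fderiv ℝ τ y : V →ₗ[ℝ] V)| * u (τ y)) :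
    LinearMap.trace ℝ V (fderiv ℝ (fun y => s y ^ 2 • X y) y₀ : V →L[ℝ] V) / s y₀ ^ 2 =
      LinearMap.trace ℝ V (fderiv ℝ Y (τ y₀) : V →L[ℝ] V) +
        fderiv ℝ (fun z => Real.log (u z ^ 2)) (τ y₀) (Y (τ y₀)) := by
  have hτd : DifferentiableAt ℝ τ y₀ := hτ.differentiableAt (by norm_num)
  have hτ' : DifferentiableAt ℝ (fderiv ℝ τ) y₀ :=
    (hτ.fderiv_right (m := 1) (by norm_num)).differentiableAt (by norm_num)
  set A := fderiv ℝ τ y₀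
  set δ := fun A : V →L[ℝ] V => LinearMap.det (A : V →ₗ[ℝ] V)
  have hδ0 : δ A ≠ 0 := by
    have h : δ A * δ B = 1 := by
      simp only [δ]
      rw [← LinearMap.det_comp]
      have : (A : V →ₗ[ℝ] V) ∘ₗ (B : V →ₗ[ℝ] V) = LinearMap.id := by
        ext v; exact DFunLike.congr_fun hB v
      rw [this, LinearMap.det_id]
    exact left_ne_zero_of_mul_eq_one h
  have hδd : DifferentiableAt ℝ δ A := (contDiff_det (V := V)).differentiable (by simp) A
  have hδτ : HasFDerivAt (fun y => δ (fderiv ℝ τ y)) ((fderiv ℝ δ A).comp (fderiv ℝ (fderiv ℝ τ) y₀))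
      y₀ := hδd.hasFDerivAt.comp y₀ hτ'.hasFDerivAt
  -- The sign of the Jacobian determinant is locally constant, so its absolute value can be
  -- differentiated as ±det.
  obtain ⟨ε, hε0, hε⟩ : ∃ ε : ℝ, ε ≠ 0 ∧ ∀ᶠ y in nhds y₀, |δ (fderiv ℝ τ y)| = ε * δ (fderiv ℝ τ y) := by
    rcases lt_or_gt_of_ne hδ0 with h | h
    · refine ⟨-1, by norm_num, ?_⟩
      filter_upwards [hδτ.continuousAt.eventually_lt continuousAt_const h] with y hy
      rw [abs_of_neg hy]; ring
    · refine ⟨1, by norm_num, ?_⟩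
      filter_upwards [continuousAt_const.eventually_lt hδτ.continuousAt h] with y hy
      rw [abs_of_pos hy]; ring
  have hs2 : ∀ᶠ y in nhds y₀, s y ^ 2 = ε * (δ (fderiv ℝ τ y) * u (τ y) ^ 2) := by
    filter_upwards [hs, hε] with y h1 h2
    rw [h1, mul_pow, Real.sq_sqrt (abs_nonneg _)]
    change |δ (fderiv ℝ τ y)| * _ = _
    rw [h2]; ring
  have huτ : HasFDerivAt (fun y => u (τ y)) ((fderiv ℝ u (τ y₀)).comp A) y₀ :=
    hu.hasFDerivAt.comp y₀ hτd.hasFDerivAt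
  have hsq := (hδτ.mul (huτ.pow 2)).const_mul ε
  have hfd : HasFDerivAt (fun y => s y ^ 2 • X y) _ y₀ :=
    (hsq.smul hX.hasFDerivAt).congr_of_eventuallyEq (by
      filter_upwards [hs2] with y hy
      rw [hy]; rfl)
  have hrel : (fderiv ℝ Y (τ y₀)).comp A =
      (fderiv ℝ (fderiv ℝ τ) y₀).flip (X y₀) + A.comp (fderiv ℝ X y₀) := by
    have h1 := hY.hasFDerivAt.comp y₀ hτd.hasFDerivAt
    have h2 := (hτ'.hasFDerivAt.clm_apply hX.hasFDerivAt).congr_of_eventuallyEq hXY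
    rw [h1.unique h2, add_comm]
  -- Differentiating Y ∘ τ = Dτ·X and using the symmetry of D²τ, the trace of DY exceeds that of DX
  -- by tr((Dτ)⁻¹ D²τ(X)). By Jacobi's formula this is the derivative of log |det Dτ| along X, which
  -- is the contribution of the Jacobian factor of the half-density.
  have htrY : LinearMap.trace ℝ V (fderiv ℝ Y (τ y₀) : V →L[ℝ] V) =
      LinearMap.trace ℝ V (B.comp (fderiv ℝ (fderiv ℝ τ) y₀ (X y₀)) : V →L[ℝ] V) +
      LinearMap.trace ℝ V (fderiv ℝ X y₀ : V →L[ℝ] V) := by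
    have e1 : ((fderiv ℝ Y (τ y₀) : V →L[ℝ] V) : V →ₗ[ℝ] V) =
        (((fderiv ℝ Y (τ y₀)).comp A : V →L[ℝ] V) : V →ₗ[ℝ] V) ∘ₗ (B : V →ₗ[ℝ] V) := by
      ext v
      have := DFunLike.congr_fun hB v
      simp only [ContinuousLinearMap.coe_comp, Function.comp_apply, ContinuousLinearMap.coe_id',
        id_eq] at this
      simp [this]
    have hsymm (v w : V) : fderiv ℝ (fderiv ℝ τ) y₀ v w = fderiv ℝ (fderiv ℝ τ) y₀ w v :=
      (hτ.isSymmSndFDerivAt (by simp)) v w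
    have e2 : (B : V →ₗ[ℝ] V) ∘ₗ (((fderiv ℝ Y (τ y₀)).comp A : V →L[ℝ] V) : V →ₗ[ℝ] V) =
        ((B.comp (fderiv ℝ (fderiv ℝ τ) y₀ (X y₀)) : V →L[ℝ] V) : V →ₗ[ℝ] V) +
        ((fderiv ℝ X y₀ : V →L[ℝ] V) : V →ₗ[ℝ] V) := by
      rw [hrel]
      ext v
      have := DFunLike.congr_fun hB' (fderiv ℝ X y₀ v)
      simp only [ContinuousLinearMap.coe_comp, Function.comp_apply, ContinuousLinearMap.coe_id',
        id_eq] at this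
      simp [this, hsymm v]
    rw [e1, LinearMap.trace_comp_comm', e2, map_add]
  have hlog : fderiv ℝ (fun z => Real.log (u z ^ 2)) (τ y₀) (Y (τ y₀)) =
      2 * fderiv ℝ u (τ y₀) (A (X y₀)) / u (τ y₀) := by
    have := (hu.hasFDerivAt.pow 2).log (pow_ne_zero 2 hu₀.ne')
    rw [this.fderiv, hXY.self_of_nhds]
    simp
    field_simp
    rfl
  rw [hfd.fderiv, htrY, hlog, hs2.self_of_nhds]
  have htr (w : V) (L : V →L[ℝ] ℝ) : LinearMap.trace ℝ V (L.smulRight w : V →L[ℝ] V) = L w := by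
    exact LinearMap.trace_smulRight (L : V →ₗ[ℝ] ℝ) w
  simp only [ContinuousLinearMap.toLinearMap_add, ContinuousLinearMap.toLinearMap_smul, map_add, map_smul,
    htr]
  simp only [δ, smul_apply, add_apply, ContinuousLinearMap.comp_apply, smul_eq_mul, hasFDerivAt_det hB]
  have hδ0' : LinearMap.det (A : V →ₗ[ℝ] V) ≠ 0 := hδ0
  have hu' := hu₀.ne'
  simp only [show fderiv ℝ τ y₀ = A from rfl]
  simp
  field_simp
  ring
end Divergence

/-! ### Smooth orthonormalization by the inverse square root of the Gram matrix -/

section Orthonormalization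

/-- A smooth square root near the unit of a Banach algebra. -/
theorem exists_sqrt_near_one (𝔸 : Type*) [NormedRing 𝔸] [NormedAlgebra ℝ 𝔸] [CompleteSpace 𝔸] :
    ∃ s : 𝔸 → 𝔸, s 1 = 1 ∧ (∀ᶠ g in nhds 1, ContDiffAt ℝ ∞ s g) ∧ (∀ᶠ g in nhds 1, s g * s g = g) ∧
      ∀ᶠ a in nhds 1, s (a * a) = a := by
  -- The inverse function theorem is applied to squaring, whose derivative at 1 is multiplication by
  -- 2. Analyticity is used because, unlike `ContDiffAt ℝ ∞`, it propagates from a point to a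
  -- neighbourhood.
  have hf : ContDiffAt ℝ ω (fun a : 𝔸 => a * a) 1 := contDiffAt_id.mul contDiffAt_id
  let f' : 𝔸 ≃L[ℝ] 𝔸 := ContinuousLinearEquiv.smulLeft (Units.mk0 (2 : ℝ) two_ne_zero)
  have hf' : HasFDerivAt (fun a : 𝔸 => a * a) (f' : 𝔸 →L[ℝ] 𝔸) 1 := by
    have h := (hasFDerivAt_id (𝕜 := ℝ) (1 : 𝔸)).mul' (hasFDerivAt_id (𝕜 := ℝ) (1 : 𝔸))
    refine HasFDerivAt.congr_fderiv (f' := _) h ?_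
    ext v
    change (1 : 𝔸) * v + v * 1 = (2 : ℝ) • v
    rw [one_mul, mul_one, two_smul]
  have hn : (ω : WithTop ℕ∞) ≠ 0 := by simp
  refine ⟨hf.localInverse hf' hn, ?_, ?_, ?_, ?_⟩
  · have := hf.localInverse_apply_image hf' hn
    simpa using this
  · have := hf.to_localInverse hf' hn
    rw [mul_one] at this
    have h2 := this.eventually (by simp)
    filter_upwards [h2] with g hg using hg.of_le le_top
  · have := (hf.hasStrictFDerivAt' hf' hn).eventually_right_inverse
    rw [mul_one] at this
    exact this
  · exact (hf.hasStrictFDerivAt' hf' hn).eventually_left_inverse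

attribute [local instance] Matrix.linftyOpNormedRing Matrix.linftyOpNormedAlgebra

/-- A smooth map `h` on symmetric matrices near the identity such that `h(g) g h(g)ᵀ = 1`. -/
theorem exists_orthonormalizer (p : Type*) [Fintype p] [DecidableEq p] :
    ∃ h : (p → p → ℝ) → p → p → ℝ,
      (h (fun a b => if a = b then 1 else 0) = fun a b => if a = b then 1 else 0) ∧
      (∀ᶠ g in nhds fun a b => if a = b then 1 else 0, ContDiffAt ℝ ∞ h g) ∧
      ∀ᶠ g in nhds fun a b => if a = b then 1 else 0, (∀ a b, g a b = g b a) →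
        ∀ a b, ∑ d, (∑ c, h g a c * g c d) * h g b d = if a = b then 1 else 0 := by
  obtain ⟨s, hs1, hsm, hsq, hinj⟩ := exists_sqrt_near_one (Matrix p p ℝ)
  let e : (p → p → ℝ) ≃L[ℝ] Matrix p p ℝ :=
    (Matrix.ofLinearEquiv ℝ : (p → p → ℝ) ≃ₗ[ℝ] Matrix p p ℝ).toContinuousLinearEquiv
  have he1 : e (fun a b => if a = b then 1 else 0) = 1 := by
    ext a b; exact (Matrix.one_apply (i := a) (j := b)).symm
  have hcont : Filter.Tendsto e (nhds fun a b => if a = b then 1 else 0) (nhds 1) := by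
    rw [← he1]; exact e.continuous.continuousAt
  have hsc : Filter.Tendsto s (nhds 1) (nhds 1) := by
    have := hsm.self_of_nhds.continuousAt.tendsto
    rwa [hs1] at this
  have hunit : ∀ᶠ g in nhds (1 : Matrix p p ℝ), IsUnit (s g) :=
    hsc.eventually (Units.nhds (1 : (Matrix p p ℝ)ˣ))
  -- The transpose of `s g` is also close to 1. When `g` is symmetric it is a square root of `g` as
  -- well, so local injectivity of squaring will force `s g` to be symmetric.
  have htr : ∀ᶠ g in nhds (1 : Matrix p p ℝ), s ((s g).transpose * (s g).transpose) = (s g).transpose := by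
    have h1 : Filter.Tendsto (fun g => (s g).transpose) (nhds (1 : Matrix p p ℝ)) (nhds 1) := by
      have h2 : Continuous (Matrix.transposeLinearEquiv p p ℝ ℝ : Matrix p p ℝ → Matrix p p ℝ) :=
        LinearMap.continuous_of_finiteDimensional
          (Matrix.transposeLinearEquiv p p ℝ ℝ : Matrix p p ℝ →ₗ[ℝ] Matrix p p ℝ)
      have h3 := (h2.tendsto 1).comp hsc
      have h4 : Matrix.transposeLinearEquiv p p ℝ ℝ (1 : Matrix p p ℝ) = 1 := Matrix.transpose_one
      rwa [h4] at h3
    exact h1.eventually hinj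
  refine ⟨fun g => e.symm (Ring.inverse (s (e g))), ?_, ?_, ?_⟩
  · change e.symm (Ring.inverse (s (e _))) = _
    rw [he1, hs1, Ring.inverse_one, ← he1, e.symm_apply_apply]
  · filter_upwards [hcont.eventually hsm, hcont.eventually hunit] with g h1 h2
    obtain ⟨u, hu⟩ := h2
    have h3 : ContDiffAt ℝ ∞ Ring.inverse ((s ∘ e) g) := by
      rw [Function.comp_apply, ← hu]
      exact contDiffAt_ringInverse ℝ u
    have h4 := h3.comp g (h1.comp g e.contDiff.contDiffAt)
    exact e.symm.contDiff.contDiffAt.comp g h4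
  · filter_upwards [hcont.eventually hsq, hcont.eventually hunit, hcont.eventually htr]
      with g h1 h2 h3 hsymm a b
    have hg : (e g).transpose = e g := by ext a b; exact hsymm b a
    have h4 : (s (e g)).transpose = s (e g) := by
      rw [← Matrix.transpose_mul, h1, hg] at h3
      exact h3.symm
    set S := s (e g)
    set T := Ring.inverse S
    have hTS : T * S = 1 := Ring.inverse_mul_cancel S h2
    have hST : S * T = 1 := Ring.mul_inverse_cancel S h2
    have hT : T.transpose = T := by
      have h5 : T.transpose * S = 1 := by
        rw [← h4, ← Matrix.transpose_mul, hST, Matrix.transpose_one]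
      calc T.transpose = T.transpose * (S * T) := by rw [hST, mul_one]
        _ = T := by rw [← mul_assoc, h5, one_mul]
    have h6 : T * e g * T.transpose = 1 := by
      rw [hT, ← h1, ← mul_assoc, hTS, one_mul, hST]
    have h7 := congrFun (congrFun h6 a) b
    rw [Matrix.one_apply, Matrix.mul_apply] at h7
    simp only [Matrix.mul_apply] at h7
    exact h7

section

variable (p : Type*) [Fintype p] [DecidableEq p]

/-- The inverse square root of symmetric matrices near the identity. -/
def orthonormalizer : (p → p → ℝ) → p → p → ℝ := (exists_orthonormalizer p).choose

theorem orthonormalizer_one : orthonormalizer p (fun a b => if a = b then 1 else 0) =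
    fun a b => if a = b then 1 else 0 := (exists_orthonormalizer p).choose_spec.1

/-- A neighbourhood of the identity on which `orthonormalizer` is well behaved. -/
theorem exists_orthonormalizer_domain : ∃ 𝒱 : Set (p → p → ℝ), IsOpen 𝒱 ∧
    (fun a b => if a = b then 1 else 0) ∈ 𝒱 ∧ ContDiffOn ℝ ∞ (orthonormalizer p) 𝒱 ∧
    ∀ g ∈ 𝒱, (∀ a b, g a b = g b a) → ∀ a b,
      ∑ d, (∑ c, orthonormalizer p g a c * g c d) * orthonormalizer p g b d =
        if a = b then 1 else 0 := by
  obtain ⟨𝒱, h1, h2, h3⟩ := mem_nhds_iff.1 (Filter.inter_mem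
    (exists_orthonormalizer p).choose_spec.2.1 (exists_orthonormalizer p).choose_spec.2.2)
  exact ⟨𝒱, h2, h3, fun g hg => ContDiffAt.contDiffWithinAt
    (show ContDiffAt ℝ ∞ (orthonormalizer p) g from (h1 hg).1), fun g hg => (h1 hg).2⟩

end

/-- Positive definite symmetric forms have orthonormal bases. -/
theorem exists_orthonormal {V : Type*} [AddCommGroup V] [Module ℝ V] [FiniteDimensional ℝ V]
    (B : LinearMap.BilinForm ℝ V) (hB : ∀ v w, B v w = B w v) (hpos : ∀ v, v ≠ 0 → 0 < B v v) :
    ∃ b : Fin (finrank ℝ V) → V, ∀ i j, B (b i) (b j) = if i = j then 1 else 0 := by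
  obtain ⟨v, hv⟩ := LinearMap.BilinForm.exists_orthogonal_basis (B := B) ⟨fun v w => hB v w⟩
  have hp (i) : 0 < B (v i) (v i) := hpos _ (v.ne_zero i)
  refine ⟨fun i => (√(B (v i) (v i)))⁻¹ • v i, fun i j => ?_⟩
  by_cases h : i = j
  · subst h
    have := Real.mul_self_sqrt (hp i).le
    have h0 := (Real.sqrt_pos.2 (hp i)).ne'
    simp only [map_smul, LinearMap.smul_apply, smul_eq_mul, if_true]
    field_simp
    rw [sq, this]
  · have h' : B (v i) (v j) = 0 := hv h
    simp [h', h]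

end Orthonormalization

/-! ### Moving frames -/

section MovingFrame

variable {P Q K A B : Type*} [Fintype P] [Fintype Q] [DecidableEq P] [DecidableEq Q] [Fintype K]
  [CommRing A] [Algebra ℝ A] [CommRing B] [Algebra ℝ B]

/-- The anchors of the frame `∑ m_{AB} f_B`. -/
def movingAnchor (m : P ⊕ Q → P ⊕ Q → A) (r : P ⊕ Q → K → A) (A₁ : P ⊕ Q) (l : K) : A :=
  ∑ E, m A₁ E * r E l

/-- The structure functions of the frame `∑ m_{AB} f_B`, where `f` is orthonormal with structure
functions `c`. -/
def movingStructure (X : P ⊕ Q → A → A) (m : P ⊕ Q → P ⊕ Q → A) (c : P ⊕ Q → P ⊕ Q → P ⊕ Q → A)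
    (A₁ A₂ A₃ : P ⊕ Q) : A :=
  ∑ E₁, ∑ E₂, ∑ E₃, m A₁ E₁ * (m A₂ E₂ * (m A₃ E₃ * c E₁ E₂ E₃)) +
    ∑ E, sgn P Q A E * (X A₁ (m A₂ E) * m A₃ E - X A₂ (m A₁ E) * m A₃ E + X A₃ (m A₁ E) * m A₂ E)

namespace SliceMap

variable {Dt : Derivation ℝ A A} {DA : K → Derivation ℝ A A} {D : K → Derivation ℝ B B}
  {φ : A →ₐ[ℝ] B} {m : P ⊕ Q → P ⊕ Q → A} {r : P ⊕ Q → K → A}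
  {c : P ⊕ Q → P ⊕ Q → P ⊕ Q → A} {κ : P ⊕ Q → P ⊕ Q → B}

theorem sum_map_delta_mul (hm : ∀ A₁ A₂, φ (m A₁ A₂) = if A₁ = A₂ then 1 else 0) (A₁ : P ⊕ Q)
    (f : P ⊕ Q → B) : ∑ E, φ (m A₁ E) * f E = f A₁ := by
  simp only [hm, ite_mul, one_mul, zero_mul, Finset.sum_ite_eq, Finset.mem_univ, if_true]

theorem map_movingAnchor (hm : ∀ A₁ A₂, φ (m A₁ A₂) = if A₁ = A₂ then 1 else 0) (A₁ : P ⊕ Q)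
    (l : K) : φ (movingAnchor m r A₁ l) = φ (r A₁ l) := by
  simp only [movingAnchor, map_sum, map_mul, sum_map_delta_mul hm]

theorem map_dt_movingAnchor (hm' : ∀ A₁ A₂, φ (Dt (m A₁ A₂)) = κ A₁ A₂)
    (hr : ∀ A₁ l, Dt (r A₁ l) = 0) (A₁ : P ⊕ Q) (l : K) :
    φ (Dt (movingAnchor m r A₁ l)) = ∑ E, κ A₁ E * φ (r E l) := by
  simp only [movingAnchor, map_sum, Derivation.leibniz, hr, mul_zero, zero_add, smul_eq_mul,
    map_mul, hm', mul_comm (φ (r _ _))]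

theorem map_sgn (E : P ⊕ Q) : φ (sgn P Q A E) = sgn P Q B E := by
  rcases E with a | i <;> simp

theorem dt_sgn (E : P ⊕ Q) : Dt (sgn P Q A E) = 0 := by
  rcases E with a | i <;> simp

theorem map_vectorField_delta (S : SliceMap Dt DA D φ)
    (hm : ∀ A₁ A₂, φ (m A₁ A₂) = if A₁ = A₂ then 1 else 0) (v : K → A) (A₁ A₂ : P ⊕ Q) :
    φ (vectorField DA v (m A₁ A₂)) = 0 := by
  rw [S.map_vectorField, hm]
  split_ifs <;> simp

theorem map_movingStructure (S : SliceMap Dt DA D φ)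
    (hm : ∀ A₁ A₂, φ (m A₁ A₂) = if A₁ = A₂ then 1 else 0) (A₁ A₂ A₃ : P ⊕ Q) :
    φ (movingStructure (fun A₁ => vectorField DA (movingAnchor m r A₁)) m c A₁ A₂ A₃) =
      φ (c A₁ A₂ A₃) := by
  simp only [movingStructure, map_add, map_sub, map_sum, map_mul, S.map_vectorField_delta hm,
    zero_mul, sub_zero, add_zero, mul_zero, Finset.sum_const_zero, ← Finset.mul_sum,
    sum_map_delta_mul hm]

theorem map_dt_movingStructure (S : SliceMap Dt DA D φ)
    (hm : ∀ A₁ A₂, φ (m A₁ A₂) = if A₁ = A₂ then 1 else 0)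
    (hm' : ∀ A₁ A₂, φ (Dt (m A₁ A₂)) = κ A₁ A₂) (hc : ∀ A₁ A₂ A₃, Dt (c A₁ A₂ A₃) = 0)
    (A₁ A₂ A₃ : P ⊕ Q) :
    φ (Dt (movingStructure (fun A₁ => vectorField DA (movingAnchor m r A₁)) m c A₁ A₂ A₃)) =
      ∑ E, κ A₁ E * φ (c E A₂ A₃) +
      ∑ E, κ A₂ E * φ (c A₁ E A₃) + ∑ E, κ A₃ E * φ (c A₁ A₂ E) +
      sgn P Q B A₃ * vectorField D (fun l => φ (r A₁ l)) (κ A₂ A₃) -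
      sgn P Q B A₃ * vectorField D (fun l => φ (r A₂ l)) (κ A₁ A₃) +
      sgn P Q B A₂ * vectorField D (fun l => φ (r A₃ l)) (κ A₁ A₂) := by
  -- On the slice `m` is the identity, so its spatial derivatives vanish there. The time derivative
  -- of such a term survives only where it falls on the differentiated coefficient itself.
  have hv (A₁ A₂ A₃ : P ⊕ Q) : φ (Dt (vectorField DA (movingAnchor m r A₁) (m A₂ A₃))) =
      vectorField D (fun l => φ (r A₁ l)) (κ A₂ A₃) := by
    rw [S.map_dt_vectorField, hm, hm']
    simp only [map_movingAnchor hm, add_eq_right]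
    split_ifs <;> simp
  have e1 : φ (Dt (∑ E₁, ∑ E₂, ∑ E₃, m A₁ E₁ * (m A₂ E₂ * (m A₃ E₃ * c E₁ E₂ E₃)))) =
      ∑ E, κ A₁ E * φ (c E A₂ A₃) + ∑ E, κ A₂ E * φ (c A₁ E A₃) +
        ∑ E, κ A₃ E * φ (c A₁ A₂ E) := by
    have h : φ (Dt (∑ E₁, ∑ E₂, ∑ E₃, m A₁ E₁ * (m A₂ E₂ * (m A₃ E₃ * c E₁ E₂ E₃)))) =
        ∑ E₁, κ A₁ E₁ * ∑ E₂, φ (m A₂ E₂) * ∑ E₃, φ (m A₃ E₃) * φ (c E₁ E₂ E₃) +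
        ∑ E₁, φ (m A₁ E₁) * ∑ E₂, κ A₂ E₂ * ∑ E₃, φ (m A₃ E₃) * φ (c E₁ E₂ E₃) +
        ∑ E₁, φ (m A₁ E₁) * ∑ E₂, φ (m A₂ E₂) * ∑ E₃, κ A₃ E₃ * φ (c E₁ E₂ E₃) := by
      simp only [Finset.mul_sum, ← Finset.sum_add_distrib, map_sum]
      refine Finset.sum_congr rfl fun E₁ _ => Finset.sum_congr rfl fun E₂ _ =>
        Finset.sum_congr rfl fun E₃ _ => ?_
      simp only [Derivation.leibniz, hc, smul_eq_mul, mul_zero, zero_add, map_add, map_mul, hm']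
      ring
    rw [h]
    simp only [sum_map_delta_mul hm]
  have e2 : φ (Dt (∑ E, sgn P Q A E * (vectorField DA (movingAnchor m r A₁) (m A₂ E) * m A₃ E -
      vectorField DA (movingAnchor m r A₂) (m A₁ E) * m A₃ E +
      vectorField DA (movingAnchor m r A₃) (m A₁ E) * m A₂ E))) =
      sgn P Q B A₃ * vectorField D (fun l => φ (r A₁ l)) (κ A₂ A₃) -
      sgn P Q B A₃ * vectorField D (fun l => φ (r A₂ l)) (κ A₁ A₃) +
      sgn P Q B A₂ * vectorField D (fun l => φ (r A₃ l)) (κ A₁ A₂) := by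
    have h (E : P ⊕ Q) : φ (Dt (sgn P Q A E * (vectorField DA (movingAnchor m r A₁) (m A₂ E) *
        m A₃ E - vectorField DA (movingAnchor m r A₂) (m A₁ E) * m A₃ E +
        vectorField DA (movingAnchor m r A₃) (m A₁ E) * m A₂ E))) =
        φ (m A₃ E) * (sgn P Q B E * vectorField D (fun l => φ (r A₁ l)) (κ A₂ E)) -
        φ (m A₃ E) * (sgn P Q B E * vectorField D (fun l => φ (r A₂ l)) (κ A₁ E)) +
        φ (m A₂ E) * (sgn P Q B E * vectorField D (fun l => φ (r A₃ l)) (κ A₁ E)) := by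
      simp only [Derivation.leibniz, dt_sgn, smul_eq_mul, mul_zero, add_zero, map_add,
        map_sub, map_mul, hv, map_sgn, S.map_vectorField_delta hm, zero_mul, zero_add]
      ring
    simp only [map_sum, h, Finset.sum_add_distrib, Finset.sum_sub_distrib, sum_map_delta_mul hm]
  rw [movingStructure, map_add, map_add, e1, e2]
  ring

/-- The evolution equation for a frame moving out of a fixed one. -/
theorem evolution_moving (S : SliceMap Dt DA D φ) (hD : ∀ l l' f, D l (D l' f) = D l' (D l f))
    {s R : A} (hm : ∀ A₁ A₂, φ (m A₁ A₂) = if A₁ = A₂ then 1 else 0)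
    (hr : ∀ A₁ l, Dt (r A₁ l) = 0) (hc : ∀ A₁ A₂ A₃, Dt (c A₁ A₂ A₃) = 0)
    (H : ChartFrame D (fun A₁ l => φ (r A₁ l)) (fun A₁ A₂ A₃ => φ (c A₁ A₂ A₃)))
    (hR : 6 * R = sixScalar DA s (movingAnchor m r)
      (movingStructure (fun A₁ => vectorField DA (movingAnchor m r A₁)) m c))
    (hs : φ (Dt s) = -φ R)
    (hm₁ : ∀ a b, φ (Dt (m (Sum.inl a) (Sum.inl b))) = 0)
    (hm₂ : ∀ i j, φ (Dt (m (Sum.inr i) (Sum.inr j))) = 0)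
    (hm₃ : ∀ a i, φ (Dt (m (Sum.inl a) (Sum.inr i))) = 2 * chartRicci D (φ s) (fun A l => φ (r A l))
      (fun A₁ A₂ A₃ => φ (c A₁ A₂ A₃)) a i)
    (hm₄ : ∀ a i, φ (Dt (m (Sum.inr i) (Sum.inl a))) = 2 * chartRicci D (φ s) (fun A l => φ (r A l))
      (fun A₁ A₂ A₃ => φ (c A₁ A₂ A₃)) a i) :
    6 * φ (Dt R) = 48 * ∑ a, ∑ i, chartRicci D (φ s) (fun A l => φ (r A l))
        (fun A₁ A₂ A₃ => φ (c A₁ A₂ A₃)) a i * chartRicci D (φ s) (fun A l => φ (r A l))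
        (fun A₁ A₂ A₃ => φ (c A₁ A₂ A₃)) a i +
      12 * ∑ a, (vectorField D (fun l => φ (r (Sum.inl a) l))
          (vectorField D (fun l => φ (r (Sum.inl a) l)) (φ R)) +
        divergence D (φ s) (fun l => φ (r (Sum.inl a) l)) *
          vectorField D (fun l => φ (r (Sum.inl a) l)) (φ R)) := by
  have h := S.evolution hD (s := s) (R := R) (r := movingAnchor m r)
    (c := movingStructure (fun A₁ => vectorField DA (movingAnchor m r A₁)) m c)
    (κ := fun a i => 2 * chartRicci D (φ s) (fun A l => φ (r A l))
      (fun A₁ A₂ A₃ => φ (c A₁ A₂ A₃)) a i) (κ' := fun A₁ A₂ => φ (Dt (m A₁ A₂)))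
  simp only [map_movingAnchor hm, S.map_movingStructure hm,
    map_dt_movingAnchor (κ := fun A₁ A₂ => φ (Dt (m A₁ A₂))) (fun _ _ => rfl) hr,
    S.map_dt_movingStructure hm (κ := fun A₁ A₂ => φ (Dt (m A₁ A₂))) (fun _ _ => rfl) hc,
    Fintype.sum_sum_type, hm₁, hm₂, zero_mul, Finset.sum_const_zero, zero_add, add_zero, hm₃, hm₄,
    implies_true, true_imp_iff] at h
  exact h H hR hs

end SliceMap

end MovingFrame

variable {n : ℕ} {M : Type*} [TopologicalSpace M] [ChartedSpace (EuclideanSpace ℝ (Fin n)) M]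
  [IsManifold (𝓡 n) ∞ M]
  {F : Type*} [NormedAddCommGroup F] [NormedSpace ℝ F]
  {E : M → Type*} [TopologicalSpace (TotalSpace F E)] [∀ x, TopologicalSpace (E x)]
  [∀ x, AddCommGroup (E x)] [∀ x, Module ℝ (E x)] [FiberBundle F E] [VectorBundle ℝ F E]
  [ContMDiffVectorBundle ∞ F E (𝓡 n)]

/-! ### Calculus of smooth sections -/

@[simp] theorem smulSec_apply (f : C^∞⟮𝓡 n, M; ℝ⟯) (u : Cₛ^∞⟮𝓡 n; F, E⟯) (x : M) :
    smulSec f u x = f x • u x := rfl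

theorem sum_section_apply {ι : Type*} (s : Finset ι) (u : ι → Cₛ^∞⟮𝓡 n; F, E⟯) (x : M) :
    (∑ i ∈ s, u i) x = ∑ i ∈ s, u i x := by
  have h := map_sum (ContMDiffSection.coeAddHom (𝓡 n) F ∞ E) u s
  have h' := congrFun h x
  rw [Finset.sum_apply] at h'
  exact h'

omit [IsManifold (𝓡 n) ∞ M] in
theorem mvfderiv_congr {f g : M → ℝ} {x : M} (h : f =ᶠ[nhds x] g) :
    mvfderiv (𝓡 n) f x = mvfderiv (𝓡 n) g x := by
  ext v
  simp only [mvfderiv, h.mfderiv_eq]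
  rfl

theorem exists_cutoff [T2Space M] {x : M} {U : Set M} (hU : U ∈ nhds x) :
    ∃ χ : C^∞⟮𝓡 n, M; ℝ⟯, (∀ᶠ y in nhds x, χ y = 1) ∧ tsupport χ ⊆ U := by
  obtain ⟨f, -, hf⟩ := (SmoothBumpFunction.nhds_basis_tsupport (I := 𝓡 n) x).mem_iff.1 hU
  exact ⟨⟨f, f.contMDiff⟩, f.eventuallyEq_one, hf⟩

section Tensorial

variable [T2Space M] {V : Type*} [AddCommGroup V] [Module ℝ V] {x : M}
  {T : Cₛ^∞⟮𝓡 n; F, E⟯ → V}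

/-- A tensorial operation is local. -/
theorem tensorial_eq_zero (hsmul : ∀ f u, T (smulSec f u) = f x • T u) {u : Cₛ^∞⟮𝓡 n; F, E⟯}
    (hu : ∀ᶠ y in nhds x, u y = 0) : T u = 0 := by
  obtain ⟨χ, hχ, hsupp⟩ := exists_cutoff (n := n) hu
  have h : u = smulSec (1 - χ) u := by
    ext y
    by_cases hy : u y = 0
    · simp [hy]
    · have : χ y = 0 := by
        by_contra h0
        exact hy (hsupp (subset_tsupport _ h0))
      simp [this]
  rw [h, hsmul]
  simp [hχ.self_of_nhds]

theorem tensorial_sum (hadd : ∀ u v, T (u + v) = T u + T v) {ι : Type*} (s : Finset ι)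
    (u : ι → Cₛ^∞⟮𝓡 n; F, E⟯) : T (∑ i ∈ s, u i) = ∑ i ∈ s, T (u i) := by
  have h0 : T 0 = 0 := by simpa using hadd 0 0
  exact map_sum (⟨⟨T, h0⟩, hadd⟩ : Cₛ^∞⟮𝓡 n; F, E⟯ →+ V) u s

/-- Expansion of a tensorial operation in a local frame. -/
theorem tensorial_eq_sum (hadd : ∀ u v, T (u + v) = T u + T v)
    (hsmul : ∀ f u, T (smulSec f u) = f x • T u) {ι : Type*} [Fintype ι]
    (e : ι → Cₛ^∞⟮𝓡 n; F, E⟯) (φ : ι → C^∞⟮𝓡 n, M; ℝ⟯) (u : Cₛ^∞⟮𝓡 n; F, E⟯)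
    (hu : ∀ᶠ y in nhds x, u y = ∑ i, φ i y • e i y) : T u = ∑ i, φ i x • T (e i) := by
  have h1 : T (u - ∑ i, smulSec (φ i) (e i)) = 0 := by
    apply tensorial_eq_zero hsmul
    filter_upwards [hu] with y hy
    rw [ContMDiffSection.coe_sub, Pi.sub_apply, sum_section_apply, hy]
    simp
  have h2 := hadd (u - ∑ i, smulSec (φ i) (e i)) (∑ i, smulSec (φ i) (e i))
  rw [sub_add_cancel, h1, zero_add, tensorial_sum hadd] at h2
  simp [h2, hsmul]

end Tensorial

namespace CourantAlgebroid

variable (C : CourantAlgebroid n F E)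

/-- The derivative `ρ(u) f`. -/
def act (u : Cₛ^∞⟮𝓡 n; F, E⟯) (f : C^∞⟮𝓡 n, M; ℝ⟯) : C^∞⟮𝓡 n, M; ℝ⟯ :=
  ⟨fun x => mvfderiv (𝓡 n) f x (C.anchor x (u x)), by
    have h1 := (f.contMDiff.contMDiff_tangentMap (m := ∞) (by simp)).comp (C.anchor_smooth u)
    exact (contMDiff_snd_tangentBundle_modelSpace ℝ 𝓘(ℝ, ℝ)).comp h1⟩

/-- The function `⟨u, v⟩`. -/
def pair (u v : Cₛ^∞⟮𝓡 n; F, E⟯) : C^∞⟮𝓡 n, M; ℝ⟯ :=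
  ⟨fun x => C.pairing x (u x) (v x), C.pairing_smooth u v⟩

theorem act_apply (u : Cₛ^∞⟮𝓡 n; F, E⟯) (f : C^∞⟮𝓡 n, M; ℝ⟯) (x : M) :
    C.act u f x = mvfderiv (𝓡 n) f x (C.anchor x (u x)) := rfl

theorem pair_apply (u v : Cₛ^∞⟮𝓡 n; F, E⟯) (x : M) :
    C.pair u v x = C.pairing x (u x) (v x) := rfl

theorem pair_symm (u v : Cₛ^∞⟮𝓡 n; F, E⟯) : C.pair u v = C.pair v u := by
  ext x; exact C.pairing_symm x _ _

theorem act_mul (u : Cₛ^∞⟮𝓡 n; F, E⟯) (f g : C^∞⟮𝓡 n, M; ℝ⟯) (x : M) :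
    C.act u (f * g) x = f x * C.act u g x + g x * C.act u f x := by
  have h := mvfderiv_mul (I := 𝓡 n) (x := x) f.mdifferentiableAt g.mdifferentiableAt
  rw [act_apply, act_apply, act_apply, ContMDiffMap.coe_mul, h]
  simp

theorem act_add (u : Cₛ^∞⟮𝓡 n; F, E⟯) (f g : C^∞⟮𝓡 n, M; ℝ⟯) (x : M) :
    C.act u (f + g) x = C.act u f x + C.act u g x := by
  have h := mvfderiv_add (I := 𝓡 n) (x := x) f.mdifferentiableAt g.mdifferentiableAt
  rw [act_apply, act_apply, act_apply, ContMDiffMap.coe_add, h]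
  simp

theorem act_congr (u : Cₛ^∞⟮𝓡 n; F, E⟯) {f g : C^∞⟮𝓡 n, M; ℝ⟯} {x : M}
    (h : ∀ᶠ y in nhds x, f y = g y) : C.act u f x = C.act u g x := by
  rw [act_apply, act_apply, mvfderiv_congr h]

theorem act_eq_zero_of_const (u : Cₛ^∞⟮𝓡 n; F, E⟯) {f : C^∞⟮𝓡 n, M; ℝ⟯} {x : M} (c : ℝ)
    (h : ∀ᶠ y in nhds x, f y = c) : C.act u f x = 0 := by
  rw [act_apply, mvfderiv_congr (g := fun _ => c) h, mvfderiv_const]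
  simp

theorem bracket_smul (u v : Cₛ^∞⟮𝓡 n; F, E⟯) (f : C^∞⟮𝓡 n, M; ℝ⟯) :
    C.bracket u (smulSec f v) = smulSec f (C.bracket u v) + smulSec (C.act u f) v := by
  ext x
  exact C.leibniz u v f x

theorem invariance' (u v w : Cₛ^∞⟮𝓡 n; F, E⟯) (x : M) :
    C.act u (C.pair v w) x = C.pair (C.bracket u v) w x + C.pair v (C.bracket u w) x :=
  C.invariance u v w x

theorem symmetric_part' (u v w : Cₛ^∞⟮𝓡 n; F, E⟯) (x : M) :
    C.pair (C.bracket u v) w x + C.pair (C.bracket v u) w x = C.act w (C.pair u v) x := by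
  rw [act_apply]
  refine Eq.trans ?_ (C.symmetric_part u v w x)
  simp [pair_apply]

/-- Leibniz rule in the first slot. -/
theorem pair_smul_bracket (u v w : Cₛ^∞⟮𝓡 n; F, E⟯) (f : C^∞⟮𝓡 n, M; ℝ⟯) (x : M) :
    C.pair (C.bracket (smulSec f u) v) w x = f x * C.pair (C.bracket u v) w x -
      C.act v f x * C.pair u w x + C.act w f x * C.pair u v x := by
  have h1 := C.symmetric_part' (smulSec f u) v w x
  have h2 := C.symmetric_part' u v w x
  have h3 : C.pair (smulSec f u) v = f * C.pair u v := by ext y; simp [pair_apply]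
  rw [h3, act_mul, bracket_smul] at h1
  have h4 : C.pair (smulSec f (C.bracket v u) + smulSec (C.act v f) u) w x =
      f x * C.pair (C.bracket v u) w x + C.act v f x * C.pair u w x := by simp [pair_apply]
  rw [h4] at h1
  linear_combination h1 - f x * h2

/-- The anchor intertwines the brackets. -/
theorem act_bracket [T2Space M] (u v : Cₛ^∞⟮𝓡 n; F, E⟯) (f : C^∞⟮𝓡 n, M; ℝ⟯) (x : M) :
    C.act (C.bracket u v) f x = C.act u (C.act v f) x - C.act v (C.act u f) x := by
  -- Comparing the Jacobi identity for `f w` with `f` times the one for `w` gives the assertion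
  -- multiplied by the vector `w x`, which must be nonzero to be cancelled. Over a zero fibre the
  -- anchor vanishes and both sides are zero.
  by_cases hE : ∃ w : E x, w ≠ 0
  · obtain ⟨w₀, hw₀⟩ := hE
    obtain ⟨w, rfl⟩ := exists_section (n := n) (F := F) x w₀
    have h := congrArg (fun s : Cₛ^∞⟮𝓡 n; F, E⟯ => s x) (C.jacobi u v (smulSec f w))
    have h' := congrArg (fun s : Cₛ^∞⟮𝓡 n; F, E⟯ => s x) (C.jacobi u v w)
    simp only [bracket_smul, map_add, ContMDiffSection.coe_add, Pi.add_apply, smulSec_apply] at h h'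
    rw [h'] at h
    have h'' : (C.act (C.bracket u v) f x - (C.act u (C.act v f) x - C.act v (C.act u f) x)) • w x
        = 0 := by
      simp only [smul_add, sub_smul] at h ⊢
      linear_combination (norm := module) -h
    exact sub_eq_zero.1 ((smul_eq_zero.1 h'').resolve_right hw₀)
  · push Not at hE
    simp [act_apply, hE]

end CourantAlgebroid

/-! ### Adapted orthonormal frames -/

section Frames

variable {P Q : Type*} [Fintype P] [Fintype Q] [DecidableEq P] [DecidableEq Q]

variable [FiniteDimensional ℝ F] {C : CourantAlgebroid n F E}

/-- The global sections `e` restrict on the open set `U` to an orthonormal frame adapted to `G`. -/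
structure IsAdaptedFrame (G : GenPseudometric C) (U : Set M)
    (e : P ⊕ Q → Cₛ^∞⟮𝓡 n; F, E⟯) : Prop where
  isOpen : IsOpen U
  ortho : ∀ x ∈ U, ∀ A₁ A₂, C.pairing x (e A₁ x) (e A₂ x) = if A₁ = A₂ then sgn P Q ℝ A₁ else 0
  eigen : ∀ x ∈ U, ∀ A, G.toFun x (e A x) = sgn P Q ℝ A • e A x
  complete : ∀ x ∈ U, ∀ v : E x, v = ∑ A, (sgn P Q ℝ A * C.pairing x (e A x) v) • e A x

theorem sgn_mul_sgn (A : P ⊕ Q) : sgn P Q ℝ A * sgn P Q ℝ A = 1 := by rcases A with a | i <;> simp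

namespace IsAdaptedFrame

variable {G : GenPseudometric C} {U : Set M} {e : P ⊕ Q → Cₛ^∞⟮𝓡 n; F, E⟯} {x : M}

theorem parseval (H : IsAdaptedFrame G U e) (hx : x ∈ U) (v w : E x) :
    C.pairing x v w = ∑ A, sgn P Q ℝ A * (C.pairing x (e A x) v * C.pairing x (e A x) w) := by
  conv_lhs => rw [H.complete x hx v]
  simp only [map_sum, map_smul, LinearMap.sum_apply, LinearMap.smul_apply, smul_eq_mul, mul_assoc]

theorem act_expand (H : IsAdaptedFrame G U e) (hx : x ∈ U) (u : Cₛ^∞⟮𝓡 n; F, E⟯)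
    (f : C^∞⟮𝓡 n, M; ℝ⟯) :
    C.act u f x = ∑ A, sgn P Q ℝ A * (C.pair (e A) u x * C.act (e A) f x) := by
  simp only [CourantAlgebroid.act_apply]
  conv_lhs => rw [H.complete x hx (u x)]
  simp only [map_sum, map_smul, smul_eq_mul, mul_assoc, CourantAlgebroid.pair_apply]

theorem act_pair_eq_zero (H : IsAdaptedFrame G U e) (hx : x ∈ U) (u : Cₛ^∞⟮𝓡 n; F, E⟯)
    (A₁ A₂ : P ⊕ Q) : C.act u (C.pair (e A₁) (e A₂)) x = 0 :=
  C.act_eq_zero_of_const u (if A₁ = A₂ then sgn P Q ℝ A₁ else 0) <| by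
    filter_upwards [H.isOpen.mem_nhds hx] with y hy using H.ortho y hy A₁ A₂

variable (C e) in
/-- The structure functions `⟨[e_A, e_B], e_C⟩` of a frame. -/
def structureFun (A₁ A₂ A₃ : P ⊕ Q) : C^∞⟮𝓡 n, M; ℝ⟯ := C.pair (C.bracket (e A₁) (e A₂)) (e A₃)

theorem structureFun_swap₁₂ (H : IsAdaptedFrame G U e) (hx : x ∈ U) (A₁ A₂ A₃ : P ⊕ Q) :
    structureFun C e A₂ A₁ A₃ x = -structureFun C e A₁ A₂ A₃ x := by
  have h := C.symmetric_part' (e A₁) (e A₂) (e A₃) x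
  rw [H.act_pair_eq_zero hx] at h
  simp only [structureFun]
  linear_combination h

theorem structureFun_swap₂₃ (H : IsAdaptedFrame G U e) (hx : x ∈ U) (A₁ A₂ A₃ : P ⊕ Q) :
    structureFun C e A₁ A₃ A₂ x = -structureFun C e A₁ A₂ A₃ x := by
  have h := C.invariance' (e A₁) (e A₂) (e A₃) x
  rw [H.act_pair_eq_zero hx, C.pair_symm (e A₂)] at h
  simp only [structureFun]
  linear_combination -h

/-- The Jacobi identity is paired with the fourth frame section. Invariance of the pairing, and the
symmetric part of the bracket for [[e₁, e₂], e₃], turn each nested bracket into the derivative of a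
structure function plus a pairing of two brackets. The latter is expanded in the frame. -/
theorem structureFun_jacobi (H : IsAdaptedFrame G U e) (hx : x ∈ U) (A₁ A₂ A₃ A₄ : P ⊕ Q) :
    C.act (e A₁) (structureFun C e A₂ A₃ A₄) x - C.act (e A₂) (structureFun C e A₁ A₃ A₄) x +
      C.act (e A₃) (structureFun C e A₁ A₂ A₄) x - C.act (e A₄) (structureFun C e A₁ A₂ A₃) x =
    ∑ A, sgn P Q ℝ A * (structureFun C e A₂ A₃ A x * structureFun C e A₁ A₄ A x -
      structureFun C e A₁ A₃ A x * structureFun C e A₂ A₄ A x +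
      structureFun C e A₁ A₂ A x * structureFun C e A₃ A₄ A x) := by
  have h := congrArg (fun s => C.pair s (e A₄) x) (C.jacobi (e A₁) (e A₂) (e A₃))
  have h0 : C.pair (C.bracket (C.bracket (e A₁) (e A₂)) (e A₃) +
      C.bracket (e A₂) (C.bracket (e A₁) (e A₃))) (e A₄) x =
      C.pair (C.bracket (C.bracket (e A₁) (e A₂)) (e A₃)) (e A₄) x +
      C.pair (C.bracket (e A₂) (C.bracket (e A₁) (e A₃))) (e A₄) x := by
    simp [CourantAlgebroid.pair_apply]
  simp only [h0] at h
  have h1 := C.invariance' (e A₁) (C.bracket (e A₂) (e A₃)) (e A₄) x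
  have h2 := C.invariance' (e A₂) (C.bracket (e A₁) (e A₃)) (e A₄) x
  have h3 := C.invariance' (e A₃) (C.bracket (e A₁) (e A₂)) (e A₄) x
  have h4 := C.symmetric_part' (C.bracket (e A₁) (e A₂)) (e A₃) (e A₄) x
  have hp (u v : Cₛ^∞⟮𝓡 n; F, E⟯) : C.pair u v x =
      ∑ A, sgn P Q ℝ A * (C.pair u (e A) x * C.pair v (e A) x) := by
    simp only [C.pair_symm _ (e _), CourantAlgebroid.pair_apply]
    exact H.parseval hx _ _
  have e1 := hp (C.bracket (e A₂) (e A₃)) (C.bracket (e A₁) (e A₄))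
  have e2 := hp (C.bracket (e A₁) (e A₃)) (C.bracket (e A₂) (e A₄))
  have e3 := hp (C.bracket (e A₁) (e A₂)) (C.bracket (e A₃) (e A₄))
  simp only [mul_add, mul_sub, Finset.sum_add_distrib, Finset.sum_sub_distrib, structureFun]
  linear_combination h + h1 - h2 + h3 + h4 + e1 - e2 + e3

/-- This is ρρ* = 0. The anchor intertwines brackets, so it kills symmetrized brackets [u, v] + [v,
u] = 𝒟⟨u, v⟩. Taking u = f e and v = e for a member e of the frame, where ⟨e, e⟩ = ±1, produces 𝒟f
up to sign. -/
theorem anchor_isotropic [T2Space M] (H : IsAdaptedFrame G U e) (hx : x ∈ U)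
    (f g : C^∞⟮𝓡 n, M; ℝ⟯) :
    ∑ A, sgn P Q ℝ A * (C.act (e A) f x * C.act (e A) g x) = 0 := by
  by_cases hne : Nonempty (P ⊕ Q)
  · obtain ⟨A₀⟩ := hne
    set u := smulSec f (e A₀)
    have h1 : C.act (C.bracket u (e A₀) + C.bracket (e A₀) u) g x = 0 := by
      have := C.act_bracket u (e A₀) g x
      have := C.act_bracket (e A₀) u g x
      simp only [CourantAlgebroid.act_apply, ContMDiffSection.coe_add, Pi.add_apply, map_add] at *
      linarith
    rw [H.act_expand hx] at h1
    have h2 (A : P ⊕ Q) : C.pair (e A) (C.bracket u (e A₀) + C.bracket (e A₀) u) x =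
        sgn P Q ℝ A₀ * C.act (e A) f x := by
      have h3 := C.symmetric_part' u (e A₀) (e A) x
      have h4 : C.pair u (e A₀) = f * C.pair (e A₀) (e A₀) := by
        ext y; simp [u, CourantAlgebroid.pair_apply]
      rw [h4, C.act_mul, H.act_pair_eq_zero hx, CourantAlgebroid.pair_apply C (e A₀) (e A₀),
        H.ortho x hx, if_pos rfl] at h3
      rw [C.pair_symm]
      simp only [CourantAlgebroid.pair_apply, ContMDiffSection.coe_add, Pi.add_apply, map_add,
        LinearMap.add_apply] at h3 ⊢
      linear_combination h3
    simp only [h2] at h1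
    have h5 : sgn P Q ℝ A₀ * ∑ A, sgn P Q ℝ A * (C.act (e A) f x * C.act (e A) g x) = 0 := by
      rw [Finset.mul_sum, ← h1]
      exact Finset.sum_congr rfl fun A _ => by ring
    have h6 := congrArg (fun y => sgn P Q ℝ A₀ * y) h5
    simpa [← mul_assoc, sgn_mul_sgn] using h6
  · rw [not_nonempty_iff] at hne
    simp

theorem act_bracket_expand [T2Space M] (H : IsAdaptedFrame G U e) (hx : x ∈ U) (A₁ A₂ : P ⊕ Q)
    (f : C^∞⟮𝓡 n, M; ℝ⟯) : C.act (e A₁) (C.act (e A₂) f) x - C.act (e A₂) (C.act (e A₁) f) x =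
      ∑ A, sgn P Q ℝ A * (structureFun C e A₁ A₂ A x * C.act (e A) f x) := by
  rw [← C.act_bracket, H.act_expand hx]
  simp only [C.pair_symm (e _), structureFun]

/-- The components of a section in an adapted frame. -/
theorem eventually_expand (H : IsAdaptedFrame G U e) (hx : x ∈ U) (u : Cₛ^∞⟮𝓡 n; F, E⟯) :
    ∀ᶠ y in nhds x, u y = ∑ A, (sgn P Q ℝ A • C.pair (e A) u) y • e A y := by
  filter_upwards [H.isOpen.mem_nhds hx] with y hy using H.complete y hy (u y)

/-- The contraction is defined with an arbitrarily chosen basis of the fibre and its dual. Expanding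
both in the frame shows independence of that choice. -/
theorem contract_eq (H : IsAdaptedFrame G U e) (hx : x ∈ U) (B : LinearMap.BilinForm ℝ (E x)) :
    C.contract x (fun a b => B a b) = ∑ A, sgn P Q ℝ A * B (e A x) (e A x) := by
  set b := fiberBasis F E x
  set b' := (C.pairing x).dualBasis (C.pairing_nondegenerate x) b
  have h1 (v : E x) : v = ∑ i, C.pairing x v (b i) • b' i := by
    conv_lhs => rw [← b'.sum_repr v]
    simp [b', LinearMap.BilinForm.dualBasis_repr_apply]
  have h2 (i) : B (b' i) (b i) = ∑ A, sgn P Q ℝ A * (C.pairing x (e A x) (b i) * B (b' i) (e A x)) := by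
    conv_lhs => rw [H.complete x hx (b i)]
    simp only [map_sum, map_smul, smul_eq_mul, mul_assoc]
  change ∑ i, B (b' i) (b i) = _
  simp only [h2]
  rw [Finset.sum_comm]
  refine Finset.sum_congr rfl fun A _ => ?_
  conv_rhs => enter [2]; rw [show B (e A x) = ∑ i, C.pairing x (e A x) (b i) • B (b' i) by
    conv_lhs => rw [h1 (e A x)]
    simp only [map_sum, map_smul]]
  rw [← Finset.mul_sum]
  simp

section Tensors

variable [T2Space M] {V : Type*} [AddCommGroup V] [Module ℝ V] {T : Cₛ^∞⟮𝓡 n; F, E⟯ → V}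

theorem tensorial_expand (H : IsAdaptedFrame G U e) (hx : x ∈ U)
    (hadd : ∀ u v, T (u + v) = T u + T v) (hsmul : ∀ f u, T (smulSec f u) = f x • T u)
    (u : Cₛ^∞⟮𝓡 n; F, E⟯) : T u = ∑ A, (sgn P Q ℝ A * C.pair (e A) u x) • T (e A) :=
  tensorial_eq_sum hadd hsmul e _ u (H.eventually_expand hx u)

theorem tensorial_congr (H : IsAdaptedFrame G U e) (hx : x ∈ U)
    (hadd : ∀ u v, T (u + v) = T u + T v) (hsmul : ∀ f u, T (smulSec f u) = f x • T u)
    {u v : Cₛ^∞⟮𝓡 n; F, E⟯} (h : u x = v x) : T u = T v := by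
  rw [H.tensorial_expand hx hadd hsmul u, H.tensorial_expand hx hadd hsmul v]
  simp [CourantAlgebroid.pair_apply, h]

end Tensors

theorem sectionThrough_apply [T2Space M] (v : E x) : sectionThrough n F x v x = v :=
  (exists_section (n := n) (F := F) x v).choose_spec

/-- Contraction of an operation on pairs of sections which is tensorial in both arguments. -/
theorem contract_tensorial [T2Space M] (H : IsAdaptedFrame G U e) (hx : x ∈ U)
    {T : Cₛ^∞⟮𝓡 n; F, E⟯ → Cₛ^∞⟮𝓡 n; F, E⟯ → ℝ}
    (hadd₁ : ∀ u u' v, T (u + u') v = T u v + T u' v)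
    (hsmul₁ : ∀ f u v, T (smulSec f u) v = f x * T u v)
    (hadd₂ : ∀ u v v', T u (v + v') = T u v + T u v')
    (hsmul₂ : ∀ f u v, T u (smulSec f v) = f x * T u v) :
    C.contract x (fun a b => T (sectionThrough n F x a) (sectionThrough n F x b)) =
      ∑ A, sgn P Q ℝ A * T (e A) (e A) := by
  have c1 {u u' v : Cₛ^∞⟮𝓡 n; F, E⟯} (h : u x = u' x) : T u v = T u' v :=
    H.tensorial_congr hx (T := fun u => T u v) (fun _ _ => hadd₁ _ _ _) (fun _ _ => hsmul₁ _ _ _) h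
  have c2 {u v v' : Cₛ^∞⟮𝓡 n; F, E⟯} (h : v x = v' x) : T u v = T u v' :=
    H.tensorial_congr hx (T := fun v => T u v) (fun _ _ => hadd₂ _ _ _) (fun _ _ => hsmul₂ _ _ _) h
  have hconst (r : ℝ) (v : E x) : (r • v) =
      smulSec (ContMDiffMap.const r) (sectionThrough n F x v) x := by
    rw [smulSec_apply, sectionThrough_apply]
    rfl
  let B : LinearMap.BilinForm ℝ (E x) := LinearMap.mk₂ ℝ
    (fun a b => T (sectionThrough n F x a) (sectionThrough n F x b))
    (fun a a' b => by
      rw [← hadd₁]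
      exact c1 (by simp [sectionThrough_apply]))
    (fun r a b => by
      rw [c1 ((sectionThrough_apply _).trans (hconst r a)), hsmul₁]
      rfl)
    (fun a b b' => by
      rw [← hadd₂]
      exact c2 (by simp [sectionThrough_apply]))
    (fun r a b => by
      rw [c2 ((sectionThrough_apply _).trans (hconst r b)), hsmul₂]
      rfl)
  refine (H.contract_eq hx B).trans (Finset.sum_congr rfl fun A _ => ?_)
  congr 1
  change T _ _ = _
  rw [c1 (sectionThrough_apply (e A x)), c2 (sectionThrough_apply (e A x))]

end IsAdaptedFrame

end Frames

/-! ### Connections and tensoriality of the generalized Riemann tensor -/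

section ConnectionCalculus

namespace CourantAlgebroid

variable (C : CourantAlgebroid n F E)

theorem act_smul_const (u : Cₛ^∞⟮𝓡 n; F, E⟯) (r : ℝ) (f : C^∞⟮𝓡 n, M; ℝ⟯) (x : M) :
    C.act u (r • f) x = r * C.act u f x := by
  have h : r • f = (ContMDiffMap.const r : C^∞⟮𝓡 n, M; ℝ⟯) * f := by
    ext y; rfl
  rw [h, act_mul, C.act_eq_zero_of_const u (f := ContMDiffMap.const r) r
    (Filter.Eventually.of_forall fun _ => rfl), mul_zero, add_zero]
  rfl

theorem act_sum {ι : Type*} (s : Finset ι) (u : Cₛ^∞⟮𝓡 n; F, E⟯) (f : ι → C^∞⟮𝓡 n, M; ℝ⟯)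
    (x : M) : C.act u (∑ i ∈ s, f i) x = ∑ i ∈ s, C.act u (f i) x := by
  classical
  induction s using Finset.induction_on with
  | empty => exact C.act_eq_zero_of_const u 0 (Filter.Eventually.of_forall fun _ => rfl)
  | insert i s hi ih => rw [Finset.sum_insert hi, Finset.sum_insert hi, act_add, ih]

theorem pair_add_left (u v w : Cₛ^∞⟮𝓡 n; F, E⟯) (x : M) :
    C.pair (u + v) w x = C.pair u w x + C.pair v w x := by simp [pair_apply]

theorem pair_sub_left (u v w : Cₛ^∞⟮𝓡 n; F, E⟯) (x : M) :
    C.pair (u - v) w x = C.pair u w x - C.pair v w x := by simp [pair_apply]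

theorem pair_smul_left (f : C^∞⟮𝓡 n, M; ℝ⟯) (u w : Cₛ^∞⟮𝓡 n; F, E⟯) (x : M) :
    C.pair (smulSec f u) w x = f x * C.pair u w x := by simp [pair_apply]

theorem pair_add_right (u v w : Cₛ^∞⟮𝓡 n; F, E⟯) (x : M) :
    C.pair u (v + w) x = C.pair u v x + C.pair u w x := by simp [pair_apply]

theorem pair_smul_right (f : C^∞⟮𝓡 n, M; ℝ⟯) (u w : Cₛ^∞⟮𝓡 n; F, E⟯) (x : M) :
    C.pair u (smulSec f w) x = f x * C.pair u w x := by simp [pair_apply]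

theorem act_add_left (u v : Cₛ^∞⟮𝓡 n; F, E⟯) (f : C^∞⟮𝓡 n, M; ℝ⟯) (x : M) :
    C.act (u + v) f x = C.act u f x + C.act v f x := by simp [act_apply]

theorem act_sub_left (u v : Cₛ^∞⟮𝓡 n; F, E⟯) (f : C^∞⟮𝓡 n, M; ℝ⟯) (x : M) :
    C.act (u - v) f x = C.act u f x - C.act v f x := by simp [act_apply]

end CourantAlgebroid

theorem smulSec_add (f : C^∞⟮𝓡 n, M; ℝ⟯) (u v : Cₛ^∞⟮𝓡 n; F, E⟯) :
    smulSec f (u + v) = smulSec f u + smulSec f v := by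
  ext x; simp

/-! ### Connections in an adapted frame -/

variable [FiniteDimensional ℝ F] {C : CourantAlgebroid n F E}

namespace Connection

variable (D : Connection C)

theorem leibniz' (u v : Cₛ^∞⟮𝓡 n; F, E⟯) (f : C^∞⟮𝓡 n, M; ℝ⟯) :
    D.toFun u (smulSec f v) = smulSec f (D.toFun u v) + smulSec (C.act u f) v := by
  ext x
  exact D.leibniz u v f x

theorem metric' (u v w : Cₛ^∞⟮𝓡 n; F, E⟯) (x : M) :
    C.act u (C.pair v w) x = C.pair (D.toFun u v) w x + C.pair v (D.toFun u w) x :=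
  D.metric u v w x

/-- Metric compatibility writes the left side as a derivative of ⟨v, w⟩ minus ⟨v, D_u w⟩, which
depends only on the germ of `v`. -/
theorem pair_toFun_congr {u v v' w : Cₛ^∞⟮𝓡 n; F, E⟯} {x : M} (h : ∀ᶠ y in nhds x, v y = v' y) :
    C.pair (D.toFun u v) w x = C.pair (D.toFun u v') w x := by
  have h1 := D.metric' u v w x
  have h2 := D.metric' u v' w x
  have h3 : C.act u (C.pair v w) x = C.act u (C.pair v' w) x := C.act_congr u <| by
    filter_upwards [h] with y hy
    simp [CourantAlgebroid.pair_apply, hy]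
  have h4 : C.pair v (D.toFun u w) x = C.pair v' (D.toFun u w) x := by
    simp [CourantAlgebroid.pair_apply, h.self_of_nhds]
  linarith

theorem comm_swap (x y z : Cₛ^∞⟮𝓡 n; F, E⟯) : D.comm y x z = -D.comm x y z := by
  simp only [comm]; abel

theorem comm_smul_left (f : C^∞⟮𝓡 n, M; ℝ⟯) (x y z : Cₛ^∞⟮𝓡 n; F, E⟯) :
    D.comm (smulSec f x) y z = smulSec f (D.comm x y z) := by
  simp only [comm, D.smul_left, D.leibniz', map_add, LinearMap.add_apply]
  ext p
  simp only [ContMDiffSection.coe_add, ContMDiffSection.coe_sub, Pi.add_apply, Pi.sub_apply,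
    smulSec_apply]
  module

theorem comm_add_left (x x' y z : Cₛ^∞⟮𝓡 n; F, E⟯) :
    D.comm (x + x') y z = D.comm x y z + D.comm x' y z := by
  simp only [comm, map_add, LinearMap.add_apply]
  abel

theorem comm_add_right (x y z z' : Cₛ^∞⟮𝓡 n; F, E⟯) :
    D.comm x y (z + z') = D.comm x y z + D.comm x y z' := by
  simp only [comm, map_add]
  abel

/-- The failure of tensoriality is governed by the defect [x, y] - D_x y + D_y x, which a vanishing
generalized torsion does not force to be zero. -/
theorem comm_smul_right [T2Space M] (f : C^∞⟮𝓡 n, M; ℝ⟯) (x y z : Cₛ^∞⟮𝓡 n; F, E⟯) (p : M) :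
    D.comm x y (smulSec f z) p = f p • D.comm x y z p +
      C.act (C.bracket x y - D.toFun x y + D.toFun y x) f p • z p := by
  simp only [comm, D.leibniz', map_add, C.act_add_left, C.act_sub_left, C.act_bracket]
  simp only [ContMDiffSection.coe_add, ContMDiffSection.coe_sub, Pi.add_apply, Pi.sub_apply,
    smulSec_apply]
  module

theorem comm_add_mid (x y y' z : Cₛ^∞⟮𝓡 n; F, E⟯) :
    D.comm x (y + y') z = D.comm x y z + D.comm x y' z := by
  rw [comm_swap, comm_add_left, D.comm_swap x y, D.comm_swap x y']; abel

theorem comm_smul_mid (f : C^∞⟮𝓡 n, M; ℝ⟯) (x y z : Cₛ^∞⟮𝓡 n; F, E⟯) :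
    D.comm x (smulSec f y) z = smulSec f (D.comm x y z) := by
  rw [comm_swap, comm_smul_left, D.comm_swap x y]; ext p; simp

end Connection

section FrameCurvature

variable {P Q : Type*} [Fintype P] [Fintype Q] [DecidableEq P] [DecidableEq Q] [T2Space M]

namespace IsAdaptedFrame

variable {G : GenPseudometric C} {U : Set M} {e : P ⊕ Q → Cₛ^∞⟮𝓡 n; F, E⟯} {x : M}

theorem pair_expand (H : IsAdaptedFrame G U e) (hx : x ∈ U) (u v : Cₛ^∞⟮𝓡 n; F, E⟯) :
    C.pair u v x = ∑ A, sgn P Q ℝ A * (C.pair u (e A) x * C.pair v (e A) x) := by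
  simp only [C.pair_symm _ (e _), CourantAlgebroid.pair_apply]
  exact H.parseval hx _ _

theorem pair_toFun_expand (H : IsAdaptedFrame G U e) (hx : x ∈ U) (D : Connection C)
    (u v w : Cₛ^∞⟮𝓡 n; F, E⟯) : C.pair (D.toFun u v) w x =
      ∑ A, sgn P Q ℝ A * (C.pair u (e A) x * C.pair (D.toFun (e A) v) w x) := by
  have h := H.tensorial_expand hx (T := fun u => C.pair (D.toFun u v) w x)
    (fun u u' => by rw [map_add, LinearMap.add_apply, C.pair_add_left])
    (fun f u => by rw [D.smul_left, C.pair_smul_left, smul_eq_mul]) u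
  simpa only [smul_eq_mul, mul_assoc, C.pair_symm u] using h

theorem riemann_eq (H : IsAdaptedFrame G U e) (hx : x ∈ U) (D : Connection C)
    (w z u v : Cₛ^∞⟮𝓡 n; F, E⟯) : D.riemann w z u v x =
      (C.pair (D.comm u v z) w x + C.pair (D.comm z w u) v x -
        ∑ A, sgn P Q ℝ A * (C.pair (D.toFun (e A) u) v x * C.pair (D.toFun (e A) z) w x)) / 2 := by
  have h := H.contract_tensorial hx (T := fun a b => C.pair (D.toFun b u) v x *
    C.pair (D.toFun a z) w x)
    (fun a a' b => by rw [map_add, LinearMap.add_apply, C.pair_add_left, mul_add])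
    (fun f a b => by rw [D.smul_left, C.pair_smul_left]; ring)
    (fun a b b' => by rw [map_add, LinearMap.add_apply, C.pair_add_left, add_mul])
    (fun f a b => by rw [D.smul_left, C.pair_smul_left]; ring)
  rw [← h, C.pair_symm (D.comm u v z), C.pair_symm (D.comm z w u)]
  rfl

/-- The definition exchanges its first two terms under this symmetry. It carries linearity in the
first two slots over to the last two. -/
theorem riemann_symm (H : IsAdaptedFrame G U e) (hx : x ∈ U) (D : Connection C)
    (w z u v : Cₛ^∞⟮𝓡 n; F, E⟯) : D.riemann w z u v x = D.riemann v u z w x := by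
  rw [H.riemann_eq hx, H.riemann_eq hx]
  simp only [mul_comm (C.pair (D.toFun _ u) v x)]
  ring

theorem riemann_add₁ (H : IsAdaptedFrame G U e) (hx : x ∈ U) (D : Connection C)
    (w w' z u v : Cₛ^∞⟮𝓡 n; F, E⟯) :
    D.riemann (w + w') z u v x = D.riemann w z u v x + D.riemann w' z u v x := by
  simp only [H.riemann_eq hx, D.comm_add_mid, C.pair_add_left, C.pair_add_right, mul_add,
    Finset.sum_add_distrib]
  ring

theorem riemann_smul₁ (H : IsAdaptedFrame G U e) (hx : x ∈ U) (D : Connection C)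
    (f : C^∞⟮𝓡 n, M; ℝ⟯) (w z u v : Cₛ^∞⟮𝓡 n; F, E⟯) :
    D.riemann (smulSec f w) z u v x = f x * D.riemann w z u v x := by
  simp only [H.riemann_eq hx, D.comm_smul_mid, C.pair_smul_left, C.pair_smul_right,
    mul_left_comm _ (f x), ← Finset.mul_sum]
  ring

theorem riemann_add₂ (H : IsAdaptedFrame G U e) (hx : x ∈ U) (D : Connection C)
    (w z z' u v : Cₛ^∞⟮𝓡 n; F, E⟯) :
    D.riemann w (z + z') u v x = D.riemann w z u v x + D.riemann w z' u v x := by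
  simp only [H.riemann_eq hx, D.comm_add_left, D.comm_add_right, C.pair_add_left, mul_add, map_add,
    Finset.sum_add_distrib]
  ring

/-- The commutator of covariant derivatives differentiates `f` along [u, v] - D_u v + D_v u. For
vanishing torsion, pairing this section with e_A gives ⟨D_A u, v⟩. The quadratic term in the Riemann
tensor produces the same derivative of `f` and cancels it. -/
theorem riemann_smul₂ (H : IsAdaptedFrame G U e) (hx : x ∈ U) {D : Connection C}
    (hD : D.IsTorsionFree) (f : C^∞⟮𝓡 n, M; ℝ⟯) (w z u v : Cₛ^∞⟮𝓡 n; F, E⟯) :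
    D.riemann w (smulSec f z) u v x = f x * D.riemann w z u v x := by
  have h1 : C.pair (D.comm u v (smulSec f z)) w x = f x * C.pair (D.comm u v z) w x +
      C.act (C.bracket u v - D.toFun u v + D.toFun v u) f x * C.pair z w x := by
    simp [CourantAlgebroid.pair_apply, D.comm_smul_right]
  have h2 : C.act (C.bracket u v - D.toFun u v + D.toFun v u) f x =
      ∑ A, sgn P Q ℝ A * (C.pair (D.toFun (e A) u) v x * C.act (e A) f x) := by
    rw [H.act_expand hx]
    refine Finset.sum_congr rfl fun A _ => ?_
    have h := hD u v (e A) x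
    have h3 : C.pair (e A) (C.bracket u v - D.toFun u v + D.toFun v u) x =
        C.pair (D.toFun (e A) u) v x := by
      rw [C.pair_symm]
      simp only [CourantAlgebroid.pair_apply, ContMDiffSection.coe_add, ContMDiffSection.coe_sub,
        Pi.add_apply, Pi.sub_apply, map_add, map_sub, LinearMap.add_apply, LinearMap.sub_apply] at h ⊢
      linarith
    rw [h3]
  simp only [H.riemann_eq hx, h1, h2, D.comm_smul_left, D.leibniz', C.pair_add_left,
    C.pair_smul_left, mul_add, Finset.sum_add_distrib, Finset.sum_mul, mul_left_comm _ (f x),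
    ← Finset.mul_sum]
  simp only [mul_assoc]
  ring

theorem riemann_add₃ (H : IsAdaptedFrame G U e) (hx : x ∈ U) (D : Connection C)
    (w z u u' v : Cₛ^∞⟮𝓡 n; F, E⟯) :
    D.riemann w z (u + u') v x = D.riemann w z u v x + D.riemann w z u' v x := by
  rw [H.riemann_symm hx, H.riemann_add₂ hx, H.riemann_symm hx D v u, H.riemann_symm hx D v u']

theorem riemann_smul₃ (H : IsAdaptedFrame G U e) (hx : x ∈ U) {D : Connection C}
    (hD : D.IsTorsionFree) (f : C^∞⟮𝓡 n, M; ℝ⟯) (w z u v : Cₛ^∞⟮𝓡 n; F, E⟯) :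
    D.riemann w z (smulSec f u) v x = f x * D.riemann w z u v x := by
  rw [H.riemann_symm hx, H.riemann_smul₂ hx hD, ← H.riemann_symm hx]

theorem riemann_add₄ (H : IsAdaptedFrame G U e) (hx : x ∈ U) (D : Connection C)
    (w z u v v' : Cₛ^∞⟮𝓡 n; F, E⟯) :
    D.riemann w z u (v + v') x = D.riemann w z u v x + D.riemann w z u v' x := by
  rw [H.riemann_symm hx, H.riemann_add₁ hx, H.riemann_symm hx D v u, H.riemann_symm hx D v' u]

theorem riemann_smul₄ (H : IsAdaptedFrame G U e) (hx : x ∈ U) (D : Connection C)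
    (f : C^∞⟮𝓡 n, M; ℝ⟯) (w z u v : Cₛ^∞⟮𝓡 n; F, E⟯) :
    D.riemann w z u (smulSec f v) x = f x * D.riemann w z u v x := by
  rw [H.riemann_symm hx, H.riemann_smul₁ hx, ← H.riemann_symm hx]

theorem fullRicci_eq (H : IsAdaptedFrame G U e) (hx : x ∈ U) {D : Connection C}
    (hD : D.IsTorsionFree) (v u : Cₛ^∞⟮𝓡 n; F, E⟯) :
    D.fullRicci x (v x) (u x) = ∑ A, sgn P Q ℝ A * D.riemann (e A) v (e A) u x := by
  rw [Connection.fullRicci, H.contract_tensorial hx (T := fun a b => D.riemann a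
    (sectionThrough n F x (v x)) b (sectionThrough n F x (u x)) x)
    (fun _ _ _ => H.riemann_add₁ hx _ _ _ _ _ _) (fun _ _ _ => H.riemann_smul₁ hx _ _ _ _ _ _)
    (fun _ _ _ => H.riemann_add₃ hx _ _ _ _ _ _) (fun _ _ _ => H.riemann_smul₃ hx hD _ _ _ _ _)]
  refine Finset.sum_congr rfl fun A _ => ?_
  congr 1
  rw [H.tensorial_congr hx (T := fun v => D.riemann (e A) v (e A) (sectionThrough n F x (u x)) x)
    (fun _ _ => H.riemann_add₂ hx _ _ _ _ _ _) (fun _ _ => H.riemann_smul₂ hx hD _ _ _ _ _)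
    (sectionThrough_apply (v x)),
    H.tensorial_congr hx (T := fun u => D.riemann (e A) v (e A) u x)
    (fun _ _ => H.riemann_add₄ hx _ _ _ _ _ _) (fun _ _ => H.riemann_smul₄ hx _ _ _ _ _ _)
    (sectionThrough_apply (u x))]

/-- The sign of e_B in the contraction cancels the eigenvalue of `G` on e_B, so the outer sum
carries no sign. -/
theorem scalar_eq (H : IsAdaptedFrame G U e) (hx : x ∈ U) {D : Connection C}
    (hD : D.IsTorsionFree) :
    D.scalar G x = ∑ B, ∑ A, sgn P Q ℝ A * D.riemann (e A) (e B) (e A) (e B) x := by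
  have h0 : D.scalar G x = C.contract x fun a b => ∑ A, sgn P Q ℝ A * D.riemann (e A)
      (G.app (sectionThrough n F x a)) (e A) (sectionThrough n F x b) x := by
    rw [Connection.scalar]
    congr 1
    funext a b
    rw [← H.fullRicci_eq hx hD, sectionThrough_apply]
    congr 1
    exact congrArg (G.toFun x) (sectionThrough_apply a).symm
  have happ (u v : Cₛ^∞⟮𝓡 n; F, E⟯) : G.app (u + v) = G.app u + G.app v := by
    ext y; exact map_add (G.toFun y) _ _
  have happ' (f : C^∞⟮𝓡 n, M; ℝ⟯) (u : Cₛ^∞⟮𝓡 n; F, E⟯) :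
      G.app (smulSec f u) = smulSec f (G.app u) := by
    ext y; exact map_smul (G.toFun y) _ _
  rw [h0, H.contract_tensorial hx (T := fun a b => ∑ A, sgn P Q ℝ A * D.riemann (e A)
      (G.app a) (e A) b x)
    (fun _ _ _ => by simp only [happ, H.riemann_add₂ hx, mul_add, Finset.sum_add_distrib])
    (fun _ _ _ => by simp only [happ', H.riemann_smul₂ hx hD, mul_left_comm (sgn P Q ℝ _),
      Finset.mul_sum])
    (fun _ _ _ => by simp only [H.riemann_add₄ hx, mul_add, Finset.sum_add_distrib])
    (fun _ _ _ => by simp only [H.riemann_smul₄ hx, mul_left_comm (sgn P Q ℝ _),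
      Finset.mul_sum])]
  refine Finset.sum_congr rfl fun B _ => ?_
  rw [Finset.mul_sum]
  refine Finset.sum_congr rfl fun A _ => ?_
  have h1 : G.app (e B) x = smulSec (ContMDiffMap.const (sgn P Q ℝ B)) (e B) x := H.eigen x hx B
  rw [H.tensorial_congr hx (T := fun v => D.riemann (e A) v (e A) (e B) x)
    (fun _ _ => H.riemann_add₂ hx _ _ _ _ _ _) (fun _ _ => H.riemann_smul₂ hx hD _ _ _ _ _) h1,
    H.riemann_smul₂ hx hD]
  change sgn P Q ℝ B * (sgn P Q ℝ A * (sgn P Q ℝ B * _)) = _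
  linear_combination sgn P Q ℝ A * D.riemann (e A) (e B) (e A) (e B) x * sgn_mul_sgn B

end IsAdaptedFrame

end FrameCurvature

end ConnectionCalculus

/-! ### Curvature in terms of structure functions and divergences -/

section CurvatureAlgebra

variable {P Q : Type*} [Fintype P] [Fintype Q]

/-- The components of `x^α y^β [D_α, D_β] z` in a frame, in terms of the connection coefficients `Γ`
and of their derivatives `dΓ`. -/
def frameCurvature (Γ : P ⊕ Q → P ⊕ Q → P ⊕ Q → ℝ) (dΓ : P ⊕ Q → P ⊕ Q → P ⊕ Q → P ⊕ Q → ℝ)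
    (X Y Z W : P ⊕ Q) : ℝ :=
  (dΓ X Y Z W - ∑ B, sgn P Q ℝ B * (Γ Y Z B * Γ X W B) - ∑ B, sgn P Q ℝ B * (Γ X Y B * Γ B Z W)) -
    (dΓ Y X Z W - ∑ B, sgn P Q ℝ B * (Γ X Z B * Γ Y W B) - ∑ B, sgn P Q ℝ B * (Γ Y X B * Γ B Z W))

/-- The part of the scalar curvature which involves a single eigenbundle. -/
theorem sum_halfCurvature {g : P → P → P → ℝ} {dg : P → P → P → P → ℝ} {k : P → P → P → ℝ}
    {d : P → ℝ} {dd : P → P → ℝ} (hg : ∀ a b c, g a c b = -g a b c)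
    (hdg : ∀ x a b c, dg x a c b = -dg x a b c) (hk : ∀ a b c, k a b c = g a b c + g b c a + g c a b)
    (hd : ∀ b, d b = ∑ a, g a b a) (hdd : ∀ x b, dd x b = ∑ a, dg x a b a) :
    ∑ b, ∑ a, ((dg a b b a - ∑ c, g b b c * g a a c - ∑ c, g a b c * g c b a) -
      (dg b a b a - ∑ c, g a b c * g b a c - ∑ c, g b a c * g c b a)) +
      (∑ b, ∑ a, ∑ c, g c a b * g c a b) / 2 =
    -2 * ∑ a, dd a a - ∑ a, d a * d a + (∑ a, ∑ b, ∑ c, k a b c * k a b c) / 6 := by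
  -- Apart from the trace of `g`, these are the two quadratic invariants that occur. Neither is
  -- determined by `k` alone, but the curvature contains S₀/2 + S₁, and the squared norm of `k` is
  -- 3S₀ + 6S₁.
  set S₀ := ∑ a, ∑ b, ∑ c, g a b c * g a b c
  set S₁ := ∑ a, ∑ b, ∑ c, g a b c * g b c a
  have e1 : ∑ b, ∑ a, dg a b b a = -∑ a, dd a a := by
    rw [Finset.sum_comm]
    simp only [hdd, ← Finset.sum_neg_distrib]
    exact Finset.sum_congr rfl fun a _ => Finset.sum_congr rfl fun b _ => hdg _ _ _ _
  have e2 : ∑ b, ∑ a, dg b a b a = ∑ a, dd a a := by simp only [hdd]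
  have e3 : ∑ b, ∑ a, ∑ c, g b b c * g a a c = ∑ c, d c * d c := by
    have h (c : P) : d c * d c = ∑ b, ∑ a, g b b c * g a a c := by
      simp only [hd, Finset.sum_mul_sum]
      refine Finset.sum_congr rfl fun b _ => Finset.sum_congr rfl fun a _ => ?_
      rw [hg b b c, hg a a c]; ring
    simp only [h]
    conv_lhs => enter [2, b]; rw [Finset.sum_comm]
    rw [Finset.sum_comm]
  have rot (f : P → P → P → ℝ) : ∑ a, ∑ b, ∑ c, f b c a = ∑ a, ∑ b, ∑ c, f a b c := by
    rw [Finset.sum_comm]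
    refine Finset.sum_congr rfl fun a _ => Finset.sum_comm
  have e4 : ∑ b, ∑ a, ∑ c, g a b c * g c b a = -S₁ := by
    rw [Finset.sum_comm, ← rot, ← Finset.sum_neg_distrib]
    refine Finset.sum_congr rfl fun a _ => ?_
    rw [← Finset.sum_neg_distrib]
    refine Finset.sum_congr rfl fun b _ => ?_
    rw [← Finset.sum_neg_distrib]
    refine Finset.sum_congr rfl fun c _ => ?_
    rw [hg a b c]; ring
  have e5 : ∑ b, ∑ a, ∑ c, g a b c * g b a c = -S₁ := by
    rw [Finset.sum_comm, ← Finset.sum_neg_distrib]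
    refine Finset.sum_congr rfl fun a _ => ?_
    rw [← Finset.sum_neg_distrib]
    refine Finset.sum_congr rfl fun b _ => ?_
    rw [← Finset.sum_neg_distrib]
    refine Finset.sum_congr rfl fun c _ => ?_
    rw [hg b a c]; ring
  have e6 : ∑ b, ∑ a, ∑ c, g b a c * g c b a = S₁ := by
    refine Eq.trans ?_ ((rot fun a b c => g b c a * g c a b).trans
      (rot fun a b c => g a b c * g b c a))
    exact Finset.sum_congr rfl fun a _ => Finset.sum_congr rfl fun b _ =>
      Finset.sum_congr rfl fun c _ => mul_comm _ _
  have e7 : ∑ b, ∑ a, ∑ c, g c a b * g c a b = S₀ := by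
    rw [Finset.sum_comm]
    exact (rot fun a b c => g b c a * g b c a).trans (rot fun a b c => g a b c * g a b c)
  have e8 : ∑ a, ∑ b, ∑ c, k a b c * k a b c = 3 * S₀ + 6 * S₁ := by
    have r1 := rot fun a b c => g a b c * g a b c
    have r2 := rot fun a b c => g b c a * g b c a
    have r3 := rot fun a b c => g a b c * g b c a
    have r4 := rot fun a b c => g b c a * g c a b
    have : ∑ a, ∑ b, ∑ c, k a b c * k a b c = S₀ + ∑ a, ∑ b, ∑ c, g b c a * g b c a +
        ∑ a, ∑ b, ∑ c, g c a b * g c a b + 2 * S₁ + 2 * ∑ a, ∑ b, ∑ c, g b c a * g c a b +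
        2 * ∑ a, ∑ b, ∑ c, g c a b * g a b c := by
      simp only [S₀, S₁, Finset.mul_sum, ← Finset.sum_add_distrib]
      refine Finset.sum_congr rfl fun a _ => Finset.sum_congr rfl fun b _ =>
        Finset.sum_congr rfl fun c _ => ?_
      rw [hk]; ring
    rw [this]
    linarith
  simp only [Finset.sum_sub_distrib, e1, e2, e3, e4, e5, e6, e7, e8]
  ring

theorem sum_trace_left {g : P → P → P → ℝ} (hg : ∀ a b c, g a c b = -g a b c) (v : P → ℝ) :
    ∑ b, ∑ c, v c * g b b c = -∑ c, (∑ b, g b c b) * v c := by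
  rw [Finset.sum_comm, ← Finset.sum_neg_distrib]
  refine Finset.sum_congr rfl fun c _ => ?_
  rw [Finset.sum_mul, ← Finset.sum_neg_distrib]
  refine Finset.sum_congr rfl fun b _ => ?_
  rw [hg b c b]; ring

theorem sum_antisymm_contract {g : P → P → P → ℝ} (hg : ∀ a b c, g a c b = -g a b c)
    {h : P → P → ℝ} (hh : ∀ b c, h c b = -h b c) (a : P) :
    ∑ b, ∑ c, h b c * g c b a = ∑ b, ∑ c, h b c * g b a c := by
  rw [Finset.sum_comm]
  refine Finset.sum_congr rfl fun b _ => Finset.sum_congr rfl fun c _ => ?_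
  rw [hh, hg]; ring

variable {Γ : P ⊕ Q → P ⊕ Q → P ⊕ Q → ℝ} {dΓ : P ⊕ Q → P ⊕ Q → P ⊕ Q → P ⊕ Q → ℝ}
  {c : P ⊕ Q → P ⊕ Q → P ⊕ Q → ℝ} {dc : P ⊕ Q → P ⊕ Q → P ⊕ Q → P ⊕ Q → ℝ}
  {d : P ⊕ Q → ℝ} {dd : P ⊕ Q → P ⊕ Q → ℝ}

/-- The coefficients, at a point, of a torsion-free connection compatible with the splitting in an
adapted frame, together with their derivatives. -/
structure FrameConnection (Γ : P ⊕ Q → P ⊕ Q → P ⊕ Q → ℝ)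
    (dΓ : P ⊕ Q → P ⊕ Q → P ⊕ Q → P ⊕ Q → ℝ) (c : P ⊕ Q → P ⊕ Q → P ⊕ Q → ℝ)
    (dc : P ⊕ Q → P ⊕ Q → P ⊕ Q → P ⊕ Q → ℝ) (d : P ⊕ Q → ℝ) (dd : P ⊕ Q → P ⊕ Q → ℝ) :
    Prop where
  antisymm : ∀ A₁ A₂ A₃, Γ A₁ A₃ A₂ = -Γ A₁ A₂ A₃
  deriv_antisymm : ∀ X A₁ A₂ A₃, dΓ X A₁ A₃ A₂ = -dΓ X A₁ A₂ A₃
  mixed : ∀ A a i, Γ A (Sum.inl a) (Sum.inr i) = 0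
  deriv_mixed : ∀ X A a i, dΓ X A (Sum.inl a) (Sum.inr i) = 0
  torsion : ∀ A₁ A₂ A₃, c A₁ A₂ A₃ = Γ A₁ A₂ A₃ + Γ A₂ A₃ A₁ + Γ A₃ A₁ A₂
  deriv_torsion : ∀ X A₁ A₂ A₃, dc X A₁ A₂ A₃ = dΓ X A₁ A₂ A₃ + dΓ X A₂ A₃ A₁ + dΓ X A₃ A₁ A₂
  div : ∀ B, d B = ∑ A, sgn P Q ℝ A * Γ A B A
  deriv_div : ∀ X B, dd X B = ∑ A, sgn P Q ℝ A * dΓ X A B A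

namespace FrameConnection

theorem mixed' (H : FrameConnection Γ dΓ c dc d dd) (A : P ⊕ Q) (a : P) (i : Q) :
    Γ A (Sum.inr i) (Sum.inl a) = 0 := by rw [H.antisymm, H.mixed, neg_zero]

theorem deriv_mixed' (H : FrameConnection Γ dΓ c dc d dd) (X A : P ⊕ Q) (a : P) (i : Q) :
    dΓ X A (Sum.inr i) (Sum.inl a) = 0 := by rw [H.deriv_antisymm, H.deriv_mixed, neg_zero]

/-- Six times the scalar curvature. -/
theorem six_scalar (H : FrameConnection Γ dΓ c dc d dd) :
    6 * ∑ B, ∑ A, sgn P Q ℝ A * ((frameCurvature Γ dΓ A B B A + frameCurvature Γ dΓ B A A B -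
      ∑ E, sgn P Q ℝ E * (Γ E A B * Γ E B A)) / 2) =
    (-12 * ∑ a, dd (Sum.inl a) (Sum.inl a) - 6 * ∑ a, d (Sum.inl a) * d (Sum.inl a) +
      ∑ a₁, ∑ a₂, ∑ a₃, c (Sum.inl a₁) (Sum.inl a₂) (Sum.inl a₃) *
        c (Sum.inl a₁) (Sum.inl a₂) (Sum.inl a₃) -
      3 * ∑ i, ∑ a₁, ∑ a₂, c (Sum.inr i) (Sum.inl a₁) (Sum.inl a₂) *
        c (Sum.inr i) (Sum.inl a₁) (Sum.inl a₂)) +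
    (-12 * ∑ i, dd (Sum.inr i) (Sum.inr i) - 6 * ∑ i, d (Sum.inr i) * d (Sum.inr i) +
      ∑ i₁, ∑ i₂, ∑ i₃, c (Sum.inr i₁) (Sum.inr i₂) (Sum.inr i₃) *
        c (Sum.inr i₁) (Sum.inr i₂) (Sum.inr i₃) -
      3 * ∑ a, ∑ i₁, ∑ i₂, c (Sum.inl a) (Sum.inr i₁) (Sum.inr i₂) *
        c (Sum.inl a) (Sum.inr i₁) (Sum.inr i₂)) := by
  have hp := sum_halfCurvature (g := fun a₁ a₂ a₃ : P => Γ (Sum.inl a₁) (Sum.inl a₂) (Sum.inl a₃))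
    (dg := fun x a₁ a₂ a₃ : P => dΓ (Sum.inl x) (Sum.inl a₁) (Sum.inl a₂) (Sum.inl a₃))
    (k := fun a₁ a₂ a₃ : P => c (Sum.inl a₁) (Sum.inl a₂) (Sum.inl a₃))
    (d := fun a => d (Sum.inl a)) (dd := fun x a => dd (Sum.inl x) (Sum.inl a))
    (fun _ _ _ => H.antisymm _ _ _) (fun _ _ _ _ => H.deriv_antisymm _ _ _ _)
    (fun _ _ _ => H.torsion _ _ _)
    (fun b => by simp [H.div, H.mixed]) (fun x b => by simp [H.deriv_div, H.deriv_mixed])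
  -- The coefficients change sign because the pairing is negative on V₋; after reversing it, V₋
  -- plays the part of a positive eigenbundle.
  have hq := sum_halfCurvature (g := fun a₁ a₂ a₃ : Q => -Γ (Sum.inr a₁) (Sum.inr a₂) (Sum.inr a₃))
    (dg := fun x a₁ a₂ a₃ : Q => -dΓ (Sum.inr x) (Sum.inr a₁) (Sum.inr a₂) (Sum.inr a₃))
    (k := fun a₁ a₂ a₃ : Q => -c (Sum.inr a₁) (Sum.inr a₂) (Sum.inr a₃))
    (d := fun a => d (Sum.inr a)) (dd := fun x a => dd (Sum.inr x) (Sum.inr a))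
    (fun _ _ _ => by rw [H.antisymm]) (fun _ _ _ _ => by rw [H.deriv_antisymm])
    (fun _ _ _ => by rw [H.torsion]; ring)
    (fun b => by simp [H.div, H.mixed']) (fun x b => by simp [H.deriv_div, H.deriv_mixed'])
  have m1 (i : Q) (a b : P) : Γ (Sum.inr i) (Sum.inl a) (Sum.inl b) =
      c (Sum.inr i) (Sum.inl a) (Sum.inl b) := by simp [H.torsion, H.mixed, H.mixed']
  have m2 (a : P) (i j : Q) : Γ (Sum.inl a) (Sum.inr i) (Sum.inr j) =
      c (Sum.inl a) (Sum.inr i) (Sum.inr j) := by simp [H.torsion, H.mixed, H.mixed']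
  -- On the diagonal the two commutators in the Riemann tensor agree, and antisymmetry of `Γ` turns
  -- the quadratic term into a sum of squares with signs.
  have sw (A B : P ⊕ Q) : (frameCurvature Γ dΓ A B B A + frameCurvature Γ dΓ B A A B -
      ∑ E, sgn P Q ℝ E * (Γ E A B * Γ E B A)) / 2 = frameCurvature Γ dΓ A B B A +
      (∑ E, sgn P Q ℝ E * (Γ E A B * Γ E A B)) / 2 := by
    have h1 : frameCurvature Γ dΓ B A A B = frameCurvature Γ dΓ A B B A := by
      simp only [frameCurvature, H.deriv_antisymm _ _ A B, H.antisymm _ A B, mul_neg,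
        Finset.sum_neg_distrib, mul_comm (Γ B B _)]
      simp only [mul_comm (Γ B A _) (Γ A B _)]
      ring
    have h2 : ∑ E, sgn P Q ℝ E * (Γ E A B * Γ E B A) = -∑ E, sgn P Q ℝ E * (Γ E A B * Γ E A B) := by
      rw [← Finset.sum_neg_distrib]
      exact Finset.sum_congr rfl fun E _ => by rw [H.antisymm E A B]; ring
    rw [h1, h2]; ring
  simp only [sw]
  simp only [frameCurvature, Fintype.sum_sum_type, sgn_inl, sgn_inr, H.mixed, H.mixed',
    H.deriv_mixed, H.deriv_mixed', mul_zero, zero_mul, Finset.sum_const_zero, sub_zero, add_zero,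
    one_mul, m1, m2, zero_div, neg_mul, Finset.sum_neg_distrib, ← sub_eq_add_neg]
  simp only [neg_mul_neg] at hq
  have cp : ∑ b : P, ∑ a : P, ∑ i, c (Sum.inr i) (Sum.inl a) (Sum.inl b) *
      c (Sum.inr i) (Sum.inl a) (Sum.inl b) = ∑ i, ∑ a : P, ∑ b : P,
      c (Sum.inr i) (Sum.inl a) (Sum.inl b) * c (Sum.inr i) (Sum.inl a) (Sum.inl b) := by
    rw [Finset.sum_comm]
    conv_lhs => enter [2, a]; rw [Finset.sum_comm]
    rw [Finset.sum_comm]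
  have cq : ∑ b : Q, ∑ a : Q, ∑ i, c (Sum.inl i) (Sum.inr a) (Sum.inr b) *
      c (Sum.inl i) (Sum.inr a) (Sum.inr b) = ∑ i, ∑ a : Q, ∑ b : Q,
      c (Sum.inl i) (Sum.inr a) (Sum.inr b) * c (Sum.inl i) (Sum.inr a) (Sum.inr b) := by
    rw [Finset.sum_comm]
    conv_lhs => enter [2, a]; rw [Finset.sum_comm]
    rw [Finset.sum_comm]
  simp only [Finset.sum_add_distrib, Finset.sum_sub_distrib, Finset.sum_neg_distrib,
    ← Finset.sum_div, sub_div, zero_sub] at hp hq ⊢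
  linarith

/-- The mixed components of the full Ricci tensor. -/
theorem two_ricci (H : FrameConnection Γ dΓ c dc d dd) (a : P) (i : Q) :
    ∑ A, sgn P Q ℝ A * (frameCurvature Γ dΓ A (Sum.inr i) (Sum.inl a) A +
      frameCurvature Γ dΓ (Sum.inl a) A A (Sum.inr i) -
      ∑ E, sgn P Q ℝ E * (Γ E A (Sum.inr i) * Γ E (Sum.inl a) A)) =
    (∑ b, (dc (Sum.inl b) (Sum.inr i) (Sum.inl a) (Sum.inl b) +
        d (Sum.inl b) * c (Sum.inr i) (Sum.inl a) (Sum.inl b)) +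
      ∑ b, ∑ j, c (Sum.inl b) (Sum.inr i) (Sum.inr j) * c (Sum.inr j) (Sum.inl a) (Sum.inl b) -
      dd (Sum.inr i) (Sum.inl a)) +
    (-∑ j, (dc (Sum.inr j) (Sum.inl a) (Sum.inr i) (Sum.inr j) +
        d (Sum.inr j) * c (Sum.inl a) (Sum.inr i) (Sum.inr j)) +
      ∑ j, ∑ b, c (Sum.inr j) (Sum.inl a) (Sum.inl b) * c (Sum.inl b) (Sum.inr i) (Sum.inr j) -
      dd (Sum.inl a) (Sum.inr i)) := by
  have m1 (i : Q) (a b : P) : c (Sum.inr i) (Sum.inl a) (Sum.inl b) =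
      Γ (Sum.inr i) (Sum.inl a) (Sum.inl b) := by simp [H.torsion, H.mixed, H.mixed']
  have m2 (a : P) (i j : Q) : c (Sum.inl a) (Sum.inr i) (Sum.inr j) =
      Γ (Sum.inl a) (Sum.inr i) (Sum.inr j) := by simp [H.torsion, H.mixed, H.mixed']
  have m3 X (i : Q) (a b : P) : dc X (Sum.inr i) (Sum.inl a) (Sum.inl b) =
      dΓ X (Sum.inr i) (Sum.inl a) (Sum.inl b) := by
    simp [H.deriv_torsion, H.deriv_mixed, H.deriv_mixed']
  have m4 X (a : P) (i j : Q) : dc X (Sum.inl a) (Sum.inr i) (Sum.inr j) =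
      dΓ X (Sum.inl a) (Sum.inr i) (Sum.inr j) := by
    simp [H.deriv_torsion, H.deriv_mixed, H.deriv_mixed']
  simp only [frameCurvature, Fintype.sum_sum_type, sgn_inl, sgn_inr, H.mixed, H.mixed',
    H.deriv_mixed, H.deriv_mixed', mul_zero, zero_mul, Finset.sum_const_zero, sub_zero, add_zero,
    zero_add, one_mul, m1, m2, m3, m4, H.div, H.deriv_div]
  -- Coefficients with all indices in one half are not determined by the torsion. They remain only
  -- in traces, which are divergences (`t1`, `t2`), or contracted with an antisymmetric mixed
  -- coefficient, where they cancel (`t3`, `t4`).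
  have t1 := sum_trace_left (g := fun a b c : P => Γ (Sum.inl a) (Sum.inl b) (Sum.inl c))
    (fun _ _ _ => H.antisymm _ _ _) (fun b => Γ (Sum.inr i) (Sum.inl a) (Sum.inl b))
  have t2 := sum_trace_left (g := fun a b c : Q => Γ (Sum.inr a) (Sum.inr b) (Sum.inr c))
    (fun _ _ _ => H.antisymm _ _ _) (fun j => Γ (Sum.inl a) (Sum.inr i) (Sum.inr j))
  have t3 := sum_antisymm_contract (g := fun a b c : P => Γ (Sum.inl a) (Sum.inl b) (Sum.inl c))
    (fun _ _ _ => H.antisymm _ _ _) (h := fun b c => Γ (Sum.inr i) (Sum.inl b) (Sum.inl c))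
    (fun _ _ => H.antisymm _ _ _) a
  have t4 := sum_antisymm_contract (g := fun a b c : Q => Γ (Sum.inr a) (Sum.inr b) (Sum.inr c))
    (fun _ _ _ => H.antisymm _ _ _) (h := fun b c => Γ (Sum.inl a) (Sum.inr b) (Sum.inr c))
    (fun _ _ => H.antisymm _ _ _) i
  simp only [H.antisymm _ (Sum.inl a) (Sum.inl _), H.antisymm _ (Sum.inr i) (Sum.inr _)] at t3 t4 ⊢
  simp only [H.deriv_antisymm _ _ (Sum.inr i) (Sum.inr _)]
  simp only [mul_comm (Γ (Sum.inl a) (Sum.inr i) (Sum.inr _))] at t2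
  simp only [mul_comm (Γ (Sum.inr i) (Sum.inl a) (Sum.inl _)),
    mul_comm (Γ (Sum.inl _) (Sum.inl a) (Sum.inl _)) (Γ (Sum.inr i) (Sum.inl _) (Sum.inl _))]
    at t1 t3 ⊢
  simp only [Finset.sum_add_distrib, Finset.sum_sub_distrib, Finset.sum_neg_distrib, neg_mul,
    mul_neg, one_mul, neg_neg] at t1 t2 t3 t4 ⊢
  linarith

end FrameConnection

end CurvatureAlgebra

/-! ### Scalar and Ricci curvature of a Courant algebroid in an adapted frame -/

section FrameCurvature

variable [FiniteDimensional ℝ F] {C : CourantAlgebroid n F E}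
  {P Q : Type*} [Fintype P] [Fintype Q] [DecidableEq P] [DecidableEq Q] [T2Space M]

namespace IsAdaptedFrame

variable {G : GenPseudometric C} {σ : PosHalfDensity n M} {U : Set M}
  {e : P ⊕ Q → Cₛ^∞⟮𝓡 n; F, E⟯} {x : M} {D : Connection C}

variable (e D) in
/-- The connection coefficients in a frame. -/
def connCoeff (A₁ A₂ A₃ : P ⊕ Q) : C^∞⟮𝓡 n, M; ℝ⟯ := C.pair (D.toFun (e A₁) (e A₂)) (e A₃)

theorem pair_comm_eq (H : IsAdaptedFrame G U e) (hx : x ∈ U) (D : Connection C)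
    (X Y Z W : P ⊕ Q) : C.pair (D.comm (e X) (e Y) (e Z)) (e W) x =
      frameCurvature (fun A₁ A₂ A₃ => connCoeff e D A₁ A₂ A₃ x)
        (fun B A₁ A₂ A₃ => C.act (e B) (connCoeff e D A₁ A₂ A₃) x) X Y Z W := by
  have h (X Y : P ⊕ Q) : C.pair (D.toFun (e X) (D.toFun (e Y) (e Z)) -
      D.toFun (D.toFun (e X) (e Y)) (e Z)) (e W) x = C.act (e X) (connCoeff e D Y Z W) x -
      ∑ B, sgn P Q ℝ B * (connCoeff e D Y Z B x * connCoeff e D X W B x) -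
      ∑ B, sgn P Q ℝ B * (connCoeff e D X Y B x * connCoeff e D B Z W x) := by
    have h1 := D.metric' (e X) (D.toFun (e Y) (e Z)) (e W) x
    rw [C.pair_sub_left, H.pair_toFun_expand hx D (D.toFun (e X) (e Y))]
    rw [H.pair_expand hx (D.toFun (e Y) (e Z)) (D.toFun (e X) (e W))] at h1
    simp only [connCoeff]
    linarith
  rw [Connection.comm, C.pair_sub_left, h, h, frameCurvature]

theorem two_mul_riemann (H : IsAdaptedFrame G U e) (hx : x ∈ U) (D : Connection C)
    (X Y Z W : P ⊕ Q) : D.riemann (e W) (e Z) (e X) (e Y) x =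
      (frameCurvature (fun A₁ A₂ A₃ => connCoeff e D A₁ A₂ A₃ x)
        (fun B A₁ A₂ A₃ => C.act (e B) (connCoeff e D A₁ A₂ A₃) x) X Y Z W +
      frameCurvature (fun A₁ A₂ A₃ => connCoeff e D A₁ A₂ A₃ x)
        (fun B A₁ A₂ A₃ => C.act (e B) (connCoeff e D A₁ A₂ A₃) x) Z W X Y -
      ∑ A, sgn P Q ℝ A * (connCoeff e D A X Y x * connCoeff e D A Z W x)) / 2 := by
  rw [H.riemann_eq hx, H.pair_comm_eq hx, H.pair_comm_eq hx]
  rfl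

theorem connCoeff_antisymm (H : IsAdaptedFrame G U e) (hx : x ∈ U) (A₁ A₂ A₃ : P ⊕ Q) :
    connCoeff e D A₁ A₃ A₂ x = -connCoeff e D A₁ A₂ A₃ x := by
  have h := D.metric' (e A₁) (e A₂) (e A₃) x
  rw [H.act_pair_eq_zero hx, C.pair_symm (e A₂)] at h
  simp only [connCoeff]
  linarith

/-- Compatibility moves `G` out of the derivative; it acts as 1 on e_a and as -1 on e_i, so the
coefficient equals its own negative. -/
theorem connCoeff_mixed (H : IsAdaptedFrame G U e) (hx : x ∈ U) (hD : D.IsCompatible G)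
    (A : P ⊕ Q) (a : P) (i : Q) : connCoeff e D A (Sum.inl a) (Sum.inr i) x = 0 := by
  have h1 : C.pair (D.toFun (e A) (G.app (e (Sum.inl a)))) (e (Sum.inr i)) x =
      C.pair (D.toFun (e A) (e (Sum.inl a))) (e (Sum.inr i)) x := by
    apply D.pair_toFun_congr
    filter_upwards [H.isOpen.mem_nhds hx] with y hy
    exact (H.eigen y hy (Sum.inl a)).trans (one_smul ℝ _)
  rw [hD] at h1
  have h2 : C.pair (G.app (D.toFun (e A) (e (Sum.inl a)))) (e (Sum.inr i)) x =
      -C.pair (D.toFun (e A) (e (Sum.inl a))) (e (Sum.inr i)) x := by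
    rw [CourantAlgebroid.pair_apply]
    change C.pairing x (G.toFun x _) _ = _
    rw [G.symm, H.eigen x hx]
    simp [CourantAlgebroid.pair_apply]
  rw [connCoeff]
  linarith

theorem connCoeff_torsion (H : IsAdaptedFrame G U e) (hx : x ∈ U) (hD : D.IsTorsionFree)
    (A₁ A₂ A₃ : P ⊕ Q) : structureFun C e A₁ A₂ A₃ x =
      connCoeff e D A₁ A₂ A₃ x + connCoeff e D A₂ A₃ A₁ x + connCoeff e D A₃ A₁ A₂ x := by
  have h := hD (e A₁) (e A₂) (e A₃) x
  rw [H.connCoeff_antisymm hx A₂ A₁ A₃]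
  simp only [map_sub, LinearMap.sub_apply] at h
  simp only [connCoeff, structureFun, CourantAlgebroid.pair_apply]
  linarith

theorem div_eq_sum_connCoeff (H : IsAdaptedFrame G U e) (hx : x ∈ U) (B : P ⊕ Q) :
    D.div (e B) x = ∑ A, sgn P Q ℝ A * connCoeff e D A B A x := by
  have h := H.contract_tensorial hx (T := fun a b => C.pair a (D.toFun b (e B)) x)
    (fun _ _ _ => C.pair_add_left _ _ _ _) (fun _ _ _ => C.pair_smul_left _ _ _ _)
    (fun _ _ _ => by rw [map_add, LinearMap.add_apply, C.pair_add_right])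
    (fun _ _ _ => by rw [D.smul_left, C.pair_smul_right])
  simp only [C.pair_symm (e _)] at h
  simp only [connCoeff]
  rw [← h, Connection.div]
  simp only [CourantAlgebroid.pair_apply, sectionThrough_apply]

variable (C σ e) in
/-- The divergence of the members of a frame. -/
def frameDiv (A : P ⊕ Q) : M → ℝ := σ.div fun y => C.anchor y (e A y)

/-- The algebraic identities hold throughout the open set `U`, so they may be differentiated; this
yields the clauses on derivatives. -/
theorem frameConnection (H : IsAdaptedFrame G U e) (hx : x ∈ U) (hD : D ∈ LeviCivita G σ) :
    FrameConnection (fun A₁ A₂ A₃ => connCoeff e D A₁ A₂ A₃ x)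
      (fun B A₁ A₂ A₃ => C.act (e B) (connCoeff e D A₁ A₂ A₃) x)
      (fun A₁ A₂ A₃ => structureFun C e A₁ A₂ A₃ x)
      (fun B A₁ A₂ A₃ => C.act (e B) (structureFun C e A₁ A₂ A₃) x)
      (fun A => frameDiv C σ e A x)
      (fun B A => mvfderiv (𝓡 n) (frameDiv C σ e A) x (C.anchor x (e B x))) where
  antisymm _ _ _ := H.connCoeff_antisymm hx _ _ _
  deriv_antisymm X A₁ A₂ A₃ := by
    rw [← neg_one_mul, ← C.act_smul_const]
    apply C.act_congr
    filter_upwards [H.isOpen.mem_nhds hx] with y hy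
    rw [H.connCoeff_antisymm hy]
    exact (neg_one_mul _).symm
  mixed _ _ _ := H.connCoeff_mixed hx hD.2.1 _ _ _
  deriv_mixed X A a i := by
    apply C.act_eq_zero_of_const _ 0
    filter_upwards [H.isOpen.mem_nhds hx] with y hy using H.connCoeff_mixed hy hD.2.1 _ _ _
  torsion _ _ _ := H.connCoeff_torsion hx hD.1 _ _ _
  deriv_torsion X A₁ A₂ A₃ := by
    rw [← C.act_add, ← C.act_add]
    apply C.act_congr
    filter_upwards [H.isOpen.mem_nhds hx] with y hy using H.connCoeff_torsion hy hD.1 _ _ _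
  div B := by
    rw [frameDiv, ← hD.2.2, H.div_eq_sum_connCoeff hx]
  deriv_div X B := by
    have h : ∀ᶠ y in nhds x, frameDiv C σ e B y =
        (∑ A, sgn P Q ℝ A • connCoeff e D A B A : C^∞⟮𝓡 n, M; ℝ⟯) y := by
      filter_upwards [H.isOpen.mem_nhds hx] with y hy
      rw [frameDiv, ← hD.2.2, H.div_eq_sum_connCoeff hy]
      have h' := map_sum (ContMDiffMap.evalRingHom (I := 𝓡 n) (n := ∞) (R := ℝ) y) (fun A => sgn P Q ℝ A • connCoeff e D A B A) Finset.univ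
      exact h'.symm
    rw [mvfderiv_congr h]
    change C.act (e X) _ x = _
    rw [C.act_sum]
    simp only [C.act_smul_const]

theorem six_scalar_eq (H : IsAdaptedFrame G U e) (hx : x ∈ U) (hD : D ∈ LeviCivita G σ) :
    6 * D.scalar G x =
    (-12 * ∑ a, mvfderiv (𝓡 n) (frameDiv C σ e (Sum.inl a)) x (C.anchor x (e (Sum.inl a) x)) -
      6 * ∑ a, frameDiv C σ e (Sum.inl a) x * frameDiv C σ e (Sum.inl a) x +
      ∑ a₁, ∑ a₂, ∑ a₃, structureFun C e (Sum.inl a₁) (Sum.inl a₂) (Sum.inl a₃) x *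
        structureFun C e (Sum.inl a₁) (Sum.inl a₂) (Sum.inl a₃) x -
      3 * ∑ i, ∑ a₁, ∑ a₂, structureFun C e (Sum.inr i) (Sum.inl a₁) (Sum.inl a₂) x *
        structureFun C e (Sum.inr i) (Sum.inl a₁) (Sum.inl a₂) x) +
    (-12 * ∑ i, mvfderiv (𝓡 n) (frameDiv C σ e (Sum.inr i)) x (C.anchor x (e (Sum.inr i) x)) -
      6 * ∑ i, frameDiv C σ e (Sum.inr i) x * frameDiv C σ e (Sum.inr i) x +
      ∑ i₁, ∑ i₂, ∑ i₃, structureFun C e (Sum.inr i₁) (Sum.inr i₂) (Sum.inr i₃) x *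
        structureFun C e (Sum.inr i₁) (Sum.inr i₂) (Sum.inr i₃) x -
      3 * ∑ a, ∑ i₁, ∑ i₂, structureFun C e (Sum.inl a) (Sum.inr i₁) (Sum.inr i₂) x *
        structureFun C e (Sum.inl a) (Sum.inr i₁) (Sum.inr i₂) x) := by
  rw [H.scalar_eq hx hD.1]
  simp only [H.two_mul_riemann hx]
  exact (H.frameConnection hx hD).six_scalar

/-- Conjugation by `G` reverses the mixed components, so Rc is twice the full Ricci tensor there.
The two summands are the mixed components as seen from V₊ and from V₋. -/
theorem ricci_mixed_eq (H : IsAdaptedFrame G U e) (hx : x ∈ U) (hD : D ∈ LeviCivita G σ) (a : P)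
    (i : Q) : D.ricci G x (e (Sum.inl a) x) (e (Sum.inr i) x) =
    (∑ b, (C.act (e (Sum.inl b)) (structureFun C e (Sum.inr i) (Sum.inl a) (Sum.inl b)) x +
        frameDiv C σ e (Sum.inl b) x * structureFun C e (Sum.inr i) (Sum.inl a) (Sum.inl b) x) +
      ∑ b, ∑ j, structureFun C e (Sum.inl b) (Sum.inr i) (Sum.inr j) x *
        structureFun C e (Sum.inr j) (Sum.inl a) (Sum.inl b) x -
      mvfderiv (𝓡 n) (frameDiv C σ e (Sum.inl a)) x (C.anchor x (e (Sum.inr i) x))) +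
    (-∑ j, (C.act (e (Sum.inr j)) (structureFun C e (Sum.inl a) (Sum.inr i) (Sum.inr j)) x +
        frameDiv C σ e (Sum.inr j) x * structureFun C e (Sum.inl a) (Sum.inr i) (Sum.inr j) x) +
      ∑ j, ∑ b, structureFun C e (Sum.inr j) (Sum.inl a) (Sum.inl b) x *
        structureFun C e (Sum.inl b) (Sum.inr i) (Sum.inr j) x -
      mvfderiv (𝓡 n) (frameDiv C σ e (Sum.inr i)) x (C.anchor x (e (Sum.inl a) x))) := by
  rw [← (H.frameConnection hx hD).two_ricci]
  have h2 : D.fullRicci x (G.toFun x (e (Sum.inl a) x)) (G.toFun x (e (Sum.inr i) x)) =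
      -D.fullRicci x (e (Sum.inl a) x) (e (Sum.inr i) x) := by
    rw [H.eigen x hx, H.eigen x hx]
    have := H.fullRicci_eq hx hD.1 (e (Sum.inl a))
      (smulSec (ContMDiffMap.const (-1)) (e (Sum.inr i)))
    simp only [H.riemann_smul₄ hx, mul_left_comm (sgn P Q ℝ _), ← Finset.mul_sum,
      ← H.fullRicci_eq hx hD.1] at this
    rw [sgn_inl, one_smul, sgn_inr]
    exact this.trans (neg_one_mul _)
  rw [Connection.ricci, h2, H.fullRicci_eq hx hD.1]
  simp only [H.two_mul_riemann hx]
  rw [sub_neg_eq_add, ← two_mul, Finset.mul_sum]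
  exact Finset.sum_congr rfl fun A _ => by ring

/-- Conjugation by `G` multiplies the component by the product of two equal signs, hence the
difference defining Rc vanishes. This is why the flow moves the eigenbundles only in mixed
directions. -/
theorem ricci_eq_zero (H : IsAdaptedFrame G U e) (hx : x ∈ U) (A B : P ⊕ Q)
    (h : sgn P Q ℝ A = sgn P Q ℝ B) (hD : D ∈ LeviCivita G σ) :
    D.ricci G x (e A x) (e B x) = 0 := by
  have h2 : D.fullRicci x (G.toFun x (e A x)) (G.toFun x (e B x)) =
      D.fullRicci x (e A x) (e B x) := by
    have := H.fullRicci_eq hx hD.1 (smulSec (ContMDiffMap.const (sgn P Q ℝ A)) (e A))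
      (smulSec (ContMDiffMap.const (sgn P Q ℝ B)) (e B))
    simp only [H.riemann_smul₄ hx, H.riemann_smul₂ hx hD.1, mul_left_comm (sgn P Q ℝ _),
      ← Finset.mul_sum, ← H.fullRicci_eq hx hD.1] at this
    rw [H.eigen x hx, H.eigen x hx]
    refine this.trans ?_
    change sgn P Q ℝ B * (sgn P Q ℝ A * _) = _
    rw [h, ← mul_assoc, sgn_mul_sgn, one_mul]
  rw [Connection.ricci, h2, sub_self]

end IsAdaptedFrame

end FrameCurvature

/-! ### Coordinate expressions -/

section Coordinates

/-- The coordinate expression of a vector field in the preferred chart at `c`. -/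
def chartVec (c : M) (X : ∀ x : M, TangentSpace (𝓡 n) x) (y : EuclideanSpace ℝ (Fin n)) :
    EuclideanSpace ℝ (Fin n) :=
  (trivializationAt (EuclideanSpace ℝ (Fin n)) (TangentSpace (𝓡 n)) c
    ⟨(extChartAt (𝓡 n) c).symm y, X ((extChartAt (𝓡 n) c).symm y)⟩).2

/-- The coordinate expression of a half-density in the preferred chart at `c`. -/
def PosHalfDensity.chartDens (σ : PosHalfDensity n M) (c : M) (y : EuclideanSpace ℝ (Fin n)) : ℝ :=
  σ.toFun ((extChartAt (𝓡 n) c).symm y) (coordFrame c ((extChartAt (𝓡 n) c).symm y))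

variable {c x : M}

theorem isOpen_chart_target (c : M) : IsOpen (extChartAt (𝓡 n) c).target :=
  isOpen_extChartAt_target c

theorem trivializationAt_snd (hx : x ∈ (chartAt (EuclideanSpace ℝ (Fin n)) c).source)
    (v : TangentSpace (𝓡 n) x) :
    (trivializationAt (EuclideanSpace ℝ (Fin n)) (TangentSpace (𝓡 n)) c ⟨x, v⟩).2 =
      mfderiv (𝓡 n) 𝓘(ℝ, EuclideanSpace ℝ (Fin n)) (extChartAt (𝓡 n) c) x v := by
  have h := TangentBundle.continuousLinearMapAt_trivializationAt (I := 𝓡 n) hx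
  have h' := DFunLike.congr_fun h v
  exact (Trivialization.continuousLinearMapAt_apply_of_mem ℝ
    (trivializationAt (EuclideanSpace ℝ (Fin n)) (TangentSpace (𝓡 n)) c) hx v).symm.trans h'

theorem extChartAt_mem_nhds (hx : x ∈ (chartAt (EuclideanSpace ℝ (Fin n)) c).source) :
    (chartAt (EuclideanSpace ℝ (Fin n)) c).source ∈ nhds x :=
  (chartAt (EuclideanSpace ℝ (Fin n)) c).open_source.mem_nhds hx

theorem contDiffAt_of_contMDiffAt {V : Type*} [NormedAddCommGroup V] [NormedSpace ℝ V] {f : M → V}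
    (hx : x ∈ (chartAt (EuclideanSpace ℝ (Fin n)) c).source)
    (hf : ContMDiffAt (𝓡 n) 𝓘(ℝ, V) ∞ f x) :
    ContDiffAt ℝ ∞ (f ∘ (extChartAt (𝓡 n) c).symm) (extChartAt (𝓡 n) c x) := by
  have hx' : x ∈ (extChartAt (𝓡 n) c).source := by rwa [extChartAt_source]
  have h1 : ContMDiffAt 𝓘(ℝ, EuclideanSpace ℝ (Fin n)) (𝓡 n) ∞ (extChartAt (𝓡 n) c).symm
      (extChartAt (𝓡 n) c x) :=
    (contMDiffOn_extChartAt_symm c).contMDiffAt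
      ((isOpen_chart_target c).mem_nhds ((extChartAt (𝓡 n) c).map_source hx'))
  have h2 : ContMDiffAt (𝓡 n) 𝓘(ℝ, V) ∞ f ((extChartAt (𝓡 n) c).symm (extChartAt (𝓡 n) c x)) := by
    rwa [(extChartAt (𝓡 n) c).left_inv hx']
  exact (h2.comp _ h1).contDiffAt

theorem mvfderiv_eq_fderiv {f : M → ℝ} (hx : x ∈ (chartAt (EuclideanSpace ℝ (Fin n)) c).source)
    (hf : ContMDiffAt (𝓡 n) 𝓘(ℝ, ℝ) ∞ f x) (v : TangentSpace (𝓡 n) x) :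
    mvfderiv (𝓡 n) f x v = fderiv ℝ (f ∘ (extChartAt (𝓡 n) c).symm) (extChartAt (𝓡 n) c x)
      (trivializationAt (EuclideanSpace ℝ (Fin n)) (TangentSpace (𝓡 n)) c ⟨x, v⟩).2 := by
  have h0 : f =ᶠ[nhds x] (f ∘ (extChartAt (𝓡 n) c).symm) ∘ extChartAt (𝓡 n) c := by
    filter_upwards [extChartAt_mem_nhds hx] with y hy
    simp only [Function.comp_apply]
    rw [(extChartAt (𝓡 n) c).left_inv (by rwa [extChartAt_source])]
  have hd := (contDiffAt_of_contMDiffAt hx hf).differentiableAt (by simp)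
  rw [mvfderiv_congr h0, mvfderiv_comp_apply x hd.mdifferentiableAt
    (mdifferentiableAt_extChartAt hx), trivializationAt_snd hx]
  rw [mvfderiv, ContinuousLinearMap.comp_apply, mfderiv_eq_fderiv]
  rfl

theorem transition_apply {c' : M} (hx : x ∈ (chartAt (EuclideanSpace ℝ (Fin n)) c).source)
    (hx' : x ∈ (chartAt (EuclideanSpace ℝ (Fin n)) c').source) (v : TangentSpace (𝓡 n) x) :
    (trivializationAt (EuclideanSpace ℝ (Fin n)) (TangentSpace (𝓡 n)) c ⟨x, v⟩).2 =
      fderiv ℝ (extChartAt (𝓡 n) c ∘ (extChartAt (𝓡 n) c').symm) (extChartAt (𝓡 n) c' x)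
      (trivializationAt (EuclideanSpace ℝ (Fin n)) (TangentSpace (𝓡 n)) c' ⟨x, v⟩).2 := by
  have h0 : extChartAt (𝓡 n) c =ᶠ[nhds x]
      (extChartAt (𝓡 n) c ∘ (extChartAt (𝓡 n) c').symm) ∘ extChartAt (𝓡 n) c' := by
    filter_upwards [extChartAt_mem_nhds hx'] with y hy
    simp only [Function.comp_apply]
    rw [(extChartAt (𝓡 n) c').left_inv (by rwa [extChartAt_source])]
  have hd := (contDiffAt_of_contMDiffAt hx' (contMDiffAt_extChartAt' (I := 𝓡 n)
    (n := ∞) hx)).differentiableAt (by simp)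
  have h1 : HasMFDerivAt (𝓡 n) 𝓘(ℝ, EuclideanSpace ℝ (Fin n)) (extChartAt (𝓡 n) c) x _ :=
    (hd.hasFDerivAt.hasMFDerivAt.comp x
      (mdifferentiableAt_extChartAt hx').hasMFDerivAt).congr_of_eventuallyEq h0
  rw [trivializationAt_snd hx, trivializationAt_snd hx']
  exact DFunLike.congr_fun h1.mfderiv v

/-- The endomorphism of the tangent space taking one coordinate frame to the other is conjugate,
through a trivialization, to the derivative of the transition map, and so has the same determinant.
-/
theorem toFun_coordFrame (σ : PosHalfDensity n M) {c' : M}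
    (hx : x ∈ (chartAt (EuclideanSpace ℝ (Fin n)) c).source)
    (hx' : x ∈ (chartAt (EuclideanSpace ℝ (Fin n)) c').source) :
    σ.toFun x (coordFrame c' x) = √|LinearMap.det (fderiv ℝ (extChartAt (𝓡 n) c ∘
      (extChartAt (𝓡 n) c').symm) (extChartAt (𝓡 n) c' x) :
        EuclideanSpace ℝ (Fin n) →ₗ[ℝ] EuclideanSpace ℝ (Fin n))| *
      σ.toFun x (coordFrame c x) := by
  set T := trivializationAt (EuclideanSpace ℝ (Fin n)) (TangentSpace (𝓡 n) (M := M)) c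
  set T' := trivializationAt (EuclideanSpace ℝ (Fin n)) (TangentSpace (𝓡 n) (M := M)) c'
  set L := T.continuousLinearEquivAt ℝ x hx
  set L' := T'.continuousLinearEquivAt ℝ x hx'
  have hL (v) : L v = (T ⟨x, v⟩).2 := rfl
  have hL' (v) : L' v = (T' ⟨x, v⟩).2 := rfl
  have hLs (w) : L.symm w = T.symm x w := rfl
  have hLs' (w) : L'.symm w = T'.symm x w := rfl
  have h := σ.map_comp x ((L'.symm : EuclideanSpace ℝ (Fin n) →L[ℝ] TangentSpace (𝓡 n) x) ∘ₗ
    ((L : TangentSpace (𝓡 n) x →L[ℝ] EuclideanSpace ℝ (Fin n)) :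
      TangentSpace (𝓡 n) x →ₗ[ℝ] EuclideanSpace ℝ (Fin n))) (coordFrame c x)
  have e1 : (fun i => ((L'.symm : EuclideanSpace ℝ (Fin n) →L[ℝ] TangentSpace (𝓡 n) x) ∘ₗ
    ((L : TangentSpace (𝓡 n) x →L[ℝ] EuclideanSpace ℝ (Fin n)) :
      TangentSpace (𝓡 n) x →ₗ[ℝ] EuclideanSpace ℝ (Fin n))) (coordFrame c x i)) =
      coordFrame c' x := by
    funext i
    change L'.symm (L (L.symm _)) = L'.symm _
    rw [L.apply_symm_apply]
  have e2 : LinearMap.det ((L'.symm : EuclideanSpace ℝ (Fin n) →L[ℝ] TangentSpace (𝓡 n) x) ∘ₗ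
    ((L : TangentSpace (𝓡 n) x →L[ℝ] EuclideanSpace ℝ (Fin n)) :
      TangentSpace (𝓡 n) x →ₗ[ℝ] EuclideanSpace ℝ (Fin n))) =
      LinearMap.det (fderiv ℝ (extChartAt (𝓡 n) c ∘
      (extChartAt (𝓡 n) c').symm) (extChartAt (𝓡 n) c' x) :
        EuclideanSpace ℝ (Fin n) →ₗ[ℝ] EuclideanSpace ℝ (Fin n)) := by
    rw [← LinearMap.det_conj _ L.toLinearEquiv]
    congr 1
    ext1 w
    change L (L'.symm (L (L.symm w))) = _
    rw [L.apply_symm_apply, hL, transition_apply hx hx', ← hL', L'.apply_symm_apply]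
    rfl
  rw [e1, e2] at h
  exact h

theorem contDiffOn_chartVec (c : M) {X : ∀ x : M, TangentSpace (𝓡 n) x}
    (hX : ContMDiff (𝓡 n) (𝓡 n).tangent ∞ fun x => (⟨x, X x⟩ : TangentBundle (𝓡 n) M)) :
    ContDiffOn ℝ ∞ (chartVec c X) (extChartAt (𝓡 n) c).target := by
  intro y hy
  have hy' : (extChartAt (𝓡 n) c).symm y ∈ (chartAt (EuclideanSpace ℝ (Fin n)) c).source := by
    simpa only [extChartAt_source] using (extChartAt (𝓡 n) c).map_target hy
  have h1 : ContMDiffAt (𝓡 n) 𝓘(ℝ, EuclideanSpace ℝ (Fin n)) ∞ (fun x =>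
      (trivializationAt (EuclideanSpace ℝ (Fin n)) (TangentSpace (𝓡 n)) c ⟨x, X x⟩).2)
      ((extChartAt (𝓡 n) c).symm y) :=
    ((Trivialization.contMDiffAt_section_iff
      (e := trivializationAt (EuclideanSpace ℝ (Fin n)) (TangentSpace (𝓡 n)) c) hy').1
      (hX _))
  have h2 := contDiffAt_of_contMDiffAt hy' h1
  rw [(extChartAt (𝓡 n) c).right_inv hy] at h2
  exact h2.contDiffWithinAt

theorem contDiffOn_chartDens (σ : PosHalfDensity n M) (c : M) :
    ContDiffOn ℝ ∞ (σ.chartDens c) (extChartAt (𝓡 n) c).target := by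
  intro y hy
  have hy' : (extChartAt (𝓡 n) c).symm y ∈ (chartAt (EuclideanSpace ℝ (Fin n)) c).source := by
    simpa only [extChartAt_source] using (extChartAt (𝓡 n) c).map_target hy
  have h1 := (σ.smooth c).contMDiffAt (extChartAt_mem_nhds hy')
  have h2 := contDiffAt_of_contMDiffAt hy' h1
  rw [(extChartAt (𝓡 n) c).right_inv hy] at h2
  exact h2.contDiffWithinAt

theorem toFun_coordFrame_pos (σ : PosHalfDensity n M)
    (hx : x ∈ (chartAt (EuclideanSpace ℝ (Fin n)) c).source) :
    0 < σ.toFun x (coordFrame c x) := by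
  apply σ.pos
  set T := trivializationAt (EuclideanSpace ℝ (Fin n)) (TangentSpace (𝓡 n) (M := M)) c
  set L := T.continuousLinearEquivAt ℝ x hx
  have h : LinearIndependent ℝ fun i : Fin n => (EuclideanSpace.single i 1 : EuclideanSpace ℝ (Fin n)) := by
    have h1 := (EuclideanSpace.basisFun (Fin n) ℝ).toBasis.linearIndependent
    have h2 : ⇑(EuclideanSpace.basisFun (Fin n) ℝ).toBasis =
        fun i : Fin n => (EuclideanSpace.single i 1 : EuclideanSpace ℝ (Fin n)) := by
      ext i; simp
    rw [h2] at h1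
    exact h1
  exact h.map' (L.symm.toLinearEquiv : EuclideanSpace ℝ (Fin n) →ₗ[ℝ] TangentSpace (𝓡 n) x)
    L.symm.toLinearEquiv.ker

/-- The divergence computed in an arbitrary preferred chart. -/
theorem PosHalfDensity.div_eq (σ : PosHalfDensity n M) {X : ∀ x : M, TangentSpace (𝓡 n) x}
    (hX : ContMDiff (𝓡 n) (𝓡 n).tangent ∞ fun x => (⟨x, X x⟩ : TangentBundle (𝓡 n) M))
    (hx : x ∈ (chartAt (EuclideanSpace ℝ (Fin n)) c).source) :
    σ.div X x = LinearMap.trace ℝ (EuclideanSpace ℝ (Fin n))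
        (fderiv ℝ (chartVec c X) (extChartAt (𝓡 n) c x) : _ →ₗ[ℝ] _) +
      fderiv ℝ (fun z => Real.log (σ.chartDens c z ^ 2)) (extChartAt (𝓡 n) c x)
        (chartVec c X (extChartAt (𝓡 n) c x)) := by
  set φ := extChartAt (𝓡 n) c
  set ψ := extChartAt (𝓡 n) x
  have hxx : x ∈ (chartAt (EuclideanSpace ℝ (Fin n)) x).source := mem_chart_source _ x
  have hxφ : x ∈ φ.source := by rwa [extChartAt_source]
  have hxψ : x ∈ ψ.source := by rwa [extChartAt_source]
  have hτ0 : (φ ∘ ψ.symm) (ψ x) = φ x := by simp only [Function.comp_apply, ψ.left_inv hxψ]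
  have hev : ∀ᶠ y in nhds (ψ x), y ∈ ψ.target ∧ ψ.symm y ∈ φ.source := by
    have h1 : ContinuousAt ψ.symm (ψ x) := continuousAt_extChartAt_symm x
    refine Filter.Eventually.and ((isOpen_chart_target x).mem_nhds (ψ.map_source hxψ))
      (h1.eventually_mem ?_)
    rw [ψ.left_inv hxψ]
    exact extChartAt_source_mem_nhds' hxφ
  -- `PosHalfDensity.div` uses at each point the preferred chart of that very point. Comparison with
  -- the fixed chart at `c` is what makes the divergence accessible as a function of the point.
  have h := trace_fderiv_transition (τ := φ ∘ ψ.symm) (X := chartVec x X) (Y := chartVec c X)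
    (s := σ.chartDens x) (u := σ.chartDens c) (y₀ := ψ x)
    (B := fderiv ℝ (ψ ∘ φ.symm) (φ x))
    ((contDiffAt_of_contMDiffAt hxx (contMDiffAt_extChartAt' (I := 𝓡 n) (n := ∞) hx)).of_le
      (by norm_cast)) ?_ ?_ ?_ ?_ ?_ ?_ ?_ ?_
  · rw [hτ0] at h
    exact h
  · ext1 w
    obtain ⟨v, rfl⟩ := (Trivialization.continuousLinearEquivAt ℝ (trivializationAt (EuclideanSpace ℝ (Fin n))
      (TangentSpace (𝓡 n) (M := M)) c) x hx).surjective w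
    change fderiv ℝ (φ ∘ ψ.symm) (ψ x) (fderiv ℝ (ψ ∘ φ.symm) (φ x) (trivializationAt (EuclideanSpace ℝ (Fin n))
      (TangentSpace (𝓡 n) (M := M)) c ⟨x, v⟩).2) = (trivializationAt (EuclideanSpace ℝ (Fin n))
      (TangentSpace (𝓡 n) (M := M)) c ⟨x, v⟩).2
    rw [← transition_apply hxx hx, ← transition_apply hx hxx]
  · ext1 w
    obtain ⟨v, rfl⟩ := (Trivialization.continuousLinearEquivAt ℝ (trivializationAt (EuclideanSpace ℝ (Fin n))
      (TangentSpace (𝓡 n) (M := M)) x) x hxx).surjective w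
    change fderiv ℝ (ψ ∘ φ.symm) (φ x) (fderiv ℝ (φ ∘ ψ.symm) (ψ x) (trivializationAt (EuclideanSpace ℝ (Fin n))
      (TangentSpace (𝓡 n) (M := M)) x ⟨x, v⟩).2) = (trivializationAt (EuclideanSpace ℝ (Fin n))
      (TangentSpace (𝓡 n) (M := M)) x ⟨x, v⟩).2
    rw [← transition_apply hx hxx, ← transition_apply hxx hx]
  · exact ((contDiffOn_chartVec x hX).contDiffAt ((isOpen_chart_target x).mem_nhds
      (ψ.map_source hxψ))).differentiableAt (by simp)
  · rw [hτ0]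
    exact ((contDiffOn_chartVec c hX).contDiffAt ((isOpen_chart_target c).mem_nhds
      (φ.map_source hxφ))).differentiableAt (by simp)
  · filter_upwards [hev] with y hy
    have h1 : φ.symm ((φ ∘ ψ.symm) y) = ψ.symm y := φ.left_inv hy.2
    have h2 := transition_apply (c := c) (c' := x) (x := ψ.symm y)
      (by simpa only [φ, extChartAt_source] using hy.2)
      (by simpa only [ψ, extChartAt_source] using ψ.map_target hy.1) (X (ψ.symm y))
    have h3 : extChartAt (𝓡 n) x (ψ.symm y) = y := ψ.right_inv hy.1
    rw [h3] at h2
    have h4 : chartVec c X ((φ ∘ ψ.symm) y) = (trivializationAt (EuclideanSpace ℝ (Fin n))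
      (TangentSpace (𝓡 n) (M := M)) c ⟨ψ.symm y, X (ψ.symm y)⟩).2 := by
      simp only [chartVec]
      rw [h1]
    rw [h4, h2]
    rfl
  · rw [hτ0]
    exact ((contDiffOn_chartDens σ c).contDiffAt ((isOpen_chart_target c).mem_nhds
      (φ.map_source hxφ))).differentiableAt (by simp)
  · rw [hτ0, PosHalfDensity.chartDens, φ.left_inv hxφ]
    exact toFun_coordFrame_pos σ hx
  · filter_upwards [hev] with y hy
    have h1 : φ.symm ((φ ∘ ψ.symm) y) = ψ.symm y := φ.left_inv hy.2
    have h2 := toFun_coordFrame σ (c := c) (c' := x) (x := ψ.symm y)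
      (by simpa only [φ, extChartAt_source] using hy.2)
      (by simpa only [ψ, extChartAt_source] using ψ.map_target hy.1)
    have h3 : extChartAt (𝓡 n) x (ψ.symm y) = y := ψ.right_inv hy.1
    rw [h3] at h2
    simp only [PosHalfDensity.chartDens]
    rw [h1]
    exact h2

end Coordinates

/-! ### Calculus of the divergence -/

section DivergenceCalculus

variable {c x : M} {X Y : ∀ x : M, TangentSpace (𝓡 n) x}

theorem chartVec_eventuallyEq {y : EuclideanSpace ℝ (Fin n)} (hy : y ∈ (extChartAt (𝓡 n) c).target)
    {p : EuclideanSpace ℝ (Fin n) → Prop} (h : ∀ y ∈ (extChartAt (𝓡 n) c).target, p y) :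
    ∀ᶠ z in nhds y, p z := by
  filter_upwards [(isOpen_chart_target c).mem_nhds hy] with z hz using h z hz

theorem symm_mem_chart_source {y : EuclideanSpace ℝ (Fin n)}
    (hy : y ∈ (extChartAt (𝓡 n) c).target) :
    (extChartAt (𝓡 n) c).symm y ∈ (chartAt (EuclideanSpace ℝ (Fin n)) c).source := by
  simpa only [extChartAt_source] using (extChartAt (𝓡 n) c).map_target hy

theorem chartVec_add {y : EuclideanSpace ℝ (Fin n)} (hy : y ∈ (extChartAt (𝓡 n) c).target) :
    chartVec c (fun x => X x + Y x) y = chartVec c X y + chartVec c Y y :=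
  map_add (Trivialization.continuousLinearEquivAt ℝ (trivializationAt (EuclideanSpace ℝ (Fin n))
    (TangentSpace (𝓡 n) (M := M)) c) _ (symm_mem_chart_source hy)) _ _

theorem chartVec_smul {y : EuclideanSpace ℝ (Fin n)} (hy : y ∈ (extChartAt (𝓡 n) c).target)
    (f : M → ℝ) : chartVec c (fun x => f x • X x) y =
      f ((extChartAt (𝓡 n) c).symm y) • chartVec c X y :=
  map_smul (Trivialization.continuousLinearEquivAt ℝ (trivializationAt (EuclideanSpace ℝ (Fin n))
    (TangentSpace (𝓡 n) (M := M)) c) _ (symm_mem_chart_source hy)) _ _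

theorem extChartAt_mem_target (hx : x ∈ (chartAt (EuclideanSpace ℝ (Fin n)) c).source) :
    extChartAt (𝓡 n) c x ∈ (extChartAt (𝓡 n) c).target :=
  (extChartAt (𝓡 n) c).map_source (by rwa [extChartAt_source])

theorem differentiableAt_chartVec
    (hX : ContMDiff (𝓡 n) (𝓡 n).tangent ∞ fun x => (⟨x, X x⟩ : TangentBundle (𝓡 n) M))
    {y : EuclideanSpace ℝ (Fin n)} (hy : y ∈ (extChartAt (𝓡 n) c).target) :
    DifferentiableAt ℝ (chartVec c X) y :=
  ((contDiffOn_chartVec c hX).contDiffAt ((isOpen_chart_target c).mem_nhds hy)).differentiableAt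
    (by simp)

theorem PosHalfDensity.div_add (σ : PosHalfDensity n M)
    (hX : ContMDiff (𝓡 n) (𝓡 n).tangent ∞ fun x => (⟨x, X x⟩ : TangentBundle (𝓡 n) M))
    (hY : ContMDiff (𝓡 n) (𝓡 n).tangent ∞ fun x => (⟨x, Y x⟩ : TangentBundle (𝓡 n) M))
    (hXY : ContMDiff (𝓡 n) (𝓡 n).tangent ∞ fun x => (⟨x, X x + Y x⟩ : TangentBundle (𝓡 n) M))
    (x : M) : σ.div (fun x => X x + Y x) x = σ.div X x + σ.div Y x := by
  have hx := mem_chart_source (EuclideanSpace ℝ (Fin n)) x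
  have hy := extChartAt_mem_target hx
  rw [σ.div_eq hXY hx, σ.div_eq hX hx, σ.div_eq hY hx]
  have h : chartVec x (fun x => X x + Y x) =ᶠ[nhds (extChartAt (𝓡 n) x x)]
      chartVec x X + chartVec x Y := chartVec_eventuallyEq hy fun y hy => chartVec_add hy
  rw [h.fderiv_eq, fderiv_add (differentiableAt_chartVec hX hy) (differentiableAt_chartVec hY hy),
    chartVec_add hy]
  simp
  ring

theorem PosHalfDensity.div_smul (σ : PosHalfDensity n M) (f : C^∞⟮𝓡 n, M; ℝ⟯)
    (hX : ContMDiff (𝓡 n) (𝓡 n).tangent ∞ fun x => (⟨x, X x⟩ : TangentBundle (𝓡 n) M))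
    (hfX : ContMDiff (𝓡 n) (𝓡 n).tangent ∞ fun x => (⟨x, f x • X x⟩ : TangentBundle (𝓡 n) M))
    (x : M) : σ.div (fun x => f x • X x) x = f x * σ.div X x + mvfderiv (𝓡 n) f x (X x) := by
  have hx := mem_chart_source (EuclideanSpace ℝ (Fin n)) x
  have hy := extChartAt_mem_target hx
  rw [σ.div_eq hfX hx, σ.div_eq hX hx]
  have h : chartVec x (fun x => f x • X x) =ᶠ[nhds (extChartAt (𝓡 n) x x)]
      (f ∘ (extChartAt (𝓡 n) x).symm) • chartVec x X :=
    chartVec_eventuallyEq hy fun y hy => chartVec_smul hy f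
  have hf := (contDiffAt_of_contMDiffAt hx f.contMDiff.contMDiffAt).differentiableAt (by simp)
  have hinv : (extChartAt (𝓡 n) x).symm (extChartAt (𝓡 n) x x) = x :=
    (extChartAt (𝓡 n) x).left_inv (mem_extChartAt_source x)
  have hXx : chartVec x X (extChartAt (𝓡 n) x x) =
      (trivializationAt (EuclideanSpace ℝ (Fin n)) (TangentSpace (𝓡 n)) x ⟨x, X x⟩).2 := by
    rw [chartVec, hinv]
  have htr (w : EuclideanSpace ℝ (Fin n)) (L : EuclideanSpace ℝ (Fin n) →L[ℝ] ℝ) :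
      LinearMap.trace ℝ (EuclideanSpace ℝ (Fin n))
        (L.smulRight w : EuclideanSpace ℝ (Fin n) →L[ℝ] EuclideanSpace ℝ (Fin n)) = L w :=
    LinearMap.trace_smulRight (L : EuclideanSpace ℝ (Fin n) →ₗ[ℝ] ℝ) w
  rw [h.fderiv_eq, (hf.hasFDerivAt.smul (differentiableAt_chartVec hX hy).hasFDerivAt).fderiv,
    chartVec_smul hy, mvfderiv_eq_fderiv hx f.contMDiff.contMDiffAt, ← hXx]
  simp only [ContinuousLinearMap.toLinearMap_add, ContinuousLinearMap.toLinearMap_smul, map_add,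
    map_smul, htr, Function.comp_apply, hinv, smul_eq_mul]
  ring

theorem PosHalfDensity.contMDiff_div (σ : PosHalfDensity n M)
    (hX : ContMDiff (𝓡 n) (𝓡 n).tangent ∞ fun x => (⟨x, X x⟩ : TangentBundle (𝓡 n) M)) :
    ContMDiff (𝓡 n) 𝓘(ℝ, ℝ) ∞ (σ.div X) := by
  intro x
  have hx := mem_chart_source (EuclideanSpace ℝ (Fin n)) x
  have hy := extChartAt_mem_target hx
  have hV := (contDiffOn_chartVec x hX).contDiffAt ((isOpen_chart_target x).mem_nhds hy)
  have hs := (contDiffOn_chartDens σ x).contDiffAt ((isOpen_chart_target x).mem_nhds hy)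
  have hs0 : σ.chartDens x (extChartAt (𝓡 n) x x) ^ 2 ≠ 0 := by
    rw [PosHalfDensity.chartDens, (extChartAt (𝓡 n) x).left_inv (mem_extChartAt_source x)]
    exact pow_ne_zero 2 (toFun_coordFrame_pos σ hx).ne'
  have htrace : ContDiff ℝ ∞ fun L : EuclideanSpace ℝ (Fin n) →L[ℝ] EuclideanSpace ℝ (Fin n) =>
      LinearMap.trace ℝ (EuclideanSpace ℝ (Fin n)) (L : _ →ₗ[ℝ] _) :=
    (LinearMap.toContinuousLinearMap ((LinearMap.trace ℝ (EuclideanSpace ℝ (Fin n))) ∘ₗ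
      (ContinuousLinearMap.coeLM ℝ : (EuclideanSpace ℝ (Fin n) →L[ℝ] EuclideanSpace ℝ (Fin n)) →ₗ[ℝ] _))).contDiff
  have hg : ContDiffAt ℝ ∞ (fun y => LinearMap.trace ℝ (EuclideanSpace ℝ (Fin n))
        (fderiv ℝ (chartVec x X) y : _ →ₗ[ℝ] _) +
      fderiv ℝ (fun z => Real.log (σ.chartDens x z ^ 2)) y (chartVec x X y))
      (extChartAt (𝓡 n) x x) :=
    (htrace.contDiffAt.comp _ (hV.fderiv_right (by simp))).add
      ((((hs.pow 2).log hs0).fderiv_right (by simp)).clm_apply hV)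
  refine ((hg.contMDiffAt).comp x (contMDiffAt_extChartAt (I := 𝓡 n))).congr_of_eventuallyEq ?_
  filter_upwards [extChartAt_mem_nhds hx] with z hz
  exact σ.div_eq hX hz

end DivergenceCalculus

/-! ### The divergence of sections -/

section SectionDivergence

variable [FiniteDimensional ℝ F]

/-- The divergence `div_σ u` of a section as a smooth function. -/
def CourantAlgebroid.divFun (C : CourantAlgebroid n F E) (σ : PosHalfDensity n M)
    (u : Cₛ^∞⟮𝓡 n; F, E⟯) : C^∞⟮𝓡 n, M; ℝ⟯ :=
  ⟨σ.div fun y => C.anchor y (u y), σ.contMDiff_div (C.anchor_smooth u)⟩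

namespace CourantAlgebroid

variable (C : CourantAlgebroid n F E) (σ : PosHalfDensity n M)

theorem divFun_apply (u : Cₛ^∞⟮𝓡 n; F, E⟯) (x : M) :
    C.divFun σ u x = σ.div (fun y => C.anchor y (u y)) x := rfl

theorem divFun_add (u v : Cₛ^∞⟮𝓡 n; F, E⟯) (x : M) :
    C.divFun σ (u + v) x = C.divFun σ u x + C.divFun σ v x := by
  simp only [divFun_apply]
  rw [← σ.div_add (C.anchor_smooth u) (C.anchor_smooth v)]
  · simp
  · simpa using C.anchor_smooth (u + v)

theorem divFun_smul (f : C^∞⟮𝓡 n, M; ℝ⟯) (u : Cₛ^∞⟮𝓡 n; F, E⟯) (x : M) :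
    C.divFun σ (smulSec f u) x = f x * C.divFun σ u x + C.act u f x := by
  simp only [divFun_apply, act_apply]
  rw [← σ.div_smul f (C.anchor_smooth u)]
  · simp
  · simpa using C.anchor_smooth (smulSec f u)

end CourantAlgebroid

end SectionDivergence

/-! ### Existence of adapted frames -/

section ExistsFrame

variable {P Q : Type*} [Fintype P] [Fintype Q] [DecidableEq P] [DecidableEq Q]

variable [FiniteDimensional ℝ F] {C : CourantAlgebroid n F E}

variable (F E) in
theorem finrank_fiber (x : M) : finrank ℝ (E x) = finrank ℝ F :=
  (VectorBundle.continuousLinearEquivAt ℝ F E x).toLinearEquiv.finrank_eq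

/-- Orthonormality gives linear independence and the count makes the family a basis, whose
coordinates are read off by pairing. An empty index set means a zero fibre. -/
theorem complete_of_ortho {x : M} {w : P ⊕ Q → E x}
    (hw : ∀ A B, C.pairing x (w A) (w B) = if A = B then sgn P Q ℝ A else 0)
    (hcard : Fintype.card (P ⊕ Q) = finrank ℝ F) (v : E x) :
    v = ∑ A, (sgn P Q ℝ A * C.pairing x (w A) v) • w A := by
  have : FiniteDimensional ℝ (E x) := Module.Finite.of_basis (fiberBasis F E x)
  have hsum (g : P ⊕ Q → ℝ) (B : P ⊕ Q) : C.pairing x (w B) (∑ A, g A • w A) = g B * sgn P Q ℝ B := by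
    simp only [map_sum, map_smul, smul_eq_mul, hw, mul_ite, mul_zero, Finset.sum_ite_eq,
      Finset.mem_univ, if_true]
  have hli : LinearIndependent ℝ w := by
    rw [Fintype.linearIndependent_iff]
    intro g hg B
    have h := hsum g B
    rw [hg, map_zero] at h
    have h' := congrArg (· * sgn P Q ℝ B) h
    simpa [mul_assoc, sgn_mul_sgn] using h'.symm
  by_cases hne : Nonempty (P ⊕ Q)
  · let b := basisOfLinearIndependentOfCardEqFinrank hli (hcard.trans (finrank_fiber F E x).symm)
    have hb : ⇑b = w := coe_basisOfLinearIndependentOfCardEqFinrank _ _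
    have hv := b.sum_repr v
    rw [hb] at hv
    have h2 (B) : sgn P Q ℝ B * C.pairing x (w B) v = b.repr v B := by
      conv_lhs => rw [← hv]
      rw [hsum, mul_comm, mul_assoc, sgn_mul_sgn, mul_one]
    simp only [h2]
    exact hv.symm
  · rw [not_nonempty_iff] at hne
    rw [Fintype.card_eq_zero] at hcard
    have h0 : finrank ℝ (E x) = 0 := by rw [finrank_fiber F E, ← hcard]
    have := finrank_zero_iff.1 h0
    exact Subsingleton.elim _ _

/-- An adapted orthonormal frame of a single fibre. -/
theorem exists_fiber_frame {G : GenPseudometric C} (hG : G.IsStrictlyPositive) (x : M) :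
    ∃ (p q : ℕ) (w : Fin p ⊕ Fin q → E x), p ≠ 1 ∧ q ≠ 1 ∧ p + q = finrank ℝ F ∧
      (∀ A B, C.pairing x (w A) (w B) = if A = B then sgn (Fin p) (Fin q) ℝ A else 0) ∧
      ∀ A, G.toFun x (w A) = sgn (Fin p) (Fin q) ℝ A • w A := by
  have : FiniteDimensional ℝ (E x) := Module.Finite.of_basis (fiberBasis F E x)
  set V₁ := End.eigenspace (G.toFun x) 1
  set V₂ := End.eigenspace (G.toFun x) (-1)
  have m1 (v : V₁) : G.toFun x v = (v : E x) := by
    simpa using End.mem_eigenspace_iff.1 v.2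
  have m2 (v : V₂) : G.toFun x v = -(v : E x) := by
    simpa using End.mem_eigenspace_iff.1 v.2
  obtain ⟨b₁, hb₁⟩ := exists_orthonormal ((C.pairing x).restrict V₁)
    (fun v w => C.pairing_symm x v w) (fun v hv => by
      have := hG x v (by simpa using hv)
      rwa [m1] at this)
  obtain ⟨b₂, hb₂⟩ := exists_orthonormal (-(C.pairing x).restrict V₂)
    (fun v w => congrArg Neg.neg (C.pairing_symm x v w)) (fun v hv => by
      have := hG x v (by simpa using hv)
      rw [m2] at this
      simpa using this)
  have hcompl : IsCompl V₁ V₂ := by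
    constructor
    · rw [Submodule.disjoint_def]
      intro v h1 h2
      have e1 := m1 ⟨v, h1⟩
      have e2 := m2 ⟨v, h2⟩
      simp only at e1 e2
      rw [e1] at e2
      have e3 : (2 : ℝ) • v = 0 := by
        rw [two_smul]
        nth_rewrite 2 [e2]
        exact add_neg_cancel v
      exact (smul_eq_zero.1 e3).resolve_left two_ne_zero
    · rw [codisjoint_iff, eq_top_iff]
      intro v _
      have h : v = (1 / 2 : ℝ) • (v + G.toFun x v) + (1 / 2 : ℝ) • (v - G.toFun x v) := by module
      rw [h]
      refine Submodule.add_mem_sup ?_ ?_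
      · rw [End.mem_eigenspace_iff]
        simp only [map_smul, map_add, G.invol]
        module
      · rw [End.mem_eigenspace_iff]
        simp only [map_smul, map_sub, G.invol]
        module
  refine ⟨finrank ℝ V₁, finrank ℝ V₂, Sum.elim (fun a => (b₁ a : E x)) (fun i => (b₂ i : E x)),
    G.rank_pos_ne_one x, G.rank_neg_ne_one x, ?_, ?_, ?_⟩
  · rw [Submodule.finrank_add_eq_of_isCompl hcompl, finrank_fiber F E]
  · have hmix (a i) : C.pairing x (b₁ a : E x) (b₂ i : E x) = 0 := by
      have h := G.symm x (b₁ a : E x) (b₂ i : E x)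
      rw [m1, m2, map_neg] at h
      linarith
    rintro (a | i) (b | j)
    · simpa using hb₁ a b
    · simpa using hmix a j
    · simpa using (C.pairing_symm x _ _).trans (hmix b i)
    · have h : -C.pairing x (b₂ i : E x) (b₂ j : E x) = if i = j then 1 else 0 := hb₂ i j
      simp only [Sum.elim_inr, Sum.inr.injEq, sgn_inr]
      rw [← neg_neg (C.pairing x _ _), h]
      split_ifs <;> simp
  · rintro (a | i)
    · simpa using m1 (b₁ a)
    · simpa using m2 (b₂ i)

/-- The projection `½ (u ± 𝒢 u)`. -/
def GenPseudometric.proj (G : GenPseudometric C) (s : ℝ) (u : Cₛ^∞⟮𝓡 n; F, E⟯) :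
    Cₛ^∞⟮𝓡 n; F, E⟯ := (1 / 2 : ℝ) • (u + s • G.app u)

theorem GenPseudometric.proj_apply (G : GenPseudometric C) (s : ℝ) (u : Cₛ^∞⟮𝓡 n; F, E⟯) (x : M) :
    G.proj s u x = (1 / 2 : ℝ) • (u x + s • G.toFun x (u x)) := rfl

theorem GenPseudometric.toFun_proj (G : GenPseudometric C) {s : ℝ} (hs : s * s = 1)
    (u : Cₛ^∞⟮𝓡 n; F, E⟯) (x : M) : G.toFun x (G.proj s u x) = s • G.proj s u x := by
  simp only [proj_apply, map_smul, map_add, G.invol, smul_add, smul_smul]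
  rw [show s * (1 / 2 * s) = 1 / 2 * (s * s) by ring, hs, mul_one, add_comm]
  ring_nf

theorem GenPseudometric.pairing_proj (G : GenPseudometric C) {s : ℝ} (hs : s * s = 1)
    (u v : Cₛ^∞⟮𝓡 n; F, E⟯) (x : M) : C.pairing x (G.proj s u x) (G.proj s v x) =
      C.pairing x (u x) (G.proj s v x) := by
  conv_lhs => rw [G.proj_apply s u]
  simp only [map_smul, map_add, LinearMap.smul_apply, LinearMap.add_apply, G.symm, smul_eq_mul]
  rw [G.toFun_proj hs]
  simp only [map_smul, smul_eq_mul]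
  linear_combination (1 / 2 : ℝ) * C.pairing x (u x) (G.proj s v x) * hs

theorem GenPseudometric.pairing_eq_zero (G : GenPseudometric C) {x : M} {v w : E x}
    (hv : G.toFun x v = (1 : ℝ) • v) (hw : G.toFun x w = (-1 : ℝ) • w) : C.pairing x v w = 0 := by
  have h := G.symm x v w
  rw [hv, hw] at h
  simp only [map_smul, LinearMap.smul_apply, smul_eq_mul] at h
  linarith

/-- The Gram matrix of the projections of the sections `f`. -/
def gram (G : GenPseudometric C) (s : ℝ) {ι : Type*} (f : ι → Cₛ^∞⟮𝓡 n; F, E⟯) (x : M) (a b : ι) : ℝ :=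
  s * C.pairing x (f a x) (G.proj s (f b) x)

theorem gram_eq (G : GenPseudometric C) {s : ℝ} (hs : s * s = 1) {ι : Type*}
    (f : ι → Cₛ^∞⟮𝓡 n; F, E⟯) (x : M) (a b : ι) : gram G s f x a b =
      (s * C.pairing x (f a x) (f b x) + C.pairing x (f a x) (G.toFun x (f b x))) / 2 := by
  simp only [gram, G.proj_apply, map_smul, map_add, smul_eq_mul]
  linear_combination (1 / 2 : ℝ) * C.pairing x (f a x) (G.toFun x (f b x)) * hs

theorem gram_symm (G : GenPseudometric C) {s : ℝ} (hs : s * s = 1) {ι : Type*}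
    (f : ι → Cₛ^∞⟮𝓡 n; F, E⟯) (x : M) (a b : ι) : gram G s f x a b = gram G s f x b a := by
  rw [gram_eq G hs, gram_eq G hs, C.pairing_symm x (f a x) (f b x), ← G.symm,
    C.pairing_symm x (G.toFun x (f a x))]

theorem contMDiff_gram (G : GenPseudometric C) (s : ℝ) {ι : Type*} [Fintype ι]
    (f : ι → Cₛ^∞⟮𝓡 n; F, E⟯) :
    ContMDiff (𝓡 n) 𝓘(ℝ, ι → ι → ℝ) ∞ (gram G s f) := by
  refine contMDiff_pi_space.2 fun a => contMDiff_pi_space.2 fun b => ?_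
  exact contMDiff_const.mul (C.pairing_smooth (f a) (G.proj s (f b)))

/-- Orthonormalization of projected sections, with a cutoff. -/
theorem exists_orthonormalized {ι : Type*} [Fintype ι] [DecidableEq ι] {G : GenPseudometric C}
    {s : ℝ} (hs : s * s = 1) {f : ι → Cₛ^∞⟮𝓡 n; F, E⟯} {𝒱 : Set (ι → ι → ℝ)} (h𝒱 : IsOpen 𝒱)
    (hsm : ContDiffOn ℝ ∞ (orthonormalizer ι) 𝒱)
    (hon : ∀ g ∈ 𝒱, (∀ a b, g a b = g b a) → ∀ a b,
      ∑ d, (∑ c, orthonormalizer ι g a c * g c d) * orthonormalizer ι g b d =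
        if a = b then 1 else 0)
    {χ : C^∞⟮𝓡 n, M; ℝ⟯} (hχ : ∀ x ∈ tsupport χ, gram G s f x ∈ 𝒱) :
    ∃ e : ι → Cₛ^∞⟮𝓡 n; F, E⟯, (∀ a x, χ x = 1 → e a x =
        ∑ b, orthonormalizer ι (gram G s f x) a b • G.proj s (f b) x) ∧
      (∀ x, χ x = 1 → ∀ a b, C.pairing x (e a x) (e b x) = if a = b then s else 0) ∧
      ∀ x, χ x = 1 → ∀ a, G.toFun x (e a x) = s • e a x := by
  -- The coefficients of the orthonormalization are smooth only where the Gram matrix is close to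
  -- the identity; the cutoff extends them to all of M, as global sections require.
  have hθ (a b : ι) : ContMDiff (𝓡 n) 𝓘(ℝ, ℝ) ∞
      (fun x => χ x • orthonormalizer ι (gram G s f x) a b) := by
    refine contMDiff_of_tsupport fun x hx => ?_
    have hx' := tsupport_smul_subset_left _ _ hx
    refine χ.contMDiff.contMDiffAt.smul ?_
    have h1 : ContDiffAt ℝ ∞ (orthonormalizer ι) (gram G s f x) :=
      (hsm _ (hχ x hx')).contDiffAt (h𝒱.mem_nhds (hχ x hx'))
    have h2 := h1.contMDiffAt.comp x (contMDiff_gram G s f).contMDiffAt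
    exact contMDiffAt_pi_space.1 (contMDiffAt_pi_space.1 h2 a) b
  let e (a : ι) : Cₛ^∞⟮𝓡 n; F, E⟯ := ∑ b, smulSec ⟨_, hθ a b⟩ (G.proj s (f b))
  have he (a x) (hx : χ x = 1) : e a x =
      ∑ b, orthonormalizer ι (gram G s f x) a b • G.proj s (f b) x := by
    simp only [e, sum_section_apply]
    refine Finset.sum_congr rfl fun b _ => ?_
    change (χ x • orthonormalizer ι (gram G s f x) a b) • G.proj s (f b) x = _
    rw [hx, one_smul]
  refine ⟨e, he, fun x hx a b => ?_, fun x hx a => ?_⟩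
  · have hmem : gram G s f x ∈ 𝒱 := hχ x (subset_tsupport _ (by simp [hx]))
    have h := hon _ hmem (fun a b => gram_symm G hs f x a b) a b
    rw [he a x hx, he b x hx]
    simp only [map_sum, map_smul, LinearMap.sum_apply, LinearMap.smul_apply, smul_eq_mul,
      G.pairing_proj hs]
    have h2 : s * (∑ d, (∑ c, orthonormalizer ι (gram G s f x) a c * gram G s f x c d) *
        orthonormalizer ι (gram G s f x) b d) = s * if a = b then 1 else 0 := by rw [h]
    rw [mul_ite, mul_one, mul_zero] at h2
    rw [← h2, Finset.mul_sum]
    refine Finset.sum_congr rfl fun d _ => ?_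
    simp only [Finset.sum_mul, Finset.mul_sum]
    refine Finset.sum_congr rfl fun c _ => ?_
    rw [gram]
    linear_combination -(orthonormalizer ι (gram G s f x) b d * orthonormalizer ι (gram G s f x) a c *
      C.pairing x (f c x) (G.proj s (f d) x)) * hs
  · rw [he a x hx]
    simp only [map_sum, map_smul, G.toFun_proj hs, Finset.smul_sum]
    exact Finset.sum_congr rfl fun b _ => smul_comm _ _ _

theorem eventually_gram_mem {ι : Type*} [Fintype ι] {J : Set ℝ} {G : ℝ → GenPseudometric C}
    (hG : ∀ u v : Cₛ^∞⟮𝓡 n; F, E⟯, ContinuousOn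
      (fun p : ℝ × M => C.pairing p.2 (v p.2) ((G p.1).toFun p.2 (u p.2))) (J ×ˢ univ))
    {s : ℝ} (hs : s * s = 1) {f : ι → Cₛ^∞⟮𝓡 n; F, E⟯} {t₀ : ℝ} (ht₀ : t₀ ∈ J) {x₀ : M}
    {𝒱 : Set (ι → ι → ℝ)} (h𝒱 : IsOpen 𝒱) (h₀ : gram (G t₀) s f x₀ ∈ 𝒱) :
    ∀ᶠ p in nhdsWithin t₀ J ×ˢ nhds x₀, gram (G p.1) s f p.2 ∈ 𝒱 := by
  have hc : ContinuousOn (fun p : ℝ × M => gram (G p.1) s f p.2) (J ×ˢ univ) := by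
    refine continuousOn_pi.2 fun a => continuousOn_pi.2 fun b => ?_
    simp only [gram_eq _ hs]
    have h1 : Continuous fun p : ℝ × M => C.pairing p.2 (f a p.2) (f b p.2) :=
      (C.pairing_smooth (f a) (f b)).continuous.comp continuous_snd
    exact ((continuousOn_const.mul h1.continuousOn).add (hG (f b) (f a))).div_const 2
  have h := (hc (t₀, x₀) ⟨ht₀, mem_univ _⟩).eventually_mem (h𝒱.mem_nhds h₀)
  rwa [nhdsWithin_prod_eq, nhdsWithin_univ] at h

/-- Adapted frames for a continuous family of metrics. -/
theorem exists_moving_frame [T2Space M] {J : Set ℝ} {G : ℝ → GenPseudometric C}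
    (hG : ∀ u v : Cₛ^∞⟮𝓡 n; F, E⟯, ContinuousOn
      (fun p : ℝ × M => C.pairing p.2 (v p.2) ((G p.1).toFun p.2 (u p.2))) (J ×ˢ univ))
    {t₀ : ℝ} (ht₀ : t₀ ∈ J) {x₀ : M} {f : P ⊕ Q → Cₛ^∞⟮𝓡 n; F, E⟯}
    (hf : ∀ A B, C.pairing x₀ (f A x₀) (f B x₀) = if A = B then sgn P Q ℝ A else 0)
    (hf' : ∀ A, (G t₀).toFun x₀ (f A x₀) = sgn P Q ℝ A • f A x₀)
    (hcard : Fintype.card (P ⊕ Q) = finrank ℝ F) :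
    ∃ I ∈ nhds t₀, ∃ U : Set M, IsOpen U ∧ x₀ ∈ U ∧ ∀ t ∈ J ∩ I,
      (∀ x ∈ U, ContDiffAt ℝ ∞ (orthonormalizer P) (gram (G t) 1 (fun a => f (Sum.inl a)) x) ∧
        ContDiffAt ℝ ∞ (orthonormalizer Q) (gram (G t) (-1) (fun i => f (Sum.inr i)) x)) ∧
      ∃ e : P ⊕ Q → Cₛ^∞⟮𝓡 n; F, E⟯, IsAdaptedFrame (G t) U e ∧
        (∀ x ∈ U, ∀ a, e (Sum.inl a) x = ∑ b, orthonormalizer P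
          (gram (G t) 1 (fun a => f (Sum.inl a)) x) a b • (G t).proj 1 (f (Sum.inl b)) x) ∧
        (∀ x ∈ U, ∀ i, e (Sum.inr i) x = ∑ j, orthonormalizer Q
          (gram (G t) (-1) (fun i => f (Sum.inr i)) x) i j • (G t).proj (-1) (f (Sum.inr j)) x) := by
  obtain ⟨𝒱, h1, h2, h3, h4⟩ := exists_orthonormalizer_domain P
  obtain ⟨𝒱', h1', h2', h3', h4'⟩ := exists_orthonormalizer_domain Q
  have g1 : gram (G t₀) 1 (fun a => f (Sum.inl a)) x₀ = fun a b => if a = b then 1 else 0 := by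
    funext a b
    rw [gram_eq _ (by norm_num), hf', map_smul, hf]
    simp
  have g2 : gram (G t₀) (-1) (fun i => f (Sum.inr i)) x₀ = fun a b => if a = b then 1 else 0 := by
    funext a b
    rw [gram_eq _ (by norm_num), hf', map_smul, hf]
    by_cases h : a = b <;> simp [h]
  have ev := (eventually_gram_mem hG (s := 1) (by norm_num) ht₀ h1 (by rw [g1]; exact h2)).and
    (eventually_gram_mem hG (s := -1) (by norm_num) ht₀ h1' (by rw [g2]; exact h2'))
  -- A product neighbourhood is needed: one open set of M must serve all times close to `t₀`.
  obtain ⟨p, hp, q, hq, hpq⟩ := Filter.eventually_prod_iff.1 ev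
  obtain ⟨I, hI, hIJ⟩ := mem_nhdsWithin_iff_exists_mem_nhds_inter.1 hp
  obtain ⟨χ, hχ1, hχ2⟩ := exists_cutoff (n := n) hq
  obtain ⟨U, hU1, hU2, hU3⟩ := mem_nhds_iff.1 hχ1
  have hsupp {x} (hx : x ∈ U) : x ∈ tsupport χ :=
    subset_tsupport _ (by simp [show χ x = 1 from hU1 hx])
  refine ⟨I, hI, U, hU2, hU3, fun t ht => ⟨fun x hx => ?_, ?_⟩⟩
  · have hm := hpq (hIJ ⟨ht.2, ht.1⟩) (hχ2 (hsupp hx))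
    exact ⟨(h3 _ hm.1).contDiffAt (h1.mem_nhds hm.1), (h3' _ hm.2).contDiffAt (h1'.mem_nhds hm.2)⟩
  obtain ⟨e, he1, he2, he3⟩ := exists_orthonormalized (G := G t) (s := 1) (by norm_num)
    (f := fun a => f (Sum.inl a)) h1 h3 h4 (χ := χ)
    (fun x hx => (hpq (hIJ ⟨ht.2, ht.1⟩) (hχ2 hx)).1)
  obtain ⟨e', he1', he2', he3'⟩ := exists_orthonormalized (G := G t) (s := -1) (by norm_num)
    (f := fun i => f (Sum.inr i)) h1' h3' h4' (χ := χ)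
    (fun x hx => (hpq (hIJ ⟨ht.2, ht.1⟩) (hχ2 hx)).2)
  have ho : ∀ x ∈ U, ∀ A B, C.pairing x ((Sum.elim e e' : P ⊕ Q → Cₛ^∞⟮𝓡 n; F, E⟯) A x)
      ((Sum.elim e e' : P ⊕ Q → Cₛ^∞⟮𝓡 n; F, E⟯) B x) = if A = B then sgn P Q ℝ A else 0 := by
    rintro x hx (a | i) (b | j)
    · simpa using he2 x (hU1 hx) a b
    · simpa using (G t).pairing_eq_zero (he3 x (hU1 hx) a) (he3' x (hU1 hx) j)
    · simpa using (C.pairing_symm x _ _).trans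
        ((G t).pairing_eq_zero (he3 x (hU1 hx) b) (he3' x (hU1 hx) i))
    · simpa using he2' x (hU1 hx) i j
  refine ⟨Sum.elim e e', ⟨hU2, ho, ?_, fun x hx => complete_of_ortho (ho x hx) hcard⟩,
    fun x hx a => he1 a x (hU1 hx), fun x hx i => he1' i x (hU1 hx)⟩
  rintro x hx (a | i)
  · exact he3 x (hU1 hx) a
  · exact he3' x (hU1 hx) i

/-- Adapted frames exist locally. -/
theorem exists_adapted_frame [T2Space M] {G : GenPseudometric C} (hG : G.IsStrictlyPositive)
    (x₀ : M) : ∃ (p q : ℕ) (U : Set M) (e : Fin p ⊕ Fin q → Cₛ^∞⟮𝓡 n; F, E⟯),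
      p ≠ 1 ∧ q ≠ 1 ∧ p + q = finrank ℝ F ∧ x₀ ∈ U ∧ IsAdaptedFrame G U e := by
  obtain ⟨p, q, w, hp, hq, hpq, hw, hw'⟩ := exists_fiber_frame hG x₀
  -- The static case is a constant family of metrics, started from any sections extending an adapted
  -- frame of the fibre.
  obtain ⟨I, hI, U, hU, hx, h⟩ := exists_moving_frame (J := univ) (G := fun _ : ℝ => G)
    (fun u v => ((C.pairing_smooth v (G.app u)).continuous.comp continuous_snd).continuousOn)
    (t₀ := 0) (mem_univ _) (x₀ := x₀) (f := fun A => sectionThrough n F x₀ (w A))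
    (by simpa only [IsAdaptedFrame.sectionThrough_apply] using hw)
    (by simpa only [IsAdaptedFrame.sectionThrough_apply] using hw') (by simpa using hpq)
  obtain ⟨-, e, he, -⟩ := h 0 ⟨mem_univ _, mem_of_mem_nhds hI⟩
  exact ⟨p, q, U, e, hp, hq, hpq, hx, he⟩

end ExistsFrame

/-! ### Existence of Levi-Civita connections -/

section LeviCivitaExistence

variable [FiniteDimensional ℝ F] {C : CourantAlgebroid n F E}

/-- The conditions defining the Levi-Civita connections of `G` and `σ`, at a single point. -/
structure IsLeviCivitaAt [T2Space M] (G : GenPseudometric C) (σ : PosHalfDensity n M) (x : M)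
    (N : Cₛ^∞⟮𝓡 n; F, E⟯ → Cₛ^∞⟮𝓡 n; F, E⟯ → Cₛ^∞⟮𝓡 n; F, E⟯) : Prop where
  leibniz : ∀ u v f, N u (smulSec f v) x = f x • N u v x + C.act u f x • v x
  metric : ∀ u v w, C.act u (C.pair v w) x = C.pair (N u v) w x + C.pair v (N u w) x
  torsion : ∀ u v w, C.pair (N u v) w x - C.pair (N v u) w x - C.pair (C.bracket u v) w x +
    C.pair (N w u) v x = 0
  compat : ∀ u v, N u (G.app v) x = G.toFun x (N u v x)
  div : ∀ u, C.contract x (fun a b => C.pairing x a (N (sectionThrough n F x b) u x)) =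
    C.divFun σ u x

theorem const_smul_eq_smulSec (r : ℝ) (u : Cₛ^∞⟮𝓡 n; F, E⟯) :
    r • u = smulSec (ContMDiffMap.const r) u := by
  ext x; rfl

namespace IsAdaptedFrame

variable {P Q : Type*} [Fintype P] [Fintype Q] [DecidableEq P] [DecidableEq Q]
  {G : GenPseudometric C} {U : Set M} {e : P ⊕ Q → Cₛ^∞⟮𝓡 n; F, E⟯} {x : M}

variable (C e) in
/-- The components `⟨∇_u v, e_B⟩` of the connection with coefficients `Γ` in the frame `e`. -/
def connComponent (Γ : P ⊕ Q → P ⊕ Q → P ⊕ Q → C^∞⟮𝓡 n, M; ℝ⟯) (u v : Cₛ^∞⟮𝓡 n; F, E⟯)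
    (B : P ⊕ Q) : C^∞⟮𝓡 n, M; ℝ⟯ :=
  C.act u (C.pair (e B) v) + ∑ A₁, ∑ A₂, (sgn P Q ℝ A₁ * sgn P Q ℝ A₂) •
    (C.pair (e A₁) u * C.pair (e A₂) v * Γ A₁ A₂ B)

variable {Γ : P ⊕ Q → P ⊕ Q → P ⊕ Q → C^∞⟮𝓡 n, M; ℝ⟯}

theorem smooth_sum_apply {ι : Type*} (s : Finset ι) (f : ι → C^∞⟮𝓡 n, M; ℝ⟯) (x : M) :
    (∑ i ∈ s, f i) x = ∑ i ∈ s, f i x :=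
  map_sum (⟨⟨fun f : C^∞⟮𝓡 n, M; ℝ⟯ => f x, rfl⟩, fun _ _ => rfl⟩ :
    C^∞⟮𝓡 n, M; ℝ⟯ →+ ℝ) f s

theorem connComponent_apply (u v : Cₛ^∞⟮𝓡 n; F, E⟯) (B : P ⊕ Q) (x : M) :
    connComponent C e Γ u v B x = C.act u (C.pair (e B) v) x +
      ∑ A₁, ∑ A₂, sgn P Q ℝ A₁ * sgn P Q ℝ A₂ *
        (C.pair (e A₁) u x * C.pair (e A₂) v x * Γ A₁ A₂ B x) := by
  simp only [connComponent, ContMDiffMap.coe_add, Pi.add_apply, smooth_sum_apply]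
  rfl

theorem connComponent_add_left (u u' v : Cₛ^∞⟮𝓡 n; F, E⟯) (B : P ⊕ Q) (x : M) :
    connComponent C e Γ (u + u') v B x = connComponent C e Γ u v B x +
      connComponent C e Γ u' v B x := by
  simp only [connComponent_apply, C.act_add_left, C.pair_add_right, add_mul, mul_add,
    Finset.sum_add_distrib]
  ring

theorem connComponent_smul_left (f : C^∞⟮𝓡 n, M; ℝ⟯) (u v : Cₛ^∞⟮𝓡 n; F, E⟯) (B : P ⊕ Q)
    (x : M) : connComponent C e Γ (smulSec f u) v B x = f x * connComponent C e Γ u v B x := by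
  have h : C.act (smulSec f u) (C.pair (e B) v) x = f x * C.act u (C.pair (e B) v) x := by
    simp [CourantAlgebroid.act_apply]
  simp only [connComponent_apply, h, C.pair_smul_right, mul_add, Finset.mul_sum]
  congr 1
  exact Finset.sum_congr rfl fun _ _ => Finset.sum_congr rfl fun _ _ => by ring

theorem connComponent_add_right (u v v' : Cₛ^∞⟮𝓡 n; F, E⟯) (B : P ⊕ Q) (x : M) :
    connComponent C e Γ u (v + v') B x = connComponent C e Γ u v B x +
      connComponent C e Γ u v' B x := by
  have h : C.pair (e B) (v + v') = C.pair (e B) v + C.pair (e B) v' := by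
    ext y; exact C.pair_add_right _ _ _ y
  simp only [connComponent_apply, h, C.act_add, C.pair_add_right, add_mul, mul_add,
    Finset.sum_add_distrib]
  ring

theorem connComponent_smul_right (f : C^∞⟮𝓡 n, M; ℝ⟯) (u v : Cₛ^∞⟮𝓡 n; F, E⟯) (B : P ⊕ Q)
    (x : M) : connComponent C e Γ u (smulSec f v) B x =
      f x * connComponent C e Γ u v B x + C.act u f x * C.pair (e B) v x := by
  have h : C.pair (e B) (smulSec f v) = f * C.pair (e B) v := by
    ext y; exact C.pair_smul_right _ _ _ y
  simp only [connComponent_apply, h, C.act_mul, C.pair_smul_right, mul_add, Finset.mul_sum]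
  rw [add_right_comm, mul_comm (C.pair (e B) v x)]
  congr 2
  exact Finset.sum_congr rfl fun _ _ => Finset.sum_congr rfl fun _ _ => by ring

variable (C e Γ) in
/-- The local connection with coefficients `Γ` in the frame `e`. -/
def frameConn (u v : Cₛ^∞⟮𝓡 n; F, E⟯) : Cₛ^∞⟮𝓡 n; F, E⟯ :=
  ∑ B, smulSec (sgn P Q ℝ B • connComponent C e Γ u v B) (e B)

theorem frameConn_apply (u v : Cₛ^∞⟮𝓡 n; F, E⟯) (x : M) :
    frameConn C e Γ u v x = ∑ B, (sgn P Q ℝ B * connComponent C e Γ u v B x) • e B x := by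
  simp only [frameConn, sum_section_apply, smulSec_apply]
  rfl

theorem frameConn_add_left (u u' v : Cₛ^∞⟮𝓡 n; F, E⟯) :
    frameConn C e Γ (u + u') v = frameConn C e Γ u v + frameConn C e Γ u' v := by
  ext x
  simp only [ContMDiffSection.coe_add, Pi.add_apply, frameConn_apply, connComponent_add_left,
    mul_add, add_smul, Finset.sum_add_distrib]

theorem frameConn_smul_left (f : C^∞⟮𝓡 n, M; ℝ⟯) (u v : Cₛ^∞⟮𝓡 n; F, E⟯) :
    frameConn C e Γ (smulSec f u) v = smulSec f (frameConn C e Γ u v) := by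
  ext x
  simp only [smulSec_apply, frameConn_apply, connComponent_smul_left, Finset.smul_sum, smul_smul,
    mul_left_comm]

theorem frameConn_add_right (u v v' : Cₛ^∞⟮𝓡 n; F, E⟯) :
    frameConn C e Γ u (v + v') = frameConn C e Γ u v + frameConn C e Γ u v' := by
  ext x
  simp only [ContMDiffSection.coe_add, Pi.add_apply, frameConn_apply, connComponent_add_right,
    mul_add, add_smul, Finset.sum_add_distrib]

theorem frameConn_const_smul_right (r : ℝ) (u v : Cₛ^∞⟮𝓡 n; F, E⟯) :
    frameConn C e Γ u (r • v) = r • frameConn C e Γ u v := by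
  rw [const_smul_eq_smulSec]
  ext x
  rw [frameConn_apply]
  simp only [connComponent_smul_right, C.act_eq_zero_of_const u (f := ContMDiffMap.const r) r
    (Filter.Eventually.of_forall fun _ => rfl), zero_mul, add_zero]
  rw [ContMDiffSection.coe_smul, Pi.smul_apply, frameConn_apply, Finset.smul_sum]
  simp only [smul_smul, mul_left_comm r]
  rfl

theorem pair_frameConn (H : IsAdaptedFrame G U e) (hx : x ∈ U) (u v : Cₛ^∞⟮𝓡 n; F, E⟯)
    (B : P ⊕ Q) : C.pair (frameConn C e Γ u v) (e B) x = connComponent C e Γ u v B x := by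
  rw [C.pair_symm, CourantAlgebroid.pair_apply, frameConn_apply]
  simp only [map_sum, map_smul, smul_eq_mul, H.ortho x hx, mul_ite, mul_zero, Finset.sum_ite_eq,
    Finset.mem_univ, if_true]
  rw [mul_right_comm, sgn_mul_sgn, one_mul]

theorem frameConn_leibniz (H : IsAdaptedFrame G U e) (hx : x ∈ U) (u v : Cₛ^∞⟮𝓡 n; F, E⟯)
    (f : C^∞⟮𝓡 n, M; ℝ⟯) : frameConn C e Γ u (smulSec f v) x =
      f x • frameConn C e Γ u v x + C.act u f x • v x := by
  conv_rhs => rw [H.complete x hx (v x)]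
  simp only [frameConn_apply, connComponent_smul_right, Finset.smul_sum, smul_smul, mul_add,
    add_smul, Finset.sum_add_distrib, CourantAlgebroid.pair_apply, mul_left_comm]

theorem pair_frameConn_frame (H : IsAdaptedFrame G U e) (hx : x ∈ U) (A₁ A₂ A₃ : P ⊕ Q) :
    C.pair (frameConn C e Γ (e A₁) (e A₂)) (e A₃) x = Γ A₁ A₂ A₃ x := by
  rw [H.pair_frameConn hx, connComponent_apply, H.act_pair_eq_zero hx, zero_add]
  simp only [CourantAlgebroid.pair_apply, H.ortho x hx, mul_ite, ite_mul, mul_zero, zero_mul,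
    Finset.sum_ite_eq', Finset.mem_univ, if_true]
  linear_combination (sgn P Q ℝ A₂ * sgn P Q ℝ A₂ * Γ A₁ A₂ A₃ x) * sgn_mul_sgn A₁ +
    Γ A₁ A₂ A₃ x * sgn_mul_sgn A₂

theorem pair_frameConn_smul (H : IsAdaptedFrame G U e) (hx : x ∈ U) (u v w : Cₛ^∞⟮𝓡 n; F, E⟯)
    (f : C^∞⟮𝓡 n, M; ℝ⟯) : C.pair (frameConn C e Γ u (smulSec f v)) w x =
      f x * C.pair (frameConn C e Γ u v) w x + C.act u f x * C.pair v w x := by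
  rw [CourantAlgebroid.pair_apply, H.frameConn_leibniz hx]
  simp [CourantAlgebroid.pair_apply]

/-- Vanishing of a trilinear tensorial expression can be checked on a frame. -/
theorem tensorial₃_eq_zero [T2Space M] (H : IsAdaptedFrame G U e) (hx : x ∈ U)
    {T : Cₛ^∞⟮𝓡 n; F, E⟯ → Cₛ^∞⟮𝓡 n; F, E⟯ → Cₛ^∞⟮𝓡 n; F, E⟯ → ℝ}
    (a₁ : ∀ u u' v w, T (u + u') v w = T u v w + T u' v w)
    (s₁ : ∀ f u v w, T (smulSec f u) v w = f x * T u v w)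
    (a₂ : ∀ u v v' w, T u (v + v') w = T u v w + T u v' w)
    (s₂ : ∀ f u v w, T u (smulSec f v) w = f x * T u v w)
    (a₃ : ∀ u v w w', T u v (w + w') = T u v w + T u v w')
    (s₃ : ∀ f u v w, T u v (smulSec f w) = f x * T u v w)
    (h : ∀ A₁ A₂ A₃, T (e A₁) (e A₂) (e A₃) = 0) (u v w : Cₛ^∞⟮𝓡 n; F, E⟯) : T u v w = 0 := by
  have h3 (A₁ A₂ w) : T (e A₁) (e A₂) w = 0 := by
    rw [H.tensorial_expand hx (T := T (e A₁) (e A₂)) (a₃ _ _) (fun f w => s₃ f _ _ w)]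
    simp [h]
  have h2 (A₁ v w) : T (e A₁) v w = 0 := by
    rw [H.tensorial_expand hx (T := fun v => T (e A₁) v w) (fun _ _ => a₂ _ _ _ _)
      (fun f v => s₂ f _ _ _)]
    simp [h3]
  rw [H.tensorial_expand hx (T := fun u => T u v w) (fun _ _ => a₁ _ _ _ _)
      (fun f v => s₁ f _ _ _)]
  simp [h2]

theorem pair_app_eventually (H : IsAdaptedFrame G U e) (hx : x ∈ U) (v : Cₛ^∞⟮𝓡 n; F, E⟯)
    (B : P ⊕ Q) : ∀ᶠ y in nhds x, C.pair (e B) (G.app v) y = (sgn P Q ℝ B • C.pair (e B) v) y := by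
  filter_upwards [H.isOpen.mem_nhds hx] with y hy
  change C.pairing y (e B y) (G.toFun y (v y)) = sgn P Q ℝ B * C.pairing y (e B y) (v y)
  rw [← G.symm, H.eigen y hy]
  simp

/-- In the metric, torsion and divergence conditions the derivatives of scalar factors cancel, so
each is tensorial and can be tested on the frame, where it becomes a condition on `Γ`. Compatibility
is checked componentwise, as `Γ` does not mix the eigenbundles. -/
theorem isLeviCivitaAt_frameConn [T2Space M] (H : IsAdaptedFrame G U e) (hx : x ∈ U)
    {σ : PosHalfDensity n M}
    (hanti : ∀ A₁ A₂ A₃, Γ A₁ A₂ A₃ x + Γ A₁ A₃ A₂ x = 0)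
    (hmixed : ∀ A₁ A₂ A₃, sgn P Q ℝ A₂ ≠ sgn P Q ℝ A₃ → Γ A₁ A₂ A₃ x = 0)
    (htor : ∀ A₁ A₂ A₃, Γ A₁ A₂ A₃ x - Γ A₂ A₁ A₃ x + Γ A₃ A₁ A₂ x = structureFun C e A₁ A₂ A₃ x)
    (hdiv : ∀ B, ∑ A, sgn P Q ℝ A * Γ A B A x = C.divFun σ (e B) x) :
    IsLeviCivitaAt G σ x (frameConn C e Γ) where
  leibniz := H.frameConn_leibniz hx
  metric u v w := by
    have h := H.tensorial₃_eq_zero hx (T := fun u v w => C.act u (C.pair v w) x -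
      C.pair (frameConn C e Γ u v) w x - C.pair v (frameConn C e Γ u w) x)
      (fun u u' v w => by
        simp only [C.act_add_left, frameConn_add_left, C.pair_add_left, C.pair_add_right]; ring)
      (fun f u v w => by
        have : C.act (smulSec f u) (C.pair v w) x = f x * C.act u (C.pair v w) x := by
          simp [CourantAlgebroid.act_apply]
        simp only [this, frameConn_smul_left, C.pair_smul_left, C.pair_smul_right]; ring)
      (fun u v v' w => by
        have : C.pair (v + v') w = C.pair v w + C.pair v' w := by
          ext y; exact C.pair_add_left _ _ _ y
        simp only [this, C.act_add, frameConn_add_right, C.pair_add_left]; ring)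
      (fun f u v w => by
        have : C.pair (smulSec f v) w = f * C.pair v w := by
          ext y; exact C.pair_smul_left _ _ _ y
        simp only [this, C.act_mul, H.pair_frameConn_smul hx, C.pair_smul_left]; ring)
      (fun u v w w' => by
        have : C.pair v (w + w') = C.pair v w + C.pair v w' := by
          ext y; exact C.pair_add_right _ _ _ y
        simp only [this, C.act_add, frameConn_add_right, C.pair_add_right]; ring)
      (fun f u v w => by
        have : C.pair v (smulSec f w) = f * C.pair v w := by
          ext y; exact C.pair_smul_right _ _ _ y
        simp only [this, C.act_mul, C.pair_symm v (frameConn _ _ _ _ _),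
          H.pair_frameConn_smul hx, C.pair_smul_right, C.pair_symm w v]; ring)
      (fun A₁ A₂ A₃ => by
        simp only [C.pair_symm (e A₂) (frameConn _ _ _ _ _), H.pair_frameConn_frame hx,
          H.act_pair_eq_zero hx]
        linear_combination -hanti A₁ A₂ A₃) u v w
    linear_combination h
  torsion := H.tensorial₃_eq_zero hx
      (fun u u' v w => by
        simp only [frameConn_add_left, frameConn_add_right, map_add, LinearMap.add_apply,
          C.pair_add_left]; ring)
      (fun f u v w => by
        simp only [frameConn_smul_left, C.pair_smul_left, C.pair_smul_bracket,
          H.pair_frameConn_smul hx]; ring)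
      (fun u v v' w => by
        simp only [frameConn_add_left, frameConn_add_right, map_add, C.pair_add_left,
          C.pair_add_right]; ring)
      (fun f u v w => by
        simp only [frameConn_smul_left, C.pair_smul_left, C.bracket_smul, C.pair_add_left,
          C.pair_smul_right, H.pair_frameConn_smul hx]; ring)
      (fun u v w w' => by
        simp only [frameConn_add_left, C.pair_add_left, C.pair_add_right]; ring)
      (fun f u v w => by
        simp only [frameConn_smul_left, C.pair_smul_left, C.pair_smul_right]; ring)
      (fun A₁ A₂ A₃ => by
        simp only [H.pair_frameConn_frame hx]
        have := htor A₁ A₂ A₃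
        rw [structureFun] at this
        linear_combination this)
  compat u v := by
    rw [H.complete x hx (frameConn C e Γ u (G.app v) x),
      H.complete x hx (G.toFun x (frameConn C e Γ u v x))]
    refine Finset.sum_congr rfl fun B _ => ?_
    congr 2
    rw [← G.symm, H.eigen x hx, map_smul, LinearMap.smul_apply, smul_eq_mul]
    change C.pair (e B) (frameConn C e Γ u (G.app v)) x =
      sgn P Q ℝ B * C.pair (e B) (frameConn C e Γ u v) x
    rw [C.pair_symm, C.pair_symm (e B), H.pair_frameConn hx, H.pair_frameConn hx,
      connComponent_apply, connComponent_apply, C.act_congr u (H.pair_app_eventually hx v B),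
      C.act_smul_const, mul_add, Finset.mul_sum]
    congr 1
    refine Finset.sum_congr rfl fun A₁ _ => ?_
    rw [Finset.mul_sum]
    refine Finset.sum_congr rfl fun A₂ _ => ?_
    rw [(H.pair_app_eventually hx v A₂).self_of_nhds]
    change _ * (_ * (sgn P Q ℝ A₂ * C.pair (e A₂) v x) * _) = _
    by_cases h : sgn P Q ℝ A₂ = sgn P Q ℝ B
    · rw [h]; ring
    · rw [hmixed A₁ A₂ B h]; ring
  div u := by
    have hc (u : Cₛ^∞⟮𝓡 n; F, E⟯) :
        C.contract x (fun a b => C.pairing x a (frameConn C e Γ (sectionThrough n F x b) u x)) =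
        ∑ A, sgn P Q ℝ A * C.pair (frameConn C e Γ (e A) u) (e A) x := by
      rw [← H.contract_tensorial hx (T := fun a b => C.pair (frameConn C e Γ b u) a x)
        (fun _ _ _ => C.pair_add_right _ _ _ _) (fun _ _ _ => C.pair_smul_right _ _ _ _)
        (fun _ _ _ => by simp only [frameConn_add_left, C.pair_add_left])
        (fun _ _ _ => by simp only [frameConn_smul_left, C.pair_smul_left])]
      congr 1
      funext a b
      rw [C.pair_symm, CourantAlgebroid.pair_apply, sectionThrough_apply]
    rw [hc, ← sub_eq_zero]
    have h := H.tensorial_expand hx (T := fun u =>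
      ∑ A, sgn P Q ℝ A * C.pair (frameConn C e Γ (e A) u) (e A) x - C.divFun σ u x)
      (fun u v => by
        simp only [frameConn_add_right, C.pair_add_left, C.divFun_add, mul_add,
          Finset.sum_add_distrib]; ring)
      (fun f u => by
        simp only [H.pair_frameConn_smul hx, C.divFun_smul, mul_add, Finset.sum_add_distrib,
          H.act_expand hx u f, smul_eq_mul, mul_sub, Finset.mul_sum, C.pair_symm u (e _),
          mul_left_comm (f x), mul_comm (C.act (e _) f x)]; ring) u
    refine h.trans (Finset.sum_eq_zero fun B _ => ?_)
    simp only [H.pair_frameConn_frame hx, hdiv, sub_self, smul_zero]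

variable (C e) in
/-- The coefficients of a Levi-Civita connection in an adapted frame. -/
def leviCivitaCoeff (σ : PosHalfDensity n M) : P ⊕ Q → P ⊕ Q → P ⊕ Q → C^∞⟮𝓡 n, M; ℝ⟯
  | .inl a, .inl b, .inl c => (1 / 3 : ℝ) • structureFun C e (.inl a) (.inl b) (.inl c) +
      (1 / (Fintype.card P - 1) : ℝ) • ((if a = c then C.divFun σ (e (.inl b)) else 0) -
        (if a = b then C.divFun σ (e (.inl c)) else 0))
  | .inr i, .inl b, .inl c => structureFun C e (.inr i) (.inl b) (.inl c)
  | .inl a, .inr j, .inr k => structureFun C e (.inl a) (.inr j) (.inr k)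
  | .inr i, .inr j, .inr k => (1 / 3 : ℝ) • structureFun C e (.inr i) (.inr j) (.inr k) -
      (1 / (Fintype.card Q - 1) : ℝ) • ((if i = k then C.divFun σ (e (.inr j)) else 0) -
        (if i = j then C.divFun σ (e (.inr k)) else 0))
  | _, .inl _, .inr _ => 0
  | _, .inr _, .inl _ => 0

/-- Vanishing torsion asks the cyclic sum of Γ to be the structure function. This forces the mixed
coefficients and is met within each half by one third of c, which is trace-free. The additional term
vanishes under the cyclic sum and adjusts the trace to the divergence. Its trace is (rank - 1) times
the divergence before normalization, so the rank must differ from one. -/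
theorem isLeviCivitaAt_leviCivitaCoeff [T2Space M] (H : IsAdaptedFrame G U e) (hx : x ∈ U)
    (σ : PosHalfDensity n M) (hP : Fintype.card P ≠ 1) (hQ : Fintype.card Q ≠ 1) :
    IsLeviCivitaAt G σ x (frameConn C e (leviCivitaCoeff C e σ)) := by
  have hite (p : Prop) [Decidable p] (f : C^∞⟮𝓡 n, M; ℝ⟯) :
      (if p then f else 0) x = if p then f x else 0 := by split_ifs <;> rfl
  have s12 := H.structureFun_swap₁₂ hx
  have s23 := H.structureFun_swap₂₃ hx
  have hP' : (Fintype.card P : ℝ) - 1 ≠ 0 := sub_ne_zero.2 (by exact_mod_cast hP)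
  have hQ' : (Fintype.card Q : ℝ) - 1 ≠ 0 := sub_ne_zero.2 (by exact_mod_cast hQ)
  have hL (a b c : P) : leviCivitaCoeff C e σ (.inl a) (.inl b) (.inl c) x =
      (1 / 3 : ℝ) * structureFun C e (.inl a) (.inl b) (.inl c) x +
      (1 / (Fintype.card P - 1) : ℝ) * ((if a = c then C.divFun σ (e (.inl b)) x else 0) -
        (if a = b then C.divFun σ (e (.inl c)) x else 0)) := by
    rw [← hite, ← hite]; rfl
  have hR (a b c : Q) : leviCivitaCoeff C e σ (.inr a) (.inr b) (.inr c) x =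
      (1 / 3 : ℝ) * structureFun C e (.inr a) (.inr b) (.inr c) x -
      (1 / (Fintype.card Q - 1) : ℝ) * ((if a = c then C.divFun σ (e (.inr b)) x else 0) -
        (if a = b then C.divFun σ (e (.inr c)) x else 0)) := by
    rw [← hite, ← hite]; rfl
  have z1 (A : P ⊕ Q) (b : P) (c : Q) : leviCivitaCoeff C e σ A (.inl b) (.inr c) x = 0 := by
    rcases A with a | i <;> rfl
  have z2 (A : P ⊕ Q) (b : P) (c : Q) : leviCivitaCoeff C e σ A (.inr c) (.inl b) x = 0 := by
    rcases A with a | i <;> rfl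
  have m1 (i : Q) (b c : P) : leviCivitaCoeff C e σ (.inr i) (.inl b) (.inl c) x =
    structureFun C e (.inr i) (.inl b) (.inl c) x := rfl
  have m2 (a : P) (j k : Q) : leviCivitaCoeff C e σ (.inl a) (.inr j) (.inr k) x =
    structureFun C e (.inl a) (.inr j) (.inr k) x := rfl
  have zaa (A B : P ⊕ Q) : structureFun C e A B A x = 0 := by
    have h1 := s12 A B A
    have h2 := s23 B A A
    linarith
  have hcP (a b : P) (r : ℝ) : (if a = b then r else 0) = if b = a then r else 0 := by
    simp only [eq_comm]
  have hcQ (i j : Q) (r : ℝ) : (if i = j then r else 0) = if j = i then r else 0 := by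
    simp only [eq_comm]
  refine H.isLeviCivitaAt_frameConn hx ?_ ?_ ?_ ?_
  · rintro (a | i) (b | j) (c | k) <;> simp only [hL, hR, z1, z2, m1, m2, add_zero]
    · linear_combination (1 / 3 : ℝ) * s23 (.inl a) (.inl b) (.inl c)
    · linear_combination s23 (.inl a) (.inr j) (.inr k)
    · linear_combination s23 (.inr i) (.inl b) (.inl c)
    · linear_combination (1 / 3 : ℝ) * s23 (.inr i) (.inr j) (.inr k)
  · rintro A (b | j) (c | k) h <;> first | exact absurd rfl h | simp only [z1, z2]
  · rintro (a | i) (b | j) (c | k) <;>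
      simp only [hL, hR, z1, z2, m1, m2, add_zero, sub_zero, zero_sub, zero_add]
    · rw [hcP b a, hcP c a, hcP c b]
      linear_combination -(1 / 3 : ℝ) * s12 (.inl a) (.inl b) (.inl c) +
        (1 / 3 : ℝ) * s12 (.inl a) (.inl c) (.inl b) - (1 / 3 : ℝ) * s23 (.inl a) (.inl b) (.inl c)
    · linear_combination s12 (.inl a) (.inr k) (.inl b) - s23 (.inl a) (.inl b) (.inr k)
    · linear_combination -s12 (.inl a) (.inr j) (.inl c)
    · linear_combination -s12 (.inr i) (.inl b) (.inr k)
    · linear_combination s12 (.inr i) (.inl c) (.inr j) - s23 (.inr i) (.inr j) (.inl c)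
    · rw [hcQ j i, hcQ k i, hcQ k j]
      linear_combination -(1 / 3 : ℝ) * s12 (.inr i) (.inr j) (.inr k) +
        (1 / 3 : ℝ) * s12 (.inr i) (.inr k) (.inr j) - (1 / 3 : ℝ) * s23 (.inr i) (.inr j) (.inr k)
  · rintro (b | j)
    · simp only [Fintype.sum_sum_type, sgn_inl, sgn_inr, hL, z1, zaa, one_mul, mul_zero, zero_add,
        if_true, ← Finset.mul_sum, Finset.sum_sub_distrib, Finset.sum_const, Finset.card_univ,
        nsmul_eq_mul, Finset.sum_ite_eq', Finset.mem_univ, add_zero]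
      field_simp
    · simp only [Fintype.sum_sum_type, sgn_inl, sgn_inr, hR, z2, zaa, one_mul, mul_zero, zero_add,
        if_true, ← Finset.mul_sum, Finset.sum_sub_distrib, Finset.sum_const, Finset.card_univ,
        nsmul_eq_mul, Finset.sum_ite_eq', Finset.mem_univ, neg_mul, zero_sub, neg_neg]
      field_simp

end IsAdaptedFrame

/-- Each local connection satisfies its conditions only over its own open set; where its weight is
zero nothing is required of it. -/
theorem sum_smul_eq_of_forall {ι V : Type*} [Fintype ι] [AddCommGroup V] [Module ℝ V] {c : ι → ℝ}
    (hc : ∑ k, c k = 1) {p : ι → Prop} (hp : ∀ k, c k ≠ 0 → p k) {L : ι → V} {R : V}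
    (h : ∀ k, p k → L k = R) : ∑ k, c k • L k = R := by
  rw [← one_smul ℝ R, ← hc, Finset.sum_smul]
  refine Finset.sum_congr rfl fun k _ => ?_
  by_cases h0 : c k = 0
  · simp [h0]
  · rw [h k (hp k h0)]

/-- Convex combinations of Levi-Civita connections are Levi-Civita connections. -/
theorem IsLeviCivitaAt.sum [T2Space M] {ι : Type*} [Fintype ι] {G : GenPseudometric C}
    {σ : PosHalfDensity n M} {x : M}
    {N : ι → Cₛ^∞⟮𝓡 n; F, E⟯ → Cₛ^∞⟮𝓡 n; F, E⟯ → Cₛ^∞⟮𝓡 n; F, E⟯} {ψ : ι → C^∞⟮𝓡 n, M; ℝ⟯}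
    (hψ : ∑ k, ψ k x = 1) (hN : ∀ k, ψ k x ≠ 0 → IsLeviCivitaAt G σ x (N k)) :
    IsLeviCivitaAt G σ x fun u v => ∑ k, smulSec (ψ k) (N k u v) := by
  have hval (u v) : (∑ k, smulSec (ψ k) (N k u v)) x = ∑ k, ψ k x • N k u v x := by
    simp only [sum_section_apply, smulSec_apply]
  have hpair (u v w) : C.pair (∑ k, smulSec (ψ k) (N k u v)) w x =
      ∑ k, ψ k x • C.pair (N k u v) w x := by
    rw [CourantAlgebroid.pair_apply, hval]
    simp only [map_sum, map_smul, LinearMap.sum_apply, LinearMap.smul_apply]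
    rfl
  -- Each condition is affine in the operation, with an inhomogeneous term `R` common to all `N k`.
  -- Weights of sum one preserve such conditions, and the weights themselves are never
  -- differentiated.
  refine ⟨fun u v f => ?_, fun u v w => ?_, fun u v w => ?_, fun u v => ?_, fun u => ?_⟩
  · have h := sum_smul_eq_of_forall hψ hN (L := fun k => N k u (smulSec f v) x - f x • N k u v x) (R := C.act u f x • v x)
      fun k h => by rw [h.leibniz]; simp
    rw [hval, hval]
    simp only [smul_sub, Finset.sum_sub_distrib, smul_comm _ (f x), ← Finset.smul_sum] at h
    rw [← h]; abel
  · have h := sum_smul_eq_of_forall hψ hN (L := fun k => C.pair (N k u v) w x + C.pair (N k u w) v x)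
      (R := C.act u (C.pair v w) x) fun k h => by rw [h.metric, C.pair_symm v]
    simp only [smul_add, Finset.sum_add_distrib] at h
    rw [← h, C.pair_symm v, hpair, hpair]
  · have h := sum_smul_eq_of_forall hψ hN (L := fun k => C.pair (N k u v) w x - C.pair (N k v u) w x + C.pair (N k w u) v x)
      (R := C.pair (C.bracket u v) w x) fun k h => by linear_combination h.torsion u v w
    simp only [smul_add, smul_sub, Finset.sum_add_distrib, Finset.sum_sub_distrib] at h
    rw [hpair, hpair, hpair]
    linear_combination h
  · have h := sum_smul_eq_of_forall hψ hN (L := fun k => N k u (G.app v) x - G.toFun x (N k u v x)) (R := 0)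
      fun k h => by rw [h.compat, sub_self]
    rw [hval, hval, map_sum]
    simp only [smul_sub, Finset.sum_sub_distrib] at h
    simp only [map_smul]
    exact sub_eq_zero.1 h
  · have h := sum_smul_eq_of_forall hψ hN (L := fun k => C.contract x
      (fun a b => C.pairing x a (N k (sectionThrough n F x b) u x))) fun k h => h.div u
    rw [← h]
    simp only [CourantAlgebroid.contract, hval, map_sum, map_smul, Finset.smul_sum]
    exact Finset.sum_comm

/-- Local connections built from adapted frames are glued with a partition of unity subordinate to a
finite cover. -/
theorem nonempty_leviCivita [T2Space M] [CompactSpace M] {G : GenPseudometric C}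
    (hG : G.IsStrictlyPositive) (σ : PosHalfDensity n M) : (LeviCivita G σ).Nonempty := by
  choose p q U e hp hq _ hxU he using exists_adapted_frame (n := n) (F := F) hG
  obtain ⟨t, ht⟩ := isCompact_univ.elim_nhds_subcover U
    fun x _ => (he x).isOpen.mem_nhds (hxU x)
  obtain ⟨ψ, hψ⟩ := SmoothPartitionOfUnity.exists_isSubordinate (𝓡 n) isClosed_univ
    (fun k : t => U k) (fun k => (he k).isOpen) (fun x hx => by
      obtain ⟨k, hk, hxk⟩ := mem_iUnion₂.1 (ht.2 hx)
      exact mem_iUnion.2 ⟨⟨k, hk⟩, hxk⟩)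
  let N (k : t) := IsAdaptedFrame.frameConn C (e k) (IsAdaptedFrame.leviCivitaCoeff C (e k) σ)
  have hN (x : M) : IsLeviCivitaAt G σ x fun u v => ∑ k, smulSec (ψ k) (N k u v) := by
    refine IsLeviCivitaAt.sum ?_ fun k hk => ?_
    · rw [← finsum_eq_sum_of_fintype]
      exact ψ.sum_eq_one (mem_univ x)
    · exact (he k).isLeviCivitaAt_leviCivitaCoeff (hψ k (subset_tsupport _ hk)) σ
        (by simpa using hp k) (by simpa using hq k)
  let D : Connection C :=
    { toFun := LinearMap.mk₂ ℝ (fun u v => ∑ k, smulSec (ψ k) (N k u v))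
        (fun u u' v => by
          simp only [N, IsAdaptedFrame.frameConn_add_left, smulSec_add, Finset.sum_add_distrib])
        (fun r u v => by
          ext x
          simp only [N, const_smul_eq_smulSec, IsAdaptedFrame.frameConn_smul_left,
            sum_section_apply, smulSec_apply, Finset.smul_sum]
          exact Finset.sum_congr rfl fun k _ => smul_comm _ _ _)
        (fun u v v' => by
          simp only [N, IsAdaptedFrame.frameConn_add_right, smulSec_add, Finset.sum_add_distrib])
        (fun r u v => by
          ext x
          simp only [N, IsAdaptedFrame.frameConn_const_smul_right]
          rw [ContMDiffSection.coe_smul, Pi.smul_apply]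
          simp only [sum_section_apply, smulSec_apply, Finset.smul_sum]
          exact Finset.sum_congr rfl fun k _ => smul_comm _ _ _)
      smul_left := fun f u v => by
        ext x
        simp only [N, LinearMap.mk₂_apply, IsAdaptedFrame.frameConn_smul_left,
            sum_section_apply, smulSec_apply, Finset.smul_sum]
        exact Finset.sum_congr rfl fun k _ => smul_comm _ _ _
      leibniz := fun u v f x => (hN x).leibniz u v f
      metric := fun u v w x => (hN x).metric u v w }
  refine ⟨D, fun u v w x => ?_, fun u v => ?_, fun u x => (hN x).div u⟩
  · have h := (hN x).torsion u v w
    simp only [map_sub, LinearMap.sub_apply]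
    exact h
  · ext x
    exact (hN x).compat u v

/-- The curvatures are those of any Levi-Civita connection. -/
theorem exists_leviCivita [T2Space M] [CompactSpace M] {G : GenPseudometric C}
    (hG : G.IsStrictlyPositive) (σ : PosHalfDensity n M) : ∃ D ∈ LeviCivita G σ,
      (∀ x v u, ricci G σ x v u = D.ricci G x v u) ∧ ∀ x, scalarCurvature G σ x = D.scalar G x := by
  have h := nonempty_leviCivita hG σ
  refine ⟨h.some, h.some_mem, fun x v u => ?_, fun x => ?_⟩
  · rw [ricci, dif_pos h]
  · rw [scalarCurvature, dif_pos h]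

end LeviCivitaExistence

/-! ### Persistence of strict positivity -/

section Positivity

variable [FiniteDimensional ℝ F] {C : CourantAlgebroid n F E}

/-- By Cauchy–Schwarz a null vector of a non-negative form lies in its radical. Here the radical is
zero, since the pairing is non-degenerate and `G` is invertible. -/
theorem GenPseudometric.pos_of_nonneg (G : GenPseudometric C) {x : M}
    (h : ∀ v, 0 ≤ C.pairing x (G.toFun x v) v) {v : E x} (hv : v ≠ 0) :
    0 < C.pairing x (G.toFun x v) v := by
  refine lt_of_le_of_ne (h v) fun h0 => hv ?_
  let B : LinearMap.BilinForm ℝ (E x) := (C.pairing x).comp (G.toFun x) LinearMap.id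
  have hB : LinearMap.IsSymm B := ⟨fun u w => by
    change C.pairing x (G.toFun x u) w = C.pairing x (G.toFun x w) u
    rw [G.symm, C.pairing_symm]⟩
  have h1 (w : E x) : C.pairing x (G.toFun x v) w = 0 := by
    have h2 := B.apply_sq_le_of_symm h hB v w
    have h3 : B v v = 0 := h0.symm
    rw [h3, zero_mul] at h2
    exact pow_eq_zero_iff two_ne_zero |>.1 (le_antisymm h2 (sq_nonneg _))
  have h4 : G.toFun x v = 0 := (C.pairing_nondegenerate x).1 _ h1
  rw [← G.invol x v, h4, map_zero]

/-- For each fibre the set of times of strict positivity is open by compactness of the unit sphere.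
It is closed because a limit of positive forms is non-negative and hence strictly positive by
`GenPseudometric.pos_of_nonneg`. The interval J is connected. -/
theorem isStrictlyPositive_of_continuousOn {J : Set ℝ} (hJ : J.OrdConnected)
    {G : ℝ → GenPseudometric C}
    (hc : ∀ x (v u : E x), ContinuousOn (fun t => C.pairing x v ((G t).toFun x u)) J)
    {t₀ : ℝ} (ht₀ : t₀ ∈ J) (h₀ : (G t₀).IsStrictlyPositive) {t : ℝ} (ht : t ∈ J) :
    (G t).IsStrictlyPositive := by
  intro x
  have hcJ (v u : E x) : Continuous fun t : J => C.pairing x v ((G t).toFun x u) :=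
    (hc x v u).domRestrict
  set S : Set J := {t | ∀ v : E x, v ≠ 0 → 0 < C.pairing x ((G t).toFun x v) v}
  have hcl : IsClosed S := by
    have hS : S = ⋂ v : E x, {t : J | 0 ≤ C.pairing x v ((G t).toFun x v)} := by
      ext t
      simp only [S, mem_ofPred_eq, mem_iInter, ← (G t).symm]
      refine ⟨fun h v => ?_, fun h v hv => (G t).pos_of_nonneg h hv⟩
      by_cases hv : v = 0
      · simp [hv]
      · exact (h v hv).le
    rw [hS]
    exact isClosed_iInter fun v => isClosed_le continuous_const (hcJ v v)
  have hop : IsOpen S := by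
    rw [isOpen_iff_mem_nhds]
    intro t ht
    set b := fiberBasis F E x
    set q : J × (Fin (finrank ℝ F) → ℝ) → ℝ := fun p =>
      ∑ i, ∑ j, p.2 i * (p.2 j * C.pairing x (b i) ((G p.1).toFun x (b j))) with hq
    have hqc : Continuous q := by
      refine continuous_finsetSum _ fun i _ => continuous_finsetSum _ fun j _ => ?_
      exact ((continuous_apply i).comp continuous_snd).mul (((continuous_apply j).comp
        continuous_snd).mul ((hcJ _ _).comp continuous_fst))
    have hqe (t : J) (c : Fin (finrank ℝ F) → ℝ) : q (t, c) =
        C.pairing x ((G t).toFun x (∑ i, c i • b i)) (∑ i, c i • b i) := by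
      rw [(G t).symm]
      simp only [hq, map_sum, map_smul, LinearMap.sum_apply, LinearMap.smul_apply, smul_eq_mul,
        Finset.mul_sum]
      rw [Finset.sum_comm]
      exact Finset.sum_congr rfl fun _ _ => Finset.sum_congr rfl fun _ _ => mul_left_comm _ _ _
    have hb0 {c : Fin (finrank ℝ F) → ℝ} (hc : c ≠ 0) : ∑ i, c i • b i ≠ 0 := fun h =>
      hc (funext ((Fintype.linearIndependent_iff.1 b.linearIndependent) c h))
    -- Positivity at each point of the unit sphere of coordinates holds for nearby times and
    -- vectors; compactness gives one neighbourhood of times for the whole sphere. Homogeneity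
    -- covers the other vectors.
    have hev := (isCompact_sphere (0 : Fin (finrank ℝ F) → ℝ) 1).eventually_forall_of_forall_eventually
      (x₀ := t) (P := fun t c => 0 < q (t, c)) fun c hc => by
        refine hqc.continuousAt.eventually_const_lt ?_
        rw [hqe]
        refine ht _ (hb0 ?_)
        rintro rfl
        simp at hc
    filter_upwards [hev] with s hs v hv
    have hv' : v = ∑ i, b.repr v i • b i := (b.sum_repr v).symm
    set c : Fin (finrank ℝ F) → ℝ := fun i => b.repr v i
    have hc0 : c ≠ 0 := by
      intro h
      apply hv
      rw [hv']
      exact Finset.sum_eq_zero fun i _ => by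
        rw [show b.repr v i = 0 from congrFun h i, zero_smul]
    have hn : ‖c‖ ≠ 0 := norm_ne_zero_iff.2 hc0
    have h1 := hs (‖c‖⁻¹ • c) (by simp [norm_smul, hn])
    have h2 : v = ‖c‖ • ∑ i, (‖c‖⁻¹ • c) i • b i := by
      conv_lhs => rw [hv']
      rw [Finset.smul_sum]
      refine Finset.sum_congr rfl fun i _ => ?_
      rw [smul_smul, Pi.smul_apply, smul_eq_mul, ← mul_assoc, mul_inv_cancel₀ hn, one_mul]
    rw [hqe] at h1
    rw [h2]
    simp only [map_smul, LinearMap.smul_apply, smul_eq_mul]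
    positivity
  have : PreconnectedSpace J := Subtype.preconnectedSpace hJ.isPreconnected
  have hS := IsClopen.eq_univ ⟨hcl, hop⟩ ⟨⟨t₀, ht₀⟩, h₀ x⟩
  have hm : (⟨t, ht⟩ : J) ∈ S := hS ▸ mem_univ _
  exact hm

end Positivity

/-! ### Transfer to a coordinate chart -/

section ChartTransfer

theorem SmoothFun.sum_apply {V : Type*} {W : Set V} [NormedAddCommGroup V] [NormedSpace ℝ V]
    {ι : Type*} (s : Finset ι) (f : ι → SmoothFun W) (x : W) :
    ((∑ i ∈ s, f i : SmoothFun W) : W → ℝ) x = ∑ i ∈ s, (f i : W → ℝ) x :=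
  map_sum ((Pi.evalAlgHom ℝ (fun _ : W => ℝ) x).comp (SmoothFun W).val) f s

/-- The part of the target of the preferred chart at `c` corresponding to `U`. -/
def chartDomain (n : ℕ) {M : Type*} [TopologicalSpace M]
    [ChartedSpace (EuclideanSpace ℝ (Fin n)) M] (c : M) (U : Set M) : Set (EuclideanSpace ℝ (Fin n)) :=
  (extChartAt (𝓡 n) c).target ∩ (extChartAt (𝓡 n) c).symm ⁻¹' U

/-- The smooth functions on `chartDomain n c U`. -/
abbrev ChartFun (n : ℕ) {M : Type*} [TopologicalSpace M]
    [ChartedSpace (EuclideanSpace ℝ (Fin n)) M] (c : M) (U : Set M) :=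
  SmoothFun (chartDomain n c U)

variable {c : M} {U : Set M}

theorem isOpen_chartDomain (c : M) (hU : IsOpen U) :
    IsOpen (chartDomain n c U) :=
  (continuousOn_extChartAt_symm c).isOpen_inter_preimage (isOpen_chart_target c) hU

theorem symm_mem_source (y : (chartDomain n c U)) :
    (extChartAt (𝓡 n) c).symm y ∈ (chartAt (EuclideanSpace ℝ (Fin n)) c).source :=
  symm_mem_chart_source y.2.1

theorem extChartAt_symm_coe (y : (chartDomain n c U)) :
    extChartAt (𝓡 n) c ((extChartAt (𝓡 n) c).symm y) = y :=
  (extChartAt (𝓡 n) c).right_inv y.2.1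

theorem contDiffOn_comp_symm {f : M → ℝ} (hf : ContMDiff (𝓡 n) 𝓘(ℝ, ℝ) ∞ f) :
    ContDiffOn ℝ ∞ (f ∘ (extChartAt (𝓡 n) c).symm) (chartDomain n c U) := by
  intro y hy
  have h := contDiffAt_of_contMDiffAt (symm_mem_source ⟨y, hy⟩) (hf.contMDiffAt)
  rw [extChartAt_symm_coe ⟨y, hy⟩] at h
  exact h.contDiffWithinAt

variable (c U) in
/-- The coordinate expression of smooth functions. -/
def toChart : C^∞⟮𝓡 n, M; ℝ⟯ →ₐ[ℝ] ChartFun n c U where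
  toFun g := SmoothFun.mk _ (contDiffOn_comp_symm g.contMDiff)
  map_one' := rfl
  map_mul' _ _ := rfl
  map_zero' := rfl
  map_add' _ _ := rfl
  commutes' _ := rfl

theorem toChart_apply (g : C^∞⟮𝓡 n, M; ℝ⟯) (y : (chartDomain n c U)) :
    (toChart c U g : _ → ℝ) y = g ((extChartAt (𝓡 n) c).symm y) := rfl

theorem toChart_congr {g g' : C^∞⟮𝓡 n, M; ℝ⟯} (h : ∀ x ∈ U, g x = g' x) :
    toChart c U g = toChart c U g' := by
  ext y
  exact h _ y.2.2

variable (c) in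
/-- The coordinate derivatives. -/
def chartDeriv (hU : IsOpen U) (l : Fin n) :
    Derivation ℝ (ChartFun n c U)
      (ChartFun n c U) :=
  SmoothFun.pd (isOpen_chartDomain c hU).uniqueDiffOn (EuclideanSpace.single l 1)

variable (C : CourantAlgebroid n F E)

theorem contDiffOn_anchor (u : Cₛ^∞⟮𝓡 n; F, E⟯) :
    ContDiffOn ℝ ∞ (chartVec c fun x => C.anchor x (u x))
      (chartDomain n c U) :=
  (contDiffOn_chartVec c (C.anchor_smooth u)).mono inter_subset_left

theorem contDiff_coord (l : Fin n) : ContDiff ℝ ∞ fun y : EuclideanSpace ℝ (Fin n) => y l :=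
  (EuclideanSpace.proj (𝕜 := ℝ) l).contDiff

theorem contDiffOn_anchorCoord (u : Cₛ^∞⟮𝓡 n; F, E⟯) (l : Fin n) :
    ContDiffOn ℝ ∞ (fun y => chartVec c (fun x => C.anchor x (u x)) y l)
      (chartDomain n c U) :=
  (contDiff_coord l).comp_contDiffOn (contDiffOn_anchor C u)

variable (c U) in
/-- The coordinates of the anchor of a section. -/
def anchorCoord (u : Cₛ^∞⟮𝓡 n; F, E⟯) (l : Fin n) :
    ChartFun n c U :=
  SmoothFun.mk (fun y => chartVec c (fun x => C.anchor x (u x)) y l) (contDiffOn_anchorCoord C u l)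

theorem contDiffOn_logDens (σ : PosHalfDensity n M) :
    ContDiffOn ℝ ∞ (fun y => Real.log (σ.chartDens c y ^ 2)) (chartDomain n c U) :=
  (((contDiffOn_chartDens σ c).mono inter_subset_left).pow 2).log fun y hy =>
    pow_ne_zero 2 (toFun_coordFrame_pos σ (symm_mem_source ⟨y, hy⟩)).ne'

variable (c U) in
/-- The logarithm of the density `σ²` in coordinates. -/
def logDens (σ : PosHalfDensity n M) : ChartFun n c U :=
  SmoothFun.mk _ (contDiffOn_logDens σ)

theorem euclidean_eq_sum (v : EuclideanSpace ℝ (Fin n)) :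
    v = ∑ l, v l • EuclideanSpace.single l (1 : ℝ) := by
  ext k
  simp [Pi.single_apply]

theorem chartDeriv_apply (hU : IsOpen U) (l : Fin n)
    (h : ChartFun n c U)
    (y : (chartDomain n c U)) :
    (chartDeriv c hU l h : _ → ℝ) y =
      fderiv ℝ (extendZero h.1) y.1 (EuclideanSpace.single l 1) := by
  rw [chartDeriv, SmoothFun.pd_apply, fderivWithin_of_isOpen (isOpen_chartDomain c hU) y.2]

theorem chartDeriv_mk_apply (hU : IsOpen U) (l : Fin n) (g : EuclideanSpace ℝ (Fin n) → ℝ)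
    (hg : ContDiffOn ℝ ∞ g (chartDomain n c U))
    (y : (chartDomain n c U)) :
    (chartDeriv c hU l (SmoothFun.mk g hg) : _ → ℝ) y =
      fderiv ℝ g y (EuclideanSpace.single l 1) := by
  rw [chartDeriv, SmoothFun.pd_mk_apply, fderivWithin_of_isOpen (isOpen_chartDomain c hU) y.2]

theorem vectorField_chart_apply (hU : IsOpen U) (u : Cₛ^∞⟮𝓡 n; F, E⟯)
    (h : ChartFun n c U)
    (y : (chartDomain n c U)) :
    (vectorField (B := ChartFun n c U) (chartDeriv c hU) (anchorCoord c U C u) h : _ → ℝ) y =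
      fderiv ℝ (extendZero h.1) y.1 (chartVec c (fun x => C.anchor x (u x)) y) := by
  conv_rhs => rw [euclidean_eq_sum (chartVec c (fun x => C.anchor x (u x)) y), map_sum]
  rw [vectorField_apply, SmoothFun.sum_apply]
  refine Finset.sum_congr rfl fun l _ => ?_
  rw [map_smul, smul_eq_mul, ← chartDeriv_apply hU]
  rfl

theorem act_eq_vectorField (hU : IsOpen U) (u : Cₛ^∞⟮𝓡 n; F, E⟯) {g : C^∞⟮𝓡 n, M; ℝ⟯}
    {h : ChartFun n c U}
    {y : (chartDomain n c U)}
    (hgh : ∀ᶠ z in nhds ((extChartAt (𝓡 n) c).symm y),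
      g z = extendZero h.1 (extChartAt (𝓡 n) c z)) :
    C.act u g ((extChartAt (𝓡 n) c).symm y) =
      (vectorField (B := ChartFun n c U) (chartDeriv c hU) (anchorCoord c U C u) h : _ → ℝ) y := by
  rw [vectorField_chart_apply, CourantAlgebroid.act_apply,
    mvfderiv_eq_fderiv (symm_mem_source y) g.contMDiff.contMDiffAt, extChartAt_symm_coe]
  have hy := (isOpen_chart_target c).mem_nhds y.2.1
  have hev : g ∘ (extChartAt (𝓡 n) c).symm =ᶠ[nhds y.1] extendZero h.1 := by
    have ht := (continuousOn_extChartAt_symm (I := 𝓡 n) c).continuousAt hy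
    filter_upwards [ht.eventually hgh, hy] with z hz hz'
    rw [Function.comp_apply, hz, (extChartAt (𝓡 n) c).right_inv hz']
  rw [hev.fderiv_eq]
  rfl

theorem toChart_act (hU : IsOpen U) (u : Cₛ^∞⟮𝓡 n; F, E⟯) (g : C^∞⟮𝓡 n, M; ℝ⟯) :
    toChart c U (C.act u g) =
      vectorField (B := ChartFun n c U) (chartDeriv c hU) (anchorCoord c U C u) (toChart c U g) := by
  ext y
  refine act_eq_vectorField C hU u ?_
  filter_upwards [(hU.inter (chartAt (EuclideanSpace ℝ (Fin n)) c).open_source).mem_nhds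
    ⟨y.2.2, symm_mem_source y⟩] with z hz
  have hz' := (extChartAt (𝓡 n) c).left_inv (x := z) (by rw [extChartAt_source]; exact hz.2)
  rw [extendZero_of_mem _ (show extChartAt (𝓡 n) c z ∈ chartDomain n c U from
    ⟨extChartAt_mem_target hz.2, by rw [mem_preimage, hz']; exact hz.1⟩), toChart_apply]
  simp only [hz']

/-- The coordinate functions. -/
def coordFun (c : M) (U : Set M) (l : Fin n) :
    ChartFun n c U :=
  SmoothFun.mk (fun y => y l) (contDiff_coord l).contDiffOn

theorem vectorField_coordFun (hU : IsOpen U) (u : Cₛ^∞⟮𝓡 n; F, E⟯) (l : Fin n) :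
    vectorField (B := ChartFun n c U) (chartDeriv c hU) (anchorCoord c U C u) (coordFun c U l) =
      anchorCoord c U C u l := by
  ext y
  rw [vectorField_apply, SmoothFun.sum_apply]
  have h (k : Fin n) : (chartDeriv c hU k (coordFun c U l) : _ → ℝ) y = if k = l then 1 else 0 := by
    rw [coordFun, chartDeriv_mk_apply]
    have : fderiv ℝ (fun y : EuclideanSpace ℝ (Fin n) => y l) (y : EuclideanSpace ℝ (Fin n)) =
        EuclideanSpace.proj l := (EuclideanSpace.proj (𝕜 := ℝ) l).fderiv
    rw [this]
    simp [eq_comm]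
  change ∑ k, (anchorCoord c U C u k : _ → ℝ) y * (chartDeriv c hU k (coordFun c U l) : _ → ℝ) y = _
  simp [h]

/-- Sections act on globally defined functions. Cut-off coordinates allow components of anchors to
be treated as such derivatives. -/
theorem exists_coord [T2Space M] {x : M} (hx : x ∈ (chartAt (EuclideanSpace ℝ (Fin n)) c).source)
    (l : Fin n) : ∃ g : C^∞⟮𝓡 n, M; ℝ⟯, ∀ᶠ z in nhds x, g z = extChartAt (𝓡 n) c z l := by
  obtain ⟨χ, hχ1, hχ2⟩ := exists_cutoff (n := n) (extChartAt_mem_nhds hx)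
  have hsm : ContMDiff (𝓡 n) 𝓘(ℝ, ℝ) ∞ fun z => χ z • extChartAt (𝓡 n) c z l := by
    refine contMDiff_of_tsupport fun z hz => ?_
    have hz' := hχ2 (tsupport_smul_subset_left _ _ hz)
    refine χ.contMDiff.contMDiffAt.smul ?_
    exact (contDiff_coord l).contMDiff.contMDiffAt.comp z
      (contMDiffAt_extChartAt' (I := 𝓡 n) hz')
  refine ⟨⟨_, hsm⟩, ?_⟩
  filter_upwards [hχ1] with z hz
  change χ z • (extChartAt (𝓡 n) c z l : ℝ) = _
  rw [hz, one_smul]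

theorem toChart_divFun [FiniteDimensional ℝ F] (hU : IsOpen U) (σ : PosHalfDensity n M)
    (u : Cₛ^∞⟮𝓡 n; F, E⟯) : toChart c U (C.divFun σ u) =
      divergence (B := ChartFun n c U) (chartDeriv c hU) (logDens c U σ) (anchorCoord c U C u) := by
  ext y
  rw [toChart_apply, CourantAlgebroid.divFun_apply,
    σ.div_eq (C.anchor_smooth u) (symm_mem_source y), extChartAt_symm_coe, divergence]
  have hadd (f g : ChartFun n c U) :
      ((f + g : SmoothFun _) : _ → ℝ) y = (f : _ → ℝ) y + (g : _ → ℝ) y := rfl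
  rw [hadd, vectorField_chart_apply, SmoothFun.sum_apply]
  congr 1
  · rw [LinearMap.trace_eq_sum_inner _ (EuclideanSpace.basisFun (Fin n) ℝ)]
    refine Finset.sum_congr rfl fun l _ => ?_
    rw [anchorCoord, chartDeriv_mk_apply]
    have hd := ((contDiffOn_anchor (U := U) C u).contDiffAt
      ((isOpen_chartDomain c hU).mem_nhds y.2)).differentiableAt (by simp)
    have h2 := ((EuclideanSpace.proj (𝕜 := ℝ) l).hasFDerivAt.comp (y : EuclideanSpace ℝ (Fin n))
      hd.hasFDerivAt).fderiv
    refine Eq.trans ?_ (congrArg (fun L => L (EuclideanSpace.single l (1 : ℝ))) h2.symm)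
    simp [EuclideanSpace.inner_single_left]
  · congr 1
    refine (Filter.EventuallyEq.fderiv_eq ?_).symm
    filter_upwards [(isOpen_chartDomain c hU).mem_nhds y.2] with z hz
    exact eqOn_extendZero (fun y => Real.log (σ.chartDens c y ^ 2)) hz

end ChartTransfer

/-! ### Curvature in a coordinate chart -/

section ChartCurvature

variable {P Q : Type*} [Fintype P] [Fintype Q] [DecidableEq P] [DecidableEq Q]
  [FiniteDimensional ℝ F] {C : CourantAlgebroid n F E} {c : M}

namespace IsAdaptedFrame

variable {G : GenPseudometric C} {U : Set M} {e : P ⊕ Q → Cₛ^∞⟮𝓡 n; F, E⟯}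

variable (C c U e) in
/-- The coordinate expressions of the structure functions. -/
def chartStructure (A₁ A₂ A₃ : P ⊕ Q) : ChartFun n c U := toChart c U (structureFun C e A₁ A₂ A₃)

theorem sgn_mul_apply {V : Type*} {W : Set V} [NormedAddCommGroup V] [NormedSpace ℝ V]
    (A : P ⊕ Q) (f : SmoothFun W) (y : W) :
    (sgn P Q (SmoothFun W) A * f).1 y = sgn P Q ℝ A * f.1 y := by
  rcases A with a | i
  · simp
  · simp

theorem sum_sgn_mul_apply {V : Type*} {W : Set V} [NormedAddCommGroup V] [NormedSpace ℝ V]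
    (f : P ⊕ Q → SmoothFun W) (y : W) :
    (∑ A, sgn P Q (SmoothFun W) A * f A).1 y = ∑ A, sgn P Q ℝ A * (f A).1 y := by
  rw [SmoothFun.sum_apply]
  exact Finset.sum_congr rfl fun A _ => sgn_mul_apply A _ y

theorem act_eq_anchorCoord (hU : IsOpen U) (u : Cₛ^∞⟮𝓡 n; F, E⟯) {g : C^∞⟮𝓡 n, M; ℝ⟯} {l : Fin n}
    {y : chartDomain n c U}
    (hg : ∀ᶠ z in nhds ((extChartAt (𝓡 n) c).symm y), g z = extChartAt (𝓡 n) c z l) :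
    ∀ᶠ z in nhds ((extChartAt (𝓡 n) c).symm y),
      C.act u g z = extendZero (anchorCoord c U C u l).1 (extChartAt (𝓡 n) c z) := by
  filter_upwards [hg.eventually_nhds, (hU.inter (chartAt (EuclideanSpace ℝ (Fin n)) c).open_source).mem_nhds
    ⟨y.2.2, symm_mem_source y⟩] with z hz hzU
  have hz' := (extChartAt (𝓡 n) c).left_inv (x := z) (by rw [extChartAt_source]; exact hzU.2)
  have hmem : extChartAt (𝓡 n) c z ∈ chartDomain n c U :=
    ⟨extChartAt_mem_target hzU.2, by rw [mem_preimage, hz']; exact hzU.1⟩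
  have h := act_eq_vectorField C hU u (g := g) (h := coordFun c U l)
    (y := ⟨extChartAt (𝓡 n) c z, hmem⟩) (by
      simp only [hz']
      filter_upwards [hz, (hU.inter (chartAt (EuclideanSpace ℝ (Fin n)) c).open_source).mem_nhds hzU]
        with w hw hwU
      have hw' := (extChartAt (𝓡 n) c).left_inv (x := w) (by rw [extChartAt_source]; exact hwU.2)
      rw [hw]
      exact (eqOn_extendZero (fun y : EuclideanSpace ℝ (Fin n) => y l)
        (⟨extChartAt_mem_target hwU.2, by rw [mem_preimage, hw']; exact hwU.1⟩ :
          extChartAt (𝓡 n) c w ∈ chartDomain n c U)).symm)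
  rw [vectorField_coordFun] at h
  simp only [hz'] at h
  rw [h, extendZero_of_mem _ hmem]

/-- The identities between anchors are obtained by applying the corresponding identities for
derivatives of functions to cut-off coordinates. -/
theorem chartFrame [T2Space M] (H : IsAdaptedFrame G U e) :
    ChartFrame (B := ChartFun n c U) (chartDeriv c H.isOpen)
      (fun A => anchorCoord c U C (e A)) (chartStructure C c U e) where
  swap₁₂ A₁ A₂ A₃ := by
    ext y
    exact H.structureFun_swap₁₂ y.2.2 A₁ A₂ A₃
  swap₂₃ A₁ A₂ A₃ := by
    ext y
    exact H.structureFun_swap₂₃ y.2.2 A₁ A₂ A₃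
  anchor_bracket A₁ A₂ l := by
    ext y
    obtain ⟨g, hg⟩ := exists_coord (symm_mem_source y) l
    have h := H.act_bracket_expand y.2.2 A₁ A₂ g
    rw [act_eq_vectorField C H.isOpen (e A₁) (act_eq_anchorCoord H.isOpen (e A₂) hg),
      act_eq_vectorField C H.isOpen (e A₂) (act_eq_anchorCoord H.isOpen (e A₁) hg)] at h
    have hy : extendZero (anchorCoord c U C (e A₁) l).1 y = (anchorCoord c U C (e A₁) l).1 y :=
      extendZero_coe _ y
    rw [sum_sgn_mul_apply]
    refine h.trans (Finset.sum_congr rfl fun A _ => ?_)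
    rw [(act_eq_anchorCoord H.isOpen (e A) hg).self_of_nhds, extChartAt_symm_coe, extendZero_coe]
    rfl
  jacobi A₁ A₂ A₃ A₄ := by
    simp only [chartStructure, ← toChart_act]
    ext y
    rw [sum_sgn_mul_apply]
    exact H.structureFun_jacobi y.2.2 A₁ A₂ A₃ A₄
  anchor_isotropic l l' := by
    ext y
    obtain ⟨g, hg⟩ := exists_coord (symm_mem_source y) l
    obtain ⟨g', hg'⟩ := exists_coord (symm_mem_source y) l'
    have h := H.anchor_isotropic y.2.2 g g'
    rw [sum_sgn_mul_apply]
    refine Eq.trans (Finset.sum_congr rfl fun A _ => ?_) h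
    rw [(act_eq_anchorCoord H.isOpen (e A) hg).self_of_nhds,
      (act_eq_anchorCoord H.isOpen (e A) hg').self_of_nhds, extChartAt_symm_coe, extendZero_coe,
      extendZero_coe]
    rfl

theorem chartDeriv_comm (hU : IsOpen U) (l l' : Fin n) (f : ChartFun n c U) :
    chartDeriv c hU l (chartDeriv c hU l' f) = chartDeriv c hU l' (chartDeriv c hU l f) :=
  SmoothFun.pd_comm _ (by
    rw [(isOpen_chartDomain c hU).interior_eq]
    exact subset_closure) _ _ f

/-- The right side involves only the frame and the density. Thus the value is the same for every
Levi-Civita connection, and it depends smoothly on the point. -/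
theorem six_scalar_chart [T2Space M] (H : IsAdaptedFrame G U e) {σ : PosHalfDensity n M}
    {D : Connection C} (hD : D ∈ LeviCivita G σ) (y : chartDomain n c U) :
    6 * D.scalar G ((extChartAt (𝓡 n) c).symm y) =
      (sixScalar (B := ChartFun n c U) (chartDeriv c H.isOpen) (logDens c U σ)
        (fun A => anchorCoord c U C (e A)) (chartStructure C c U e)).1 y := by
  rw [H.six_scalar_eq y.2.2 hD]
  have hsub (f g : ChartFun n c U) : (f - g).1 y = f.1 y - g.1 y := rfl
  have hadd (f g : ChartFun n c U) : (f + g).1 y = f.1 y + g.1 y := rfl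
  have hmul (f g : ChartFun n c U) : (f * g).1 y = f.1 y * g.1 y := rfl
  have hneg (f : ChartFun n c U) : (-f).1 y = -f.1 y := rfl
  have h6 : (6 : ChartFun n c U).1 y = 6 := rfl
  have h3 : (3 : ChartFun n c U).1 y = 3 := rfl
  simp only [sixScalar, halfScalar, ← toChart_divFun, chartStructure, ← toChart_act, hadd, hsub,
    hmul, hneg, h6, h3, SmoothFun.sum_apply, neg_mul_neg]
  rfl

/-- The component is the sum of the mixed Ricci expressions of the two halves, which coincide by
`HalfFrame.mixedRicci_flip`. -/
theorem ricci_chart [T2Space M] (H : IsAdaptedFrame G U e) {σ : PosHalfDensity n M}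
    {D : Connection C} (hD : D ∈ LeviCivita G σ) (y : chartDomain n c U) (a : P) (i : Q) :
    D.ricci G ((extChartAt (𝓡 n) c).symm y) (e (Sum.inl a) ((extChartAt (𝓡 n) c).symm y))
      (e (Sum.inr i) ((extChartAt (𝓡 n) c).symm y)) =
      (2 * chartRicci (B := ChartFun n c U) (chartDeriv c H.isOpen) (logDens c U σ)
        (fun A => anchorCoord c U C (e A)) (chartStructure C c U e) a i).1 y := by
  have hflip := (H.chartFrame (c := c).halfFrame_pos (chartDeriv_comm H.isOpen)
    (logDens c U σ)).mixedRicci_flip a i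
  rw [H.ricci_mixed_eq y.2.2 hD, two_mul]
  have hsub (f g : ChartFun n c U) : (f - g).1 y = f.1 y - g.1 y := rfl
  have hadd (f g : ChartFun n c U) : (f + g).1 y = f.1 y + g.1 y := rfl
  have hmul (f g : ChartFun n c U) : (f * g).1 y = f.1 y * g.1 y := rfl
  have hneg (f : ChartFun n c U) : (-f).1 y = -f.1 y := rfl
  rw [hadd]
  congr 1
  · simp only [chartRicci, mixedRicci, ← toChart_divFun, chartStructure, ← toChart_act, hadd, hsub,
      hmul, SmoothFun.sum_apply]
    rfl
  · rw [chartRicci, ← hflip]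
    simp only [mixedRicci, ← toChart_divFun, chartStructure, map_neg, ← toChart_act, hadd, hsub,
      hmul, hneg, SmoothFun.sum_apply, neg_mul_neg]
    simp only [mul_neg, ← neg_add, Finset.sum_neg_distrib]
    rfl

end IsAdaptedFrame

end ChartCurvature

/-! ### Frames moving with the flow -/

section MovingSections

variable {P Q : Type*} [Fintype P] [Fintype Q] [DecidableEq P] [DecidableEq Q]
  [FiniteDimensional ℝ F] {C : CourantAlgebroid n F E} {c : M} {U : Set M}

theorem CourantAlgebroid.pair_sum_left (C : CourantAlgebroid n F E) {ι : Type*} (s : Finset ι)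
    (u : ι → Cₛ^∞⟮𝓡 n; F, E⟯) (w : Cₛ^∞⟮𝓡 n; F, E⟯) (x : M) :
    C.pair (∑ i ∈ s, u i) w x = ∑ i ∈ s, C.pair (u i) w x := by
  simp only [pair_apply, sum_section_apply, map_sum, LinearMap.sum_apply]

theorem CourantAlgebroid.pair_sum_right (C : CourantAlgebroid n F E) {ι : Type*} (s : Finset ι)
    (u : ι → Cₛ^∞⟮𝓡 n; F, E⟯) (w : Cₛ^∞⟮𝓡 n; F, E⟯) (x : M) :
    C.pair w (∑ i ∈ s, u i) x = ∑ i ∈ s, C.pair w (u i) x := by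
  simp only [pair_apply, sum_section_apply, map_sum]

theorem CourantAlgebroid.act_sum_smul (C : CourantAlgebroid n F E) {ι : Type*} (s : Finset ι)
    (m : ι → C^∞⟮𝓡 n, M; ℝ⟯) (u : ι → Cₛ^∞⟮𝓡 n; F, E⟯) (g : C^∞⟮𝓡 n, M; ℝ⟯) (x : M) :
    C.act (∑ i ∈ s, smulSec (m i) (u i)) g x = ∑ i ∈ s, m i x * C.act (u i) g x := by
  simp only [act_apply, sum_section_apply, smulSec_apply, map_sum, map_smul, smul_eq_mul]

/-- The sections `∑ m_{AB} f_B`. -/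
def movingFrame (m : P ⊕ Q → P ⊕ Q → C^∞⟮𝓡 n, M; ℝ⟯) (f : P ⊕ Q → Cₛ^∞⟮𝓡 n; F, E⟯)
    (A : P ⊕ Q) : Cₛ^∞⟮𝓡 n; F, E⟯ := ∑ B, smulSec (m A B) (f B)

theorem IsAdaptedFrame.congr {G : GenPseudometric C} {e e' : P ⊕ Q → Cₛ^∞⟮𝓡 n; F, E⟯}
    (H : IsAdaptedFrame G U e) (h : ∀ x ∈ U, ∀ A, e' A x = e A x) : IsAdaptedFrame G U e' where
  isOpen := H.isOpen
  ortho x hx A₁ A₂ := by rw [h x hx, h x hx, H.ortho x hx]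
  eigen x hx A := by rw [h x hx, H.eigen x hx]
  complete x hx v := by simpa only [h x hx] using H.complete x hx v

theorem IsAdaptedFrame.mono {G : GenPseudometric C} {V : Set M} {e : P ⊕ Q → Cₛ^∞⟮𝓡 n; F, E⟯}
    (H : IsAdaptedFrame G U e) (hV : IsOpen V) (h : V ⊆ U) : IsAdaptedFrame G V e :=
  ⟨hV, fun x hx => H.ortho x (h hx), fun x hx => H.eigen x (h hx), fun x hx => H.complete x (h hx)⟩

theorem sgn_smooth_apply (A : P ⊕ Q) (x : M) : sgn P Q C^∞⟮𝓡 n, M; ℝ⟯ A x = sgn P Q ℝ A := by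
  rcases A with a | i <;> rfl

/-- The bracket is expanded by the Leibniz rules in both slots. The derivative along the third frame
section comes from the anomalous term of the Leibniz rule in the first slot. -/
theorem IsAdaptedFrame.structureFun_movingFrame {G : GenPseudometric C}
    {f : P ⊕ Q → Cₛ^∞⟮𝓡 n; F, E⟯} (H : IsAdaptedFrame G U f)
    (m : P ⊕ Q → P ⊕ Q → C^∞⟮𝓡 n, M; ℝ⟯) {x : M} (hx : x ∈ U) (A₁ A₂ A₃ : P ⊕ Q) :
    structureFun C (movingFrame m f) A₁ A₂ A₃ x =
      movingStructure (fun A => C.act (movingFrame m f A)) m (structureFun C f) A₁ A₂ A₃ x := by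
  have hw (B : P ⊕ Q) : C.pair (f B) (movingFrame m f A₃) x = sgn P Q ℝ B * m A₃ B x := by
    rw [movingFrame, C.pair_sum_right]
    simp only [C.pair_smul_right, CourantAlgebroid.pair_apply, H.ortho x hx, mul_ite, mul_zero,
      Finset.sum_ite_eq, Finset.mem_univ, if_true]
    exact mul_comm _ _
  have h1 (B : P ⊕ Q) : C.pair (C.bracket (movingFrame m f A₁) (f B)) (movingFrame m f A₃) x =
      ∑ B₁, (m A₁ B₁ x * ∑ B₃, m A₃ B₃ x * structureFun C f B₁ B B₃ x) -
        ∑ B₁, sgn P Q ℝ B₁ * (C.act (f B) (m A₁ B₁) x * m A₃ B₁ x) +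
        sgn P Q ℝ B * C.act (movingFrame m f A₃) (m A₁ B) x := by
    conv_lhs => rw [show movingFrame m f A₁ = ∑ B, smulSec (m A₁ B) (f B) from rfl]
    rw [map_sum, LinearMap.sum_apply, C.pair_sum_left]
    simp only [C.pair_smul_bracket, hw, Finset.sum_add_distrib, Finset.sum_sub_distrib]
    congr 2
    · refine Finset.sum_congr rfl fun B₁ _ => ?_
      conv_lhs => rw [show movingFrame m f A₃ = ∑ B, smulSec (m A₃ B) (f B) from rfl]
      rw [C.pair_sum_right]
      simp only [C.pair_smul_right]
      rfl
    · exact Finset.sum_congr rfl fun _ _ => by ring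
    · simp only [CourantAlgebroid.pair_apply, H.ortho x hx, mul_ite, mul_zero, Finset.sum_ite_eq',
        Finset.mem_univ, if_true]
      exact mul_comm _ _
  have h2 (B : P ⊕ Q) : C.act (movingFrame m f A₂) (m A₁ B) x =
      ∑ B₂, m A₂ B₂ x * C.act (f B₂) (m A₁ B) x := C.act_sum_smul _ _ _ _ _
  rw [structureFun]
  conv_lhs => rw [show movingFrame m f A₂ = ∑ B, smulSec (m A₂ B) (f B) from rfl]
  rw [map_sum, C.pair_sum_left]
  simp only [C.bracket_smul, C.pair_add_left, C.pair_smul_left, hw, h1]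
  simp only [movingStructure, ContMDiffMap.coe_add, ContMDiffMap.coe_sub, ContMDiffMap.coe_mul,
    Pi.add_apply, Pi.sub_apply, Pi.mul_apply, smooth_sum_apply, sgn_smooth_apply, h2]
  simp only [mul_add, mul_sub, Finset.sum_add_distrib, Finset.sum_sub_distrib, Finset.mul_sum,
    Finset.sum_mul]
  have e1 : ∑ B₂, ∑ B₁, ∑ B₃, m A₂ B₂ x * (m A₁ B₁ x * (m A₃ B₃ x * structureFun C f B₁ B₂ B₃ x)) =
      ∑ B₁, ∑ B₂, ∑ B₃, m A₁ B₁ x * (m A₂ B₂ x * (m A₃ B₃ x * structureFun C f B₁ B₂ B₃ x)) := by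
    rw [Finset.sum_comm]
    simp only [mul_left_comm (m A₂ _ x)]
  have e2 : ∑ B₂, ∑ B₁, m A₂ B₂ x * (sgn P Q ℝ B₁ * (C.act (f B₂) (m A₁ B₁) x * m A₃ B₁ x)) =
      ∑ B₁, ∑ B₂, sgn P Q ℝ B₁ * (m A₂ B₂ x * C.act (f B₂) (m A₁ B₁) x * m A₃ B₁ x) := by
    rw [Finset.sum_comm]
    exact Finset.sum_congr rfl fun _ _ => Finset.sum_congr rfl fun _ _ => by ring
  have e3 : ∑ B, m A₂ B x * (sgn P Q ℝ B * C.act (movingFrame m f A₃) (m A₁ B) x) =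
      ∑ B, sgn P Q ℝ B * (C.act (movingFrame m f A₃) (m A₁ B) x * m A₂ B x) :=
    Finset.sum_congr rfl fun _ _ => by ring
  have e4 : ∑ B, C.act (movingFrame m f A₁) (m A₂ B) x * (sgn P Q ℝ B * m A₃ B x) =
      ∑ B, sgn P Q ℝ B * (C.act (movingFrame m f A₁) (m A₂ B) x * m A₃ B x) :=
    Finset.sum_congr rfl fun _ _ => by ring
  rw [e1, e2, e3, e4]
  ring

theorem anchorCoord_movingFrame (m : P ⊕ Q → P ⊕ Q → C^∞⟮𝓡 n, M; ℝ⟯)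
    (f : P ⊕ Q → Cₛ^∞⟮𝓡 n; F, E⟯) (A : P ⊕ Q) (l : Fin n) :
    anchorCoord c U C (movingFrame m f A) l = movingAnchor (fun A B => toChart c U (m A B))
      (fun B => anchorCoord c U C (f B)) A l := by
  ext y
  rw [movingAnchor, SmoothFun.sum_apply]
  have hL := symm_mem_source y
  set L := Trivialization.continuousLinearEquivAt ℝ (trivializationAt (EuclideanSpace ℝ (Fin n))
    (TangentSpace (𝓡 n) (M := M)) c) _ hL
  change L (C.anchor _ (movingFrame m f A _)) l = ∑ B, m A B _ * L (C.anchor _ (f B _)) l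
  simp only [movingFrame, sum_section_apply, smulSec_apply, map_sum, map_smul]
  simp

theorem toChart_movingStructure (hU : IsOpen U) (m : P ⊕ Q → P ⊕ Q → C^∞⟮𝓡 n, M; ℝ⟯)
    (f : P ⊕ Q → Cₛ^∞⟮𝓡 n; F, E⟯) (k : P ⊕ Q → P ⊕ Q → P ⊕ Q → C^∞⟮𝓡 n, M; ℝ⟯)
    (A₁ A₂ A₃ : P ⊕ Q) :
    toChart c U (movingStructure (fun A => C.act (movingFrame m f A)) m k A₁ A₂ A₃) =
      movingStructure (A := ChartFun n c U) (fun A => vectorField (B := ChartFun n c U)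
        (chartDeriv c hU) (anchorCoord c U C (movingFrame m f A)))
        (fun A B => toChart c U (m A B)) (fun A₁ A₂ A₃ => toChart c U (k A₁ A₂ A₃)) A₁ A₂ A₃ := by
  have hs (A : P ⊕ Q) : toChart c U (sgn P Q C^∞⟮𝓡 n, M; ℝ⟯ A) = sgn P Q (ChartFun n c U) A := by
    rcases A with a | i <;> simp
  simp only [movingStructure, map_add, map_sum, map_mul, map_sub, toChart_act C hU, hs]

end MovingSections

/-! ### The coefficients of a moving frame -/

section MovingCoefficients

variable [FiniteDimensional ℝ F] {C : CourantAlgebroid n F E} {c : M} {U : Set M}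

theorem contDiffOn_spacetime {J T : Set ℝ} {S : Set M} {g : ℝ × M → ℝ}
    (hg : ContMDiffOn (𝓘(ℝ, ℝ).prod (𝓡 n)) 𝓘(ℝ, ℝ) ∞ g (J ×ˢ S)) (hT : T ⊆ J)
    (hS : ∀ y ∈ chartDomain n c U, (extChartAt (𝓡 n) c).symm y ∈ S) :
    ContDiffOn ℝ ∞ (fun p : ℝ × EuclideanSpace ℝ (Fin n) => g (p.1, (extChartAt (𝓡 n) c).symm p.2))
      (T ×ˢ chartDomain n c U) := by
  have h1 : ContMDiffOn (𝓘(ℝ, ℝ).prod 𝓘(ℝ, EuclideanSpace ℝ (Fin n))) (𝓡 n) ∞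
      (fun p : ℝ × EuclideanSpace ℝ (Fin n) => (extChartAt (𝓡 n) c).symm p.2)
      (T ×ˢ chartDomain n c U) :=
    (contMDiffOn_extChartAt_symm c).comp contMDiffOn_snd fun p hp => hp.2.1
  have h2 := hg.comp (contMDiffOn_fst.prodMk h1) fun p hp => ⟨hT hp.1, hS _ hp.2⟩
  rw [← modelWithCornersSelf_prod, chartedSpaceSelf_prod] at h2
  exact h2.contDiffOn

variable {ι : Type*} [Fintype ι] [DecidableEq ι]

/-- The pairings of a section `w` with the orthonormalized projections of the sections `f`. -/
def orthoCoeff (G : GenPseudometric C) (s : ℝ) (f : ι → Cₛ^∞⟮𝓡 n; F, E⟯) (a : ι)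
    (w : Cₛ^∞⟮𝓡 n; F, E⟯) (x : M) : ℝ :=
  ∑ b, orthonormalizer ι (gram G s f x) a b * C.pairing x (w x) (G.proj s (f b) x)

theorem GenPseudometric.pairing_proj_eq (G : GenPseudometric C) (s : ℝ)
    (w u : Cₛ^∞⟮𝓡 n; F, E⟯) (x : M) : C.pairing x (w x) (G.proj s u x) =
      (C.pairing x (w x) (u x) + s * C.pairing x (w x) (G.toFun x (u x))) / 2 := by
  simp only [G.proj_apply, map_smul, map_add, smul_eq_mul]
  ring

theorem orthoCoeff_eq {G : GenPseudometric C} {s : ℝ} (hs : s * s = 1)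
    {f : ι → Cₛ^∞⟮𝓡 n; F, E⟯} {x : M}
    (hf : ∀ a b, C.pairing x (f a x) (f b x) = if a = b then s else 0)
    (hf' : ∀ a, G.toFun x (f a x) = s • f a x) :
    (gram G s f x = fun a b => if a = b then 1 else 0) ∧
    ∀ a w, orthoCoeff G s f a w x = C.pairing x (w x) (f a x) := by
  have h1 : gram G s f x = fun a b => if a = b then 1 else 0 := by
    funext a b
    rw [gram_eq _ hs, hf', map_smul, hf, smul_eq_mul]
    split_ifs
    · linear_combination hs
    · ring
  refine ⟨h1, fun a w => ?_⟩
  rw [orthoCoeff, h1, orthonormalizer_one]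
  simp only [ite_mul, one_mul, zero_mul, Finset.sum_ite_eq, Finset.mem_univ, if_true]
  rw [G.pairing_proj_eq, hf', map_smul, smul_eq_mul]
  linear_combination (1 / 2 : ℝ) * C.pairing x (w x) (f a x) * hs

theorem contDiffOn_orthoCoeff {J T : Set ℝ} (hT : T ⊆ J) {G : ℝ → GenPseudometric C}
    (hG : ∀ u v : Cₛ^∞⟮𝓡 n; F, E⟯, ContMDiffOn (𝓘(ℝ, ℝ).prod (𝓡 n)) 𝓘(ℝ, ℝ) ∞
      (fun p : ℝ × M => C.pairing p.2 (v p.2) ((G p.1).toFun p.2 (u p.2))) (J ×ˢ univ))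
    {s : ℝ} (hs : s * s = 1) {f : ι → Cₛ^∞⟮𝓡 n; F, E⟯}
    (hh : ∀ t ∈ T, ∀ x ∈ U, ContDiffAt ℝ ∞ (orthonormalizer ι) (gram (G t) s f x)) (a : ι)
    (w : Cₛ^∞⟮𝓡 n; F, E⟯) :
    ContDiffOn ℝ ∞ (fun p : ℝ × EuclideanSpace ℝ (Fin n) =>
      orthoCoeff (G p.1) s f a w ((extChartAt (𝓡 n) c).symm p.2)) (T ×ˢ chartDomain n c U) := by
  have h1 (u v : Cₛ^∞⟮𝓡 n; F, E⟯) := contDiffOn_spacetime (c := c) (U := U) (hG u v) hT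
    fun _ _ => mem_univ _
  have h2 (u v : Cₛ^∞⟮𝓡 n; F, E⟯) : ContDiffOn ℝ ∞ (fun p : ℝ × EuclideanSpace ℝ (Fin n) =>
      C.pairing ((extChartAt (𝓡 n) c).symm p.2) (u ((extChartAt (𝓡 n) c).symm p.2))
        (v ((extChartAt (𝓡 n) c).symm p.2))) (T ×ˢ chartDomain n c U) :=
    (contDiffOn_comp_symm (c := c) (U := U) (C.pairing_smooth u v)).comp contDiffOn_snd
      fun p hp => hp.2
  have hgram : ContDiffOn ℝ ∞ (fun p : ℝ × EuclideanSpace ℝ (Fin n) =>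
      gram (G p.1) s f ((extChartAt (𝓡 n) c).symm p.2)) (T ×ˢ chartDomain n c U) := by
    refine contDiffOn_pi.2 fun a => contDiffOn_pi.2 fun b => ?_
    simp only [gram_eq _ hs]
    exact ((contDiffOn_const.mul (h2 (f a) (f b))).add (h1 (f b) (f a))).div_const 2
  have hcomp : ContDiffOn ℝ ∞ (fun p : ℝ × EuclideanSpace ℝ (Fin n) =>
      orthonormalizer ι (gram (G p.1) s f ((extChartAt (𝓡 n) c).symm p.2)))
      (T ×ˢ chartDomain n c U) := fun p hp =>
    (hh p.1 hp.1 _ hp.2.2).comp_contDiffWithinAt p (hgram p hp)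
  refine ContDiffOn.sum fun b _ => ?_
  refine (contDiffOn_pi.1 (contDiffOn_pi.1 hcomp a) b).mul ?_
  simp only [GenPseudometric.pairing_proj_eq]
  exact ((h2 w (f b)).add (contDiffOn_const.mul (h1 (f b) w))).div_const 2

/-- The Ricci tensor has no component within an eigenbundle, so the Gram matrix is stationary at
`t₀` and with it the orthonormalizing matrix, whatever the derivative of the square root. Only the
projection moves, at half the speed of `s` times `G`. -/
theorem hasDerivWithinAt_orthoCoeff [T2Space M] {J : Set ℝ} {G : ℝ → GenPseudometric C}
    {σ : ℝ → PosHalfDensity n M} (hflow : IsGenRicciFlow J G σ) {t₀ : ℝ} (ht₀ : t₀ ∈ J)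
    {s : ℝ} (hs : s * s = 1) {f : ι → Cₛ^∞⟮𝓡 n; F, E⟯} {x : M}
    (hh : ContDiffAt ℝ ∞ (orthonormalizer ι) (gram (G t₀) s f x))
    (hgram : gram (G t₀) s f x = fun a b => if a = b then 1 else 0)
    (hric : ∀ a b, ricci (G t₀) (σ t₀) x (f a x) (f b x) = 0) (a : ι) (w : Cₛ^∞⟮𝓡 n; F, E⟯) :
    HasDerivWithinAt (fun t => orthoCoeff (G t) s f a w x)
      (-s * ricci (G t₀) (σ t₀) x (w x) (f a x)) J t₀ := by
  have h1 : HasDerivWithinAt (fun t => gram (G t) s f x) 0 J t₀ := by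
    refine hasDerivWithinAt_pi.2 fun a => hasDerivWithinAt_pi.2 fun b => ?_
    simp only [gram_eq _ hs]
    have h := ((hflow.metric_eq t₀ ht₀ x (f a x) (f b x)).const_add
      (s * C.pairing x (f a x) (f b x))).div_const 2
    rw [hric, mul_zero, zero_div] at h
    exact h
  have h2 := (hh.differentiableAt (by simp)).hasFDerivAt.comp_hasDerivWithinAt t₀ h1
  rw [map_zero] at h2
  have h3 (b : ι) : HasDerivWithinAt (fun t => orthonormalizer ι (gram (G t) s f x) a b) 0 J t₀ :=
    hasDerivWithinAt_pi.1 (hasDerivWithinAt_pi.1 h2 a) b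
  have h4 (b : ι) : HasDerivWithinAt (fun t => C.pairing x (w x) ((G t).proj s (f b) x))
      (-s * ricci (G t₀) (σ t₀) x (w x) (f b x)) J t₀ := by
    simp only [GenPseudometric.pairing_proj_eq]
    refine ((((hflow.metric_eq t₀ ht₀ x (w x) (f b x)).const_mul s).const_add
      (C.pairing x (w x) (f b x))).div_const 2).congr_deriv ?_
    ring
  have h5 := HasDerivWithinAt.fun_sum (u := Finset.univ) fun b _ => (h3 b).mul (h4 b)
  refine h5.congr_deriv ?_
  rw [hgram, orthonormalizer_one]
  simp

end MovingCoefficients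

/-! ### Existence of adapted frames moving with the flow -/

section MovingFrameExistence

variable [FiniteDimensional ℝ F] {C : CourantAlgebroid n F E}

/-- Adapted frames near a point which move with the flow, expressed in a fixed frame. -/
theorem exists_moving_coeff [T2Space M] [CompactSpace M] {J : Set ℝ} {G : ℝ → GenPseudometric C}
    {σ : ℝ → PosHalfDensity n M} (hflow : IsGenRicciFlow J G σ)
    (hpos : ∀ t ∈ J, (G t).IsStrictlyPositive) {t₀ : ℝ} (ht₀ : t₀ ∈ J) (x₀ : M) :
    ∃ (p q : ℕ) (f : Fin p ⊕ Fin q → Cₛ^∞⟮𝓡 n; F, E⟯) (ε : ℝ) (U : Set M)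
      (m : ℝ → Fin p ⊕ Fin q → Fin p ⊕ Fin q → C^∞⟮𝓡 n, M; ℝ⟯), 0 < ε ∧ x₀ ∈ U ∧
      IsAdaptedFrame (G t₀) U f ∧
      (∀ t ∈ J ∩ Metric.ball t₀ ε, IsAdaptedFrame (G t) U (movingFrame (m t) f)) ∧
      (∀ A B, ContDiffOn ℝ ∞ (fun p : ℝ × EuclideanSpace ℝ (Fin n) =>
        m p.1 A B ((extChartAt (𝓡 n) x₀).symm p.2))
        ((J ∩ Metric.ball t₀ ε) ×ˢ chartDomain n x₀ U)) ∧
      (∀ x ∈ U, ∀ A B, m t₀ A B x = if A = B then 1 else 0) ∧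
      ∀ x ∈ U, ∀ A B, HasDerivWithinAt (fun t => m t A B x)
        (-(sgn (Fin p) (Fin q) ℝ A * sgn (Fin p) (Fin q) ℝ B *
          ricci (G t₀) (σ t₀) x (f B x) (f A x))) (J ∩ Metric.ball t₀ ε) t₀ := by
  obtain ⟨p, q, U₀, f, hp, hq, hpq, hx₀, hf⟩ := exists_adapted_frame (hpos t₀ ht₀) x₀
  obtain ⟨I, hI, U₁, hU₁, hx₁, h⟩ := exists_moving_frame
    (fun u v => (hflow.smooth_metric u v).continuousOn) ht₀ (hf.ortho x₀ hx₀) (hf.eigen x₀ hx₀)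
    (by simpa using hpq)
  obtain ⟨ε, hε, hball⟩ := Metric.mem_nhds_iff.1 hI
  have hT (t) (ht : t ∈ J ∩ Metric.ball t₀ ε) := h t ⟨ht.1, hball ht.2⟩
  choose! hsm e he he₁ he₂ using hT
  set U := U₀ ∩ U₁
  have hU : IsOpen U := hf.isOpen.inter hU₁
  have hfU := hf.mono hU inter_subset_left
  have heU (t) (ht : t ∈ J ∩ Metric.ball t₀ ε) := (he t ht).mono hU inter_subset_right
  have ht₀' : t₀ ∈ J ∩ Metric.ball t₀ ε := ⟨ht₀, Metric.mem_ball_self hε⟩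
  have hm₁ (t) (ht : t ∈ J ∩ Metric.ball t₀ ε) (x) (hx : x ∈ U) (a B) :
      C.pair (f B) (e t (Sum.inl a)) x =
        orthoCoeff (G t) 1 (fun a => f (Sum.inl a)) a (f B) x := by
    rw [CourantAlgebroid.pair_apply, he₁ t ht x hx.2, map_sum]
    simp only [map_smul, smul_eq_mul, orthoCoeff]
  have hm₂ (t) (ht : t ∈ J ∩ Metric.ball t₀ ε) (x) (hx : x ∈ U) (i B) :
      C.pair (f B) (e t (Sum.inr i)) x =
        orthoCoeff (G t) (-1) (fun i => f (Sum.inr i)) i (f B) x := by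
    rw [CourantAlgebroid.pair_apply, he₂ t ht x hx.2, map_sum]
    simp only [map_smul, smul_eq_mul, orthoCoeff]
  have hs₁ : (1 : ℝ) * 1 = 1 := one_mul 1
  have hs₂ : (-1 : ℝ) * -1 = 1 := by norm_num
  have o₁ {x} (hx : x ∈ U) := orthoCoeff_eq (G := G t₀) hs₁ (x := x) (f := fun a => f (Sum.inl a))
    (fun a b => by simp [hfU.ortho x hx]) (fun a => by simp [hfU.eigen x hx])
  have o₂ {x} (hx : x ∈ U) := orthoCoeff_eq (G := G t₀) hs₂ (x := x) (f := fun i => f (Sum.inr i))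
    (fun a b => by simp [hfU.ortho x hx]) (fun a => by simp [hfU.eigen x hx])
  obtain ⟨D, hD, hDric, -⟩ := exists_leviCivita (hpos t₀ ht₀) (σ t₀)
  have hzero {x} (hx : x ∈ U) (A B) (hAB : sgn (Fin p) (Fin q) ℝ A = sgn (Fin p) (Fin q) ℝ B) :
      ricci (G t₀) (σ t₀) x (f A x) (f B x) = 0 := by
    rw [hDric, hfU.ricci_eq_zero hx A B hAB hD]
  -- The pairing does not depend on time, so `f` remains orthonormal and the coefficients of the
  -- moving frame in it are ±⟨f_B, e_A⟩.
  refine ⟨p, q, f, ε, U, fun t A B => sgn (Fin p) (Fin q) ℝ B • C.pair (f B) (e t A), hε,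
    ⟨hx₀, hx₁⟩, hfU, fun t ht => (heU t ht).congr fun x hx A => ?_, fun A B => ?_,
    fun x hx A B => ?_, fun x hx A B => ?_⟩
  · conv_rhs => rw [hfU.complete x hx (e t A x)]
    rw [movingFrame, sum_section_apply]
    rfl
  · rcases A with a | i
    · refine (contDiffOn_const (c := sgn (Fin p) (Fin q) ℝ B)).mul
        ((contDiffOn_orthoCoeff inter_subset_left hflow.smooth_metric hs₁
          (fun t ht x (hx : x ∈ U) => (hsm t ht x hx.2).1) a (f B)).congr fun y hy => ?_)
      exact hm₁ y.1 hy.1 _ hy.2.2 a B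
    · refine (contDiffOn_const (c := sgn (Fin p) (Fin q) ℝ B)).mul
        ((contDiffOn_orthoCoeff inter_subset_left hflow.smooth_metric hs₂
          (fun t ht x (hx : x ∈ U) => (hsm t ht x hx.2).2) i (f B)).congr fun y hy => ?_)
      exact hm₂ y.1 hy.1 _ hy.2.2 i B
  · change sgn (Fin p) (Fin q) ℝ B * C.pair (f B) (e t₀ A) x = _
    have h1 : C.pair (f B) (e t₀ A) x = C.pairing x (f B x) (f A x) := by
      rcases A with a | i
      · rw [hm₁ t₀ ht₀' x hx, (o₁ hx).2]
      · rw [hm₂ t₀ ht₀' x hx, (o₂ hx).2]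
    rw [h1, hfU.ortho x hx]
    by_cases hAB : A = B
    · simp [hAB, sgn_mul_sgn]
    · simp [hAB, Ne.symm hAB]
  · rcases A with a | i
    · have h1 := ((hasDerivWithinAt_orthoCoeff hflow ht₀ hs₁ (hsm t₀ ht₀' x hx.2).1 (o₁ hx).1
        (fun a b => hzero hx _ _ rfl) a (f B)).const_mul (sgn (Fin p) (Fin q) ℝ B)).mono
        (inter_subset_left (t := Metric.ball t₀ ε))
      refine (h1.congr (fun t ht => ?_) ?_).congr_deriv ?_
      · rw [← hm₁ t ht x hx]; rfl
      · rw [← hm₁ t₀ ht₀' x hx]; rfl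
      · simp only [sgn_inl]; ring
    · have h1 := ((hasDerivWithinAt_orthoCoeff hflow ht₀ hs₂ (hsm t₀ ht₀' x hx.2).2 (o₂ hx).1
        (fun a b => hzero hx _ _ rfl) i (f B)).const_mul (sgn (Fin p) (Fin q) ℝ B)).mono
        (inter_subset_left (t := Metric.ball t₀ ε))
      refine (h1.congr (fun t ht => ?_) ?_).congr_deriv ?_
      · rw [← hm₂ t ht x hx]; rfl
      · rw [← hm₂ t₀ ht₀' x hx]; rfl
      · simp only [sgn_inr]; ring

end MovingFrameExistence

/-! ### Space-time functions -/

section Spacetime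

namespace SmoothFun

variable {V : Type*} [NormedAddCommGroup V] [NormedSpace ℝ V] {T : Set ℝ} {Ω : Set V}

variable (T) in
/-- A function of `y`, as a function of `(t, y)`. -/
def static : SmoothFun Ω →ₐ[ℝ] SmoothFun (T ×ˢ Ω) where
  toFun f := SmoothFun.mk (fun p => extendZero (f : Ω → ℝ) p.2)
    ((SmoothFun.contDiffOn f).comp contDiffOn_snd fun p hp => hp.2)
  map_one' := by
    ext p
    exact extendZero_of_mem _ p.2.2
  map_mul' f g := by
    ext p
    change extendZero _ _ = extendZero _ _ * extendZero _ _
    simp only [extendZero_of_mem _ p.2.2]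
    rfl
  map_zero' := by
    ext p
    exact extendZero_of_mem _ p.2.2
  map_add' f g := by
    ext p
    change extendZero _ _ = extendZero _ _ + extendZero _ _
    simp only [extendZero_of_mem _ p.2.2]
    rfl
  commutes' c := by
    ext p
    exact extendZero_of_mem _ p.2.2

theorem slice_static {t : ℝ} (ht : t ∈ T) (f : SmoothFun Ω) : slice ht (static T f) = f := by
  ext y
  exact extendZero_coe _ y

/-- The flow equations prescribe time derivatives pointwise; uniqueness of derivatives within `T`
identifies them with the time derivation. -/
theorem pd_time_eq (hT : UniqueDiffOn ℝ T) (hW : UniqueDiffOn ℝ (T ×ˢ Ω))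
    (f : SmoothFun (T ×ˢ Ω)) {t : ℝ} (ht : t ∈ T) (y : Ω) {g : ℝ → ℝ} {d : ℝ}
    (hg : ∀ s (hs : s ∈ T), f.1 ⟨(s, y), hs, y.2⟩ = g s) (hd : HasDerivWithinAt g d T t) :
    (pd hW (1, 0) f).1 ⟨(t, y), ht, y.2⟩ = d :=
  (hT t ht).eq_deriv _ ((hasDerivWithinAt_time hW f ht y).congr (fun s hs => by
    rw [extendZero_of_mem _ (show (s, (y : V)) ∈ T ×ˢ Ω from ⟨hs, y.2⟩), hg s hs]) (by
    rw [extendZero_of_mem _ (show (t, (y : V)) ∈ T ×ˢ Ω from ⟨ht, y.2⟩), hg t ht])) hd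

theorem pd_time_static (hT : UniqueDiffOn ℝ T) (hW : UniqueDiffOn ℝ (T ×ˢ Ω)) (f : SmoothFun Ω) :
    pd hW (1, 0) (static T f) = 0 := by
  ext ⟨⟨t, y⟩, ht, hy⟩
  exact pd_time_eq hT hW _ ht ⟨y, hy⟩ (g := fun _ => extendZero f.1 y) (fun _ _ => rfl)
    (hasDerivWithinAt_const _ _ _)

theorem sliceMap_slice {K : Type*} [Fintype K] {t : ℝ} (ht : t ∈ T)
    (hW : UniqueDiffOn ℝ (T ×ˢ Ω)) (hW' : T ×ˢ Ω ⊆ closure (interior (T ×ˢ Ω)))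
    (hΩ : UniqueDiffOn ℝ Ω) (v : K → V) :
    SliceMap (A := SmoothFun (T ×ˢ Ω)) (B := SmoothFun Ω) (pd hW (1, 0)) (fun l => pd hW (0, v l))
      (fun l => pd hΩ (v l)) (slice ht) where
  map_deriv l f := slice_pd ht hW hΩ (v l) f
  comm _ f := pd_comm hW hW' _ _ f

theorem vectorField_eq_zero_of_isMin {K : Type*} [Fintype K] (hΩ : IsOpen Ω) (v : K → V)
    (r : K → SmoothFun Ω) (f : SmoothFun Ω) (y : Ω) (hy : ∀ z, f.1 y ≤ f.1 z) :
    (vectorField (B := SmoothFun Ω) (fun l => pd hΩ.uniqueDiffOn (v l)) r f).1 y = 0 := by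
  rw [vectorField_apply, SmoothFun.sum_apply]
  refine Finset.sum_eq_zero fun l _ => ?_
  change (r l).1 y * (pd hΩ.uniqueDiffOn (v l) f).1 y = 0
  rw [pd_eq_zero_of_isMin hΩ f (v l) y hy, mul_zero]

/-- At the minimum the derivatives of the coefficients `r` are multiplied by first derivatives of
`f`, which vanish. The coefficients may thus be frozen at `y`, which leaves a second directional
derivative. -/
theorem vectorField_vectorField_nonneg_of_isMin {K : Type*} [Fintype K] (hΩ : IsOpen Ω)
    (v : K → V) (r : K → SmoothFun Ω) (f : SmoothFun Ω) (y : Ω) (hy : ∀ z, f.1 y ≤ f.1 z) :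
    0 ≤ (vectorField (B := SmoothFun Ω) (fun l => pd hΩ.uniqueDiffOn (v l)) r
      (vectorField (B := SmoothFun Ω) (fun l => pd hΩ.uniqueDiffOn (v l)) r f)).1 y := by
  set h := hΩ.uniqueDiffOn (𝕜 := ℝ)
  have hlin (g : SmoothFun Ω) (y : Ω) (c : K → ℝ) :
      (pd h (∑ l, c l • v l) g).1 y = ∑ l, c l * (pd h (v l) g).1 y := by
    simp only [pd_apply, map_sum, map_smul, smul_eq_mul]
  set w := ∑ l, (r l).1 y • v l
  have key : (vectorField (B := SmoothFun Ω) (fun l => pd h (v l)) r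
      (vectorField (B := SmoothFun Ω) (fun l => pd h (v l)) r f)).1 y = (pd h w (pd h w f)).1 y := by
    have e1 : pd h w f = ∑ l, (r l).1 y • pd h (v l) f := by
      ext z
      rw [SmoothFun.sum_apply]
      exact hlin f z _
    rw [hlin, vectorField_apply, SmoothFun.sum_apply]
    refine Finset.sum_congr rfl fun l _ => ?_
    rw [e1, vectorField_apply, map_sum, map_sum]
    change (r l).1 y * (∑ k, _ : SmoothFun Ω).1 y = _
    rw [SmoothFun.sum_apply, SmoothFun.sum_apply]
    congr 1
    refine Finset.sum_congr rfl fun k _ => ?_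
    rw [Derivation.leibniz, Derivation.map_smul]
    change (r k).1 y * (pd h (v l) (pd h (v k) f)).1 y + (pd h (v k) f).1 y * _ = (r k).1 y * _
    rw [show (pd h (v k) f).1 y = 0 from pd_eq_zero_of_isMin hΩ f (v k) y hy]
    ring
  rw [key]
  exact pd_pd_nonneg_of_isMin hΩ f w y hy

end SmoothFun

end Spacetime

/-! ### The scalar curvature along the flow -/

section ScalarFlow

variable [FiniteDimensional ℝ F] {C : CourantAlgebroid n F E}

/-- Every 𝒢_t is self-adjoint, hence so is its time derivative -2 Rc. -/
theorem ricci_comm_of_flow [T2Space M] [CompactSpace M] {J : Set ℝ} {G : ℝ → GenPseudometric C}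
    {σ : ℝ → PosHalfDensity n M} (hflow : IsGenRicciFlow J G σ) (hJ : UniqueDiffOn ℝ J) {t : ℝ}
    (ht : t ∈ J) (x : M) (v u : E x) : ricci (G t) (σ t) x v u = ricci (G t) (σ t) x u v := by
  have h1 := hflow.metric_eq t ht x v u
  have h2 := hflow.metric_eq t ht x u v
  have h3 : (fun s => C.pairing x v ((G s).toFun x u)) = fun s => C.pairing x u ((G s).toFun x v) := by
    funext s
    rw [← (G s).symm, C.pairing_symm]
  rw [h3] at h1
  have := (hJ t ht).eq_deriv _ h1 h2
  linarith

theorem uniqueDiffOn_inter_ball {J : Set ℝ} (hJ : UniqueDiffOn ℝ J) (t ε : ℝ) :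
    UniqueDiffOn ℝ (J ∩ Metric.ball t ε) :=
  hJ.inter Metric.isOpen_ball

theorem subset_closure_interior_spacetime {J : Set ℝ} (hJ : J ⊆ closure (interior J)) (t ε : ℝ)
    {V : Type*} [TopologicalSpace V] {Ω : Set V} (hΩ : IsOpen Ω) :
    (J ∩ Metric.ball t ε) ×ˢ Ω ⊆ closure (interior ((J ∩ Metric.ball t ε) ×ˢ Ω)) := by
  rw [interior_prod_eq, closure_prod_eq, hΩ.interior_eq, interior_inter,
    Metric.isOpen_ball.interior_eq]
  refine prod_mono (fun s hs => ?_) subset_closure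
  exact closure_mono (inter_subset_inter_left _ subset_rfl)
    (Metric.isOpen_ball.closure_inter ⟨hJ hs.1, hs.2⟩)

theorem hasDerivWithinAt_log_density [T2Space M] [CompactSpace M] {J : Set ℝ}
    {G : ℝ → GenPseudometric C} {σ : ℝ → PosHalfDensity n M} (hflow : IsGenRicciFlow J G σ) {t : ℝ}
    (ht : t ∈ J) {c x : M} (hx : x ∈ (chartAt (EuclideanSpace ℝ (Fin n)) c).source) :
    HasDerivWithinAt (fun s => Real.log ((σ s).toFun x (coordFrame c x) ^ 2))
      (-scalarCurvature (G t) (σ t) x) J t := by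
  have hp := toFun_coordFrame_pos (σ t) hx
  have h := ((hflow.density_eq t ht x (coordFrame c x)).pow 2).log (pow_ne_zero 2 hp.ne')
  refine h.congr_deriv (Eq.symm ?_)
  rw [eq_div_iff (show ((fun s => (σ s).toFun x (coordFrame c x)) ^ 2) t ≠ 0 from pow_ne_zero 2 hp.ne')]
  simp only [Pi.pow_apply]
  push_cast
  ring

/-- Near any point of space-time the scalar curvature is a smooth function, whose time derivative
at a spatial minimum is non-negative. -/
theorem exists_local_scalar [T2Space M] [CompactSpace M] {J : Set ℝ} {G : ℝ → GenPseudometric C}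
    {σ : ℝ → PosHalfDensity n M} (hflow : IsGenRicciFlow J G σ)
    (hpos : ∀ t ∈ J, (G t).IsStrictlyPositive) (hJ : UniqueDiffOn ℝ J)
    (hJ' : J ⊆ closure (interior J)) {t₀ : ℝ} (ht₀ : t₀ ∈ J) (x₀ : M) :
    ∃ (ε : ℝ) (U : Set M) (hε : 0 < ε) (hU : IsOpen U)
      (R : SmoothFun ((J ∩ Metric.ball t₀ ε) ×ˢ chartDomain n x₀ U)), x₀ ∈ U ∧
      (∀ t (ht : t ∈ J ∩ Metric.ball t₀ ε) (y : chartDomain n x₀ U), R.1 ⟨(t, y), ht, y.2⟩ =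
        scalarCurvature (G t) (σ t) ((extChartAt (𝓡 n) x₀).symm y)) ∧
      ∀ y : chartDomain n x₀ U, (∀ z : chartDomain n x₀ U,
        scalarCurvature (G t₀) (σ t₀) ((extChartAt (𝓡 n) x₀).symm y) ≤
          scalarCurvature (G t₀) (σ t₀) ((extChartAt (𝓡 n) x₀).symm z)) →
        0 ≤ (SmoothFun.pd ((uniqueDiffOn_inter_ball hJ t₀ ε).prod
          (isOpen_chartDomain x₀ hU).uniqueDiffOn) (1, 0) R).1
            ⟨(t₀, y), ⟨ht₀, Metric.mem_ball_self hε⟩, y.2⟩ := by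
  obtain ⟨p, q, f, ε, U, m, hε, hx₀, hf, hmov, hmsm, hm₀, hmd⟩ :=
    exists_moving_coeff hflow hpos ht₀ x₀
  have hU := hf.isOpen
  have hΩ := isOpen_chartDomain (n := n) x₀ hU
  set T := J ∩ Metric.ball t₀ ε
  set Ω := chartDomain n x₀ U
  have hT : UniqueDiffOn ℝ T := uniqueDiffOn_inter_ball hJ t₀ ε
  have hW : UniqueDiffOn ℝ (T ×ˢ Ω) := hT.prod hΩ.uniqueDiffOn
  have hW' : T ×ˢ Ω ⊆ closure (interior (T ×ˢ Ω)) := subset_closure_interior_spacetime hJ' t₀ ε hΩ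
  have ht₀' : t₀ ∈ T := ⟨ht₀, Metric.mem_ball_self hε⟩
  let v : Fin n → EuclideanSpace ℝ (Fin n) := fun l => EuclideanSpace.single l 1
  have S (t) (ht : t ∈ T) : SliceMap (A := SmoothFun (T ×ˢ Ω)) (B := SmoothFun Ω)
      (SmoothFun.pd hW (1, 0)) (fun l => SmoothFun.pd hW (0, v l)) (chartDeriv x₀ hU)
      (SmoothFun.slice ht) := SmoothFun.sliceMap_slice ht hW hW' hΩ.uniqueDiffOn v
  let m' : Fin p ⊕ Fin q → Fin p ⊕ Fin q → SmoothFun (T ×ˢ Ω) := fun A B =>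
    SmoothFun.mk _ (hmsm A B)
  have hs' : ContDiffOn ℝ ∞ (fun p : ℝ × EuclideanSpace ℝ (Fin n) =>
      Real.log ((σ p.1).chartDens x₀ p.2 ^ 2)) (T ×ˢ Ω) :=
    ((contDiffOn_spacetime (hflow.smooth_density x₀) inter_subset_left
      fun y hy => symm_mem_source ⟨y, hy⟩).pow 2).log fun y hy =>
        pow_ne_zero 2 (toFun_coordFrame_pos (σ y.1) (symm_mem_source ⟨y.2, hy.2⟩)).ne'
  let s' : SmoothFun (T ×ˢ Ω) := SmoothFun.mk _ hs'
  let r' : Fin p ⊕ Fin q → Fin n → SmoothFun (T ×ˢ Ω) := fun A l =>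
    SmoothFun.static T (anchorCoord x₀ U C (f A) l)
  let c' : Fin p ⊕ Fin q → Fin p ⊕ Fin q → Fin p ⊕ Fin q → SmoothFun (T ×ˢ Ω) := fun A₁ A₂ A₃ =>
    SmoothFun.static T (IsAdaptedFrame.chartStructure C x₀ U f A₁ A₂ A₃)
  -- Anchors and structure functions of the fixed frame are constant in time; all time dependence
  -- sits in the coefficients `m'` and the log-density `s'`. This presents 6R near the point as a
  -- smooth space-time function.
  let R' : SmoothFun (T ×ˢ Ω) := sixScalar (B := SmoothFun (T ×ˢ Ω))
    (fun l => SmoothFun.pd hW (0, v l)) s' (movingAnchor (A := SmoothFun (T ×ˢ Ω)) m' r')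
    (movingStructure (A := SmoothFun (T ×ˢ Ω)) (fun A₁ => vectorField (B := SmoothFun (T ×ˢ Ω))
      (fun l => SmoothFun.pd hW (0, v l)) (movingAnchor (A := SmoothFun (T ×ˢ Ω)) m' r' A₁)) m' c')
  have hslm (t) (ht : t ∈ T) (A B) : SmoothFun.slice ht (m' A B) = toChart x₀ U (m t A B) := rfl
  have hsls (t) (ht : t ∈ T) : SmoothFun.slice ht s' = logDens x₀ U (σ t) := rfl
  have hslr (t) (ht : t ∈ T) (A l) : SmoothFun.slice ht (r' A l) = anchorCoord x₀ U C (f A) l :=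
    SmoothFun.slice_static ht _
  have hslc (t) (ht : t ∈ T) (A₁ A₂ A₃) : SmoothFun.slice ht (c' A₁ A₂ A₃) =
      IsAdaptedFrame.chartStructure C x₀ U f A₁ A₂ A₃ :=
    SmoothFun.slice_static ht _
  have hslA (t) (ht : t ∈ T) (A l) :
      SmoothFun.slice ht (movingAnchor (A := SmoothFun (T ×ˢ Ω)) m' r' A l) =
        anchorCoord x₀ U C (movingFrame (m t) f A) l := by
    rw [anchorCoord_movingFrame]
    simp only [movingAnchor, map_sum, map_mul, hslm, hslr]
  have hslC (t) (ht : t ∈ T) (A₁ A₂ A₃) : SmoothFun.slice ht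
      (movingStructure (A := SmoothFun (T ×ˢ Ω)) (fun A₁ => vectorField (B := SmoothFun (T ×ˢ Ω))
        (fun l => SmoothFun.pd hW (0, v l)) (movingAnchor (A := SmoothFun (T ×ˢ Ω)) m' r' A₁)) m' c'
          A₁ A₂ A₃) = IsAdaptedFrame.chartStructure C x₀ U (movingFrame (m t) f) A₁ A₂ A₃ := by
    rw [IsAdaptedFrame.chartStructure, toChart_congr fun x hx =>
      hf.structureFun_movingFrame (m t) hx A₁ A₂ A₃, toChart_movingStructure hU]
    have hv (u : Fin n → SmoothFun (T ×ˢ Ω)) (g : SmoothFun (T ×ˢ Ω)) := (S t ht).map_vectorField u g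
    simp only [movingStructure, map_add, map_sub, map_sum, map_mul, hv, hslm, hslc, hslA,
      SliceMap.map_sgn]
    rfl
  have hsl6 (t) (ht : t ∈ T) : SmoothFun.slice ht R' = sixScalar (B := ChartFun n x₀ U)
      (chartDeriv x₀ hU) (logDens x₀ U (σ t)) (fun A => anchorCoord x₀ U C (movingFrame (m t) f A))
      (IsAdaptedFrame.chartStructure C x₀ U (movingFrame (m t) f)) := by
    refine ((S t ht).map_sixScalar s' _ _).trans ?_
    simp only [hslA, hslC, hsls]
  set R : SmoothFun (T ×ˢ Ω) := (6 : ℝ)⁻¹ • R' with hRdef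
  have h6 : 6 * R = R' := by
    ext z
    change 6 * ((6 : ℝ)⁻¹ * R'.1 z) = R'.1 z
    ring
  have hval (t) (ht : t ∈ T) (y : Ω) : R.1 ⟨(t, y), ht, y.2⟩ =
      scalarCurvature (G t) (σ t) ((extChartAt (𝓡 n) x₀).symm y) := by
    obtain ⟨D, hD, -, hDs⟩ := exists_leviCivita (hpos t ht.1) (σ t)
    have h := (hmov t ht).six_scalar_chart (c := x₀) hD y
    have h2 := congrArg (fun g : ChartFun n x₀ U => g.1 y) (hsl6 t ht)
    have h3 : R.1 ⟨(t, y), ht, y.2⟩ = (6 : ℝ)⁻¹ * (SmoothFun.slice ht R' : Ω → ℝ) y := rfl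
    rw [h3, hDs]
    rw [h2, ← h]
    ring
  refine ⟨ε, U, hε, hU, R, hx₀, hval, fun y hy => ?_⟩
  obtain ⟨D, hD, hDric, hDs⟩ := exists_leviCivita (hpos t₀ ht₀) (σ t₀)
  have hdm (A B) (y : Ω) : (SmoothFun.slice ht₀' (SmoothFun.pd hW (1, 0) (m' A B))).1 y =
      -(sgn (Fin p) (Fin q) ℝ A * sgn (Fin p) (Fin q) ℝ B *
        ricci (G t₀) (σ t₀) ((extChartAt (𝓡 n) x₀).symm y) (f B ((extChartAt (𝓡 n) x₀).symm y))
          (f A ((extChartAt (𝓡 n) x₀).symm y))) :=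
    SmoothFun.pd_time_eq hT hW (m' A B) ht₀' y (fun _ _ => rfl) (hmd _ y.2.2 A B)
  have hr₀ : (fun A l => SmoothFun.slice ht₀' (r' A l)) = fun A => anchorCoord x₀ U C (f A) := by
    funext A l
    exact hslr t₀ ht₀' A l
  have hc₀ : (fun A₁ A₂ A₃ => SmoothFun.slice ht₀' (c' A₁ A₂ A₃)) =
      IsAdaptedFrame.chartStructure C x₀ U f := by
    funext A₁ A₂ A₃
    exact hslc t₀ ht₀' A₁ A₂ A₃
  -- At `t₀` the moving frame is `f` itself and its velocity is off-diagonal, with entries Rc(e_a,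
  -- e_i) equal to twice the mixed Ricci component.
  have hev := (S t₀ ht₀').evolution_moving (s := s') (R := R) (m := m') (r := r') (c := c')
    (IsAdaptedFrame.chartDeriv_comm hU)
    (fun A B => by
      ext y
      refine (hm₀ _ y.2.2 A B).trans ?_
      split_ifs <;> rfl)
    (fun A l => SmoothFun.pd_time_static hT hW _)
    (fun A₁ A₂ A₃ => SmoothFun.pd_time_static hT hW _)
    (by rw [hr₀, hc₀]; exact hf.chartFrame)
    h6
    (by
      ext y
      refine (SmoothFun.pd_time_eq hT hW s' ht₀' y (fun _ _ => rfl)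
        ((hasDerivWithinAt_log_density hflow ht₀ (symm_mem_source y)).mono inter_subset_left)).trans ?_
      exact congrArg Neg.neg (hval t₀ ht₀' y).symm)
    (fun a b => by
      ext y
      refine (hdm _ _ y).trans ?_
      rw [hDric, hf.ricci_eq_zero y.2.2 (Sum.inl b) (Sum.inl a) (by simp) hD, mul_zero, neg_zero]
      rfl)
    (fun i j => by
      ext y
      refine (hdm _ _ y).trans ?_
      rw [hDric, hf.ricci_eq_zero y.2.2 (Sum.inr j) (Sum.inr i) (by simp) hD, mul_zero, neg_zero]
      rfl)
    (fun a i => by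
      ext y
      refine (hdm _ _ y).trans ?_
      -- The velocity appears as Rc(e_i, e_a), while the frame formula computes Rc(e_a, e_i).
      rw [hr₀, hc₀, hsls, ricci_comm_of_flow hflow hJ ht₀, hDric, hf.ricci_chart hD y a i]
      simp)
    (fun a i => by
      ext y
      refine (hdm _ _ y).trans ?_
      rw [hr₀, hc₀, hsls, hDric, hf.ricci_chart hD y a i]
      simp)
  have hmin (z : Ω) : (SmoothFun.slice ht₀' R).1 y ≤ (SmoothFun.slice ht₀' R).1 z := by
    have := hy z
    rw [← hval t₀ ht₀', ← hval t₀ ht₀'] at this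
    exact this
  have hevy := congrArg (fun g : SmoothFun Ω => g.1 y) hev
  have hmul (g h : SmoothFun Ω) : (g * h).1 y = g.1 y * h.1 y := rfl
  have hadd (g h : SmoothFun Ω) : (g + h).1 y = g.1 y + h.1 y := rfl
  have n6 : (6 : SmoothFun Ω).1 y = 6 := rfl
  have n48 : (48 : SmoothFun Ω).1 y = 48 := rfl
  have n12 : (12 : SmoothFun Ω).1 y = 12 := rfl
  have hX (r : Fin n → SmoothFun Ω) := SmoothFun.vectorField_eq_zero_of_isMin hΩ v r _ y hmin
  have hXX (r : Fin n → SmoothFun Ω) :=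
    SmoothFun.vectorField_vectorField_nonneg_of_isMin hΩ v r _ y hmin
  simp only [hmul, hadd, n6, n48, n12, SmoothFun.sum_apply] at hevy
  -- The Ricci term is a sum of squares, the second derivatives are non-negative at the minimum, and
  -- the drift terms vanish with the gradient.
  have h1 : 0 ≤ 6 * (SmoothFun.slice ht₀' (SmoothFun.pd hW (1, 0) R)).1 y := by
    rw [hevy]
    refine add_nonneg (mul_nonneg (by norm_num) (Finset.sum_nonneg fun a _ =>
      Finset.sum_nonneg fun i _ => mul_self_nonneg _)) (mul_nonneg (by norm_num)
        (Finset.sum_nonneg fun a _ => ?_))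
    refine add_nonneg (hXX _) (le_of_eq ?_)
    exact (mul_eq_zero_of_right _ (hX _)).symm
  exact nonneg_of_mul_nonneg_right h1 (by norm_num)

end ScalarFlow

/-! ### The maximum principle -/

section MaximumPrinciple

/-- If a function on a compact space evolves with non-negative speed at its minima, then its
infimum is nondecreasing. -/
theorem monotoneOn_iInf_of_deriv_nonneg_at_min {X : Type*} [TopologicalSpace X] [CompactSpace X]
    {J : Set ℝ} (hJ : J.OrdConnected) {f : ℝ → X → ℝ}
    (hf : ContinuousOn (fun p : ℝ × X => f p.1 p.2) (J ×ˢ univ))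
    (hd : ∀ t ∈ J, ∀ x, (∀ z, f t x ≤ f t z) →
      ∃ d, 0 ≤ d ∧ HasDerivWithinAt (fun s => f s x) d J t)
    (hb : ∀ t ∈ J, BddBelow (range (f t))) : MonotoneOn (fun t => ⨅ x, f t x) J := by
  intro s hs t ht hst
  rcases hst.eq_or_lt with rfl | hlt
  · exact le_rfl
  rcases isEmpty_or_nonempty X with hX | hX
  · simp [iInf_of_isEmpty]
  refine le_ciInf fun x => ?_
  have hsub : Icc s t ⊆ J := hJ.out hs ht
  refine le_of_forall_pos_le_add fun δ hδ => ?_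
  -- Adding `ε * (r - s)` makes the speed at minima strictly positive, at a total cost of exactly
  -- `δ` at time `t`.
  set ε := δ / (t - s)
  have hts : 0 < t - s := sub_pos.2 hlt
  have hε : 0 < ε := div_pos hδ hts
  have hεδ : ε * (t - s) = δ := div_mul_cancel₀ δ hts.ne'
  have hcont : ContinuousOn (fun p : ℝ × X => f p.1 p.2 + ε * (p.1 - s)) (Icc s t ×ˢ univ) :=
    (hf.mono (prod_mono hsub subset_rfl)).add (by fun_prop)
  obtain ⟨⟨τ, x₀⟩, ⟨hτ, -⟩, hmin⟩ := (isCompact_Icc.prod isCompact_univ).exists_isMinOn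
    ⟨(s, x), left_mem_Icc.2 hst, mem_univ x⟩ hcont
  have hmin' (τ') (hτ' : τ' ∈ Icc s t) (z : X) :
      f τ x₀ + ε * (τ - s) ≤ f τ' z + ε * (τ' - s) := hmin (show (τ', z) ∈ _ from ⟨hτ', mem_univ z⟩)
  -- If the space-time minimum is attained at the initial time, comparison with time `t` gives the
  -- claim. At a later time the slopes from the left would be non-positive, although they tend to d
  -- + ε > 0.
  rcases hτ.1.eq_or_lt with rfl | hsτ
  · have h1 := hmin' t (right_mem_Icc.2 hst) x
    have h2 := ciInf_le (hb s hs) x₀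
    rw [hεδ] at h1
    simp only [sub_self, mul_zero, add_zero] at h1
    exact h2.trans h1
  · exfalso
    obtain ⟨d, hd0, hd⟩ := hd τ (hsub hτ) x₀ fun z => by linarith [hmin' τ hτ z]
    have h1 : HasDerivWithinAt (fun r => f r x₀ + ε * (r - s)) (d + ε * 1) (Ico s τ) τ :=
      (hd.mono fun r hr => hsub ⟨hr.1, hr.2.le.trans hτ.2⟩).add
        (((hasDerivAt_id τ).sub_const s).const_mul ε).hasDerivWithinAt
    rw [hasDerivWithinAt_iff_tendsto_slope' (by simp)] at h1
    have hne : (nhdsWithin τ (Ico s τ)).NeBot := by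
      rw [← mem_closure_iff_nhdsWithin_neBot, closure_Ico hsτ.ne]
      exact right_mem_Icc.2 hsτ.le
    have h2 : d + ε * 1 ≤ 0 := by
      refine le_of_tendsto h1 ?_
      filter_upwards [self_mem_nhdsWithin] with r hr
      rw [slope_def_field]
      exact div_nonpos_of_nonneg_of_nonpos
        (sub_nonneg.2 (hmin' r ⟨hr.1, hr.2.le.trans hτ.2⟩ x₀)) (sub_nonpos.2 hr.2.le)
    linarith

variable [FiniteDimensional ℝ F] {C : CourantAlgebroid n F E}

theorem extChartAt_mem_chartDomain {c x : M} {U : Set M}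
    (hx : x ∈ (chartAt (EuclideanSpace ℝ (Fin n)) c).source) (hxU : x ∈ U) :
    extChartAt (𝓡 n) c x ∈ chartDomain n c U := by
  refine ⟨extChartAt_mem_target hx, ?_⟩
  rw [mem_preimage, (extChartAt (𝓡 n) c).left_inv (by rwa [extChartAt_source])]
  exact hxU

/-- Boundedness is asserted even when J is a single point, where space-time smoothness is not
available; hence continuity at a fixed time is derived directly from the frame formula. -/
theorem continuous_scalarCurvature [T2Space M] [CompactSpace M] {G : GenPseudometric C}
    (hG : G.IsStrictlyPositive) (σ : PosHalfDensity n M) :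
    Continuous fun x => scalarCurvature G σ x := by
  rw [continuous_iff_continuousAt]
  intro x₀
  obtain ⟨p, q, U, f, -, -, -, hx₀, hf⟩ := exists_adapted_frame hG x₀
  obtain ⟨D, hD, -, hDs⟩ := exists_leviCivita hG σ
  set g : ChartFun n x₀ U := sixScalar (B := ChartFun n x₀ U) (chartDeriv x₀ hf.isOpen)
    (logDens x₀ U σ) (fun A => anchorCoord x₀ U C (f A)) (IsAdaptedFrame.chartStructure C x₀ U f)
    with hg
  have hsrc := mem_chart_source (EuclideanSpace ℝ (Fin n)) x₀
  have h1 : ContinuousAt (fun x => (6 : ℝ)⁻¹ * extendZero g.1 (extChartAt (𝓡 n) x₀ x)) x₀ := by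
    refine continuousAt_const.mul (ContinuousAt.comp (g := extendZero g.1) ?_
      (continuousAt_extChartAt x₀))
    exact (SmoothFun.contDiffOn g).continuousOn.continuousAt
      ((isOpen_chartDomain x₀ hf.isOpen).mem_nhds (extChartAt_mem_chartDomain hsrc hx₀))
  refine h1.congr ?_
  filter_upwards [(hf.isOpen.inter (chartAt (EuclideanSpace ℝ (Fin n)) x₀).open_source).mem_nhds
    ⟨hx₀, hsrc⟩] with x hx
  have hmem := extChartAt_mem_chartDomain hx.2 hx.1
  have h := hf.six_scalar_chart hD ⟨_, hmem⟩
  rw [(extChartAt (𝓡 n) x₀).left_inv (by rw [extChartAt_source]; exact hx.2), ← hg, ← hDs] at h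
  rw [extendZero_of_mem _ hmem, ← h]
  ring

theorem bddBelow_scalarCurvature [T2Space M] [CompactSpace M] {G : GenPseudometric C}
    (hG : G.IsStrictlyPositive) (σ : PosHalfDensity n M) :
    BddBelow (range fun x => scalarCurvature G σ x) :=
  (isCompact_range (continuous_scalarCurvature hG σ)).bddBelow

section Flow

variable [T2Space M] [CompactSpace M] {J : Set ℝ} {G : ℝ → GenPseudometric C}
  {σ : ℝ → PosHalfDensity n M}

theorem continuousOn_scalarCurvature (hflow : IsGenRicciFlow J G σ)
    (hpos : ∀ t ∈ J, (G t).IsStrictlyPositive) (hJ : UniqueDiffOn ℝ J)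
    (hJ' : J ⊆ closure (interior J)) :
    ContinuousOn (fun p : ℝ × M => scalarCurvature (G p.1) (σ p.1) p.2) (J ×ˢ univ) := by
  rintro ⟨t₀, x₀⟩ ⟨ht₀, -⟩
  replace ht₀ : t₀ ∈ J := ht₀
  obtain ⟨ε, U, hε, hU, R, hx₀, hR, -⟩ := exists_local_scalar hflow hpos hJ hJ' ht₀ x₀
  have hsrc := mem_chart_source (EuclideanSpace ℝ (Fin n)) x₀
  have hO : IsOpen (Metric.ball t₀ ε ×ˢ (U ∩ (chartAt (EuclideanSpace ℝ (Fin n)) x₀).source)) :=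
    Metric.isOpen_ball.prod (hU.inter (chartAt (EuclideanSpace ℝ (Fin n)) x₀).open_source)
  have hmaps : MapsTo (fun p : ℝ × M => (p.1, extChartAt (𝓡 n) x₀ p.2))
      ((J ×ˢ univ) ∩ Metric.ball t₀ ε ×ˢ (U ∩ (chartAt (EuclideanSpace ℝ (Fin n)) x₀).source))
      ((J ∩ Metric.ball t₀ ε) ×ˢ chartDomain n x₀ U) := fun p hp =>
    ⟨⟨hp.1.1, hp.2.1⟩, extChartAt_mem_chartDomain hp.2.2.2 hp.2.2.1⟩
  have hmem : (t₀, x₀) ∈ Metric.ball t₀ ε ×ˢ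
      (U ∩ (chartAt (EuclideanSpace ℝ (Fin n)) x₀).source) :=
    ⟨Metric.mem_ball_self hε, hx₀, hsrc⟩
  rw [← continuousWithinAt_inter (hO.mem_nhds hmem)]
  have h1 : ContinuousWithinAt (fun p : ℝ × M => (p.1, extChartAt (𝓡 n) x₀ p.2))
      ((J ×ˢ univ) ∩ Metric.ball t₀ ε ×ˢ (U ∩ (chartAt (EuclideanSpace ℝ (Fin n)) x₀).source))
      (t₀, x₀) := by
    refine (continuousAt_fst.prodMk ?_).continuousWithinAt
    exact (continuousAt_extChartAt x₀).comp (x := (t₀, x₀)) (f := Prod.snd) continuousAt_snd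
  have h2 := ContinuousWithinAt.comp (x := (t₀, x₀)) (g := extendZero R.1)
    ((SmoothFun.contDiffOn R).continuousOn _ (hmaps ⟨⟨ht₀, mem_univ x₀⟩, hmem⟩)) h1 hmaps
  have he (p : ℝ × M) (hp : p ∈ (J ×ˢ univ) ∩ Metric.ball t₀ ε ×ˢ
      (U ∩ (chartAt (EuclideanSpace ℝ (Fin n)) x₀).source)) :
      scalarCurvature (G p.1) (σ p.1) p.2 =
        extendZero R.1 (p.1, extChartAt (𝓡 n) x₀ p.2) := by
    rw [extendZero_of_mem _ (hmaps hp)]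
    refine Eq.trans ?_ (hR p.1 ⟨hp.1.1, hp.2.1⟩ ⟨_, (hmaps hp).2⟩).symm
    rw [(extChartAt (𝓡 n) x₀).left_inv (by rw [extChartAt_source]; exact hp.2.2.2)]
  exact h2.congr he (he _ ⟨⟨ht₀, mem_univ x₀⟩, hmem⟩)

theorem exists_deriv_scalarCurvature_nonneg (hflow : IsGenRicciFlow J G σ)
    (hpos : ∀ t ∈ J, (G t).IsStrictlyPositive) (hJ : UniqueDiffOn ℝ J)
    (hJ' : J ⊆ closure (interior J)) {t₀ : ℝ} (ht₀ : t₀ ∈ J) (x₀ : M)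
    (hmin : ∀ z, scalarCurvature (G t₀) (σ t₀) x₀ ≤ scalarCurvature (G t₀) (σ t₀) z) :
    ∃ d, 0 ≤ d ∧ HasDerivWithinAt (fun t => scalarCurvature (G t) (σ t) x₀) d J t₀ := by
  obtain ⟨ε, U, hε, hU, R, hx₀, hR, hd⟩ := exists_local_scalar hflow hpos hJ hJ' ht₀ x₀
  have hsrc := mem_chart_source (EuclideanSpace ℝ (Fin n)) x₀
  have hxx : (extChartAt (𝓡 n) x₀).symm (extChartAt (𝓡 n) x₀ x₀) = x₀ :=
    extChartAt_to_inv (I := 𝓡 n) x₀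
  set y : chartDomain n x₀ U := ⟨_, extChartAt_mem_chartDomain hsrc hx₀⟩
  have ht₀' : t₀ ∈ J ∩ Metric.ball t₀ ε := ⟨ht₀, Metric.mem_ball_self hε⟩
  have hy : (extChartAt (𝓡 n) x₀).symm y = x₀ := hxx
  refine ⟨_, hd y fun z => by rw [hy]; exact hmin _, ?_⟩
  rw [← hasDerivWithinAt_inter (Metric.ball_mem_nhds t₀ hε)]
  have he (t) (ht : t ∈ J ∩ Metric.ball t₀ ε) :
      scalarCurvature (G t) (σ t) x₀ = extendZero R.1 (t, (y : EuclideanSpace ℝ (Fin n))) := by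
    rw [extendZero_of_mem _ (show (t, (y : EuclideanSpace ℝ (Fin n))) ∈
      (J ∩ Metric.ball t₀ ε) ×ˢ chartDomain n x₀ U from ⟨ht, y.2⟩), hR t ht y, hy]
  exact (SmoothFun.hasDerivWithinAt_time _ R ht₀' y).congr he (he t₀ ht₀')

end Flow

end MaximumPrinciple

end CourantFlow

end

/-! ### The main theorem -/

theorem mainTheorem4 {n : ℕ} {M : Type*} [TopologicalSpace M]
    [ChartedSpace (EuclideanSpace ℝ (Fin n)) M] [IsManifold (𝓡 n) ∞ M]
    [T2Space M] [CompactSpace M]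
    {F : Type*} [NormedAddCommGroup F] [NormedSpace ℝ F] [FiniteDimensional ℝ F]
    {E : M → Type*} [TopologicalSpace (TotalSpace F E)] [∀ x, TopologicalSpace (E x)]
    [∀ x, AddCommGroup (E x)] [∀ x, Module ℝ (E x)] [FiberBundle F E] [VectorBundle ℝ F E]
    [ContMDiffVectorBundle ∞ F E (𝓡 n)]
    (C : CourantFlow.CourantAlgebroid n F E)
    (J : Set ℝ) (hJ : J.OrdConnected) (hJ0 : IsLeast J 0)
    (G : ℝ → CourantFlow.GenPseudometric C) (σ : ℝ → CourantFlow.PosHalfDensity n M)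
    (hflow : CourantFlow.IsGenRicciFlow J G σ)
    (hG₀ : (G 0).IsGenMetric) (hpos₀ : (G 0).IsStrictlyPositive) :
    (∀ t ∈ J, BddBelow (range fun x : M => CourantFlow.scalarCurvature (G t) (σ t) x)) ∧
      MonotoneOn (fun t => ⨅ x : M, CourantFlow.scalarCurvature (G t) (σ t) x) J := by
  have hpos (t) (ht : t ∈ J) : (G t).IsStrictlyPositive :=
    CourantFlow.isStrictlyPositive_of_continuousOn hJ
      (fun x v u t ht => (hflow.metric_eq t ht x v u).continuousWithinAt) hJ0.1 hpos₀ ht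
  have hb (t) (ht : t ∈ J) := CourantFlow.bddBelow_scalarCurvature (hpos t ht) (σ t)
  refine ⟨hb, ?_⟩
  -- If J is a single point, derivatives within J carry no information and monotonicity is trivial.
  -- Otherwise J is convex with non-empty interior, so derivatives within J are unique, also at its
  -- endpoints.
  rcases J.subsingleton_or_nontrivial with hsub | hnt
  · exact hsub.monotoneOn _
  have hconv : Convex ℝ J := hJ.convex
  have hne : (interior J).Nonempty := by
    obtain ⟨a, ha, b, hb, hab⟩ := hnt.exists_lt
    refine (nonempty_Ioo.2 hab).mono ?_
    rw [← interior_Icc]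
    exact interior_mono (hJ.out ha hb)
  have hud := uniqueDiffOn_convex hconv hne
  have hcl : J ⊆ closure (interior J) := by
    rw [hconv.closure_interior_eq_closure_of_nonempty_interior hne]
    exact subset_closure
  exact CourantFlow.monotoneOn_iInf_of_deriv_nonneg_at_min hJ
    (CourantFlow.continuousOn_scalarCurvature hflow hpos hud hcl)
    (fun t ht x hx => CourantFlow.exists_deriv_scalarCurvature_nonneg hflow hpos hud hcl ht x hx) hb
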